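/- **Setting.** Fix $d$, a vector $\boldsymbol k\in\mathbb R^d$ with entries linearly independent over $\mathbb Z$, and $s>\frac{d+1}{2}$. For functions (or distributions) $u=\sum_{\boldsymbol j\in\mathbb Z^d}\hat u_{\boldsymbol j}e^{i\langle \boldsymbol j,\boldsymbol\alpha\rangle}$ on $\mathbb T^d=\mathbb R^d/(2\pi\mathbb Z)^d$ put $u_\alpha=\partial_\alpha u=\sum_i k_i\partial_i u$, let $H$ be the multiplier with symbol $-i\,\mathrm{sgn}\langle \boldsymbol j,\boldsymbol k\rangle$, $P=\frac12(I-iH)$, $\bar P=\frac12(I+iH)$, and let $$\|u\|_{H^{\sigma,\theta}}^2=\sum_{\boldsymbol j}(1+|\boldsymbol j|^2)^{\sigma}(1+\langle \boldsymbol j,\boldsymbol k\rangle^2)^{\theta}|\hat u_{\boldsymbol j}|^2,\qquad \mathcal H^\sigma=H^{\sigma,0}\times H^{\sigma,\frac12}.$$ Call $u$ holomorphic (with zero average) if $\hat u_{\boldsymbol j}=0$ whenever $\langle \boldsymbol j,\boldsymbol k\rangle\ge 0$. A *state* is a pair $(\mathbf W,R)\in\mathcal H^s$ of holomorphic functions such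 that $1+\mathbf W$ vanishes nowhere and $Y:=\mathbf W/(1+\mathbf W)$ is holomorphic. For a state put $$b=2\Re P[R(1-\bar Y)],\quad a=i\big(\bar P[\bar RR_\alpha]-P[R\bar R_\alpha]\big),\quad M=\bar P[\bar RY_\alpha-R_\alpha\bar Y]+P[R\bar Y_\alpha-\bar R_\alpha Y],$$ $$A=\|(\mathbf W,R)\|_{\mathcal H^{s-\frac12}},\qquad B=\|(\mathbf W,R)\|_{\mathcal H^{s}}.$$ A *solution* $(\mathbf W,R)\in C([0,T];\mathcal H^s)$ consists of states and satisfies, in the sense of distributions, $$\mathbf W_t+b\mathbf W_\alpha+\frac{(1+\mathbf W)R_\alpha}{1+\bar{\mathbf W}}=(1+\mathbf W)M,\qquad R_t+bR_\alpha=i\,\frac{\mathbf W-a}{1+\mathbf W}.$$ A *solution of the linearized equation* around it is a pair of holomorphic functions $(w,r)\in C([0,T];\mathcal H^0)$ with, for $D_t=\partial_t+b\partial_\alpha$, $$D_tw+(1-\bar Y)(1+\mathbf W)r_\alpha=f,\qquad D_tr-i(1+a)(1-Y)^2w=g,$$ $$f=-(1-\bar Y)R_\alpha w+(1-\bar Y)^2(1+\mathbf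 W)R_\alpha\bar w+Mw-\mathbf W_\alpha\,\delta b+(1+\mathbf W)\,\delta M,\qquad g=-R_\alpha\,\delta b-i(1-Y)\,\delta a,$$ $$\delta b=2\Re P[(1-\bar Y)r-(1-\bar Y)^2R\bar w],\qquad \delta a=2\Im P[\bar R_\alpha r+R\bar r_\alpha],$$ $$\delta M=2\Re P[r\bar Y_\alpha-2R(1-\bar Y)\bar w\bar Y_\alpha+R(1-\bar Y)^2\bar w_\alpha-\bar r_\alpha Y-\bar R_\alpha(1-Y)^2w].$$ The linearized energy is $$E_{\rm lin}(w,r)=\int_{\mathbb T^d}(1+a)|1-Y|^2|w|^2+\Im(r\bar r_\alpha)+|r|^2\,d\boldsymbol\alpha .$$ **Theorem.** Let $A_1\in\mathbb R$ and $\delta>0$. 1. (Coercivity.) There is $C=C(d,\boldsymbol k,s,A_1,\delta)>0$ such that for every state with $A\le A_1$ and $|1+\mathbf W|\ge\delta$ and all holomorphic $(w,r)\in\mathcal H^0$, $$C^{-1}\|(w,r)\|_{\mathcal H^0}^2\le E_{\rm lin}(w,r)\le C\|(w,r)\|_{\mathcal H^0}^2 .$$ 2. (Growth bound around a nonzero solution.)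 For every $A_0>0$ there is $C=C(d,\boldsymbol k,s,A_0,A_1,\delta)>0$ such that for every $T>0$, every solution $(\mathbf W,R)$ on $[0,T]$ and every solution $(w,r)$ of the linearized equation around it: at each $t\in[0,T]$ with $A_0\le A(t)\le A_1$ and $|1+\mathbf W(t)|\ge\delta$, the function $E_{\rm lin}(w,r)$ is differentiable in $t$ (one-sidedly at the end points) and $$\Big|\frac{d}{dt}E_{\rm lin}(w,r)\Big|\le C\,B\,\|(w,r)\|_{\mathcal H^0}^2 .$$ If these conditions hold at all times in $[0,T]$, then $\|(w,r)(t)\|_{\mathcal H^0}\le C\exp\big(C\int_0^tB(\tau)\,d\tau\big)\|(w,r)(0)\|_{\mathcal H^0}$ for $t\in[0,T]$. 3. (Growth bound, uniformly as $A\to0$.) There is $C=C(d,\boldsymbol k,s,A_1,\delta)>0$ such that, for all such solutions, at each $t\in[0,T]$ with $A(t)\le A_1$ and $|1+\mathbf W(t)|\ge\delta$, $E_{\rm lin}(w,r)$ is differentiable and $$\Big|\frac{d}{dt}E_{\rm lin}(w,r)\Big|\le C\big(B\,\|(w,r)\|_{\mathcal H^0}^2+\|w\|_{L^2}\|r\|_{L^2}\big).$$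 If these conditions hold at all times in $[0,T]$, then $\|(w,r)(t)\|_{\mathcal H^0}\le C\exp\big(C\int_0^t(1+B(\tau))\,d\tau\big)\|(w,r)(0)\|_{\mathcal H^0}$ for $t\in[0,T]$. -/

import Mathlib

open Set Filter Topology

noncomputable section

namespace QPWaterWaves

/-- Periodic functions (more generally, periodic distributions) on the torus
`𝕋^d = ℝ^d / (2πℤ)^d`, given by their Fourier series `u(𝛂) = ∑_j u_j e^{i⟨j,𝛂⟩}`; the
quasiperiodic function on the line is `α ↦ u(𝐤 α)`. -/
abbrev PerFun (d : ℕ) := (Fin d → ℤ) → ℂ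

variable {d : ℕ}

/-- The frequency `⟨j, 𝐤⟩ = ξ_α` in the direction `𝐤`. -/
def freq (k : Fin d → ℝ) (j : Fin d → ℤ) : ℝ := ∑ i, (j i : ℝ) * k i

/-- The constant function `1`. -/
def one : PerFun d := Pi.single 0 1

/-- The pointwise product of functions, i.e. the convolution of the Fourier coefficients. -/
def mul (u v : PerFun d) : PerFun d := fun j => ∑' l, u l * v (j - l)

infixl:70 " ⊡ " => mul

/-- The complex conjugate of a function. -/
def bar (u : PerFun d) : PerFun d := fun j => star (u (-j))

/-- The real part of a function, `(u + ū) / 2`. -/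
def rePart (u : PerFun d) : PerFun d := (1 / 2 : ℂ) • (u + bar u)

/-- The imaginary part of a function, `(u - ū) / (2i)`. -/
def imPart (u : PerFun d) : PerFun d := (1 / (2 * Complex.I)) • (u - bar u)

/-- The integral over `𝕋^d` of a function, with respect to Lebesgue measure of total mass
`(2π)^d`. -/
def integral (u : PerFun d) : ℂ := ((2 * Real.pi) ^ d : ℝ) * u 0

/-- `∂_α = k_1 ∂_1 + ⋯ + k_d ∂_d`. -/
def dα (k : Fin d → ℝ) (u : PerFun d) : PerFun d := fun j => Complex.I * (freq k j : ℂ) * u j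

/-- The Hilbert transform, with symbol `-i sgn ⟨j, 𝐤⟩`. -/
def hilbert (k : Fin d → ℝ) (u : PerFun d) : PerFun d :=
  fun j => -Complex.I * (Real.sign (freq k j) : ℂ) * u j

/-- `P = (I - iH) / 2`: negative frequencies plus half of the zero mode. -/
def P (k : Fin d → ℝ) (u : PerFun d) : PerFun d :=
  (1 / 2 : ℂ) • (u - Complex.I • hilbert k u)

/-- `P̄ = (I + iH) / 2`. -/
def Pbar (k : Fin d → ℝ) (u : PerFun d) : PerFun d :=
  (1 / 2 : ℂ) • (u + Complex.I • hilbert k u)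

/-- Zero-average holomorphic functions: only frequencies `⟨j, 𝐤⟩ < 0` are present. -/
def IsHol (k : Fin d → ℝ) (u : PerFun d) : Prop := ∀ j, 0 ≤ freq k j → u j = 0

/-! ### Sobolev spaces -/

/-- The weight `⟨j⟩^{2σ} ⟨ξ_α⟩^{2θ}`, where `⟨ξ⟩ = (1 + |ξ|²)^{1/2}`. -/
def weight (k : Fin d → ℝ) (σ θ : ℝ) (j : Fin d → ℤ) : ℝ :=
  (1 + ∑ i, (j i : ℝ) ^ 2) ^ σ * (1 + freq k j ^ 2) ^ θ

/-- Membership in `H^{σ,θ}(𝕋^d)`. -/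
def MemH (k : Fin d → ℝ) (σ θ : ℝ) (u : PerFun d) : Prop :=
  Summable fun j => weight k σ θ j * ‖u j‖ ^ 2

/-- The norm of `H^{σ,θ}(𝕋^d)`; `H^σ` is `H^{σ,0}` and `L²` is `H^{0,0}`. -/
def normH (k : Fin d → ℝ) (σ θ : ℝ) (u : PerFun d) : ℝ :=
  Real.sqrt (∑' j, weight k σ θ j * ‖u j‖ ^ 2)

/-- Membership in `𝓗^σ = H^σ × H^{σ,1/2}`. -/
def MemPair (k : Fin d → ℝ) (σ : ℝ) (u v : PerFun d) : Prop :=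
  MemH k σ 0 u ∧ MemH k σ (1 / 2) v

/-- The norm of `𝓗^σ`. -/
def normPair (k : Fin d → ℝ) (σ : ℝ) (u v : PerFun d) : ℝ :=
  Real.sqrt (normH k σ 0 u ^ 2 + normH k σ (1 / 2) v ^ 2)

/-- `(u, v) ∈ C(I; 𝓗^σ)`. -/
def ContInPair (k : Fin d → ℝ) (σ : ℝ) (I : Set ℝ) (u v : ℝ → PerFun d) : Prop :=
  (∀ t ∈ I, MemPair k σ (u t) (v t)) ∧
    ∀ t₀ ∈ I, Tendsto (fun t => normPair k σ (u t - u t₀) (v t - v t₀)) (𝓝[I] t₀) (𝓝 0)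

/-- The control parameter `A = ‖(𝐖, R)‖` in `𝓗^{s-1/2}`. -/
def ctrlA (k : Fin d → ℝ) (s : ℝ) (W R : PerFun d) : ℝ := normPair k (s - 1 / 2) W R

/-- The control parameter `B = ‖(𝐖, R)‖` in `𝓗^s`. -/
def ctrlB (k : Fin d → ℝ) (s : ℝ) (W R : PerFun d) : ℝ := normPair k s W R

/-! ### The auxiliary functions -/

/-- The value of a function with absolutely convergent Fourier series at the point `𝛂 = 2πx`,
`x ∈ (ℝ/ℤ)^d`. -/
def eval (u : PerFun d) (x : UnitAddTorus (Fin d)) : ℂ := ∑' j, u j * UnitAddTorus.mFourier j x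

/-- `Y = 𝐖 / (1 + 𝐖)`. -/
def Y (W : PerFun d) : PerFun d :=
  UnitAddTorus.mFourierCoeff fun x => eval W x / (1 + eval W x)

/-- `1 - Y = 1 / (1 + 𝐖)`. -/
def oneSubY (W : PerFun d) : PerFun d := one - Y W

/-- The advection velocity `b = 2 Re P[R (1 - Ȳ)]`. -/
def b (k : Fin d → ℝ) (W R : PerFun d) : PerFun d :=
  (2 : ℂ) • rePart (P k (R ⊡ bar (oneSubY W)))

/-- The frequency shift `a = i (P̄[R̄ R_α] - P[R R̄_α])`. -/
def a (k : Fin d → ℝ) (R : PerFun d) : PerFun d :=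
  Complex.I • (Pbar k (bar R ⊡ dα k R) - P k (R ⊡ dα k (bar R)))

/-- `M = P̄[R̄ Y_α - R_α Ȳ] + P[R Ȳ_α - R̄_α Y]`. -/
def M (k : Fin d → ℝ) (W R : PerFun d) : PerFun d :=
  Pbar k (bar R ⊡ dα k (Y W) - dα k R ⊡ bar (Y W)) +
    P k (R ⊡ dα k (bar (Y W)) - dα k (bar R) ⊡ Y W)

/-! ### The differentiated water wave system -/

/-- The states `(𝐖, R) ∈ 𝓗^s` of the system: `𝐖`, `R` are zero-average holomorphic, `1 + 𝐖`
does not vanish on the real line and `𝐖 / (1 + 𝐖)` is again holomorphic (`1 + 𝐖` is the boundary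
value of the derivative of a conformal map, hence has no zeros in the lower half-plane either). -/
structure IsState (k : Fin d → ℝ) (s : ℝ) (W R : PerFun d) : Prop where
  mem : MemPair k s W R
  hol_W : IsHol k W
  hol_R : IsHol k R
  ne_zero : ∀ x, 1 + eval W x ≠ 0
  hol_Y : IsHol k (Y W)

/-- `(𝐖, R) ∈ C([0,T]; 𝓗^s)` solves the differentiated gravity water wave system
`𝐖_t + b 𝐖_α + (1 + 𝐖) R_α / (1 + 𝐖̄) = (1 + 𝐖) M`,
`R_t + b R_α = i (𝐖 - a) / (1 + 𝐖)`
in the sense of periodic distributions (Fourier mode by Fourier mode);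
`1 / (1 + 𝐖) = 1 - Y`. -/
structure IsSolution (k : Fin d → ℝ) (s T : ℝ) (W R : ℝ → PerFun d) : Prop where
  state : ∀ t ∈ Icc 0 T, IsState k s (W t) (R t)
  cont : ContInPair k s (Icc 0 T) W R
  eq_W : ∀ t ∈ Icc 0 T, ∀ j, HasDerivWithinAt (fun τ => W τ j)
    ((-(b k (W t) (R t)) ⊡ dα k (W t)
      - (one + W t) ⊡ bar (oneSubY (W t)) ⊡ dα k (R t)
      + (one + W t) ⊡ M k (W t) (R t)) j) (Icc 0 T) t
  eq_R : ∀ t ∈ Icc 0 T, ∀ j, HasDerivWithinAt (fun τ => R τ j)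
    ((-(b k (W t) (R t)) ⊡ dα k (R t)
      + Complex.I • ((W t - a k (R t)) ⊡ oneSubY (W t))) j) (Icc 0 T) t

/-! ### The linearized system -/

/-- `δb = 2 Re P[(1 - Ȳ) r - (1 - Ȳ)² R w̄]`. -/
def δb (k : Fin d → ℝ) (W R w r : PerFun d) : PerFun d :=
  (2 : ℂ) • rePart (P k (bar (oneSubY W) ⊡ r
    - bar (oneSubY W) ⊡ bar (oneSubY W) ⊡ R ⊡ bar w))

/-- `δa = 2 Im P[R̄_α r + R r̄_α]`. -/
def δa (k : Fin d → ℝ) (R r : PerFun d) : PerFun d :=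
  (2 : ℂ) • imPart (P k (dα k (bar R) ⊡ r + R ⊡ dα k (bar r)))

/-- `δM = 2 Re P[r Ȳ_α - 2 R (1 - Ȳ) w̄ Ȳ_α + R (1 - Ȳ)² w̄_α - r̄_α Y - R̄_α (1 - Y)² w]`. -/
def δM (k : Fin d → ℝ) (W R w r : PerFun d) : PerFun d :=
  (2 : ℂ) • rePart (P k
    (r ⊡ dα k (bar (Y W))
      - (2 : ℂ) • (R ⊡ bar (oneSubY W) ⊡ bar w ⊡ dα k (bar (Y W)))
      + R ⊡ (bar (oneSubY W) ⊡ bar (oneSubY W)) ⊡ dα k (bar w)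
      - dα k (bar r) ⊡ Y W
      - dα k (bar R) ⊡ (oneSubY W ⊡ oneSubY W) ⊡ w))

/-- `f = -(1 - Ȳ) R_α w + (1 - Ȳ)² (1 + 𝐖) R_α w̄ + M w - 𝐖_α δb + (1 + 𝐖) δM`. -/
def sourceF (k : Fin d → ℝ) (W R w r : PerFun d) : PerFun d :=
  - (bar (oneSubY W) ⊡ dα k R ⊡ w)
    + bar (oneSubY W) ⊡ bar (oneSubY W) ⊡ (one + W) ⊡ dα k R ⊡ bar w
    + M k W R ⊡ w
    - dα k W ⊡ δb k W R w r
    + (one + W) ⊡ δM k W R w r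

/-- `g = -R_α δb - i (1 - Y) δa`. -/
def sourceG (k : Fin d → ℝ) (W R w r : PerFun d) : PerFun d :=
  - (dα k R ⊡ δb k W R w r) - Complex.I • (oneSubY W ⊡ δa k R r)

/-- Zero-average holomorphic pairs `(w, r) ∈ 𝓗^0`. -/
structure IsLinState (k : Fin d → ℝ) (w r : PerFun d) : Prop where
  mem : MemPair k 0 w r
  hol_w : IsHol k w
  hol_r : IsHol k r

/-- `(w, r) ∈ C([0,T]; 𝓗^0)` solves the full linearized system around `(𝐖, R)`,
`D_t w + (1 - Ȳ)(1 + 𝐖) r_α = f`, `D_t r - i (1 + a)(1 - Y)² w = g`, `D_t = ∂_t + b ∂_α`,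
in the sense of periodic distributions. -/
structure IsLinSolution (k : Fin d → ℝ) (T : ℝ) (W R w r : ℝ → PerFun d) : Prop where
  state : ∀ t ∈ Icc 0 T, IsLinState k (w t) (r t)
  cont : ContInPair k 0 (Icc 0 T) w r
  eq_w : ∀ t ∈ Icc 0 T, ∀ j, HasDerivWithinAt (fun τ => w τ j)
    ((-(b k (W t) (R t)) ⊡ dα k (w t)
      - bar (oneSubY (W t)) ⊡ (one + W t) ⊡ dα k (r t)
      + sourceF k (W t) (R t) (w t) (r t)) j) (Icc 0 T) t
  eq_r : ∀ t ∈ Icc 0 T, ∀ j, HasDerivWithinAt (fun τ => r τ j)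
    ((-(b k (W t) (R t)) ⊡ dα k (r t)
      + Complex.I • ((one + a k (R t)) ⊡ (oneSubY (W t) ⊡ oneSubY (W t)) ⊡ w t)
      + sourceG k (W t) (R t) (w t) (r t)) j) (Icc 0 T) t

/-- The linearized energy
`E_lin(w, r) = ∫ (1 + a) |1 - Y|² |w|² + Im (r r̄_α) + |r|² d𝛂`. -/
def Elin (k : Fin d → ℝ) (W R w r : PerFun d) : ℝ :=
  (integral ((one + a k R) ⊡ (oneSubY W ⊡ bar (oneSubY W)) ⊡ (w ⊡ bar w)
    + imPart (r ⊡ dα k (bar r)) + r ⊡ bar r)).re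

/-- Bounds on the background: `A ≤ A₁` and `|1 + 𝐖| ≥ δ`. -/
def Bounded (k : Fin d → ℝ) (s A₁ δ : ℝ) (W R : PerFun d) : Prop :=
  ctrlA k s W R ≤ A₁ ∧ ∀ x, δ ≤ ‖1 + eval W x‖

end QPWaterWaves

end

/-! Everything happens on Fourier coefficients, in weighted `ℓ^p` spaces with weights that are
powers of `λ = 1 + |⟨j,k⟩|`. The Wiener algebra `ℓ^1` plays the role of `L^∞`: since `s - 1/2 >
d/2`, Cauchy–Schwarz embeds `H^{s-1/2}` into it. Thus `A` controls `𝐖` in `ℓ^1` and `R` with half an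
`α`-derivative, and `B` controls half a derivative more of each. A bound by `B` must be linear in
these higher norms.

The energy identity comes from the variable `ŵ = (1 - Y) w = w / (1 + 𝐖)`. It satisfies `D_t ŵ + (1
- Ȳ) r_α = …` and `D_t r = i (1 + a)(1 - Y) ŵ + g`. On holomorphic functions `λ` is the symbol of `1
+ i∂_α`, so up to the factor `(2π)^d` the energy is `⟨ŵ, (1 + a) ŵ⟩ + ‖λ^{1/2} r‖²`. In its time
derivative the transport terms integrate by parts and leave only `b_α` and `D_t a`. The two terms
containing `r_α` cancel, because `(1 + a)(1 - Y)` is `1 + a` times the conjugate of `1 - Ȳ`. The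
sources `f` and `g` cost one factor `B`. The part `|r|²` of the energy leaves `2 Re ⟨r, i (1 + a)(1
- Y) ŵ⟩`, the only term without a factor `B`; this is the extra `‖w‖ ‖r‖` in the uniform bound. When
`A ≥ A₀`, the inequality `1 ≤ B / A₀` absorbs it. Coercivity follows from `a ≥ 0` and the
invertibility of `1 + 𝐖`, and the bounds in time from Grönwall's inequality.

The following facts carry the argument.

Inverse of `1 + 𝐖`: it lies in the Wiener algebra by Wiener's lemma (`isUnit_of_eval_ne_zero`). Its
norm is uniformly bounded because the embedding of `H^{s-1/2}` is compact (`exists_bound_inverse`),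
and weighted norms of `Y` follow from a commutator with a truncated weight (`inverse_weight_aux`).

Holomorphy: in `P` of a holomorphic times an antiholomorphic function every derivative can be moved
to the holomorphic factor (`P_ker_le`). This controls `b`, `a`, `M` and `δb`, `δa`, `δM` although
`w` and `r` have hardly any regularity.

Products with `𝐖_α`: in general this function is only in `H^{s-1}`, which need not embed into `ℓ^1`.
Its product with `δb`, which has half an `α`-derivative, is square summable by the lattice sum
`schur_sum`; the condition `s > (d+1)/2` is exactly what that sum needs.

Taylor coefficient: `a` is a bilinear expression in `R` and `R̄` with kernel `min(|ξ|, |η|)`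
(`a_eq_minMul`). Positivity of this kernel gives `a ≥ 0` (`inner_minMul_nonneg`), and its Lipschitz
bound makes `D_t a` of size `B` (`sourceA_zero`).

Regularisation: the solutions are too rough to differentiate the energy directly. The equations are
mollified by a Fourier multiplier; the commutators are uniformly bounded and converge strongly to
zero, and the integrated identity passes to the limit (`hasDerivWithinAt_energy`). -/

noncomputable section

namespace QPWaterWaves

set_option linter.unusedSectionVars false

variable {d : ℕ}

/-! ### Sequence spaces on `ℤ^d` -/

/-- The sequence space `ℓ^p(ℤ^d)`. -/
abbrev Seq (d : ℕ) (p : ENNReal) := lp (fun _ : Fin d → ℤ => ℂ) p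

/-- The operators below are built once for all finite exponents; only `p = 1` and `p = 2` are
instantiated. -/
instance fact_one_ne_top : Fact ((1 : ENNReal) ≠ ⊤) := ⟨by simp⟩
instance fact_two_ne_top : Fact ((2 : ENNReal) ≠ ⊤) := ⟨by simp⟩

theorem toReal_pos_of_fact (p : ENNReal) [h1 : Fact (1 ≤ p)] [h2 : Fact (p ≠ ⊤)] :
    0 < p.toReal :=
  ENNReal.toReal_pos (by have := h1.out; rintro rfl; simp at this) h2.out

theorem l1_summable (u : Seq d 1) : Summable fun j => ‖u j‖ := by
  simpa using (lp.memℓp u).summable (by simp)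

theorem l1_norm (u : Seq d 1) : ‖u‖ = ∑' j, ‖u j‖ := by
  simpa using lp.norm_eq_tsum_rpow (p := 1) (by simp) u

theorem l2_summable (u : Seq d 2) : Summable fun j => ‖u j‖ ^ 2 := by
  simpa using (lp.memℓp u).summable (by simp)

theorem l2_norm_sq (u : Seq d 2) : ‖u‖ ^ 2 = ∑' j, ‖u j‖ ^ 2 := by
  simpa using lp.norm_rpow_eq_tsum (p := 2) (by simp) u

/-! ### Bounded Fourier multipliers and translations on `ℓ^p`. -/

section ops
variable (p : ENNReal) [Fact (1 ≤ p)] [Fact (p ≠ ⊤)]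

theorem memℓp_diag (σ : (Fin d → ℤ) → ℂ) {K : ℝ} (h : ∀ j, ‖σ j‖ ≤ K) (x : Seq d p) :
    Memℓp (fun j => σ j * x j) p := by
  refine ((lp.memℓp x).const_mul (K : ℂ)).mono' ?_
  intro j
  have hK : 0 ≤ K := (norm_nonneg _).trans (h j)
  simp only [norm_mul, Complex.norm_real, Real.norm_eq_abs, abs_of_nonneg hK]
  exact mul_le_mul_of_nonneg_right (h j) (norm_nonneg _)

/-- The multiplier with bounded symbol `σ`. -/
def diag (σ : (Fin d → ℤ) → ℂ) (K : ℝ) (h : ∀ j, ‖σ j‖ ≤ K) : Seq d p →L[ℂ] Seq d p :=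
  LinearMap.mkContinuous
    { toFun := fun x => ⟨fun j => σ j * x j, memℓp_diag p σ h x⟩
      map_add' := fun x y => by
        ext j; change σ j * (x j + y j) = σ j * x j + σ j * y j; ring
      map_smul' := fun c x => by
        ext j; change σ j * (c * x j) = c * (σ j * x j); ring } K (fun x => by
    have hK : 0 ≤ K := (norm_nonneg _).trans (h 0)
    have hp : p ≠ 0 := (zero_lt_one.trans_le (Fact.out : 1 ≤ p)).ne'
    have h2 : ‖(K : ℂ) • x‖ = K * ‖x‖ := by
      rw [norm_smul]; simp [abs_of_nonneg hK]
    rw [← h2]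
    refine lp.norm_mono hp fun j => ?_
    change ‖σ j * x j‖ ≤ ‖(K : ℂ) * x j‖
    simp only [norm_mul, Complex.norm_real, Real.norm_eq_abs, abs_of_nonneg hK]
    exact mul_le_mul_of_nonneg_right (h j) (norm_nonneg _))

@[simp] theorem diag_apply (σ : (Fin d → ℤ) → ℂ) (K : ℝ) (h) (x : Seq d p) (j) :
    diag p σ K h x j = σ j * x j := rfl

theorem diag_norm_le (σ : (Fin d → ℤ) → ℂ) (K : ℝ) (h) : ‖diag (d := d) p σ K h‖ ≤ K :=
  LinearMap.mkContinuous_norm_le _ ((norm_nonneg _).trans (h 0)) _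

theorem memℓp_shift (l : Fin d → ℤ) (x : Seq d p) : Memℓp (fun j => x (j - l)) p := by
  have hp := toReal_pos_of_fact p
  rw [memℓp_gen_iff hp]
  exact (Equiv.subRight l).summable_iff.mpr ((lp.memℓp x).summable hp)

/-- Translation of sequences. -/
def shift (l : Fin d → ℤ) : Seq d p →L[ℂ] Seq d p :=
  LinearMap.mkContinuous
    { toFun := fun x => ⟨fun j => x (j - l), memℓp_shift p l x⟩
      map_add' := fun x y => by ext j; rfl
      map_smul' := fun c x => by ext j; rfl } 1 (fun x => by
    have hp := toReal_pos_of_fact p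
    rw [one_mul]
    refine lp.norm_le_of_tsum_le hp (norm_nonneg _) ?_
    rw [lp.norm_rpow_eq_tsum hp]
    exact ((Equiv.subRight l).tsum_eq (fun j => ‖x j‖ ^ p.toReal)).le)

@[simp] theorem shift_apply (l : Fin d → ℤ) (x : Seq d p) (j) : shift p l x j = x (j - l) := rfl

theorem shift_norm_le (l : Fin d → ℤ) : ‖shift (d := d) p l‖ ≤ 1 :=
  LinearMap.mkContinuous_norm_le _ zero_le_one _

end ops

/-! ### Sums of bounded families against `ℓ^1` coefficients. -/

section l1lift
variable {Z : Type*} [NormedAddCommGroup Z] [NormedSpace ℂ Z] [CompleteSpace Z]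

theorem l1lift_summable_norm (F : (Fin d → ℤ) → Z) {K : ℝ} (hF : ∀ l, ‖F l‖ ≤ K) (u : Seq d 1) :
    Summable fun l => ‖u l • F l‖ := by
  refine Summable.of_nonneg_of_le (fun _ => norm_nonneg _) (fun l => ?_)
    ((l1_summable u).mul_right K)
  rw [norm_smul]
  exact mul_le_mul_of_nonneg_left (hF l) (norm_nonneg _)

/-- The map `u ↦ ∑ u_l F_l` on `ℓ^1` attached to a bounded family `F`. -/
def l1lift (F : (Fin d → ℤ) → Z) (K : ℝ) (hF : ∀ l, ‖F l‖ ≤ K) : Seq d 1 →L[ℂ] Z :=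
  LinearMap.mkContinuous
    { toFun := fun u => ∑' l, u l • F l
      map_add' := fun u v => by
        rw [← ((l1lift_summable_norm F hF u).of_norm).tsum_add (l1lift_summable_norm F hF v).of_norm]
        refine tsum_congr fun l => ?_
        rw [lp.coeFn_add]; simp [add_smul]
      map_smul' := fun c u => by
        rw [RingHom.id_apply, ← tsum_const_smul'']
        refine tsum_congr fun l => ?_
        rw [lp.coeFn_smul]; simp [mul_smul] } K (fun u => by
    have h := l1lift_summable_norm F hF u
    refine (norm_tsum_le_tsum_norm h).trans ?_
    rw [l1_norm, mul_comm, ← tsum_mul_right]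
    refine h.tsum_le_tsum (fun l => ?_) ((l1_summable u).mul_right K)
    rw [norm_smul]
    exact mul_le_mul_of_nonneg_left (hF l) (norm_nonneg _))

theorem l1lift_norm_le (F : (Fin d → ℤ) → Z) (K : ℝ) (hF) : ‖l1lift F K hF‖ ≤ K :=
  LinearMap.mkContinuous_norm_le _ ((norm_nonneg _).trans (hF 0)) _

end l1lift

/-! ### Bilinear Fourier multipliers from `ℓ^1 × ℓ^p` to `ℓ^p`. -/

section bil
variable (p : ENNReal) [Fact (1 ≤ p)] [Fact (p ≠ ⊤)]

theorem bil_aux (κ : (Fin d → ℤ) → (Fin d → ℤ) → ℂ) (K : ℝ) (h : ∀ l n, ‖κ l n‖ ≤ K)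
    (l : Fin d → ℤ) : ‖(shift p l).comp (diag p (κ l) K (h l))‖ ≤ K :=
  (ContinuousLinearMap.opNorm_comp_le _ _).trans (by
    have h1 := shift_norm_le p l
    have h2 := diag_norm_le p (κ l) K (h l)
    calc _ ≤ 1 * K := mul_le_mul h1 h2 (norm_nonneg _) zero_le_one
      _ = K := one_mul K)

/-- The bilinear operator with bounded symbol `κ`. -/
def bil (κ : (Fin d → ℤ) → (Fin d → ℤ) → ℂ) (K : ℝ) (h : ∀ l n, ‖κ l n‖ ≤ K) :
    Seq d 1 →L[ℂ] Seq d p →L[ℂ] Seq d p :=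
  l1lift (fun l => (shift p l).comp (diag p (κ l) K (h l))) K (bil_aux p κ K h)

theorem bil_norm_le (κ : (Fin d → ℤ) → (Fin d → ℤ) → ℂ) (K : ℝ) (h) : ‖bil p κ K h‖ ≤ K :=
  l1lift_norm_le _ _ _

theorem bil_apply_eq_tsum (κ : (Fin d → ℤ) → (Fin d → ℤ) → ℂ) (K : ℝ) (h) (u : Seq d 1)
    (v : Seq d p) : bil p κ K h u v = ∑' l, u l • (shift p l (diag p (κ l) K (h l) v)) := by
  have hs := (l1lift_summable_norm _ (bil_aux p κ K h) u).of_norm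
  exact (ContinuousLinearMap.apply ℂ (Seq d p) v).map_tsum hs

theorem bil_summable (κ : (Fin d → ℤ) → (Fin d → ℤ) → ℂ) (K : ℝ) (h : ∀ l n, ‖κ l n‖ ≤ K)
    (u : Seq d 1) (v : Seq d p) : Summable fun l => u l • (shift p l (diag p (κ l) K (h l) v)) := by
  have hs := (l1lift_summable_norm _ (bil_aux p κ K h) u).of_norm
  have h2 := (ContinuousLinearMap.apply ℂ (Seq d p) v).summable hs
  refine h2.congr fun l => ?_
  rfl

theorem bil_apply (κ : (Fin d → ℤ) → (Fin d → ℤ) → ℂ) (K : ℝ) (h) (u : Seq d 1)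
    (v : Seq d p) (n : Fin d → ℤ) :
    bil p κ K h u v n = ∑' l, u l * (κ l (n - l) * v (n - l)) := by
  rw [bil_apply_eq_tsum]
  exact (lp.evalCLM ℂ (fun _ : Fin d → ℤ => ℂ) (p := p) n).map_tsum (bil_summable p κ K h u v)

theorem bil_le (κ : (Fin d → ℤ) → (Fin d → ℤ) → ℂ) (K : ℝ) (h) (u : Seq d 1)
    (v : Seq d p) : ‖bil p κ K h u v‖ ≤ K * (‖u‖ * ‖v‖) := by
  have := (bil p κ K h).le_opNorm₂ u v
  refine this.trans ?_
  rw [mul_assoc]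
  exact mul_le_mul_of_nonneg_right (bil_norm_le p κ K h) (by positivity)

end bil

/-! ### Products with a symbol -/

/-- The bilinear multiplier with symbol `κ`. -/
def bmul (κ : (Fin d → ℤ) → (Fin d → ℤ) → ℂ) (u v : PerFun d) : PerFun d :=
  fun n => ∑' l, κ l (n - l) * u l * v (n - l)

theorem mul_eq_bmul (u v : PerFun d) : u ⊡ v = bmul (fun _ _ => 1) u v := by
  ext n; simp [mul, bmul]

/-- `u` is a continuous family of elements of the space `ℓ^p` with weight `m` on the time
interval `I`, with norm bounded by `β`. -/
def CB (p : ENNReal) [Fact (1 ≤ p)] (m : (Fin d → ℤ) → ℝ) (I : Set ℝ) (u : ℝ → PerFun d)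
    (β : ℝ → ℝ) : Prop :=
  ∃ U : ℝ → Seq d p, ContinuousOn U I ∧ ∀ t ∈ I, (∀ j, U t j = (m j : ℂ) * u t j) ∧ ‖U t‖ ≤ β t

/-! ### Calculus of continuous families in weighted spaces. -/

namespace CB
variable {p : ENNReal} [Fact (1 ≤ p)] [Fact (p ≠ ⊤)] {m m' m₁ m₂ : (Fin d → ℤ) → ℝ} {I : Set ℝ}
  {u v : ℝ → PerFun d} {β γ η : ℝ → ℝ}

theorem mono (h : CB p m I u β) (hβ : ∀ t ∈ I, β t ≤ γ t) : CB p m I u γ := by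
  obtain ⟨U, h1, h2⟩ := h
  exact ⟨U, h1, fun t ht => ⟨(h2 t ht).1, (h2 t ht).2.trans (hβ t ht)⟩⟩

theorem congr (h : CB p m I u β) (huv : ∀ t ∈ I, v t = u t) : CB p m I v β := by
  obtain ⟨U, h1, h2⟩ := h
  exact ⟨U, h1, fun t ht => ⟨fun j => by rw [huv t ht]; exact (h2 t ht).1 j, (h2 t ht).2⟩⟩

theorem nonneg (h : CB p m I u β) {t : ℝ} (ht : t ∈ I) : 0 ≤ β t := by
  obtain ⟨U, h1, h2⟩ := h
  exact (norm_nonneg _).trans (h2 t ht).2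

theorem add (hu : CB p m I u β) (hv : CB p m I v γ) :
    CB p m I (fun t => u t + v t) (fun t => β t + γ t) := by
  obtain ⟨U, hU, hu⟩ := hu
  obtain ⟨V, hV, hv⟩ := hv
  refine ⟨fun t => U t + V t, hU.add hV, fun t ht => ⟨fun j => ?_, ?_⟩⟩
  · rw [lp.coeFn_add]; simp [(hu t ht).1, (hv t ht).1, mul_add]
  · exact (norm_add_le _ _).trans (add_le_add (hu t ht).2 (hv t ht).2)

theorem smul (c : ℂ) (hu : CB p m I u β) : CB p m I (fun t => c • u t) (fun t => ‖c‖ * β t) := by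
  obtain ⟨U, hU, hu⟩ := hu
  refine ⟨fun t => c • U t, hU.const_smul c, fun t ht => ⟨fun j => ?_, ?_⟩⟩
  · rw [lp.coeFn_smul]; simp [(hu t ht).1]; ring
  · rw [norm_smul]; exact mul_le_mul_of_nonneg_left (hu t ht).2 (norm_nonneg _)

theorem neg (hu : CB p m I u β) : CB p m I (fun t => -u t) β := by
  refine ((hu.smul (-1)).congr (fun t _ => by simp)).mono (fun _ _ => by simp)

theorem sub (hu : CB p m I u β) (hv : CB p m I v γ) :
    CB p m I (fun t => u t - v t) (fun t => β t + γ t) :=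
  (hu.add hv.neg).congr fun _ _ => sub_eq_add_neg _ _

/-- Action of a Fourier multiplier. -/
theorem mult (hu : CB p m I u β) (σ : (Fin d → ℤ) → ℂ) {K : ℝ} (hm : ∀ j, 0 < m j)
    (hσ : ∀ j, ‖σ j‖ * |m' j| ≤ K * m j) :
    CB p m' I (fun t j => σ j * u t j) (fun t => K * β t) := by
  obtain ⟨U, hU, hu⟩ := hu
  have hσ' : ∀ j, ‖σ j * m' j / m j‖ ≤ K := fun j => by
    rw [norm_div, norm_mul, Complex.norm_real, Complex.norm_real, div_le_iff₀ (by simpa using (hm j).ne')]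
    simpa [abs_of_pos (hm j)] using hσ j
  refine ⟨fun t => diag p (fun j => σ j * m' j / m j) K hσ' (U t),
    (diag p _ K hσ').continuous.comp_continuousOn hU, fun t ht => ⟨fun j => ?_, ?_⟩⟩
  · have : (m j : ℂ) ≠ 0 := by exact_mod_cast (hm j).ne'
    simp only [diag_apply, (hu t ht).1]
    field_simp
  · refine ((diag p _ K hσ').le_opNorm _).trans ?_
    exact mul_le_mul (diag_norm_le _ _ _ _) (hu t ht).2 (norm_nonneg _)
      ((norm_nonneg _).trans (hσ' 0))

theorem weight (hu : CB p m I u β) {K : ℝ} (hm : ∀ j, 0 < m j) (h : ∀ j, |m' j| ≤ K * m j) :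
    CB p m' I u (fun t => K * β t) := by
  simpa using hu.mult (m' := m') (K := K) (fun _ => 1) hm (by simpa using h)

theorem memℓp_bar (x : Seq d p) : Memℓp (fun j => star (x (-j))) p := by
  have hp := toReal_pos_of_fact p
  rw [memℓp_gen_iff hp]
  refine ((Equiv.neg (Fin d → ℤ)).summable_iff.mpr ((lp.memℓp x).summable hp)).congr fun j => ?_
  simp

/-- Complex conjugation on the Fourier side. -/
def barSeq (x : Seq d p) : Seq d p := ⟨fun j => star (x (-j)), memℓp_bar x⟩

theorem barSeq_apply (x : Seq d p) (j) : barSeq x j = star (x (-j)) := rfl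

theorem norm_barSeq (x : Seq d p) : ‖barSeq x‖ = ‖x‖ := by
  have hp := toReal_pos_of_fact p
  rw [lp.norm_eq_tsum_rpow hp, lp.norm_eq_tsum_rpow hp]
  congr 1
  rw [← (Equiv.neg (Fin d → ℤ)).tsum_eq]
  refine tsum_congr fun j => ?_
  rw [barSeq_apply]; simp

theorem barSeq_sub (x y : Seq d p) : barSeq x - barSeq y = barSeq (x - y) := by
  ext j; rw [lp.coeFn_sub, Pi.sub_apply, barSeq_apply, barSeq_apply, barSeq_apply, lp.coeFn_sub]
  simp

theorem continuous_barSeq : Continuous (barSeq : Seq d p → Seq d p) := by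
  refine LipschitzWith.continuous (K := 1) (LipschitzWith.of_dist_le_mul fun x y => ?_)
  rw [dist_eq_norm, dist_eq_norm, barSeq_sub, norm_barSeq]; simp

theorem bar (hu : CB p m I u β) (hm : ∀ j, m (-j) = m j) :
    CB p m I (fun t => QPWaterWaves.bar (u t)) β := by
  obtain ⟨U, hU, hu⟩ := hu
  refine ⟨fun t => barSeq (U t), continuous_barSeq.comp_continuousOn hU, fun t ht => ⟨fun j => ?_, ?_⟩⟩
  · rw [barSeq_apply, (hu t ht).1, hm]; simp [QPWaterWaves.bar]
  · rw [norm_barSeq]; exact (hu t ht).2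

/-- The weights are absorbed into the symbol, which may be set to zero off the supports `S₁`, `S₂`.
Hence the weight inequality is needed only for frequencies that occur, and this is how holomorphy of
the factors enters the estimates. -/
theorem bmul (hu : CB 1 m₁ I u β) (hv : CB p m₂ I v γ) (hm₁ : ∀ j, 0 < m₁ j)
    (hm₂ : ∀ j, 0 < m₂ j) {S₁ S₂ : (Fin d → ℤ) → Prop} (h₁ : ∀ t ∈ I, ∀ l, ¬ S₁ l → u t l = 0)
    (h₂ : ∀ t ∈ I, ∀ l, ¬ S₂ l → v t l = 0) (κ : (Fin d → ℤ) → (Fin d → ℤ) → ℂ) {K : ℝ}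
    (hK : 0 ≤ K) (hκ : ∀ l n, S₁ l → S₂ n → ‖κ l n‖ * |m (l + n)| ≤ K * (m₁ l * m₂ n)) :
    CB p m I (fun t => QPWaterWaves.bmul κ (u t) (v t)) (fun t => K * (β t * γ t)) := by
  classical
  have hγ : ∀ t ∈ I, 0 ≤ γ t := fun t ht => hv.nonneg ht
  have hβ : ∀ t ∈ I, 0 ≤ β t := fun t ht => hu.nonneg ht
  obtain ⟨U, hU, hu⟩ := hu
  obtain ⟨V, hV, hv⟩ := hv
  let κ' : (Fin d → ℤ) → (Fin d → ℤ) → ℂ := fun l n =>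
    if S₁ l ∧ S₂ n then κ l n * m (l + n) / (m₁ l * m₂ n) else 0
  have hκ' : ∀ l n, ‖κ' l n‖ ≤ K := fun l n => by
    by_cases h : S₁ l ∧ S₂ n
    · simp only [κ', h, and_self, if_true, norm_div, norm_mul, Complex.norm_real, Real.norm_eq_abs,
        abs_of_pos (hm₁ l), abs_of_pos (hm₂ n)]
      rw [div_le_iff₀ (mul_pos (hm₁ l) (hm₂ n))]
      exact hκ l n h.1 h.2
    · simp [κ', h, hK]
  refine ⟨fun t => bil p κ' K hκ' (U t) (V t), ?_, fun t ht => ⟨fun j => ?_, ?_⟩⟩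
  · exact ((bil p κ' K hκ').continuous.comp_continuousOn hU).clm_apply hV
  · rw [bil_apply]
    change _ = _ * ∑' l, κ l (j - l) * u t l * v t (j - l)
    rw [← tsum_mul_left]
    refine tsum_congr fun l => ?_
    rw [(hu t ht).1, (hv t ht).1]
    have e1 : (m₁ l : ℂ) ≠ 0 := by exact_mod_cast (hm₁ l).ne'
    have e2 : (m₂ (j - l) : ℂ) ≠ 0 := by exact_mod_cast (hm₂ (j - l)).ne'
    by_cases ha : S₁ l
    · by_cases hb : S₂ (j - l)
      · simp only [κ', ha, hb, and_self, if_true, add_sub_cancel]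
        field_simp
      · rw [h₂ t ht _ hb]; simp
    · rw [h₁ t ht _ ha]; simp
  · refine (bil_le p κ' K hκ' _ _).trans (mul_le_mul_of_nonneg_left ?_ hK)
    exact mul_le_mul (hu t ht).2 (hv t ht).2 (norm_nonneg _) (hβ t ht)

end CB

/-- `u` belongs to the space `ℓ^p` with weight `m`. -/
def Mem (p : ENNReal) [Fact (1 ≤ p)] (m : (Fin d → ℤ) → ℝ) (u : PerFun d) : Prop :=
  ∃ x : Seq d p, ∀ j, x j = (m j : ℂ) * u j

theorem CB.mem {p : ENNReal} [Fact (1 ≤ p)] {m : (Fin d → ℤ) → ℝ} {I : Set ℝ} {u : ℝ → PerFun d}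
    {β : ℝ → ℝ} (h : CB p m I u β) {t : ℝ} (ht : t ∈ I) : Mem p m (u t) := by
  obtain ⟨U, -, h⟩ := h
  exact ⟨U t, (h t ht).1⟩

section
variable {p : ENNReal} [Fact (1 ≤ p)] [Fact (p ≠ ⊤)] {m m' m₁ m₂ : (Fin d → ℤ) → ℝ}

theorem norm_coord_le (x : Seq d p) (j) : ‖x j‖ ≤ ‖x‖ :=
  lp.norm_apply_le_norm (zero_lt_one.trans_le (Fact.out : 1 ≤ p)).ne' x j

theorem Mem.summable_bmul {u v : PerFun d} (hu : Mem 1 m₁ u) (hv : Mem p m₂ v)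
    (κ : (Fin d → ℤ) → (Fin d → ℤ) → ℂ) (n : Fin d → ℤ) {C : ℝ}
    (hκ : ∀ l, ‖κ l (n - l)‖ ≤ C * (|m₁ l| * |m₂ (n - l)|)) :
    Summable fun l => κ l (n - l) * u l * v (n - l) := by
  obtain ⟨x, hx⟩ := hu
  obtain ⟨y, hy⟩ := hv
  have hC : ∀ l, ‖κ l (n - l) * u l * v (n - l)‖ ≤ ‖x l‖ * (|C| * ‖y‖) := fun l => by
    rw [norm_mul, norm_mul, hx]
    calc ‖κ l (n - l)‖ * ‖u l‖ * ‖v (n - l)‖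
        ≤ (|C| * (|m₁ l| * |m₂ (n - l)|)) * ‖u l‖ * ‖v (n - l)‖ := by
          gcongr
          exact (hκ l).trans (by gcongr; exact le_abs_self C)
      _ = (|m₁ l| * ‖u l‖) * (|C| * (|m₂ (n - l)| * ‖v (n - l)‖)) := by ring
      _ ≤ ‖(m₁ l : ℂ) * u l‖ * (|C| * ‖y‖) := by
          have h1 : |m₂ (n - l)| * ‖v (n - l)‖ ≤ ‖y‖ := by
            have := norm_coord_le y (n - l)
            rw [hy, norm_mul, Complex.norm_real] at this
            exact this
          rw [norm_mul, Complex.norm_real, Real.norm_eq_abs]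
          gcongr
  exact Summable.of_norm_bounded ((l1_summable x).mul_right _) hC

theorem Mem.summable_mul {u v : PerFun d} (hu : Mem 1 (fun _ => 1) u) (hv : Mem p (fun _ => 1) v)
    (n : Fin d → ℤ) : Summable fun l => u l * v (n - l) := by
  simpa using hu.summable_bmul hv (fun _ _ => 1) n (C := 1) (by simp)

/-! ### Multiplication by a square summable symbol -/

theorem memℓp_of_l2_mul (σ x : Seq d 2) : Memℓp (fun j => σ j * x j) 1 := by
  refine memℓp_gen ?_
  simpa using (lp.summable_mul (p := 2) (q := 2) (by norm_num; exact Real.HolderConjugate.two_two) σ x)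

/-- Multiplication by a square summable sequence, from `ℓ^2` to `ℓ^1`. -/
def l2ToL1 (σ : Seq d 2) : Seq d 2 →L[ℂ] Seq d 1 :=
  LinearMap.mkContinuous
    { toFun := fun x => ⟨fun j => σ j * x j, memℓp_of_l2_mul σ x⟩
      map_add' := fun x y => by
        ext j; change σ j * (x j + y j) = σ j * x j + σ j * y j; ring
      map_smul' := fun c x => by
        ext j; change σ j * (c * x j) = c * (σ j * x j); ring } ‖σ‖ (fun x => by
    rw [l1_norm]
    have := lp.tsum_mul_le_mul_norm' (p := 2) (q := 2) (by norm_num; exact Real.HolderConjugate.two_two) σ x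
    refine le_trans (le_of_eq ?_) this
    refine tsum_congr fun j => ?_
    exact norm_mul _ _)

theorem l2ToL1_norm_le (σ : Seq d 2) : ‖l2ToL1 σ‖ ≤ ‖σ‖ :=
  LinearMap.mkContinuous_norm_le _ (norm_nonneg _) _

theorem l2ToL1_apply (σ x : Seq d 2) (j) : l2ToL1 σ x j = σ j * x j := rfl

/-- Cauchy–Schwarz against the square summable quotient of the weights; the source of all Sobolev
embeddings into the Wiener algebra. -/
theorem CB.embed {I : Set ℝ} {u : ℝ → PerFun d} {β : ℝ → ℝ} (hu : CB 2 m I u β)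
    (hm : ∀ j, 0 < m j) {σ : Seq d 2} (hσ : ∀ j, σ j = (m' j / m j : ℝ)) :
    CB 1 m' I u (fun t => ‖σ‖ * β t) := by
  obtain ⟨U, hU, hu⟩ := hu
  refine ⟨fun t => l2ToL1 σ (U t), (l2ToL1 σ).continuous.comp_continuousOn hU,
    fun t ht => ⟨fun j => ?_, ?_⟩⟩
  · rw [l2ToL1_apply, (hu t ht).1, hσ]
    have : (m j : ℂ) ≠ 0 := by exact_mod_cast (hm j).ne'
    push_cast; field_simp
  · exact ((l2ToL1 σ).le_opNorm _).trans
      (mul_le_mul (l2ToL1_norm_le σ) (hu t ht).2 (norm_nonneg _) (norm_nonneg _))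

/-! ### Dominated convergence -/

theorem diag_tendsto_zero (σ : ℕ → (Fin d → ℤ) → ℂ) (K : ℝ) (h : ∀ N j, ‖σ N j‖ ≤ K)
    (hσ : ∀ j, Tendsto (fun N => σ N j) atTop (𝓝 0)) (x : Seq d p) :
    Tendsto (fun N => diag p (σ N) K (h N) x) atTop (𝓝 0) := by
  have hp := toReal_pos_of_fact p
  rw [tendsto_zero_iff_norm_tendsto_zero]
  simp only [lp.norm_eq_tsum_rpow hp]
  have key : Tendsto (fun N => ∑' i, ‖diag p (σ N) K (h N) x i‖ ^ p.toReal) atTop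
      (𝓝 (∑' _ : Fin d → ℤ, (0 : ℝ))) := by
    refine tendsto_tsum_of_dominated_convergence (bound := fun i => (K * ‖x i‖) ^ p.toReal) ?_ ?_ ?_
    · have hK : 0 ≤ K := (norm_nonneg _).trans (h 0 0)
      simp only [Real.mul_rpow hK (norm_nonneg _)]
      exact ((lp.memℓp x).summable hp).mul_left _
    · intro j
      have : Tendsto (fun N => ‖σ N j * x j‖ ^ p.toReal) atTop (𝓝 (‖(0 : ℂ) * x j‖ ^ p.toReal)) :=
        (((hσ j).mul_const (x j)).norm).rpow_const (Or.inr hp.le)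
      simpa [Real.zero_rpow hp.ne'] using this
    · refine Eventually.of_forall fun N j => ?_
      rw [Real.norm_of_nonneg (by positivity), diag_apply, norm_mul]
      gcongr
      exact h N j
  have h2 := key.rpow_const (p := 1 / p.toReal) (Or.inr (by positivity))
  simpa [Real.zero_rpow (inv_ne_zero hp.ne')] using h2

theorem diag_tendsto (σ : ℕ → (Fin d → ℤ) → ℂ) (σ' : (Fin d → ℤ) → ℂ) (K : ℝ)
    (h : ∀ N j, ‖σ N j‖ ≤ K) (h' : ∀ j, ‖σ' j‖ ≤ K)
    (hσ : ∀ j, Tendsto (fun N => σ N j) atTop (𝓝 (σ' j))) (x : Seq d p) :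
    Tendsto (fun N => diag p (σ N) K (h N) x) atTop (𝓝 (diag p σ' K h' x)) := by
  have h2 : ∀ N j, ‖σ N j - σ' j‖ ≤ K + K := fun N j =>
    (norm_sub_le _ _).trans (add_le_add (h N j) (h' j))
  have := diag_tendsto_zero (fun N j => σ N j - σ' j) (K + K) h2
    (fun j => by simpa using (hσ j).sub_const (σ' j)) x
  rw [tendsto_iff_norm_sub_tendsto_zero]
  refine (tendsto_zero_iff_norm_tendsto_zero.1 this).congr fun N => ?_
  congr 1
  ext j
  rw [lp.coeFn_sub]
  simp [sub_mul]

/-- Pointwise convergence of uniformly bounded symbols gives strong convergence of the operators, by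
dominated convergence applied twice; convergence in operator norm is not claimed. It is used for the
commutators with the mollifiers. -/
theorem bil_tendsto_zero (κ : ℕ → (Fin d → ℤ) → (Fin d → ℤ) → ℂ) (K : ℝ)
    (h : ∀ N l n, ‖κ N l n‖ ≤ K) (hκ : ∀ l n, Tendsto (fun N => κ N l n) atTop (𝓝 0))
    (u : Seq d 1) (v : Seq d p) :
    Tendsto (fun N => bil p (κ N) K (h N) u v) atTop (𝓝 0) := by
  simp only [bil_apply_eq_tsum]
  rw [show (0 : Seq d p) = ∑' _ : Fin d → ℤ, (0 : Seq d p) by simp]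
  refine tendsto_tsum_of_dominated_convergence (bound := fun l => ‖u l‖ * (K * ‖v‖))
    ((l1_summable u).mul_right _) (fun l => ?_) (Eventually.of_forall fun N l => ?_)
  · have h1 := diag_tendsto_zero (fun N => κ N l) K (fun N => h N l) (hκ l) v
    have h2 := (((shift p l).continuous.tendsto 0).comp h1).const_smul (u l)
    simpa using h2
  · rw [norm_smul]
    refine mul_le_mul_of_nonneg_left ?_ (norm_nonneg _)
    refine ((shift p l).le_opNorm _).trans ?_
    calc _ ≤ 1 * (K * ‖v‖) := by
          refine mul_le_mul (shift_norm_le p l) ?_ (norm_nonneg _) zero_le_one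
          exact ((diag p (κ N l) K (h N l)).le_opNorm v).trans
            (mul_le_mul_of_nonneg_right (diag_norm_le _ _ _ _) (norm_nonneg _))
      _ = _ := one_mul _

/-! ### Differentiability from differentiability of the coefficients -/

/-- Evaluation at a frequency commutes with the Bochner integral, so the coefficientwise fundamental
theorem of calculus gives `U t = U 0 + ∫ U'` in `ℓ^p`. This upgrades the equations, which hold mode
by mode, to derivatives in norm. -/
theorem hasDerivWithinAt_of_coord {T : ℝ} {U U' : ℝ → Seq d p}
    (hU' : ContinuousOn U' (Icc 0 T))
    (h : ∀ t ∈ Icc 0 T, ∀ j, HasDerivWithinAt (fun τ => U τ j) (U' t j) (Icc 0 T) t) :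
    ∀ t ∈ Icc 0 T, HasDerivWithinAt U (U' t) (Icc 0 T) t := by
  have hint : ∀ t ∈ Icc 0 T, IntervalIntegrable U' MeasureTheory.volume 0 t := fun t ht =>
    (hU'.mono (Icc_subset_Icc_right ht.2)).intervalIntegrable_of_Icc ht.1
  have key : ∀ t ∈ Icc 0 T, U t = U 0 + ∫ τ in (0 : ℝ)..t, U' τ := by
    intro t ht
    ext j
    let L := lp.evalCLM ℂ (fun _ : Fin d → ℤ => ℂ) (p := p) j
    have h1 : L (∫ τ in (0 : ℝ)..t, U' τ) = ∫ τ in (0 : ℝ)..t, L (U' τ) :=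
      (L.intervalIntegral_comp_comm (hint t ht)).symm
    have hsub : Icc 0 t ⊆ Icc 0 T := Icc_subset_Icc_right ht.2
    have h2 : ∫ τ in (0 : ℝ)..t, L (U' τ) = U t j - U 0 j := by
      refine intervalIntegral.integral_eq_sub_of_hasDerivAt_of_le (f := fun τ => U τ j) ht.1
        (fun τ hτ => ((h τ (hsub hτ) j).continuousWithinAt).mono hsub) (fun τ hτ => ?_)
        ((L.continuous.comp_continuousOn (hU'.mono hsub)).intervalIntegrable_of_Icc ht.1)
      exact (h τ (hsub (Ioo_subset_Icc_self hτ)) j).hasDerivAt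
        (Icc_mem_nhds hτ.1 (hτ.2.trans_le ht.2))
    rw [lp.coeFn_add, Pi.add_apply]
    change _ = _ + L (∫ τ in (0 : ℝ)..t, U' τ)
    rw [h1, h2]; ring
  intro t ht
  -- This selects the fundamental theorem of calculus within `[0,T]`, one-sided at the end points.
  have : Fact (t ∈ Icc 0 T) := ⟨ht⟩
  have h3 : HasDerivWithinAt (fun t => ∫ τ in (0 : ℝ)..t, U' τ) (U' t) (Icc 0 T) t :=
    intervalIntegral.integral_hasDerivWithinAt_right (hint t ht)
      (hU'.stronglyMeasurableAtFilter_nhdsWithin measurableSet_Icc t) (hU' t ht)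
  exact (h3.const_add (U 0)).congr (fun τ hτ => key τ hτ) (key t ht)

end

/-! ### Algebra of convolutions -/

theorem mul_comm' (u v : PerFun d) : u ⊡ v = v ⊡ u := by
  ext n
  change ∑' l, u l * v (n - l) = ∑' l, v l * u (n - l)
  rw [← (Equiv.subLeft n).tsum_eq]
  exact tsum_congr fun l => by simp [mul_comm]

/-- The convolution of `u` and `v` converges absolutely. -/
def Conv (u v : PerFun d) : Prop := ∀ n, Summable fun l => u l * v (n - l)

theorem Conv.symm {u v : PerFun d} (h : Conv u v) : Conv v u := fun n => by
  refine ((Equiv.subLeft n).summable_iff.2 (h n)).congr fun l => ?_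
  simp [mul_comm]

theorem mul_add' {u v x : PerFun d} (h : Conv u v) (h' : Conv u x) :
    u ⊡ (v + x) = u ⊡ v + u ⊡ x := by
  ext n
  change ∑' l, u l * (v (n - l) + x (n - l)) = (∑' l, u l * v (n - l)) + ∑' l, u l * x (n - l)
  rw [← (h n).tsum_add (h' n)]
  exact tsum_congr fun l => mul_add _ _ _

theorem smul_mul' (c : ℂ) (u v : PerFun d) : (c • u) ⊡ v = c • (u ⊡ v) := by
  ext n
  change ∑' l, (c * u l) * v (n - l) = c * ∑' l, u l * v (n - l)
  rw [← tsum_mul_left]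
  exact tsum_congr fun l => mul_assoc _ _ _

theorem mul_smul' (c : ℂ) (u v : PerFun d) : u ⊡ (c • v) = c • (u ⊡ v) := by
  rw [mul_comm', smul_mul', mul_comm' v u]

theorem neg_mul' (u v : PerFun d) : (-u) ⊡ v = -(u ⊡ v) := by
  simpa using smul_mul' (-1) u v

theorem mul_neg' (u v : PerFun d) : u ⊡ (-v) = -(u ⊡ v) := by
  simpa using mul_smul' (-1) u v

theorem Conv.neg {u v : PerFun d} (h : Conv u v) : Conv u (-v) := fun n => by
  simpa using (h n).neg

theorem mul_sub' {u v x : PerFun d} (h : Conv u v) (h' : Conv u x) :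
    u ⊡ (v - x) = u ⊡ v - u ⊡ x := by
  rw [sub_eq_add_neg, mul_add' h h'.neg, mul_neg', sub_eq_add_neg]

theorem add_mul' {u v x : PerFun d} (h : Conv u x) (h' : Conv v x) :
    (u + v) ⊡ x = u ⊡ x + v ⊡ x := by
  rw [mul_comm', mul_add' h.symm h'.symm, mul_comm' x u, mul_comm' x v]

theorem sub_mul' {u v x : PerFun d} (h : Conv u x) (h' : Conv v x) :
    (u - v) ⊡ x = u ⊡ x - v ⊡ x := by
  rw [mul_comm', mul_sub' h.symm h'.symm, mul_comm' x u, mul_comm' x v]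

theorem one_mul' (u : PerFun d) : one ⊡ u = u := by
  ext n
  change ∑' l, (Pi.single 0 1 : PerFun d) l * u (n - l) = u n
  rw [tsum_eq_single 0 (fun l hl => by simp [hl])]
  simp

theorem bar_mul (u v : PerFun d) : bar (u ⊡ v) = bar u ⊡ bar v := by
  ext n
  change star (∑' l, u l * v (-n - l)) = ∑' l, star (u (-l)) * star (v (-(n - l)))
  rw [tsum_star, ← (Equiv.neg _).tsum_eq]
  refine tsum_congr fun l => ?_
  simp only [Equiv.neg_apply, star_mul']
  congr 3
  abel

/-! ### Conjugation, frequencies and the derivative `∂_α`. -/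

@[simp] theorem bar_bar (u : PerFun d) : bar (bar u) = u := by ext n; simp [bar]
theorem bar_add (u v : PerFun d) : bar (u + v) = bar u + bar v := by ext n; simp [bar]
theorem bar_sub (u v : PerFun d) : bar (u - v) = bar u - bar v := by ext n; simp [bar]
theorem bar_neg (u : PerFun d) : bar (-u) = -bar u := by ext n; simp [bar]
theorem bar_smul (c : ℂ) (u : PerFun d) : bar (c • u) = star c • bar u := by ext n; simp [bar]
@[simp] theorem bar_one : bar (one : PerFun d) = one := by
  ext n
  by_cases h : n = 0 <;> simp [bar, one, h]

theorem freq_add (k : Fin d → ℝ) (j l : Fin d → ℤ) : freq k (j + l) = freq k j + freq k l := by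
  simp [freq, add_mul, Finset.sum_add_distrib]
@[simp] theorem freq_neg (k : Fin d → ℝ) (j : Fin d → ℤ) : freq k (-j) = -freq k j := by
  simp [freq]
theorem freq_sub (k : Fin d → ℝ) (j l : Fin d → ℤ) : freq k (j - l) = freq k j - freq k l := by
  rw [sub_eq_add_neg, freq_add, freq_neg, sub_eq_add_neg]
@[simp] theorem freq_zero (k : Fin d → ℝ) : freq k 0 = 0 := by simp [freq]

theorem dα_bar (k : Fin d → ℝ) (u : PerFun d) : dα k (bar u) = bar (dα k u) := by
  ext n; simp [dα, bar]
theorem dα_add (k : Fin d → ℝ) (u v : PerFun d) : dα k (u + v) = dα k u + dα k v := by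
  ext n; simp [dα, mul_add]
@[simp] theorem dα_one (k : Fin d → ℝ) : dα k (one : PerFun d) = 0 := by
  ext n
  by_cases h : n = 0 <;> simp [dα, one, h]

theorem dα_mul (k : Fin d → ℝ) {u v : PerFun d} (h : Conv (dα k u) v) (h' : Conv u (dα k v)) :
    dα k (u ⊡ v) = dα k u ⊡ v + u ⊡ dα k v := by
  ext n
  change Complex.I * freq k n * ∑' l, u l * v (n - l) =
    (∑' l, dα k u l * v (n - l)) + ∑' l, u l * dα k v (n - l)
  rw [← (h n).tsum_add (h' n), ← tsum_mul_left]
  refine tsum_congr fun l => ?_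
  simp only [dα, freq_sub]
  push_cast; ring

theorem mul_assoc' {u v x : PerFun d}
    (h : ∀ n, Summable fun q : (Fin d → ℤ) × (Fin d → ℤ) => u q.1 * (v q.2 * x (n - q.1 - q.2))) :
    u ⊡ v ⊡ x = u ⊡ (v ⊡ x) := by
  ext n
  have h1 : (u ⊡ (v ⊡ x)) n =
      ∑' q : (Fin d → ℤ) × (Fin d → ℤ), u q.1 * (v q.2 * x (n - q.1 - q.2)) := by
    rw [(h n).tsum_prod]
    exact tsum_congr fun l => (tsum_mul_left).symm
  -- A pair `(p, l)` goes to `(l, p - l)`: `p` is the total frequency of `u ⊡ v` and `l` the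
  -- frequency of `u`.
  let e : (Fin d → ℤ) × (Fin d → ℤ) ≃ (Fin d → ℤ) × (Fin d → ℤ) :=
    { toFun := fun q => (q.2, q.1 - q.2)
      invFun := fun q => (q.1 + q.2, q.1)
      left_inv := fun q => by simp
      right_inv := fun q => by simp }
  have h2 := e.summable_iff.2 (h n)
  rw [h1, ← e.tsum_eq]
  refine Eq.trans ?_ h2.tsum_prod.symm
  refine tsum_congr fun p => ?_
  change (∑' l, u l * v (p - l)) * x (n - p) = _
  rw [← tsum_mul_right]
  refine tsum_congr fun l => ?_
  simp only [e, Equiv.coe_fn_mk]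
  change _ = u l * (v (p - l) * x (n - l - (p - l)))
  rw [mul_assoc, sub_sub_sub_cancel_right]

theorem l2_conv_summable (v x : Seq d 2) (n : Fin d → ℤ) :
    (Summable fun l => ‖v l‖ * ‖x (n - l)‖) ∧ ∑' l, ‖v l‖ * ‖x (n - l)‖ ≤ ‖v‖ * ‖x‖ := by
  have hr : Memℓp (fun l => x (n - l)) 2 := by
    refine memℓp_gen ?_
    exact ((Equiv.subLeft n).summable_iff.2 ((lp.memℓp x).summable (p := 2) (by simp)))
  let y : Seq d 2 := ⟨fun l => x (n - l), hr⟩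
  have hy : ‖y‖ = ‖x‖ := by
    rw [lp.norm_eq_tsum_rpow (by simp), lp.norm_eq_tsum_rpow (by simp)]
    congr 1
    exact (Equiv.subLeft n).tsum_eq (fun l => ‖x l‖ ^ (2 : ENNReal).toReal)
  have := lp.tsum_mul_le_mul_norm (p := 2) (q := 2)
    (by norm_num; exact Real.HolderConjugate.two_two) v y
  rw [hy] at this
  exact this

theorem summable_prod_mul {ι : Type*} {f : ι → ℝ} {g : ι → ι → ℝ} (hf0 : ∀ l, 0 ≤ f l)
    (hg0 : ∀ l m, 0 ≤ g l m) (hf : Summable f) {C : ℝ}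
    (hg : ∀ l, Summable (g l) ∧ ∑' m, g l m ≤ C) :
    Summable fun q : ι × ι => f q.1 * g q.1 q.2 := by
  have h1 : Summable fun l => ∑' m, f l * g l m := by
    simp only [tsum_mul_left]
    exact Summable.of_nonneg_of_le (fun l => mul_nonneg (hf0 l) (tsum_nonneg (hg0 l)))
      (fun l => mul_le_mul_of_nonneg_left (hg l).2 (hf0 l)) (hf.mul_right C)
  have h2 : ∀ l, Summable fun m => f l * g l m := fun l => Summable.mul_left (f l) (hg l).1
  have h0 : 0 ≤ fun q : ι × ι => f q.1 * g q.1 q.2 := fun q => by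
    simpa using mul_nonneg (hf0 q.1) (hg0 q.1 q.2)
  rw [summable_prod_of_nonneg h0]
  exact ⟨h2, h1⟩

theorem summable_triple_aux (u : Seq d 1) (v x : Seq d 2) (n : Fin d → ℤ) :
    Summable fun q : (Fin d → ℤ) × (Fin d → ℤ) => ‖u q.1‖ * (‖v q.2‖ * ‖x (n - q.1 - q.2)‖) :=
  summable_prod_mul (f := fun l => ‖u l‖) (g := fun l m => ‖v m‖ * ‖x (n - l - m)‖)
    (fun _ => norm_nonneg _) (fun _ _ => mul_nonneg (norm_nonneg _) (norm_nonneg _))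
    (l1_summable u) (C := ‖v‖ * ‖x‖) (fun l => l2_conv_summable v x (n - l))

/-- The weight `1 + |ξ|`. -/
def lam (k : Fin d → ℝ) (j : Fin d → ℤ) : ℝ := 1 + |freq k j|

/-- Powers of the weight `1 + |ξ|`. -/
def wt (k : Fin d → ℝ) (θ : ℝ) (j : Fin d → ℤ) : ℝ := lam k j ^ θ

theorem one_le_lam (k : Fin d → ℝ) (j) : 1 ≤ lam k j := by simp [lam]
theorem lam_pos (k : Fin d → ℝ) (j) : 0 < lam k j := zero_lt_one.trans_le (one_le_lam k j)
theorem wt_pos (k : Fin d → ℝ) (θ : ℝ) (j) : 0 < wt k θ j := Real.rpow_pos_of_pos (lam_pos k j) θ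
theorem wt_zero (k : Fin d → ℝ) : wt k 0 = fun _ => 1 := by ext j; simp [wt]
theorem wt_one (k : Fin d → ℝ) : wt k 1 = lam k := by ext j; simp [wt]
@[simp] theorem lam_neg (k : Fin d → ℝ) (j) : lam k (-j) = lam k j := by simp [lam]
@[simp] theorem wt_neg (k : Fin d → ℝ) (θ : ℝ) (j) : wt k θ (-j) = wt k θ j := by simp [wt]
theorem wt_mono (k : Fin d → ℝ) {θ θ' : ℝ} (h : θ ≤ θ') (j) : wt k θ j ≤ wt k θ' j :=
  Real.rpow_le_rpow_of_exponent_le (one_le_lam k j) h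
theorem wt_add (k : Fin d → ℝ) (θ θ' : ℝ) (j) : wt k (θ + θ') j = wt k θ j * wt k θ' j :=
  Real.rpow_add (lam_pos k j) _ _
theorem lam_mul (k : Fin d → ℝ) (j l) : lam k (j + l) ≤ lam k j * lam k l := by
  simp only [lam, freq_add]
  nlinarith [abs_add_le (freq k j) (freq k l), abs_nonneg (freq k j), abs_nonneg (freq k l),
    mul_nonneg (abs_nonneg (freq k j)) (abs_nonneg (freq k l))]
theorem wt_mul (k : Fin d → ℝ) {θ : ℝ} (h : 0 ≤ θ) (j l) :
    wt k θ (j + l) ≤ wt k θ j * wt k θ l := by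
  rw [wt, wt, wt, ← Real.mul_rpow (lam_pos k j).le (lam_pos k l).le]
  exact Real.rpow_le_rpow (lam_pos k _).le (lam_mul k j l) h

/-- Associativity of the product for three functions in a Sobolev type scale. -/
theorem mul_assoc_wt (k : Fin d → ℝ) {θ : ℝ} (hθ : 0 ≤ θ) {u v x : PerFun d} (hu : Mem 1 (wt k θ) u)
    (hv : Mem 2 (wt k θ) v) (hx : Mem 2 (wt k (-θ)) x) : u ⊡ v ⊡ x = u ⊡ (v ⊡ x) := by
  obtain ⟨U, hU⟩ := hu
  obtain ⟨V, hV⟩ := hv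
  obtain ⟨X, hX⟩ := hx
  refine mul_assoc' fun n => ?_
  refine Summable.of_norm_bounded ((summable_triple_aux U V X n).mul_left (wt k θ n)) fun q => ?_
  obtain ⟨l, m⟩ := q
  simp only [hU, hV, hX, norm_mul, Complex.norm_real, Real.norm_eq_abs, abs_of_pos (wt_pos k _ _)]
  set r := n - l - m
  -- For a fixed output frequency `n`, Peetre's inequality lets the positive weights at `l` and `m`
  -- pay for the negative weight at `r = n - l - m`, up to a factor depending on `n`.
  have h1 : wt k θ r ≤ wt k θ n * (wt k θ l * wt k θ m) := by
    have e : r = n + (-l + -m) := by simp [r]; abel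
    rw [e]
    refine (wt_mul k hθ _ _).trans (mul_le_mul_of_nonneg_left ?_ (wt_pos k θ n).le)
    simpa using wt_mul k hθ (-l) (-m)
  have h2 : wt k θ r * wt k (-θ) r = 1 := by rw [← wt_add]; simp [wt]
  calc ‖u l‖ * (‖v m‖ * ‖x r‖) = (wt k θ r * wt k (-θ) r) * (‖u l‖ * (‖v m‖ * ‖x r‖)) := by
        rw [h2, one_mul]
    _ ≤ ((wt k θ n * (wt k θ l * wt k θ m)) * wt k (-θ) r) * (‖u l‖ * (‖v m‖ * ‖x r‖)) := by
        have := (wt_pos k (-θ) r).le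
        gcongr
    _ = _ := by ring

theorem Mem.one_two {m : (Fin d → ℤ) → ℝ} {u : PerFun d} (h : Mem 1 m u) : Mem 2 m u := by
  obtain ⟨x, hx⟩ := h
  exact ⟨⟨x, (lp.memℓp x).of_exponent_ge (by norm_num)⟩, hx⟩

theorem Mem.mono {p : ENNReal} [Fact (1 ≤ p)] [Fact (p ≠ ⊤)] {m m' : (Fin d → ℤ) → ℝ} {u : PerFun d}
    (h : Mem p m u) (hm : ∀ j, 0 < m j) {K : ℝ} (hmm : ∀ j, |m' j| ≤ K * m j) : Mem p m' u := by
  obtain ⟨x, hx⟩ := h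
  have hσ : ∀ j, ‖((m' j / m j : ℝ) : ℂ)‖ ≤ K := fun j => by
    rw [Complex.norm_real, Real.norm_eq_abs, abs_div, abs_of_pos (hm j), div_le_iff₀ (hm j)]
    exact hmm j
  refine ⟨diag p (fun j => ((m' j / m j : ℝ) : ℂ)) K hσ x, fun j => ?_⟩
  have : (m j : ℂ) ≠ 0 := by exact_mod_cast (hm j).ne'
  rw [diag_apply, hx]
  push_cast; field_simp

theorem Mem.mono_wt {p : ENNReal} [Fact (1 ≤ p)] [Fact (p ≠ ⊤)] {k : Fin d → ℝ} {θ θ' : ℝ} {u : PerFun d}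
    (h : Mem p (wt k θ) u) (hθ : θ' ≤ θ) : Mem p (wt k θ') u :=
  h.mono (wt_pos k θ) (K := 1) fun j => by
    rw [abs_of_pos (wt_pos k _ j), one_mul]; exact wt_mono k hθ j

theorem Mem.bar {p : ENNReal} [Fact (1 ≤ p)] [Fact (p ≠ ⊤)] {m : (Fin d → ℤ) → ℝ} {u : PerFun d}
    (h : Mem p m u) (hm : ∀ j, m (-j) = m j) : Mem p m (bar u) := by
  obtain ⟨x, hx⟩ := h
  exact ⟨CB.barSeq x, fun j => by rw [CB.barSeq_apply, hx, hm]; simp [QPWaterWaves.bar]⟩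

theorem Mem.dα {p : ENNReal} [Fact (1 ≤ p)] [Fact (p ≠ ⊤)] {k : Fin d → ℝ} {θ θ' : ℝ} {u : PerFun d}
    (h : Mem p (wt k θ) u) (hθ : θ' + 1 ≤ θ) : Mem p (wt k θ') (dα k u) := by
  obtain ⟨x, hx⟩ := h
  have hσ : ∀ j, ‖Complex.I * freq k j * ((wt k θ' j / wt k θ j : ℝ) : ℂ)‖ ≤ 1 := fun j => by
    simp only [norm_mul, Complex.norm_I, one_mul, Complex.norm_real, Real.norm_eq_abs, abs_div,
      abs_of_pos (wt_pos k _ _)]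
    rw [← mul_div_assoc, div_le_one (wt_pos k _ _)]
    calc |freq k j| * wt k θ' j ≤ lam k j * wt k θ' j := by
          have := (wt_pos k θ' j).le
          gcongr; simp [lam]
      _ = wt k (θ' + 1) j := by rw [wt_add, wt_one, mul_comm]
      _ ≤ _ := wt_mono k hθ j
  refine ⟨diag p _ 1 hσ x, fun j => ?_⟩
  have : (wt k θ j : ℂ) ≠ 0 := by exact_mod_cast (wt_pos k θ j).ne'
  rw [diag_apply, hx, QPWaterWaves.dα]
  push_cast; field_simp

/-- For a fixed output frequency `n` the weights at `l` and `n - l` are comparable up to `wt k θ n`,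
so the positive order of `u` compensates the negative order of `v`. -/
theorem Mem.conv {p : ENNReal} [Fact (1 ≤ p)] [Fact (p ≠ ⊤)] {k : Fin d → ℝ} {θ : ℝ}
    {u v : PerFun d} (hθ : 0 ≤ θ) (hu : Mem 1 (wt k θ) u) (hv : Mem p (wt k (-θ)) v) :
    Conv u v := fun n => by
  have := hu.summable_bmul hv (fun _ _ => 1) n (C := wt k θ n) (fun l => by
    rw [abs_of_pos (wt_pos k _ _), abs_of_pos (wt_pos k _ _), norm_one]
    have h1 : wt k θ (n - l) ≤ wt k θ n * wt k θ l := by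
      simpa [sub_eq_add_neg] using wt_mul k hθ n (-l)
    have h2 : wt k θ (n - l) * wt k (-θ) (n - l) = 1 := by rw [← wt_add]; simp [wt]
    rw [← h2, ← mul_assoc]
    exact mul_le_mul_of_nonneg_right h1 (wt_pos k _ _).le)
  simpa using this

theorem Mem.conv22 {u v : PerFun d} (hu : Mem 2 (fun _ => 1) u) (hv : Mem 2 (fun _ => 1) v) :
    Conv u v := fun n => by
  obtain ⟨x, hx⟩ := hu
  obtain ⟨y, hy⟩ := hv
  refine Summable.of_norm_bounded (l2_conv_summable x y n).1 fun l => ?_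
  rw [norm_mul, hx, hy]; simp

/-! ### The bilinear map on `ℓ^2` -/

/-- Cauchy–Schwarz in `l` separates the kernel from the functions and leaves `|U|² * |V|²`, whose
sum over `n` is the product of the two norms squared. -/
theorem sq_tsum_mul_le (k : (Fin d → ℤ) → (Fin d → ℤ) → ℝ) {K : ℝ}
    (hk : ∀ n, (Summable fun l => k l (n - l) ^ 2) ∧ ∑' l, k l (n - l) ^ 2 ≤ K ^ 2) (U V : Seq d 2)
    (n : Fin d → ℤ) :
    (Summable fun l => (k l (n - l) : ℂ) * U l * V (n - l)) ∧
    ‖∑' l, (k l (n - l) : ℂ) * U l * V (n - l)‖ ^ 2 ≤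
      K ^ 2 * ∑' l, ‖U l‖ ^ 2 * ‖V (n - l)‖ ^ 2 ∧
    Summable fun l => ‖U l‖ ^ 2 * ‖V (n - l)‖ ^ 2 := by
  have hs2 : Summable fun l => ‖U l‖ ^ 2 * ‖V (n - l)‖ ^ 2 := by
    refine Summable.of_nonneg_of_le (fun l => by positivity) (fun l => ?_)
      ((l2_summable U).mul_right (‖V‖ ^ 2))
    gcongr
    exact norm_coord_le V (n - l)
  let σ : Seq d 2 := ⟨fun l => (k l (n - l) : ℂ), memℓp_gen (by simpa using (hk n).1)⟩
  let y : Seq d 2 := ⟨fun l => U l * V (n - l), memℓp_gen (by simpa [mul_pow] using hs2)⟩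
  have h := lp.tsum_mul_le_mul_norm (p := 2) (q := 2)
    (by norm_num; exact Real.HolderConjugate.two_two) σ y
  have hσ : ‖σ‖ ^ 2 ≤ K ^ 2 := by
    rw [l2_norm_sq]; simpa [σ] using (hk n).2
  have hy : ‖y‖ ^ 2 = ∑' l, ‖U l‖ ^ 2 * ‖V (n - l)‖ ^ 2 := by
    rw [l2_norm_sq]; simp [y, mul_pow]
  have hn : ∀ l, ‖(k l (n - l) : ℂ) * U l * V (n - l)‖ = ‖σ l‖ * ‖y l‖ := fun l => by
    simp [σ, y, mul_assoc]
  have hs : Summable fun l => ‖(k l (n - l) : ℂ) * U l * V (n - l)‖ := h.1.congr fun l => (hn l).symm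
  refine ⟨hs.of_norm, ?_, hs2⟩
  calc _ ≤ (‖σ‖ * ‖y‖) ^ 2 := by
        gcongr
        refine (norm_tsum_le_tsum_norm hs).trans ?_
        rw [tsum_congr hn]
        exact h.2
    _ ≤ _ := by rw [mul_pow, hy]; gcongr

theorem sum_sq_bound (k : (Fin d → ℤ) → (Fin d → ℤ) → ℝ) {K : ℝ}
    (hk : ∀ n, (Summable fun l => k l (n - l) ^ 2) ∧ ∑' l, k l (n - l) ^ 2 ≤ K ^ 2) (U V : Seq d 2)
    (s : Finset (Fin d → ℤ)) :
    ∑ n ∈ s, ‖∑' l, (k l (n - l) : ℂ) * U l * V (n - l)‖ ^ 2 ≤ (K * (‖U‖ * ‖V‖)) ^ 2 := by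
  have h := sq_tsum_mul_le k hk U V
  calc _ ≤ ∑ n ∈ s, K ^ 2 * ∑' l, ‖U l‖ ^ 2 * ‖V (n - l)‖ ^ 2 :=
        Finset.sum_le_sum fun n _ => (h n).2.1
    _ = K ^ 2 * ∑' l, ∑ n ∈ s, ‖U l‖ ^ 2 * ‖V (n - l)‖ ^ 2 := by
        rw [← Finset.mul_sum, Summable.tsum_finsetSum fun n _ => (h n).2.2]
    _ ≤ K ^ 2 * (‖U‖ ^ 2 * ‖V‖ ^ 2) := by
        gcongr
        rw [l2_norm_sq U, ← tsum_mul_right]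
        have hle : ∀ l, ∑ n ∈ s, ‖U l‖ ^ 2 * ‖V (n - l)‖ ^ 2 ≤ ‖U l‖ ^ 2 * ‖V‖ ^ 2 := fun l => by
          rw [← Finset.mul_sum]
          gcongr
          rw [l2_norm_sq, ← (Equiv.subRight l).tsum_eq]
          exact Summable.sum_le_tsum (f := fun n => ‖V (n - l)‖ ^ 2) s (fun _ _ => by positivity)
            ((Equiv.subRight l).summable_iff.2 (l2_summable V))
        have hs2 := (l2_summable U).mul_right (‖V‖ ^ 2)
        exact Summable.tsum_le_tsum hle (Summable.of_nonneg_of_le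
          (fun l => Finset.sum_nonneg fun _ _ => by positivity) hle hs2) hs2
    _ = _ := by ring

/-- The bilinear operator on `ℓ^2` whose kernel is uniformly square summable. -/
def bil22 (k : (Fin d → ℤ) → (Fin d → ℤ) → ℝ) (K : ℝ) (hK : 0 ≤ K)
    (hk : ∀ n, (Summable fun l => k l (n - l) ^ 2) ∧ ∑' l, k l (n - l) ^ 2 ≤ K ^ 2) :
    Seq d 2 →L[ℂ] Seq d 2 →L[ℂ] Seq d 2 :=
  LinearMap.mkContinuous₂
    (LinearMap.mk₂ ℂ (fun U V => (⟨fun n => ∑' l, (k l (n - l) : ℂ) * U l * V (n - l),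
        memℓp_gen' (C := (K * (‖U‖ * ‖V‖)) ^ 2)
          (fun s => by simpa using sum_sq_bound k hk U V s)⟩ : Seq d 2))
      (fun U U' V => by
        ext n
        change ∑' l, (k l (n - l) : ℂ) * (U l + U' l) * V (n - l) =
          (∑' l, (k l (n - l) : ℂ) * U l * V (n - l)) + ∑' l, (k l (n - l) : ℂ) * U' l * V (n - l)
        rw [← (sq_tsum_mul_le k hk U V n).1.tsum_add (sq_tsum_mul_le k hk U' V n).1]
        exact tsum_congr fun l => by ring)
      (fun c U V => by
        ext n
        change ∑' l, (k l (n - l) : ℂ) * (c * U l) * V (n - l) =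
          c * ∑' l, (k l (n - l) : ℂ) * U l * V (n - l)
        rw [← tsum_mul_left]
        exact tsum_congr fun l => by ring)
      (fun U V V' => by
        ext n
        change ∑' l, (k l (n - l) : ℂ) * U l * (V (n - l) + V' (n - l)) =
          (∑' l, (k l (n - l) : ℂ) * U l * V (n - l)) + ∑' l, (k l (n - l) : ℂ) * U l * V' (n - l)
        rw [← (sq_tsum_mul_le k hk U V n).1.tsum_add (sq_tsum_mul_le k hk U V' n).1]
        exact tsum_congr fun l => by ring)
      (fun c U V => by
        ext n
        change ∑' l, (k l (n - l) : ℂ) * U l * (c * V (n - l)) =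
          c * ∑' l, (k l (n - l) : ℂ) * U l * V (n - l)
        rw [← tsum_mul_left]
        exact tsum_congr fun l => by ring)) K (fun U V => by
    refine lp.norm_le_of_forall_sum_le (by simp) (by positivity) fun s => ?_
    have := sum_sq_bound k hk U V s
    simpa [mul_assoc] using this)

theorem bil22_apply (k : (Fin d → ℤ) → (Fin d → ℤ) → ℝ) (K : ℝ) (hK) (hk) (U V : Seq d 2) (n) :
    bil22 k K hK hk U V n = ∑' l, (k l (n - l) : ℂ) * U l * V (n - l) := rfl

/-! ### The Wiener algebra -/

/-- The action of `ℓ^1` on `ℓ^p` by convolution. -/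
def convCLM (p : ENNReal) [Fact (1 ≤ p)] [Fact (p ≠ ⊤)] : Seq d 1 →L[ℂ] Seq d p →L[ℂ] Seq d p :=
  bil p (fun _ _ => 1) 1 (fun _ _ => by simp)

theorem coe_convCLM (p : ENNReal) [Fact (1 ≤ p)] [Fact (p ≠ ⊤)] (u : Seq d 1) (v : Seq d p) :
    (⇑(convCLM p u v) : PerFun d) = (⇑u : PerFun d) ⊡ ⇑v := by
  ext n
  rw [convCLM, bil_apply]
  exact tsum_congr fun l => by rw [one_mul]

theorem norm_convCLM_le (p : ENNReal) [Fact (1 ≤ p)] [Fact (p ≠ ⊤)] (u : Seq d 1) (v : Seq d p) :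
    ‖convCLM p u v‖ ≤ ‖u‖ * ‖v‖ := by
  rw [convCLM]
  simpa using bil_le p (fun _ _ => 1) 1 (fun _ _ => by simp) u v

theorem mem_coe {p : ENNReal} [Fact (1 ≤ p)] (u : Seq d p) : Mem p (fun _ => 1) (⇑u : PerFun d) :=
  ⟨u, fun j => by simp⟩

theorem Mem.mul_assoc {u v x : PerFun d} (hu : Mem 1 (fun _ => 1) u) (hv : Mem 2 (fun _ => 1) v)
    (hx : Mem 2 (fun _ => 1) x) : u ⊡ v ⊡ x = u ⊡ (v ⊡ x) := by
  refine mul_assoc_wt (0 : Fin d → ℝ) (θ := 0) le_rfl ?_ ?_ ?_ <;> simpa [wt_zero]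

/-! ### `ℓ^1` as a commutative Banach algebra acting on `ℓ^2`. -/

instance : Mul (Seq d 1) := ⟨fun u v => convCLM 1 u v⟩
instance : One (Seq d 1) := ⟨lp.single 1 0 1⟩

theorem mul_def (u v : Seq d 1) : u * v = convCLM 1 u v := rfl

theorem coe_mul (u v : Seq d 1) : (⇑(u * v) : PerFun d) = (⇑u : PerFun d) ⊡ ⇑v := coe_convCLM 1 u v

theorem coe_one : (⇑(1 : Seq d 1) : PerFun d) = one := by
  ext n
  exact congrFun (lp.coeFn_single (E := fun _ : Fin d → ℤ => ℂ) 1 0 (1 : ℂ)) n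

instance : CommRing (Seq d 1) :=
  { (inferInstance : AddCommGroup (Seq d 1)) with
    left_distrib := fun a b c => map_add (convCLM 1 a) b c
    right_distrib := fun a b c => by simp only [mul_def, map_add, _root_.add_apply]
    zero_mul := fun a => by simp only [mul_def, map_zero, _root_.zero_apply]
    mul_zero := fun a => by simp only [mul_def, map_zero]
    mul_assoc := fun a b c => by
      refine lp.ext ?_
      change (⇑(a * b * c) : PerFun d) = ⇑(a * (b * c))
      simp only [coe_mul]
      exact (mem_coe a).mul_assoc (mem_coe b).one_two (mem_coe c).one_two
    one_mul := fun a => by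
      refine lp.ext ?_
      change (⇑(1 * a) : PerFun d) = ⇑a
      rw [coe_mul, coe_one, one_mul']
    mul_one := fun a => by
      refine lp.ext ?_
      change (⇑(a * 1) : PerFun d) = ⇑a
      rw [coe_mul, coe_one, mul_comm', one_mul']
    mul_comm := fun a b => by
      refine lp.ext ?_
      change (⇑(a * b) : PerFun d) = ⇑(b * a)
      rw [coe_mul, coe_mul, mul_comm'] }

instance : NormedCommRing (Seq d 1) :=
  { (inferInstance : CommRing (Seq d 1)), (inferInstance : NormedAddCommGroup (Seq d 1)) with
    norm_mul_le := fun a b => norm_convCLM_le 1 a b }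

instance : Algebra ℂ (Seq d 1) := Algebra.ofModule
  (fun c a b => by simp only [mul_def, map_smul, _root_.smul_apply])
  (fun c a b => by simp only [mul_def, map_smul])

instance : NormedAlgebra ℂ (Seq d 1) :=
  { (inferInstance : Algebra ℂ (Seq d 1)) with
    norm_smul_le := fun c a => norm_smul_le c a }

/-- With convolution as a module action, identities between products become linear algebra over a
commutative ring and need no further summability checks. -/
instance : Module (Seq d 1) (Seq d 2) where
  smul u v := convCLM 2 u v
  one_smul v := by
    refine lp.ext ?_
    change (⇑(convCLM 2 1 v) : PerFun d) = ⇑v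
    rw [coe_convCLM, coe_one, one_mul']
  mul_smul a b c := by
    refine lp.ext ?_
    change (⇑(convCLM 2 (a * b) c) : PerFun d) = ⇑(convCLM 2 a (convCLM 2 b c))
    simp only [coe_convCLM, coe_mul]
    exact (mem_coe a).mul_assoc (mem_coe b).one_two (mem_coe c)
  smul_zero a := map_zero (convCLM 2 a)
  smul_add a := map_add (convCLM 2 a)
  add_smul a b c := by
    change convCLM 2 (a + b) c = convCLM 2 a c + convCLM 2 b c
    rw [map_add]; rfl
  zero_smul c := by
    change convCLM 2 0 c = 0
    rw [map_zero]; rfl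

theorem smul_def (u : Seq d 1) (v : Seq d 2) : u • v = convCLM 2 u v := rfl

theorem coe_smul (u : Seq d 1) (v : Seq d 2) : (⇑(u • v) : PerFun d) = (⇑u : PerFun d) ⊡ ⇑v :=
  coe_convCLM 2 u v

theorem norm_smul_le' (u : Seq d 1) (v : Seq d 2) : ‖u • v‖ ≤ ‖u‖ * ‖v‖ := norm_convCLM_le 2 u v

/-! ### Evaluation on the torus -/

open UnitAddTorus in
theorem mFourier_apply_norm (j : Fin d → ℤ) (θ : UnitAddTorus (Fin d)) : ‖mFourier j θ‖ ≤ 1 :=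
  ((mFourier j).norm_coe_le_norm θ).trans (by rw [mFourier_norm])

/-- Evaluation of an absolutely convergent Fourier series at a point. -/
def evalCLM (θ : UnitAddTorus (Fin d)) : Seq d 1 →L[ℂ] ℂ :=
  l1lift (fun j => UnitAddTorus.mFourier j θ) 1 (fun j => mFourier_apply_norm j θ)

theorem evalCLM_eq (θ : UnitAddTorus (Fin d)) (u : Seq d 1) : evalCLM θ u = eval u θ := rfl

theorem eval_mul (u v : Seq d 1) (θ : UnitAddTorus (Fin d)) :
    eval (⇑(u * v)) θ = eval u θ * eval v θ := by
  have hs := bil_summable 1 (fun _ _ => (1 : ℂ)) 1 (fun _ _ => by simp) u v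
  have h1 : evalCLM θ (u * v) = ∑' l, u l * (UnitAddTorus.mFourier l θ * eval v θ) := by
    rw [mul_def, convCLM, bil_apply_eq_tsum, (evalCLM θ).map_tsum hs]
    refine tsum_congr fun l => ?_
    rw [map_smul, smul_eq_mul]
    congr 1
    change ∑' n, ((1 : ℂ) * v (n - l)) * UnitAddTorus.mFourier n θ = _ * ∑' n, _
    rw [← tsum_mul_left, ← (Equiv.subRight l).tsum_eq (fun n => _ * (v n * _))]
    refine tsum_congr fun n => ?_
    have : UnitAddTorus.mFourier n θ =
        UnitAddTorus.mFourier l θ * UnitAddTorus.mFourier (n - l) θ := by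
      rw [← UnitAddTorus.mFourier_add]; congr 2; abel
    rw [this]
    simp only [Equiv.subRight_apply]
    ring
  rw [← evalCLM_eq, h1]
  change _ = (∑' l, u l * UnitAddTorus.mFourier l θ) * eval v θ
  rw [← tsum_mul_right]
  exact tsum_congr fun l => by ring

theorem eval_one (θ : UnitAddTorus (Fin d)) : eval (⇑(1 : Seq d 1)) θ = 1 := by
  rw [coe_one, eval, tsum_eq_single 0 (fun l hl => by simp [one, hl])]
  simp [one, UnitAddTorus.mFourier_zero]

section
attribute [local instance] instMeasureSpaceUnitAddCircle

local instance : MeasureTheory.IsProbabilityMeasure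
    (MeasureTheory.volume : MeasureTheory.Measure UnitAddCircle) :=
  inferInstanceAs (MeasureTheory.IsProbabilityMeasure AddCircle.haarAddCircle)

/-- The series converges in `C(𝕋^d)`, hence in `L²`, where the exponentials are orthonormal. This
identifies `Y`, defined through Fourier coefficients of a pointwise quotient, with an element of the
Wiener algebra. -/
theorem mFourierCoeff_eval (u : Seq d 1) :
    UnitAddTorus.mFourierCoeff (fun θ => eval u θ) = u := by
  have hs : Summable fun j => u j • (UnitAddTorus.mFourier j : C(UnitAddTorus (Fin d), ℂ)) := by
    refine Summable.of_norm ((l1_summable u).congr fun j => ?_)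
    rw [norm_smul, UnitAddTorus.mFourier_norm, mul_one]
  let F : C(UnitAddTorus (Fin d), ℂ) := ∑' j, u j • UnitAddTorus.mFourier j
  have hF : ∀ θ, F θ = eval u θ := fun θ => (ContinuousMap.evalCLM ℂ θ).map_tsum hs
  have h1 : (fun θ => eval u θ) = F := by ext θ; rw [hF]
  ext i
  rw [h1, ← UnitAddTorus.mFourierCoeff_toLp, ← UnitAddTorus.mFourierBasis_repr]
  have h2 := (ContinuousMap.toLp (E := ℂ) 2 (MeasureTheory.volume) ℂ).map_tsum hs
  change (UnitAddTorus.mFourierBasis.repr (ContinuousMap.toLp (E := ℂ) 2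
    (MeasureTheory.volume) ℂ (∑' j, u j • UnitAddTorus.mFourier j))) i = _
  rw [h2]
  have hs' := (ContinuousMap.toLp (E := ℂ) 2
    (MeasureTheory.volume : MeasureTheory.Measure (UnitAddTorus (Fin d))) ℂ).summable hs
  rw [UnitAddTorus.mFourierBasis.repr_apply_apply]
  change innerSL ℂ (UnitAddTorus.mFourierBasis i) _ = _
  rw [(innerSL ℂ (UnitAddTorus.mFourierBasis i)).map_tsum hs', tsum_eq_single i]
  · simp only [map_smul, smul_eq_mul, innerSL_apply_apply]
    have := orthonormal_iff_ite.1 (UnitAddTorus.mFourierBasis (d := Fin d)).orthonormal i i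
    rw [UnitAddTorus.coe_mFourierBasis] at this ⊢
    rw [this]; simp
  · intro j hj
    simp only [map_smul, smul_eq_mul, innerSL_apply_apply]
    have := orthonormal_iff_ite.1 (UnitAddTorus.mFourierBasis (d := Fin d)).orthonormal i j
    rw [UnitAddTorus.coe_mFourierBasis] at this ⊢
    rw [this, if_neg hj.symm, mul_zero]

end

/-! ### Wiener's lemma -/

/-- The monomial `e^{i⟨j,α⟩}`. -/
def mono (j : Fin d → ℤ) : Seq d 1 := lp.single 1 j 1

theorem norm_mono (j : Fin d → ℤ) : ‖mono j‖ = 1 := by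
  rw [mono, lp.norm_single (by simp)]; simp

theorem mono_add (j l : Fin d → ℤ) : mono (j + l) = mono j * mono l := by
  refine lp.ext ?_
  change (⇑(mono (j + l)) : PerFun d) = ⇑(mono j * mono l)
  rw [coe_mul]
  ext n
  change _ = ∑' i, mono j i * mono l (n - i)
  rw [tsum_eq_single j]
  · simp only [mono, lp.single_apply, Pi.single_apply]
    by_cases h : n = j + l
    · simp [h]
    · have hn : n - j ≠ l := fun h' => h (by rw [← h']; abel)
      simp [h, hn]
  · intro i hi
    simp [mono, lp.single_apply, Pi.single_apply, hi]

theorem mono_zero : mono (0 : Fin d → ℤ) = 1 := rfl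

/-- A character has modulus at most one on each monomial and on its inverse, hence modulus one. It
restricts to a homomorphism on `ℤ^d`, determined by its values at the `d` basis vectors, and these
define a point of the torus. Finite sums of monomials are dense, so the character is evaluation
there. -/
theorem exists_character_point (φ : WeakDual.characterSpace ℂ (Seq d 1)) :
    ∃ θ : UnitAddTorus (Fin d), ∀ u : Seq d 1, φ u = eval u θ := by
  have hle : ∀ j, ‖φ (mono j)‖ ≤ 1 := fun j => by
    have h1 := AlgHom.norm_apply_le_self_mul_norm_one
      (WeakDual.CharacterSpace.toAlgHom φ) (mono j)
    have h2 : ‖(1 : Seq d 1)‖ = 1 := norm_mono 0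
    rw [norm_mono, h2] at h1
    simpa using h1
  have hadd : ∀ j l, φ (mono (j + l)) = φ (mono j) * φ (mono l) := fun j l => by
    rw [mono_add, map_mul]
  have h0 : φ (mono 0) = 1 := by rw [mono_zero, map_one]
  have hone : ∀ j, ‖φ (mono j)‖ = 1 := fun j => by
    have h1 : φ (mono j) * φ (mono (-j)) = 1 := by rw [← hadd]; simp [h0]
    have h2 : ‖φ (mono j)‖ * ‖φ (mono (-j))‖ = 1 := by rw [← norm_mul, h1]; simp
    nlinarith [hle j, hle (-j), norm_nonneg (φ (mono j)), norm_nonneg (φ (mono (-j)))]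
  let z : Fin d → Circle := fun i => ⟨φ (mono (Pi.single i 1)), by
    change φ (mono (Pi.single i 1)) ∈ Metric.sphere (0 : ℂ) 1
    simpa using hone _⟩
  let θ : UnitAddTorus (Fin d) := fun i => (AddCircle.homeomorphCircle one_ne_zero).symm (z i)
  have hz : ∀ i, fourier 1 (θ i) = φ (mono (Pi.single i 1)) := fun i => by
    have h1 : AddCircle.toCircle (θ i) = z i := by
      rw [← AddCircle.homeomorphCircle_apply one_ne_zero]
      exact (AddCircle.homeomorphCircle one_ne_zero).apply_symm_apply (z i)
    rw [fourier_one, h1]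
  let f : (Fin d → ℤ) →+ Additive ℂˣ :=
    { toFun := fun j => Additive.ofMul ⟨φ (mono j), φ (mono (-j)),
        by rw [← hadd]; simp [h0], by rw [← hadd]; simp [h0]⟩
      map_zero' := by
        apply Additive.toMul.injective; apply Units.ext; exact h0
      map_add' := fun j l => by
        apply Additive.toMul.injective; apply Units.ext; exact hadd j l }
  let g : (Fin d → ℤ) →+ Additive ℂˣ :=
    { toFun := fun j => Additive.ofMul ⟨UnitAddTorus.mFourier j θ, UnitAddTorus.mFourier (-j) θ,
        by rw [← UnitAddTorus.mFourier_add]; simp [UnitAddTorus.mFourier_zero],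
        by rw [← UnitAddTorus.mFourier_add]; simp [UnitAddTorus.mFourier_zero]⟩
      map_zero' := by
        apply Additive.toMul.injective; apply Units.ext
        change UnitAddTorus.mFourier 0 θ = 1
        simp [UnitAddTorus.mFourier_zero]
      map_add' := fun j l => by
        apply Additive.toMul.injective; apply Units.ext
        exact UnitAddTorus.mFourier_add }
  have hfg : f = g := by
    refine AddMonoidHom.functions_ext' _ _ _ fun i => ?_
    refine AddMonoidHom.ext_int ?_
    apply Additive.toMul.injective; apply Units.ext
    change φ (mono (Pi.single i 1)) = UnitAddTorus.mFourier (Pi.single i 1) θ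
    rw [UnitAddTorus.mFourier_single, hz]
  have hm : ∀ j, φ (mono j) = UnitAddTorus.mFourier j θ := fun j =>
    congrArg (fun x => ((Additive.toMul x : ℂˣ) : ℂ)) (DFunLike.congr_fun hfg j)
  refine ⟨θ, fun u => ?_⟩
  have hs := lp.hasSum_single (E := fun _ : Fin d → ℤ => ℂ) (p := 1) (by simp) u
  have hc : Continuous φ := map_continuous φ
  have h2 := hs.map φ hc
  rw [← h2.tsum_eq, eval]
  refine tsum_congr fun j => ?_
  have : lp.single 1 j (u j) = u j • mono (d := d) j := by
    rw [mono, ← lp.single_smul]; simp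
  simp only [Function.comp]
  rw [this, map_smul, hm, smul_eq_mul]

/-- Gelfand theory: a non-unit is annihilated by some character, and characters are point
evaluations. -/
theorem isUnit_of_eval_ne_zero {u : Seq d 1} (h : ∀ θ, eval u θ ≠ 0) : IsUnit u := by
  by_contra hu
  obtain ⟨φ, hφ⟩ := WeakDual.CharacterSpace.exists_apply_eq_zero hu
  obtain ⟨θ, hθ⟩ := exists_character_point φ
  exact h θ (by rw [← hθ, hφ])

theorem eval_one_add (u : Seq d 1) (θ) : eval (⇑(1 + u)) θ = 1 + eval u θ := by
  rw [← evalCLM_eq, map_add, evalCLM_eq, evalCLM_eq, eval_one]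

/-- The function `1 - Y` is the inverse of `1 + 𝐖` in the Wiener algebra. -/
theorem exists_inverse {W : PerFun d} (x : Seq d 1) (hx : ⇑x = W) (h : ∀ θ, 1 + eval W θ ≠ 0) :
    ∃ v : Seq d 1, (1 + x) * v = 1 ∧ (⇑v : PerFun d) = oneSubY W := by
  subst hx
  have hu : IsUnit (1 + x) := isUnit_of_eval_ne_zero fun θ => by rw [eval_one_add]; exact h θ
  obtain ⟨v, hv⟩ := hu.exists_right_inv
  refine ⟨v, hv, ?_⟩
  have h1 : ∀ θ, eval x θ / (1 + eval x θ) = eval (⇑(1 - v)) θ := fun θ => by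
    have h2 := eval_mul (1 + x) v θ
    rw [hv, eval_one, eval_one_add] at h2
    have h3 : eval (⇑(1 - v)) θ = 1 - eval v θ := by
      rw [← evalCLM_eq, map_sub, evalCLM_eq, evalCLM_eq, eval_one]
    rw [h3, div_eq_iff (h θ)]
    linear_combination -h2
  have h4 : Y (⇑x) = ⇑(1 - v) := by
    rw [Y, ← mFourierCoeff_eval (1 - v)]
    congr 1
    ext θ; exact h1 θ
  rw [oneSubY, h4, ← coe_one, lp.coeFn_sub]
  simp

/-! ### Uniform bounds for inverses in the Wiener algebra -/

theorem l2ToL1_single (j : Fin d → ℤ) (c : ℂ) :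
    (⇑(l2ToL1 (lp.single 2 j c)) : Seq d 2 → Seq d 1) =
      fun x => (c * lp.evalCLM ℂ (fun _ : Fin d → ℤ => ℂ) (p := 2) j x) • mono j := by
  ext x n
  rw [l2ToL1_apply, lp.coeFn_smul, Pi.smul_apply, mono]
  change _ = (c * x j) * _
  by_cases h : n = j
  · subst h; simp
  · simp [lp.single_apply, h]

/-- The operator depends continuously on `σ` in operator norm, and `σ` is the `ℓ^2` limit of its
finite truncations, for which the operator has finite rank. -/
theorem isCompactOperator_l2ToL1 (σ : Seq d 2) : IsCompactOperator (l2ToL1 σ) := by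
  let Φ : Seq d 2 →L[ℂ] Seq d 2 →L[ℂ] Seq d 1 := LinearMap.mkContinuous
    { toFun := fun σ => l2ToL1 σ
      map_add' := fun σ τ => by
        ext x n
        change (σ n + τ n) * x n = σ n * x n + τ n * x n; ring
      map_smul' := fun c σ => by
        ext x n
        change (c * σ n) * x n = c * (σ n * x n); ring } 1
    (fun σ => by rw [one_mul]; exact l2ToL1_norm_le σ)
  have h := Φ.hasSum (lp.hasSum_single (E := fun _ : Fin d → ℤ => ℂ) (p := 2) (by simp) σ)
  change IsCompactOperator (Φ σ)
  refine isCompactOperator_of_tendsto h (Eventually.of_forall fun s => ?_)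
  have h1 : ∀ j, IsCompactOperator (Φ (lp.single 2 j (σ j))) := fun j => by
    change IsCompactOperator (l2ToL1 (lp.single 2 j (σ j)))
    rw [l2ToL1_single]
    have hc : IsCompactOperator (fun x : Seq d 2 =>
        σ j * lp.evalCLM ℂ (fun _ : Fin d → ℤ => ℂ) (p := 2) j x) :=
      isCompactOperator_of_locallyCompactSpace_dom (R₁ := ℂ) (R₂ := ℂ)
        (σ j • lp.evalCLM ℂ (fun _ : Fin d → ℤ => ℂ) (p := 2) j)
    exact hc.continuous_comp (g := fun z : ℂ => z • mono j) (by fun_prop)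
  classical
  induction s using Finset.induction_on with
  | empty => simpa using isCompactOperator_zero
  | insert a s ha ih => rw [Finset.sum_insert ha]; exact (h1 a).add ih

theorem eq_ringInverse {R : Type*} [CommRing R] {u v : R} (h : u * v = 1) :
    v = Ring.inverse u := by
  have hu : IsUnit u := IsUnit.of_mul_eq_one _ h
  calc v = Ring.inverse u * u * v := by rw [Ring.inverse_mul_cancel _ hu, one_mul]
    _ = _ := by rw [mul_assoc, h, mul_one]

theorem bil_summable_apply {p : ENNReal} [Fact (1 ≤ p)] [Fact (p ≠ ⊤)]
    (κ : (Fin d → ℤ) → (Fin d → ℤ) → ℂ) (K : ℝ) (h : ∀ l n, ‖κ l n‖ ≤ K)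
    (u : Seq d 1) (v : Seq d p) (n : Fin d → ℤ) :
    Summable fun l => u l * (κ l (n - l) * v (n - l)) := by
  refine Summable.of_norm_bounded ((l1_summable u).mul_right (K * ‖v‖)) fun l => ?_
  rw [norm_mul, norm_mul]
  have := norm_coord_le v (n - l)
  have h0 := (norm_nonneg _).trans (h 0 0)
  have := h l (n - l)
  gcongr

/-- On the functions `x` in a ball of a weighted `ℓ^2` space with square summable inverse weight
for which `|1 + x|` is bounded below, `(1 + x)⁻¹` is bounded in the Wiener algebra. -/
theorem exists_bound_inverse (σ : Seq d 2) (A δ : ℝ) (hδ : 0 < δ) :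
    ∃ C : ℝ, ∀ y : Seq d 2, ‖y‖ ≤ A → (∀ θ, δ ≤ ‖1 + eval (⇑(l2ToL1 σ y)) θ‖) →
      ∀ v : Seq d 1, (1 + l2ToL1 σ y) * v = 1 → ‖v‖ ≤ C := by
  -- In the Wiener algebra a norm bound and a lower bound on the modulus do not in general bound the
  -- inverse. Uniformity comes from compactness of the image of the ball and continuity of inversion
  -- at units, so the constant is not explicit.
  let S : Set (Seq d 1) := closure (l2ToL1 σ '' Metric.closedBall 0 A)
  have hS : IsCompact S :=
    IsCompactOperator.isCompact_closure_image_closedBall (f := (l2ToL1 σ : Seq d 2 →ₗ[ℂ] Seq d 1))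
      (isCompactOperator_l2ToL1 σ) A
  let S' : Set (Seq d 1) := {x | ∀ θ, δ ≤ ‖1 + evalCLM θ x‖}
  have hS' : IsClosed S' := by
    have : S' = ⋂ θ, {x | δ ≤ ‖1 + evalCLM θ x‖} := by ext x; simp [S']
    rw [this]
    exact isClosed_iInter fun θ => isClosed_le continuous_const
      ((continuous_const.add (evalCLM θ).continuous).norm)
  have hunit : ∀ x ∈ S', IsUnit (1 + x) := fun x hx => isUnit_of_eval_ne_zero fun θ => by
    rw [eval_one_add, ← evalCLM_eq]
    exact norm_pos_iff.1 (hδ.trans_le (hx θ))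
  have hcont : ContinuousOn (fun x : Seq d 1 => Ring.inverse (1 + x)) (S ∩ S') := by
    intro x hx
    obtain ⟨u, hu⟩ := hunit x hx.2
    have h1 := NormedRing.inverse_continuousAt u
    rw [hu] at h1
    exact (ContinuousAt.comp (f := fun x : Seq d 1 => 1 + x) (g := Ring.inverse) h1
      (by fun_prop)).continuousWithinAt
  obtain ⟨C, hC⟩ := (hS.inter_right hS').exists_bound_of_continuousOn hcont
  refine ⟨C, fun y hy hθ v hv => ?_⟩
  have hx : l2ToL1 σ y ∈ S ∩ S' :=
    ⟨subset_closure ⟨y, by simpa using hy, rfl⟩, hθ⟩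
  have h2 : v = Ring.inverse (1 + l2ToL1 σ y) := by
    exact eq_ringInverse hv
  rw [h2]
  exact hC _ hx

theorem continuousOn_inverse {I : Set ℝ} {x v : ℝ → Seq d 1} (hx : ContinuousOn x I)
    (h : ∀ t ∈ I, (1 + x t) * v t = 1) : ContinuousOn v I := by
  have h2 : ∀ t ∈ I, v t = Ring.inverse (1 + x t) := fun t ht => by
    exact eq_ringInverse (h t ht)
  refine ContinuousOn.congr (fun t ht => ?_) h2
  obtain ⟨u, hu⟩ := IsUnit.of_mul_eq_one _ (h t ht)
  have h1 := NormedRing.inverse_continuousAt u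
  rw [hu] at h1
  exact ContinuousAt.comp_continuousWithinAt (f := fun t => 1 + x t) (g := Ring.inverse) h1
    (continuousWithinAt_const.add (hx t ht))

/-! ### Weighted bounds for inverses -/

/-- A weight whose increments are controlled by the weight itself. -/
structure SubWeight (m : (Fin d → ℤ) → ℝ) : Prop where
  pos : ∀ j, 0 < m j
  incr : ∀ j l, |m l - m (j + l)| ≤ m j

theorem SubWeight.trunc {m : (Fin d → ℤ) → ℝ} (hm : SubWeight m) (N : ℝ) (j l) :
    |min (m l) N - min (m (j + l)) N| ≤ m j :=
  (abs_min_sub_min_le_max _ _ _ _).trans (max_le (hm.incr j l) (by simpa using (hm.pos j).le))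

section
variable (p : ENNReal) [Fact (1 ≤ p)] [Fact (p ≠ ⊤)]

/-- From `(1 + x) y = x`, multiplication by the truncated weight gives `(1 + x) z = X' + c`, where
`X'` is the truncated weight applied to `x` and `c` is a commutator. Its symbol is an increment of
the truncated weight divided by the weight of the increment, hence at most one. Multiplying by `v =
(1 + x)⁻¹` gives a bound independent of the truncation and linear in `X`. -/
theorem inverse_weight_aux {m : (Fin d → ℤ) → ℝ} (hm : SubWeight m)
    (hone : ∀ c : Seq d p, convCLM p 1 c = c)
    (hassoc : ∀ (a b : Seq d 1) (c : Seq d p), convCLM p (a * b) c = convCLM p a (convCLM p b c))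
    {x v y : Seq d 1} (hv : (1 + x) * v = 1) (hvy : y = 1 - v) {X : Seq d p} (hX : ∀ j, X j = m j * x j)
    {N : ℝ} (hN : 0 ≤ N) {z : Seq d p} (hz : ∀ j, z j = ((min (m j) N : ℝ) : ℂ) * y j) :
    ‖z‖ ≤ ‖v‖ * ((1 + ‖y‖) * ‖X‖) := by
  have hm0 : ∀ j, (m j : ℂ) ≠ 0 := fun j => by exact_mod_cast (hm.pos j).ne'
  have hσ : ∀ j, ‖((min (m j) N / m j : ℝ) : ℂ)‖ ≤ 1 := fun j => by
    rw [Complex.norm_real, Real.norm_eq_abs, abs_of_nonneg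
      (div_nonneg (le_min (hm.pos j).le hN) (hm.pos j).le), div_le_one (hm.pos j)]
    exact min_le_left _ _
  let κ : (Fin d → ℤ) → (Fin d → ℤ) → ℂ := fun l r =>
    ((min (m l) N - min (m (r + l)) N) / m r : ℝ)
  have hκ : ∀ l r, ‖κ l r‖ ≤ 1 := fun l r => by
    rw [Complex.norm_real, Real.norm_eq_abs, abs_div, abs_of_pos (hm.pos r), div_le_one (hm.pos r)]
    exact hm.trunc N r l
  let X' := diag p (fun j => ((min (m j) N / m j : ℝ) : ℂ)) 1 hσ X
  let c := bil p κ 1 hκ y X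
  have hy : (1 + x) * y = x := by rw [hvy, mul_sub, hv]; ring
  have key : convCLM p (1 + x) z = X' + c := by
    rw [map_add, _root_.add_apply, hone]
    ext n
    have e0 : y n + ((⇑x : PerFun d) ⊡ ⇑y) n = x n := by
      have := congrArg (fun u : Seq d 1 => (⇑u : PerFun d) n) hy
      simp only at this
      rw [add_mul, one_mul, lp.coeFn_add, Pi.add_apply, coe_mul] at this
      exact this
    rw [lp.coeFn_add, lp.coeFn_add, Pi.add_apply, Pi.add_apply, diag_apply, hX, hz]
    change _ + (⇑(convCLM p x z) : PerFun d) n = _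
    rw [coe_convCLM, mul_comm', bil_apply]
    change _ + ∑' l, z l * x (n - l) = _
    have hs1 : Summable fun l => y l * x (n - l) := by
      simpa using (mem_coe y).summable_mul (mem_coe x) n
    have e1 : ((⇑x : PerFun d) ⊡ ⇑y) n = ∑' l, y l * x (n - l) := by
      rw [mul_comm']; rfl
    have e2 : ∀ l, z l * x (n - l) = ((min (m n) N : ℝ) : ℂ) * (y l * x (n - l)) +
        y l * (κ l (n - l) * X (n - l)) := fun l => by
      rw [hz, hX]
      simp only [κ, sub_add_cancel]
      have := hm0 (n - l)
      push_cast
      field_simp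
      ring
    have hs2 : Summable fun l => y l * (κ l (n - l) * X (n - l)) :=
      bil_summable_apply κ 1 hκ y X n
    rw [tsum_congr e2, (hs1.mul_left _).tsum_add hs2, tsum_mul_left, ← e1, ← e0]
    have := hm0 n
    push_cast
    field_simp
    ring
  have h2 : z = convCLM p v (X' + c) := by
    rw [← key, ← hassoc, mul_comm v, hv, hone]
  have hX' : ‖X'‖ ≤ ‖X‖ := by
    refine ((diag p _ 1 hσ).le_opNorm X).trans ?_
    calc _ ≤ 1 * ‖X‖ := mul_le_mul_of_nonneg_right (diag_norm_le _ _ _ _) (norm_nonneg _)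
      _ = _ := one_mul _
  have hc : ‖c‖ ≤ ‖y‖ * ‖X‖ := by simpa using bil_le p κ 1 hκ y X
  calc ‖z‖ ≤ ‖v‖ * ‖X' + c‖ := by rw [h2]; exact norm_convCLM_le p _ _
    _ ≤ _ := by
      gcongr
      exact (norm_add_le _ _).trans (by linarith)

theorem inverse_weight {m : (Fin d → ℤ) → ℝ} (hm : SubWeight m) (hp : 1 ≤ p)
    (hone : ∀ c : Seq d p, convCLM p 1 c = c)
    (hassoc : ∀ (a b : Seq d 1) (c : Seq d p), convCLM p (a * b) c = convCLM p a (convCLM p b c))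
    {x v : Seq d 1} (hv : (1 + x) * v = 1) {X : Seq d p} (hX : ∀ j, X j = m j * x j) :
    ∃ Z : Seq d p, (∀ j, Z j = m j * (1 - v) j) ∧ ‖Z‖ ≤ ‖v‖ * ((1 + ‖1 - v‖) * ‖X‖) := by
  have hp0 := toReal_pos_of_fact p
  set C := ‖v‖ * ((1 + ‖1 - v‖) * ‖X‖) with hC
  have hC0 : 0 ≤ C := by positivity
  have hb : ∀ s : Finset (Fin d → ℤ), ∑ j ∈ s, ‖(m j : ℂ) * (1 - v) j‖ ^ p.toReal ≤
      C ^ p.toReal := by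
    intro s
    -- The truncation level exceeds every weight on the finite set `s`, so the truncation is
    -- invisible there.
    let N := ∑ j ∈ s, m j
    have hN : 0 ≤ N := Finset.sum_nonneg fun j _ => (hm.pos j).le
    have hσ : ∀ j, ‖((min (m j) N : ℝ) : ℂ)‖ ≤ N := fun j => by
      rw [Complex.norm_real, Real.norm_eq_abs, abs_of_nonneg (le_min (hm.pos j).le hN)]
      exact min_le_right _ _
    let y : Seq d p := ⟨⇑(1 - v), (lp.memℓp (1 - v)).of_exponent_ge hp⟩
    let z := diag p _ N hσ y
    have hz := inverse_weight_aux p hm hone hassoc hv rfl hX hN (z := z) (fun j => rfl)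
    have h1 := lp.sum_rpow_le_norm_rpow hp0 z s
    refine le_trans (le_of_eq (Finset.sum_congr rfl fun j hj => ?_))
      (h1.trans (Real.rpow_le_rpow (norm_nonneg _) hz hp0.le))
    have : min (m j) N = m j := min_eq_left
      (Finset.single_le_sum (f := m) (fun i _ => (hm.pos i).le) hj)
    simp only [z, diag_apply, this]
    rfl
  refine ⟨⟨fun j => (m j : ℂ) * (1 - v) j, memℓp_gen' hb⟩, fun j => rfl, ?_⟩
  exact lp.norm_le_of_forall_sum_le hp0 hC0 hb

end

theorem inverse_weight_one {m : (Fin d → ℤ) → ℝ} (hm : SubWeight m)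
    {x v : Seq d 1} (hv : (1 + x) * v = 1) {X : Seq d 1} (hX : ∀ j, X j = m j * x j) :
    ∃ Z : Seq d 1, (∀ j, Z j = m j * (1 - v) j) ∧ ‖Z‖ ≤ ‖v‖ * ((1 + ‖1 - v‖) * ‖X‖) :=
  inverse_weight 1 hm le_rfl (fun c => one_mul c) (fun a b c => mul_assoc a b c) hv hX

theorem inverse_weight_two {m : (Fin d → ℤ) → ℝ} (hm : SubWeight m)
    {x v : Seq d 1} (hv : (1 + x) * v = 1) {X : Seq d 2} (hX : ∀ j, X j = m j * x j) :
    ∃ Z : Seq d 2, (∀ j, Z j = m j * (1 - v) j) ∧ ‖Z‖ ≤ ‖v‖ * ((1 + ‖1 - v‖) * ‖X‖) :=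
  inverse_weight 2 hm (by norm_num) (fun c => one_smul (Seq d 1) c) (fun a b c => mul_smul a b c)
    hv hX

/-- For `0 ≤ θ ≤ 1` the power `λ^θ` is even and subadditive. -/
theorem subWeight_wt (k : Fin d → ℝ) {θ : ℝ} (h0 : 0 ≤ θ) (h1 : θ ≤ 1) : SubWeight (wt k θ) where
  pos := wt_pos k θ
  incr j l := by
    have key : ∀ a c : Fin d → ℤ, wt k θ (a + c) ≤ wt k θ a + wt k θ c := fun a c => by
      refine le_trans (Real.rpow_le_rpow (lam_pos k _).le ?_ h0)
        (Real.rpow_add_le_add_rpow (lam_pos k a).le (lam_pos k c).le h0 h1)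
      simp only [lam, freq_add]
      linarith [abs_add_le (freq k a) (freq k c)]
    rw [abs_le]
    constructor
    · linarith [key j l]
    · have := key (-j) (j + l)
      rw [wt_neg, neg_add_cancel_left] at this
      linarith

/-! ### Lattice sums -/

/-- The square `1 + |j|²` of the Japanese bracket. -/
def jap (j : Fin d → ℤ) : ℝ := 1 + ∑ i, (j i : ℝ) ^ 2

theorem one_le_jap (j : Fin d → ℤ) : 1 ≤ jap j :=
  le_add_of_nonneg_right (Finset.sum_nonneg fun _ _ => sq_nonneg _)

theorem jap_pos (j : Fin d → ℤ) : 0 < jap j := zero_lt_one.trans_le (one_le_jap j)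

/-- Comparison with the lattice `ℤ^d` in `ℝ^d` under the sup norm, where `‖j‖² ≤ 1 + |j|²`; the zero
frequency is discarded. -/
theorem summable_jap {τ : ℝ} (h : (d : ℝ) / 2 < τ) :
    Summable fun j : Fin d → ℤ => jap j ^ (-τ) := by
  let bs := Pi.basisFun ℝ (Fin d)
  let L := Submodule.span ℤ (Set.range bs)
  have hL : ((Module.finrank ℤ L : ℕ) : ℝ) = d := by
    rw [Module.finrank_eq_card_basis (bs.restrictScalars ℤ), Fintype.card_fin]
  have hmem : ∀ j : Fin d → ℤ, (fun i => (j i : ℝ)) ∈ L := fun j => by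
    have : (fun i => (j i : ℝ)) = ∑ i, j i • bs i := by
      ext i
      simp [bs, Finset.sum_apply, Pi.single_apply]
    rw [this]
    exact Submodule.sum_mem _ fun i _ => Submodule.smul_mem _ _ (Submodule.subset_span ⟨i, rfl⟩)
  let φ : (Fin d → ℤ) → L := fun j => ⟨_, hmem j⟩
  have hφ : Function.Injective φ := fun i j hij => by
    ext x
    simpa [φ] using congrFun (congrArg Subtype.val hij) x
  have h1 := (ZLattice.summable_norm_rpow L (-(2 * τ)) (by rw [hL]; linarith)).comp_injective hφ
  refine Summable.of_norm_bounded_eventually h1 ?_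
  filter_upwards [(Set.finite_singleton (0 : Fin d → ℤ)).compl_mem_cofinite] with j hj
  have hj0 : j ≠ 0 := hj
  have hn : ‖φ j‖ = ‖fun i => (j i : ℝ)‖ := rfl
  have hpos : 0 < ‖φ j‖ := by
    rw [hn, norm_pos_iff]
    intro h0
    exact hj0 (by ext x; simpa using congrFun h0 x)
  have hd : 0 ≤ (d : ℝ) := Nat.cast_nonneg d
  have hle : ‖φ j‖ ^ 2 ≤ jap j := by
    have : ‖φ j‖ ≤ Real.sqrt (jap j) := by
      rw [hn, pi_norm_le_iff_of_nonneg (Real.sqrt_nonneg _)]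
      intro i
      refine Real.le_sqrt_of_sq_le ?_
      rw [Real.norm_eq_abs, sq_abs]
      have := Finset.single_le_sum (f := fun i => (j i : ℝ) ^ 2) (fun _ _ => sq_nonneg _)
        (Finset.mem_univ i)
      simp only [jap]
      linarith
    calc _ ≤ Real.sqrt (jap j) ^ 2 := by gcongr
      _ = _ := Real.sq_sqrt (jap_pos j).le
  rw [Real.norm_of_nonneg (Real.rpow_nonneg (jap_pos j).le _)]
  calc _ ≤ (‖φ j‖ ^ 2) ^ (-τ) :=
        Real.rpow_le_rpow_of_nonpos (by positivity) hle (by linarith)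
    _ = _ := by
      rw [← Real.rpow_natCast, ← Real.rpow_mul hpos.le]
      simp

/-- Recentring the lattice at the integer part of `x` costs a constant depending only on `κ`, which
makes the sums uniform in `x`. -/
theorem one_dim_lower (κ x : ℝ) (m : ℤ) (hm : m = ⌊x⌋) (l : ℤ) :
    min 1 |κ| / 2 * (1 + |((l - m : ℤ) : ℝ)|) ≤ 1 + |κ * (x - l)| := by
  set c := min 1 |κ|
  have hc1 : c ≤ 1 := min_le_left _ _
  have hc2 : c ≤ |κ| := min_le_right _ _
  have hc0 : 0 ≤ c := le_min zero_le_one (abs_nonneg _)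
  have hx : |((l - m : ℤ) : ℝ)| ≤ |x - l| + 1 := by
    have h1 : |x - m| ≤ 1 := by
      rw [hm, abs_of_nonneg (by linarith [Int.floor_le x])]
      linarith [Int.lt_floor_add_one x]
    have : ((l - m : ℤ) : ℝ) = -(x - l) + (x - m) := by push_cast; ring
    rw [this]
    exact (abs_add_le _ _).trans (by rw [abs_neg]; linarith)
  rw [abs_mul]
  have h2 : c * |x - l| ≤ |κ| * |x - l| := by gcongr
  have h3 := abs_nonneg (x - l)
  nlinarith

/-- Uniform bounds for sums over translated one-dimensional lattices. -/
theorem one_dim_sum {κ η : ℝ} (hκ : κ ≠ 0) (hη : 1 < η) :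
    ∃ K : ℝ, ∀ x : ℝ, (Summable fun l : ℤ => (1 + |κ * (x - l)|) ^ (-η)) ∧
      ∑' l : ℤ, (1 + |κ * (x - l)|) ^ (-η) ≤ K := by
  set c := min 1 |κ| / 2
  have hc : 0 < c := half_pos (lt_min one_pos (abs_pos.2 hκ))
  have h0 : Summable fun l : ℤ => (1 + |(l : ℝ)|) ^ (-η) := by
    refine Summable.of_norm_bounded_eventually (Real.summable_abs_int_rpow hη) ?_
    filter_upwards [(Set.finite_singleton (0 : ℤ)).compl_mem_cofinite] with j hj
    have : 0 < |(j : ℝ)| := abs_pos.2 (by exact_mod_cast hj)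
    rw [Real.norm_of_nonneg (by positivity)]
    exact Real.rpow_le_rpow_of_nonpos this (by linarith) (by linarith)
  refine ⟨c ^ (-η) * ∑' l : ℤ, (1 + |(l : ℝ)|) ^ (-η), fun x => ?_⟩
  have h1 : HasSum (fun l : ℤ => c ^ (-η) * (1 + |((l - ⌊x⌋ : ℤ) : ℝ)|) ^ (-η))
      (c ^ (-η) * ∑' l : ℤ, (1 + |(l : ℝ)|) ^ (-η)) :=
    (((Equiv.subRight ⌊x⌋).hasSum_iff (f := fun l : ℤ => (1 + |(l : ℝ)|) ^ (-η))).2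
      h0.hasSum).mul_left _
  have h2 : ∀ l : ℤ, (1 + |κ * (x - l)|) ^ (-η) ≤
      c ^ (-η) * (1 + |((l - ⌊x⌋ : ℤ) : ℝ)|) ^ (-η) := fun l => by
    rw [← Real.mul_rpow hc.le (by positivity)]
    exact Real.rpow_le_rpow_of_nonpos (by positivity) (one_dim_lower κ x _ rfl l) (by linarith)
  have h3 : Summable fun l : ℤ => (1 + |κ * (x - l)|) ^ (-η) :=
    Summable.of_nonneg_of_le (fun l => by positivity) h2 h1.summable
  exact ⟨h3, (h3.tsum_le_tsum h2 h1.summable).trans h1.tsum_eq.le⟩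

/-- Replacing the larger of `X` and `Z` by the smaller one only increases the product. This
decouples two decay factors with different centres. -/
theorem rpow_mul_inv_le {X Z ε : ℝ} (hX : 0 < X) (hZ : 0 < Z) (hε : 0 ≤ ε) :
    X ^ (-ε) * Z⁻¹ ≤ X ^ (-(1 + ε)) + Z ^ (-(1 + ε)) := by
  have e : ∀ x : ℝ, 0 < x → x ^ (-(1 + ε)) = x ^ (-ε) * x⁻¹ := fun x hx => by
    rw [← Real.rpow_neg_one x, ← Real.rpow_add hx]; ring_nf
  rw [e X hX, e Z hZ]
  have p1 : 0 ≤ X ^ (-ε) * X⁻¹ := by positivity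
  have p2 : 0 ≤ Z ^ (-ε) * Z⁻¹ := by positivity
  rcases le_total X Z with h | h
  · have : X ^ (-ε) * Z⁻¹ ≤ X ^ (-ε) * X⁻¹ := by gcongr
    linarith
  · have : X ^ (-ε) * Z⁻¹ ≤ Z ^ (-ε) * Z⁻¹ := by
      exact mul_le_mul_of_nonneg_right (Real.rpow_le_rpow_of_nonpos hZ h (by linarith))
        (inv_nonneg.2 hZ.le)
    linarith

theorem summable_of_fiber {α β : Type*} {f : α × β → ℝ} (hf : ∀ x, 0 ≤ f x) {F : α → ℝ}
    (hF : Summable F) (hF0 : ∀ a, 0 ≤ F a) {G : α → β → ℝ} {K : ℝ}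
    (hfG : ∀ a b, f (a, b) ≤ F a * G a b) (hG : ∀ a, Summable (G a) ∧ ∑' b, G a b ≤ K) :
    Summable f ∧ ∑' x, f x ≤ (∑' a, F a) * K := by
  have h1 : ∀ a, Summable fun b => f (a, b) := fun a =>
    Summable.of_nonneg_of_le (fun b => hf _) (hfG a) ((hG a).1.mul_left _)
  have h2 : ∀ a, ∑' b, f (a, b) ≤ F a * K := fun a => by
    refine ((h1 a).tsum_le_tsum (hfG a) ((hG a).1.mul_left _)).trans ?_
    rw [tsum_mul_left]
    exact mul_le_mul_of_nonneg_left (hG a).2 (hF0 a)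
  have h3 : Summable f := (summable_prod_of_nonneg hf).2
    ⟨h1, Summable.of_nonneg_of_le (fun a => tsum_nonneg fun _ => hf _) h2 (hF.mul_right K)⟩
  refine ⟨h3, ?_⟩
  rw [h3.tsum_prod, ← tsum_mul_right]
  exact h3.prod.tsum_le_tsum h2 (hF.mul_right K)

/-- The zeroth coordinate is summed for fixed transverse frequency `l`. A part `d/2 + ε` of the
exponent is kept for the sum over `l`; the remaining `ε` yields decay `|l₀|^{-2ε}`, which together
with `λ⁻¹` is of order `1 + 2ε > 1` in `l₀`. The two centres, `0` and the zero of the frequency, are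
separated by `rpow_mul_inv_le`. -/
theorem schur_fiber (k : Fin (d + 1) → ℝ) (hk0 : k 0 ≠ 0) {s ε : ℝ} (hε0 : 0 < ε)
    (hε : -(s - 1) = -(d / 2 + ε) + -ε) :
    ∃ K : ℝ, ∀ n : Fin (d + 1) → ℤ, ∃ G : (Fin d → ℤ) → ℤ → ℝ,
        (∀ l l₀, jap (Fin.cons l₀ l : Fin (d + 1) → ℤ) ^ (-(s - 1)) *
          (lam k (n - Fin.cons l₀ l))⁻¹ ≤ jap l ^ (-(d / 2 + ε)) * G l l₀) ∧
        ∀ l, Summable (G l) ∧ ∑' l₀, G l l₀ ≤ K := by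
  have hd : 0 ≤ (d : ℝ) := Nat.cast_nonneg d
  obtain ⟨K₁, h₁⟩ := one_dim_sum (κ := 1) one_ne_zero (η := 1 + 2 * ε) (by linarith)
  obtain ⟨K₂, h₂⟩ := one_dim_sum hk0 (η := 1 + 2 * ε) (by linarith)
  refine ⟨2 ^ (1 + 2 * ε) * K₁ + K₂, fun n => ?_⟩
  -- The real value of `l₀` at which the frequency of `n - (l₀, l)` vanishes.
  let x : (Fin d → ℤ) → ℝ := fun l => (freq k n - ∑ i, (l i : ℝ) * k i.succ) / k 0
  refine ⟨fun l l₀ => 2 ^ (1 + 2 * ε) * (1 + |1 * (0 - (l₀ : ℝ))|) ^ (-(1 + 2 * ε)) +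
    (1 + |k 0 * (x l - l₀)|) ^ (-(1 + 2 * ε)), fun l l₀ => ?_,
    fun l => ⟨((h₁ 0).1.mul_left _).add (h₂ (x l)).1, ?_⟩⟩
  · have e1 : freq k (n - Fin.cons l₀ l) = k 0 * (x l - l₀) := by
      simp only [x, freq_sub]
      rw [mul_sub, mul_div_cancel₀ _ hk0]
      simp only [freq, Fin.sum_univ_succ, Fin.cons_zero, Fin.cons_succ]
      ring
    have e2 : jap (Fin.cons l₀ l : Fin (d + 1) → ℤ) = jap l + (l₀ : ℝ) ^ 2 := by
      simp only [jap, Fin.sum_univ_succ, Fin.cons_zero, Fin.cons_succ]; ring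
    have j1 := one_le_jap l
    have j2 : jap l ≤ jap (Fin.cons l₀ l : Fin (d + 1) → ℤ) := by
      rw [e2]; nlinarith [sq_nonneg (l₀ : ℝ)]
    set X : ℝ := 1 + |(l₀ : ℝ)| with hX
    have X0 : 0 < X := by positivity
    have j3 : (X / 2) ^ 2 ≤ jap (Fin.cons l₀ l : Fin (d + 1) → ℤ) := by
      rw [e2, hX]
      nlinarith [sq_abs (l₀ : ℝ), sq_nonneg (1 - |(l₀ : ℝ)|), abs_nonneg (l₀ : ℝ)]
    have j4 : jap (Fin.cons l₀ l : Fin (d + 1) → ℤ) ^ (-(s - 1)) ≤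
        jap l ^ (-(d / 2 + ε)) * (X / 2) ^ (-(2 * ε)) := by
      rw [hε, Real.rpow_add (jap_pos _)]
      have : (X / 2) ^ (-(2 * ε)) = ((X / 2) ^ 2) ^ (-ε) := by
        rw [← Real.rpow_natCast, ← Real.rpow_mul (by positivity)]; congr 1; push_cast; ring
      rw [this]
      exact mul_le_mul (Real.rpow_le_rpow_of_nonpos (jap_pos _) j2 (by linarith))
        (Real.rpow_le_rpow_of_nonpos (by positivity) j3 (by linarith))
        (Real.rpow_nonneg (jap_pos _).le _) (Real.rpow_nonneg (jap_pos _).le _)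
    have e3 : lam k (n - Fin.cons l₀ l) = 1 + |k 0 * (x l - l₀)| := by rw [lam, e1]
    rw [e3]
    have j5 := rpow_mul_inv_le (X := X / 2) (Z := 1 + |k 0 * (x l - l₀)|) (ε := 2 * ε)
      (by positivity) (by positivity) (by linarith)
    have e4 : (X / 2) ^ (-(1 + 2 * ε)) =
        2 ^ (1 + 2 * ε) * (1 + |1 * (0 - (l₀ : ℝ))|) ^ (-(1 + 2 * ε)) := by
      rw [one_mul, zero_sub, abs_neg, ← hX, Real.div_rpow X0.le (by norm_num),
        Real.rpow_neg (by norm_num : (0 : ℝ) ≤ 2), div_inv_eq_mul, mul_comm]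
    change _ ≤ _ * (2 ^ (1 + 2 * ε) * (1 + |1 * (0 - (l₀ : ℝ))|) ^ (-(1 + 2 * ε)) + _)
    rw [← e4]
    calc _ ≤ (jap l ^ (-(d / 2 + ε)) * (X / 2) ^ (-(2 * ε))) * (1 + |k 0 * (x l - l₀)|)⁻¹ := by
          gcongr
      _ = jap l ^ (-(d / 2 + ε)) * ((X / 2) ^ (-(2 * ε)) * (1 + |k 0 * (x l - l₀)|)⁻¹) := by ring
      _ ≤ _ := mul_le_mul_of_nonneg_left j5 (Real.rpow_nonneg (jap_pos _).le _)
  · rw [((h₁ 0).1.mul_left _).tsum_add (h₂ (x l)).1, tsum_mul_left]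
    exact add_le_add (mul_le_mul_of_nonneg_left (h₁ 0).2 (by positivity)) (h₂ (x l)).2

/-- The condition on `s` says `2 (s - 1) > d - 1`, so for `d ≥ 1` the Japanese bracket alone sums
only over `d - 1` directions. The factor `λ⁻¹`, not quite summable along a line, supplies the last
direction with the help of the small excess. Independence of the entries of `k` enters through `k 0
≠ 0`. -/
theorem schur_sum (k : Fin d → ℝ) (hk : LinearIndependent ℤ k) {s : ℝ}
    (hs : ((d : ℝ) + 1) / 2 < s) :
    ∃ K : ℝ, 0 ≤ K ∧ ∀ n, (Summable fun l : Fin d → ℤ =>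
        (1 / (jap l ^ ((s - 1) / 2) * wt k (1 / 2) (n - l))) ^ 2) ∧
      ∑' l : Fin d → ℤ, (1 / (jap l ^ ((s - 1) / 2) * wt k (1 / 2) (n - l))) ^ 2 ≤ K ^ 2 := by
  have hsq : ∀ n l : Fin d → ℤ, (1 / (jap l ^ ((s - 1) / 2) * wt k (1 / 2) (n - l))) ^ 2 =
      jap l ^ (-(s - 1)) * (lam k (n - l))⁻¹ := fun n l => by
    have a1 : (jap l ^ ((s - 1) / 2)) ^ 2 = jap l ^ (s - 1) := by
      rw [← Real.rpow_natCast, ← Real.rpow_mul (jap_pos l).le]; congr 1; push_cast; ring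
    have a2 : wt k (1 / 2) (n - l) ^ 2 = lam k (n - l) := by
      rw [wt, ← Real.rpow_natCast, ← Real.rpow_mul (lam_pos k _).le]; norm_num
    rw [div_pow, mul_pow, a1, a2, Real.rpow_neg (jap_pos l).le, one_pow, one_div, mul_inv]
  suffices h : ∃ K : ℝ, ∀ n, (Summable fun l : Fin d → ℤ => jap l ^ (-(s - 1)) * (lam k (n - l))⁻¹) ∧
      ∑' l : Fin d → ℤ, jap l ^ (-(s - 1)) * (lam k (n - l))⁻¹ ≤ K by
    obtain ⟨K, hK⟩ := h
    have hK0 : 0 ≤ K := (tsum_nonneg fun l => mul_nonneg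
      (Real.rpow_nonneg (jap_pos l).le _) (inv_nonneg.2 (lam_pos k _).le)).trans (hK 0).2
    refine ⟨Real.sqrt K, Real.sqrt_nonneg _, fun n => ?_⟩
    rw [Real.sq_sqrt hK0]
    simpa only [hsq] using hK n
  clear hsq
  cases d with
  | zero =>
    exact ⟨∑' l : Fin 0 → ℤ, jap l ^ (-(s - 1)) * (lam k (0 - l))⁻¹, fun n => by
      rw [Subsingleton.elim n 0]; exact ⟨Summable.of_finite, le_rfl⟩⟩
  | succ d =>
    have hk0 : k 0 ≠ 0 := hk.ne_zero 0
    push_cast at hs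
    -- Half of the excess of `s` over its threshold: one half serves the transverse sum, the other
    -- the sum along the zeroth coordinate.
    set ε := (s - 1 - d / 2) / 2 with hε
    have hε0 : 0 < ε := by rw [hε]; linarith
    have hd : 0 ≤ (d : ℝ) := Nat.cast_nonneg d
    obtain ⟨K, key⟩ := schur_fiber k hk0 (s := s) hε0 (by rw [hε]; ring)
    refine ⟨(∑' l : Fin d → ℤ, jap l ^ (-(d / 2 + ε))) * K, fun n => ?_⟩
    obtain ⟨G, hG1, hG2⟩ := key n
    let e : (Fin d → ℤ) × ℤ ≃ (Fin (d + 1) → ℤ) :=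
      (Equiv.prodComm _ _).trans (Fin.consEquiv fun _ : Fin (d + 1) => ℤ)
    have h := summable_of_fiber (f := fun x => jap (e x) ^ (-(s - 1)) * (lam k (n - e x))⁻¹)
      (fun x => mul_nonneg (Real.rpow_nonneg (jap_pos _).le _) (inv_nonneg.2 (lam_pos k _).le))
      (summable_jap (d := d) (τ := d / 2 + ε) (by linarith))
      (fun l => Real.rpow_nonneg (jap_pos _).le _) hG1 hG2
    refine ⟨e.summable_iff.1 h.1, ?_⟩
    rw [← e.tsum_eq]
    exact h.2

/-! ### Products of two square summable functions with a kernel -/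

theorem CB.bmul22 {I : Set ℝ} {u v : ℝ → PerFun d} {β γ : ℝ → ℝ} {m m₁ m₂ : (Fin d → ℤ) → ℝ}
    (hu : CB 2 m₁ I u β) (hv : CB 2 m₂ I v γ) (hm₁ : ∀ j, 0 < m₁ j) (hm₂ : ∀ j, 0 < m₂ j)
    {κ h : (Fin d → ℤ) → (Fin d → ℤ) → ℝ}
    (hκ : ∀ l n, |κ l n * m (l + n)| ≤ m₁ l * m₂ n * h l n) {K : ℝ} (hK : 0 ≤ K)
    (hk : ∀ n, (Summable fun l => (h l (n - l)) ^ 2) ∧ ∑' l, (h l (n - l)) ^ 2 ≤ K ^ 2) :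
    CB 2 m I (fun t => QPWaterWaves.bmul (fun l n => (κ l n : ℂ)) (u t) (v t))
      (fun t => K * (β t * γ t)) := by
  have hβ : ∀ t ∈ I, 0 ≤ β t := fun t ht => hu.nonneg ht
  obtain ⟨U, hU, hu⟩ := hu
  obtain ⟨V, hV, hv⟩ := hv
  have hle : ∀ l n, (κ l n * m (l + n) / (m₁ l * m₂ n)) ^ 2 ≤ h l n ^ 2 := fun l n => by
    have hp := mul_pos (hm₁ l) (hm₂ n)
    refine sq_le_sq' ?_ ?_
    · rw [le_div_iff₀ hp]; linarith [(abs_le.1 (hκ l n)).1]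
    · rw [div_le_iff₀ hp]; linarith [(abs_le.1 (hκ l n)).2]
  have hk' : ∀ n, (Summable fun l => (κ l (n - l) * m (l + (n - l)) / (m₁ l * m₂ (n - l))) ^ 2) ∧
      ∑' l, (κ l (n - l) * m (l + (n - l)) / (m₁ l * m₂ (n - l))) ^ 2 ≤ K ^ 2 := fun n => by
    have hs := Summable.of_nonneg_of_le (fun l => sq_nonneg _) (fun l => hle l (n - l)) (hk n).1
    exact ⟨hs, (hs.tsum_le_tsum (fun l => hle l (n - l)) (hk n).1).trans (hk n).2⟩
  let T := bil22 (fun l n => κ l n * m (l + n) / (m₁ l * m₂ n)) K hK hk'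
  refine ⟨fun t => T (U t) (V t), (T.continuous.comp_continuousOn hU).clm_apply hV,
    fun t ht => ⟨fun n => ?_, ?_⟩⟩
  · rw [bil22_apply]
    change _ = _ * ∑' l, _
    rw [← tsum_mul_left]
    refine tsum_congr fun l => ?_
    have e1 : (m₁ l : ℂ) ≠ 0 := by exact_mod_cast (hm₁ l).ne'
    have e2 : (m₂ (n - l) : ℂ) ≠ 0 := by exact_mod_cast (hm₂ (n - l)).ne'
    rw [(hu t ht).1, (hv t ht).1, add_sub_cancel]
    push_cast; field_simp
  · refine (T.le_opNorm₂ _ _).trans ?_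
    rw [mul_assoc]
    exact mul_le_mul (LinearMap.mkContinuous₂_norm_le _ hK _)
      (mul_le_mul (hu t ht).2 (hv t ht).2 (norm_nonneg _) (hβ t ht)) (by positivity) hK

/-- Splitting of the half weight of a product between the two factors. -/
def halfKer (k : Fin d → ℝ) (l n : Fin d → ℤ) : ℝ :=
  wt k (1 / 2) l / (wt k (1 / 2) l + wt k (1 / 2) n)

theorem wt_half_add (k : Fin d → ℝ) (l n : Fin d → ℤ) :
    wt k (1 / 2) (l + n) ≤ wt k (1 / 2) l + wt k (1 / 2) n := by
  refine le_trans (Real.rpow_le_rpow (lam_pos k _).le ?_ (by norm_num))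
    (Real.rpow_add_le_add_rpow (lam_pos k l).le (lam_pos k n).le (by norm_num) (by norm_num))
  simp only [lam, freq_add]
  linarith [abs_add_le (freq k l) (freq k n)]

theorem halfKer_nonneg (k : Fin d → ℝ) (l n : Fin d → ℤ) : 0 ≤ halfKer k l n :=
  div_nonneg (wt_pos _ _ _).le (add_pos (wt_pos _ _ _) (wt_pos _ _ _)).le

theorem halfKer_add (k : Fin d → ℝ) (l n : Fin d → ℤ) : halfKer k l n + halfKer k n l = 1 := by
  have := wt_pos k (1 / 2) l
  have := wt_pos k (1 / 2) n
  rw [halfKer, halfKer, add_comm (wt k (1 / 2) n), ← add_div, div_self]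
  positivity

theorem halfKer_le_one (k : Fin d → ℝ) (l n : Fin d → ℤ) : halfKer k l n ≤ 1 := by
  linarith [halfKer_add k l n, halfKer_nonneg k n l]

/-- By subadditivity of `λ^{1/2}`, this share of the half derivative of the product is charged
entirely to the frequency `l`. -/
theorem halfKer_mul_wt (k : Fin d → ℝ) (l n : Fin d → ℤ) :
    halfKer k l n * wt k (1 / 2) (l + n) ≤ wt k (1 / 2) l := by
  have h1 := wt_pos k (1 / 2) l
  have h2 := wt_pos k (1 / 2) n
  rw [halfKer, div_mul_eq_mul_div, div_le_iff₀ (by positivity)]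
  exact mul_le_mul_of_nonneg_left (wt_half_add k l n) h1.le

theorem mul_eq_halfKer (k : Fin d → ℝ) {u v : PerFun d} (h : ∀ n, Summable fun l => ‖u l * v (n - l)‖) :
    u ⊡ v = bmul (fun l n => (halfKer k l n : ℂ)) u v +
      bmul (fun l n => (halfKer k n l : ℂ)) u v := by
  ext n
  change ∑' l, u l * v (n - l) = ∑' l, (halfKer k l (n - l) : ℂ) * u l * v (n - l) +
    ∑' l, (halfKer k (n - l) l : ℂ) * u l * v (n - l)
  have hs : ∀ κ : (Fin d → ℤ) → (Fin d → ℤ) → ℝ, (∀ l n, 0 ≤ κ l n) → (∀ l n, κ l n ≤ 1) →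
      Summable fun l => (κ l (n - l) : ℂ) * u l * v (n - l) := fun κ h0 h1 => by
    refine Summable.of_norm_bounded (h n) fun l => ?_
    rw [mul_assoc, norm_mul, Complex.norm_real, Real.norm_of_nonneg (h0 _ _)]
    exact mul_le_of_le_one_left (norm_nonneg _) (h1 _ _)
  rw [← (hs (halfKer k) (halfKer_nonneg k) (halfKer_le_one k)).tsum_add
    (hs (fun l n => halfKer k n l) (fun l n => halfKer_nonneg k n l) (fun l n => halfKer_le_one k n l))]
  refine tsum_congr fun l => ?_
  have : (halfKer k l (n - l) : ℂ) + halfKer k (n - l) l = 1 := by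
    exact_mod_cast halfKer_add k l (n - l)
  rw [← add_mul, ← add_mul, this, one_mul]

/-! ### Families of controlled size -/

/-- `u` is a continuous family in the `ℓ^p` space with weight `m`, of size at most `α ^ n * γ`. -/
structure CO (p : ENNReal) [Fact (1 ≤ p)] (m : (Fin d → ℤ) → ℝ) (I : Set ℝ) (α : ℝ → ℝ) (n : ℕ)
    (γ : ℝ → ℝ) (u : ℝ → PerFun d) : Prop where
  two_le : ∀ t ∈ I, 2 ≤ α t
  pos : ∀ j, 0 < m j
  bound : CB p m I u fun t => α t ^ n * γ t

namespace CO

variable {p : ENNReal} [Fact (1 ≤ p)] [Fact (p ≠ ⊤)] {k : Fin d → ℝ} {m m' m₁ m₂ : (Fin d → ℤ) → ℝ}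
  {I : Set ℝ} {α γ γ₁ γ₂ : ℝ → ℝ} {n n' n₁ n₂ : ℕ} {u v : ℝ → PerFun d}

theorem pos_pow (h : CO p m I α n γ u) (n' : ℕ) {t : ℝ} (ht : t ∈ I) : 0 < α t ^ n' :=
  pow_pos (by linarith [h.two_le t ht]) _

theorem nonneg (h : CO p m I α n γ u) {t : ℝ} (ht : t ∈ I) : 0 ≤ γ t :=
  nonneg_of_mul_nonneg_right (h.bound.nonneg ht) (h.pos_pow n ht)

theorem mono_γ (h : CO p m I α n γ u) (hγ : ∀ t ∈ I, α t ^ n * γ t ≤ α t ^ n' * γ₁ t) :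
    CO p m I α n' γ₁ u :=
  ⟨h.two_le, h.pos, h.bound.mono hγ⟩

theorem weaken (h : CO p m I α n γ u) (hn : n ≤ n') (hγ : γ = γ₁) : CO p m I α n' γ₁ u := by
  subst hγ
  refine h.mono_γ fun t ht => mul_le_mul_of_nonneg_right ?_ (h.nonneg ht)
  exact pow_le_pow_right₀ (by linarith [h.two_le t ht]) hn

theorem congr (h : CO p m I α n γ u) (hv : ∀ t ∈ I, v t = u t) : CO p m I α n γ v :=
  ⟨h.two_le, h.pos, h.bound.congr hv⟩

theorem weight (h : CO p m I α n γ u) (hm : ∀ j, 0 < m' j) (hmm : ∀ j, m' j ≤ m j) :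
    CO p m' I α n γ u :=
  ⟨h.two_le, hm, (h.bound.weight (K := 1) h.pos fun j => by
    rw [abs_of_pos (hm j), one_mul]; exact hmm j).mono fun _ _ => (one_mul _).le⟩

theorem lower {θ θ' : ℝ} (h : CO p (wt k θ) I α n γ u) (hθ : θ' ≤ θ) : CO p (wt k θ') I α n γ u :=
  h.weight (wt_pos k θ') (wt_mono k hθ)

/-- Since `α ≥ 2`, the factor two from the triangle inequality is absorbed by one more power of `α`;
numerical constants then need no tracking. -/
theorem add (hu : CO p m I α n₁ γ u) (hv : CO p m I α n₂ γ v) :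
    CO p m I α (max n₁ n₂ + 1) γ (fun t => u t + v t) := by
  have h1 := hu.weaken (le_max_left n₁ n₂) rfl
  have h2 := hv.weaken (le_max_right n₁ n₂) rfl
  refine ⟨hu.two_le, hu.pos, (h1.bound.add h2.bound).mono fun t ht => ?_⟩
  rw [pow_succ]
  nlinarith [hu.two_le t ht, mul_nonneg (hu.pos_pow (max n₁ n₂) ht).le (hu.nonneg ht)]

theorem neg (hu : CO p m I α n γ u) : CO p m I α n γ (fun t => -u t) :=
  ⟨hu.two_le, hu.pos, hu.bound.neg⟩

theorem sub (hu : CO p m I α n₁ γ u) (hv : CO p m I α n₂ γ v) :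
    CO p m I α (max n₁ n₂ + 1) γ (fun t => u t - v t) :=
  (hu.add hv.neg).congr fun _ _ => sub_eq_add_neg _ _

theorem smul (hu : CO p m I α n γ u) {c : ℂ} (hc : ‖c‖ ≤ 1) : CO p m I α n γ (fun t => c • u t) :=
  ⟨hu.two_le, hu.pos, (hu.bound.smul c).mono fun _ ht =>
    mul_le_of_le_one_left (hu.bound.nonneg ht) hc⟩

theorem bar (hu : CO p m I α n γ u) (hm : ∀ j, m (-j) = m j) :
    CO p m I α n γ (fun t => QPWaterWaves.bar (u t)) :=
  ⟨hu.two_le, hu.pos, hu.bound.bar hm⟩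

theorem mult (hu : CO p m I α n γ u) (σ : (Fin d → ℤ) → ℂ) (hm' : ∀ j, 0 < m' j)
    (hσ : ∀ j, ‖σ j‖ * m' j ≤ m j) : CO p m' I α n γ (fun t j => σ j * u t j) :=
  ⟨hu.two_le, hm', (hu.bound.mult σ (K := 1) hu.pos fun j => by
    rw [abs_of_pos (hm' j), one_mul]; exact hσ j).mono fun _ _ => (one_mul _).le⟩

theorem dα {θ θ' : ℝ} (hu : CO p (wt k θ) I α n γ u) (hθ : θ' + 1 ≤ θ) :
    CO p (wt k θ') I α n γ (fun t => QPWaterWaves.dα k (u t)) := by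
  refine hu.mult (fun j => Complex.I * (freq k j : ℂ)) (wt_pos k θ') fun j => ?_
  rw [norm_mul, Complex.norm_I, one_mul, Complex.norm_real, Real.norm_eq_abs]
  calc |freq k j| * wt k θ' j ≤ wt k 1 j * wt k θ' j := by
        rw [wt_one]
        exact mul_le_mul_of_nonneg_right (by simp [lam]) (wt_pos _ _ _).le
    _ = wt k (θ' + 1) j := by rw [mul_comm, wt_add]
    _ ≤ _ := wt_mono k hθ j

theorem bmul (hu : CO 1 m₁ I α n₁ γ₁ u) (hv : CO p m₂ I α n₂ γ₂ v)
    (hm : ∀ j, 0 < m j) {S₁ S₂ : (Fin d → ℤ) → Prop} (h₁ : ∀ t ∈ I, ∀ l, ¬ S₁ l → u t l = 0)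
    (h₂ : ∀ t ∈ I, ∀ l, ¬ S₂ l → v t l = 0) (κ : (Fin d → ℤ) → (Fin d → ℤ) → ℂ)
    (hκ : ∀ l n, S₁ l → S₂ n → ‖κ l n‖ * m (l + n) ≤ m₁ l * m₂ n) :
    CO p m I α (n₁ + n₂) (γ₁ * γ₂) (fun t => QPWaterWaves.bmul κ (u t) (v t)) := by
  refine ⟨hu.two_le, hm, (hu.bound.bmul hv.bound (m := m) hu.pos hv.pos h₁ h₂ κ (K := 1) zero_le_one
    fun l n h h' => ?_).mono fun t _ => ?_⟩
  · rw [abs_of_pos (hm _), one_mul]; exact hκ l n h h'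
  · rw [Pi.mul_apply, pow_add]; exact le_of_eq (by ring)

theorem bmul' (hu : CO 1 m₁ I α n₁ γ₁ u) (hv : CO p m₂ I α n₂ γ₂ v)
    (hm : ∀ j, 0 < m j) (κ : (Fin d → ℤ) → (Fin d → ℤ) → ℂ)
    (hκ : ∀ l n, ‖κ l n‖ * m (l + n) ≤ m₁ l * m₂ n) :
    CO p m I α (n₁ + n₂) (γ₁ * γ₂) (fun t => QPWaterWaves.bmul κ (u t) (v t)) :=
  hu.bmul hv hm (S₁ := fun _ => True) (S₂ := fun _ => True) (by simp) (by simp) κ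
    (fun l n _ _ => hκ l n)

theorem mul {θ : ℝ} (hθ : 0 ≤ θ) (hu : CO 1 (wt k θ) I α n₁ γ₁ u) (hv : CO p (wt k θ) I α n₂ γ₂ v) :
    CO p (wt k θ) I α (n₁ + n₂) (γ₁ * γ₂) (fun t => u t ⊡ v t) :=
  (hu.bmul' hv (wt_pos k θ) (fun _ _ => 1) fun l n => by
    rw [norm_one, one_mul]; exact wt_mul k hθ l n).congr fun t _ => mul_eq_bmul _ _

/-- The half derivative falls on one factor at a time, so each contribution uses the high norm of
one factor and the low norm of the other. With this tame form bounds stay linear in `β`. -/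
theorem mul_half {n₁' n₂' : ℕ} {γ₁' γ₂' : ℝ → ℝ} (hu : CO 1 (wt k (1 / 2)) I α n₁ γ₁ u)
    (hu0 : CO 1 (wt k 0) I α n₁' γ₁' u) (hv : CO p (wt k (1 / 2)) I α n₂ γ₂ v)
    (hv0 : CO p (wt k 0) I α n₂' γ₂' v) (hγ : γ₁ * γ₂' = γ) (hγ' : γ₁' * γ₂ = γ) :
    CO p (wt k (1 / 2)) I α (max (n₁ + n₂') (n₁' + n₂) + 1) γ (fun t => u t ⊡ v t) := by
  have h1 := (hu.bmul' hv0 (wt_pos k (1 / 2)) (fun l n => (halfKer k l n : ℂ)) fun l n => by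
    rw [Complex.norm_real, Real.norm_of_nonneg (halfKer_nonneg k l n), wt_zero, mul_one]
    exact halfKer_mul_wt k l n).weaken le_rfl hγ
  have h2 := (hu0.bmul' hv (wt_pos k (1 / 2)) (fun l n => (halfKer k n l : ℂ)) fun l n => by
    rw [Complex.norm_real, Real.norm_of_nonneg (halfKer_nonneg k n l), wt_zero, one_mul, add_comm]
    exact halfKer_mul_wt k n l).weaken le_rfl hγ'
  refine (h1.add h2).congr fun t ht => mul_eq_halfKer k fun n => ?_
  have hu1 : Mem 1 (fun _ => 1) (u t) := by rw [← wt_zero k]; exact hu0.bound.mem ht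
  have hv1 : Mem p (fun _ => 1) (v t) := by rw [← wt_zero k]; exact hv0.bound.mem ht
  exact (hu1.summable_mul hv1 n).norm

end CO

/-! ### Supports and the projection `P` -/

/-- Only frequencies `≤ 0` are present. -/
def SuppNonpos (k : Fin d → ℝ) (u : PerFun d) : Prop := ∀ j, 0 < freq k j → u j = 0

/-- Only frequencies `≥ 0` are present. -/
def SuppNonneg (k : Fin d → ℝ) (u : PerFun d) : Prop := ∀ j, freq k j < 0 → u j = 0

section supp
variable {k : Fin d → ℝ} {u v : PerFun d}

theorem IsHol.suppNonpos (h : IsHol k u) : SuppNonpos k u := fun j hj => h j hj.le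

theorem SuppNonpos.bar (h : SuppNonpos k u) : SuppNonneg k (bar u) := fun j hj => by
  simp only [QPWaterWaves.bar]; rw [h _ (by simpa using hj)]; simp

theorem SuppNonneg.dα (h : SuppNonneg k u) : SuppNonneg k (dα k u) := fun j hj => by
  simp [QPWaterWaves.dα, h j hj]

theorem SuppNonneg.mul (h : SuppNonneg k u) (h' : SuppNonneg k v) : SuppNonneg k (u ⊡ v) := by
  intro j hj
  change ∑' l, _ = _
  convert tsum_zero with l
  by_cases hl : freq k l < 0
  · rw [h l hl, zero_mul]
  · rw [h' (j - l) (by rw [freq_sub]; linarith), mul_zero]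

theorem suppNonpos_one : SuppNonpos k one := fun j hj => by
  have : j ≠ 0 := by rintro rfl; simp at hj
  simp [one, this]

theorem SuppNonpos.sub (h : SuppNonpos k u) (h' : SuppNonpos k v) : SuppNonpos k (u - v) :=
  fun j hj => by rw [Pi.sub_apply, h j hj, h' j hj, sub_zero]

end supp

/-- The symbol of `P`, as a function of the frequency. -/
def symP (x : ℝ) : ℝ := (1 - Real.sign x) / 2

theorem symP_nonneg (x : ℝ) : 0 ≤ symP x := by
  rcases Real.sign_apply_eq x with h | h | h <;> rw [symP, h] <;> norm_num

theorem symP_le_one (x : ℝ) : symP x ≤ 1 := by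
  rcases Real.sign_apply_eq x with h | h | h <;> rw [symP, h] <;> norm_num

theorem symP_of_pos {x : ℝ} (h : 0 < x) : symP x = 0 := by rw [symP, Real.sign_of_pos h]; norm_num
theorem symP_of_neg {x : ℝ} (h : x < 0) : symP x = 1 := by rw [symP, Real.sign_of_neg h]; norm_num
theorem symP_zero : symP 0 = 1 / 2 := by rw [symP, Real.sign_zero]; norm_num

theorem P_apply (k : Fin d → ℝ) (u : PerFun d) (j) : P k u j = (symP (freq k j) : ℂ) * u j := by
  simp only [P, hilbert, symP, Pi.smul_apply, Pi.sub_apply, smul_eq_mul]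
  push_cast
  linear_combination (1 / 2 * Real.sign (freq k j) * u j : ℂ) * Complex.I_mul_I

theorem Pbar_eq (k : Fin d → ℝ) (u : PerFun d) : Pbar k u = bar (P k (bar u)) := by
  ext j
  simp only [bar, P_apply, Pbar, hilbert, symP, Pi.smul_apply, Pi.add_apply, smul_eq_mul, freq_neg,
    Real.sign_neg, neg_neg, star_star, star_mul']
  simp only [Complex.star_def, Complex.conj_ofReal]
  push_cast
  linear_combination (-1 / 2 * Real.sign (freq k j) * u j : ℂ) * Complex.I_mul_I

theorem P_add (k : Fin d → ℝ) (u v : PerFun d) : P k (u + v) = P k u + P k v := by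
  ext j; simp only [P_apply, Pi.add_apply, mul_add]

theorem P_sub (k : Fin d → ℝ) (u v : PerFun d) : P k (u - v) = P k u - P k v := by
  ext j; simp only [P_apply, Pi.sub_apply, mul_sub]

theorem P_mul_eq (k : Fin d → ℝ) (u v : PerFun d) :
    P k (u ⊡ v) = bmul (fun l n => (symP (freq k (l + n)) : ℂ)) u v := by
  ext j
  rw [P_apply]
  change _ * ∑' l, _ = ∑' l, _
  rw [← tsum_mul_left]
  exact tsum_congr fun l => by simp only [add_sub_cancel, mul_assoc]

theorem two_re (u : PerFun d) : (2 : ℂ) • rePart u = u + bar u := by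
  rw [rePart, smul_smul]; norm_num

theorem two_im (u : PerFun d) : (2 : ℂ) • imPart u = (-Complex.I) • (u - bar u) := by
  rw [imPart, smul_smul]
  congr 1
  field_simp
  simp

/-! ### Holomorphic times antiholomorphic products under `P`. -/

namespace CO

variable {p : ENNReal} [Fact (1 ≤ p)] [Fact (p ≠ ⊤)] {k : Fin d → ℝ}
  {I : Set ℝ} {α γ γ₁ γ₂ : ℝ → ℝ} {n n' n₁ n₂ : ℕ} {u v : ℝ → PerFun d} {θ θ₁ θ₂ : ℝ}

theorem P (hu : CO p (wt k θ) I α n γ u) : CO p (wt k θ) I α n γ (fun t => QPWaterWaves.P k (u t)) :=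
  (hu.mult (fun j => (symP (freq k j) : ℂ)) hu.pos fun j => by
    rw [Complex.norm_real, Real.norm_of_nonneg (symP_nonneg _)]
    exact mul_le_of_le_one_left (hu.pos j).le (symP_le_one _)).congr fun t _ => by
      ext j; rw [P_apply]

theorem add_bar (hu : CO p (wt k θ) I α n γ u) :
    CO p (wt k θ) I α (n + 1) γ (fun t => u t + QPWaterWaves.bar (u t)) :=
  (hu.add (hu.bar (wt_neg k θ))).weaken (by simp) rfl

theorem sub_bar (hu : CO p (wt k θ) I α n γ u) :
    CO p (wt k θ) I α (n + 1) γ (fun t => u t - QPWaterWaves.bar (u t)) :=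
  (hu.sub (hu.bar (wt_neg k θ))).weaken (by simp) rfl

/-- `P` keeps only `ξ_l + ξ_n ≤ 0`, while `ξ_l ≤ 0 ≤ ξ_n`. Then both `|ξ_l + ξ_n|` and `|ξ_n|` are
at most `|ξ_l|`, so the output weight and the negative order of the antiholomorphic factor are both
paid by the holomorphic one. -/
theorem P_ker_le (h0 : 0 ≤ θ) (h2 : θ₂ ≤ 0) (h : θ - θ₂ ≤ θ₁) (l n : Fin d → ℤ)
    (hl : ¬ 0 < freq k l) (hn : ¬ freq k n < 0) :
    ‖(symP (freq k (l + n)) : ℂ)‖ * wt k θ (l + n) ≤ wt k θ₁ l * wt k θ₂ n := by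
  rw [Complex.norm_real, Real.norm_of_nonneg (symP_nonneg _)]
  push Not at hl hn
  rcases lt_or_ge 0 (freq k (l + n)) with h3 | h3
  · rw [symP_of_pos h3, zero_mul]
    exact (mul_pos (wt_pos _ _ _) (wt_pos _ _ _)).le
  · rw [freq_add] at h3
    have h4 : lam k (l + n) ≤ lam k l := by
      rw [lam, lam, freq_add, abs_of_nonpos h3, abs_of_nonpos hl]; linarith
    have h5 : lam k n ≤ lam k l := by
      rw [lam, lam, abs_of_nonpos hl, abs_of_nonneg hn]; linarith
    calc _ ≤ wt k θ (l + n) := mul_le_of_le_one_left (wt_pos _ _ _).le (symP_le_one _)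
      _ ≤ wt k θ l := Real.rpow_le_rpow (lam_pos _ _).le h4 h0
      _ ≤ wt k (θ₁ + θ₂) l := wt_mono k (by linarith) l
      _ = wt k θ₁ l * wt k θ₂ l := wt_add _ _ _ _
      _ ≤ _ := mul_le_mul_of_nonneg_left (Real.rpow_le_rpow_of_nonpos (lam_pos _ _) h5 h2)
        (wt_pos _ _ _).le

/-- `P` of the product of a holomorphic and an antiholomorphic function: all derivatives fall on
the holomorphic factor. -/
theorem P_mul (hu : CO 1 (wt k θ₁) I α n₁ γ₁ u) (hv : CO p (wt k θ₂) I α n₂ γ₂ v)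
    (su : ∀ t ∈ I, SuppNonpos k (u t)) (sv : ∀ t ∈ I, SuppNonneg k (v t))
    (h0 : 0 ≤ θ) (h2 : θ₂ ≤ 0) (h : θ - θ₂ ≤ θ₁) :
    CO p (wt k θ) I α (n₁ + n₂) (γ₁ * γ₂) (fun t => QPWaterWaves.P k (u t ⊡ v t)) :=
  (hu.bmul hv (wt_pos k θ) (S₁ := fun l => ¬ 0 < freq k l) (S₂ := fun l => ¬ freq k l < 0)
    (fun t ht l hl => su t ht l (not_not.1 hl)) (fun t ht l hl => sv t ht l (not_not.1 hl)) _
    (P_ker_le h0 h2 h)).congr fun _ _ => P_mul_eq k _ _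

theorem P_mul' (hu : CO p (wt k θ₁) I α n₁ γ₁ u) (hv : CO 1 (wt k θ₂) I α n₂ γ₂ v)
    (su : ∀ t ∈ I, SuppNonpos k (u t)) (sv : ∀ t ∈ I, SuppNonneg k (v t))
    (h0 : 0 ≤ θ) (h2 : θ₂ ≤ 0) (h : θ - θ₂ ≤ θ₁) :
    CO p (wt k θ) I α (n₁ + n₂) (γ₁ * γ₂) (fun t => QPWaterWaves.P k (u t ⊡ v t)) :=
  ((hv.bmul hu (wt_pos k θ) (S₁ := fun l => ¬ freq k l < 0) (S₂ := fun l => ¬ 0 < freq k l)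
    (fun t ht l hl => sv t ht l (not_not.1 hl)) (fun t ht l hl => su t ht l (not_not.1 hl))
    (fun l n => (symP (freq k (l + n)) : ℂ))
    fun l n hl hn => by rw [add_comm l n, mul_comm (wt k θ₂ l)]; exact P_ker_le h0 h2 h n l hn hl).congr
      fun t _ => by rw [mul_comm', P_mul_eq k]).weaken (add_comm _ _).le (mul_comm _ _)

/-- Products of two antiholomorphic functions, one of negative order. -/
theorem mul_anti (hu : CO 1 (wt k θ₁) I α n₁ γ₁ u) (hv : CO p (wt k θ₂) I α n₂ γ₂ v)
    (su : ∀ t ∈ I, SuppNonneg k (u t)) (sv : ∀ t ∈ I, SuppNonneg k (v t))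
    (h2 : θ₂ ≤ 0) (h : 0 ≤ θ₁) :
    CO p (wt k θ₂) I α (n₁ + n₂) (γ₁ * γ₂) (fun t => u t ⊡ v t) :=
  (hu.bmul hv (wt_pos k θ₂) (S₁ := fun l => ¬ freq k l < 0) (S₂ := fun l => ¬ freq k l < 0)
    (fun t ht l hl => su t ht l (not_not.1 hl)) (fun t ht l hl => sv t ht l (not_not.1 hl))
    (fun _ _ => 1) fun l n hl hn => by
      push Not at hl hn
      rw [norm_one, one_mul]
      have h1 : 1 ≤ wt k θ₁ l := Real.one_le_rpow (one_le_lam k l) h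
      -- Adding frequencies of the same sign does not decrease the modulus, so a negative power of
      -- `λ` does not increase.
      have h3 : wt k θ₂ (l + n) ≤ wt k θ₂ n := by
        refine Real.rpow_le_rpow_of_nonpos (lam_pos _ _) ?_ h2
        rw [lam, lam, freq_add, abs_of_nonneg hn, abs_of_nonneg (add_nonneg hl hn)]
        linarith
      nlinarith [wt_pos k θ₂ n]).congr fun t _ => mul_eq_bmul _ _

theorem mul_anti' (hu : CO p (wt k θ₁) I α n₁ γ₁ u) (hv : CO 1 (wt k θ₂) I α n₂ γ₂ v)
    (su : ∀ t ∈ I, SuppNonneg k (u t)) (sv : ∀ t ∈ I, SuppNonneg k (v t))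
    (h2 : θ₂ ≤ 0) (h : 0 ≤ θ₁) :
    CO p (wt k θ₂) I α (n₁ + n₂) (γ₁ * γ₂) (fun t => u t ⊡ v t) :=
  ((hv.bmul hu (wt_pos k θ₂) (S₁ := fun l => ¬ freq k l < 0) (S₂ := fun l => ¬ freq k l < 0)
    (fun t ht l hl => sv t ht l (not_not.1 hl)) (fun t ht l hl => su t ht l (not_not.1 hl))
    (fun _ _ => 1) fun l n hl hn => by
      push Not at hl hn
      rw [norm_one, one_mul]
      have h1 : 1 ≤ wt k θ₁ n := Real.one_le_rpow (one_le_lam k n) h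
      have h3 : wt k θ₂ (l + n) ≤ wt k θ₂ l := by
        refine Real.rpow_le_rpow_of_nonpos (lam_pos _ _) ?_ h2
        rw [lam, lam, freq_add, abs_of_nonneg hl, abs_of_nonneg (add_nonneg hl hn)]
        linarith
      nlinarith [wt_pos k θ₂ l]).weaken (add_comm _ _).le (mul_comm _ _)).congr fun t _ => by
        rw [mul_comm' (u t) (v t), mul_eq_bmul]

end CO

/-! ### Sobolev norms as weighted `ℓ^2` norms -/

/-- The square root of the weight of `H^{σ,θ}`. -/
def mH (k : Fin d → ℝ) (σ θ : ℝ) (j : Fin d → ℤ) : ℝ :=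
  jap j ^ (σ / 2) * (1 + freq k j ^ 2) ^ (θ / 2)

theorem mH_pos (k : Fin d → ℝ) (σ θ : ℝ) (j) : 0 < mH k σ θ j :=
  mul_pos (Real.rpow_pos_of_pos (jap_pos j) _) (Real.rpow_pos_of_pos (by positivity) _)

theorem rpow_half_sq {x : ℝ} (hx : 0 ≤ x) (σ : ℝ) : (x ^ (σ / 2)) ^ 2 = x ^ σ := by
  rw [← Real.rpow_natCast, ← Real.rpow_mul hx]; congr 1; push_cast; ring

theorem mH_sq (k : Fin d → ℝ) (σ θ : ℝ) (j) : mH k σ θ j ^ 2 = weight k σ θ j := by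
  rw [mH, mul_pow, rpow_half_sq (jap_pos j).le, rpow_half_sq (by positivity)]; rfl

theorem normH_nonneg (k : Fin d → ℝ) (σ θ : ℝ) (u : PerFun d) : 0 ≤ normH k σ θ u :=
  Real.sqrt_nonneg _

theorem normPair_nonneg (k : Fin d → ℝ) (σ : ℝ) (u v : PerFun d) : 0 ≤ normPair k σ u v :=
  Real.sqrt_nonneg _

theorem normPair_sq (k : Fin d → ℝ) (σ : ℝ) (u v : PerFun d) :
    normPair k σ u v ^ 2 = normH k σ 0 u ^ 2 + normH k σ (1 / 2) v ^ 2 :=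
  Real.sq_sqrt (by positivity)

theorem normH_le_left (k : Fin d → ℝ) (σ : ℝ) (u v : PerFun d) :
    normH k σ 0 u ≤ normPair k σ u v :=
  Real.le_sqrt_of_sq_le (by nlinarith [sq_nonneg (normH k σ (1 / 2) v)])

theorem normH_le_right (k : Fin d → ℝ) (σ : ℝ) (u v : PerFun d) :
    normH k σ (1 / 2) v ≤ normPair k σ u v :=
  Real.le_sqrt_of_sq_le (by nlinarith [sq_nonneg (normH k σ 0 u)])

theorem normH_eq {k : Fin d → ℝ} {σ θ : ℝ} {u : PerFun d} {x : Seq d 2}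
    (hx : ∀ j, x j = (mH k σ θ j : ℂ) * u j) : normH k σ θ u = ‖x‖ := by
  have : ‖x‖ ^ 2 = ∑' j, weight k σ θ j * ‖u j‖ ^ 2 := by
    rw [l2_norm_sq]
    refine tsum_congr fun j => ?_
    rw [hx, norm_mul, mul_pow, Complex.norm_real, Real.norm_eq_abs, sq_abs, mH_sq]
  rw [normH, ← this, Real.sqrt_sq (norm_nonneg _)]

theorem MemH.exists_lift {k : Fin d → ℝ} {σ θ : ℝ} {u : PerFun d} (h : MemH k σ θ u) :
    ∃ x : Seq d 2, ∀ j, x j = (mH k σ θ j : ℂ) * u j :=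
  ⟨⟨fun j => (mH k σ θ j : ℂ) * u j, memℓp_gen (by
    refine h.congr fun j => ?_
    simp only [ENNReal.toReal_ofNat, Real.rpow_ofNat]
    rw [norm_mul, mul_pow, Complex.norm_real, Real.norm_eq_abs, sq_abs, mH_sq])⟩, fun _ => rfl⟩

theorem CB.normH {k : Fin d → ℝ} {σ θ : ℝ} {I : Set ℝ} {u : ℝ → PerFun d} {β : ℝ → ℝ}
    (h : CB 2 (mH k σ θ) I u β) :
    CB 2 (mH k σ θ) I u (fun t => QPWaterWaves.normH k σ θ (u t)) := by
  obtain ⟨U, hU, hu⟩ := h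
  exact ⟨U, hU, fun t ht => ⟨(hu t ht).1, (normH_eq (hu t ht).1).ge⟩⟩

theorem CB.continuousOn_normH {k : Fin d → ℝ} {σ θ : ℝ} {I : Set ℝ} {u : ℝ → PerFun d} {β : ℝ → ℝ}
    (h : CB 2 (mH k σ θ) I u β) : ContinuousOn (fun t => QPWaterWaves.normH k σ θ (u t)) I := by
  obtain ⟨U, hU, hu⟩ := h
  exact hU.norm.congr fun t ht => normH_eq (hu t ht).1

theorem cb_of_tendsto {k : Fin d → ℝ} {σ θ : ℝ} {I : Set ℝ} {u : ℝ → PerFun d}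
    (h : ∀ t ∈ I, MemH k σ θ (u t))
    (hc : ∀ t₀ ∈ I, Tendsto (fun t => normH k σ θ (u t - u t₀)) (𝓝[I] t₀) (𝓝 0)) :
    CB 2 (mH k σ θ) I u (fun t => normH k σ θ (u t)) := by
  choose! U hU using fun t (ht : t ∈ I) => (h t ht).exists_lift
  refine ⟨U, fun t₀ ht₀ => ?_, fun t ht => ⟨hU t ht, (normH_eq (hU t ht)).ge⟩⟩
  refine tendsto_iff_norm_sub_tendsto_zero.2 ((hc t₀ ht₀).congr' ?_)
  filter_upwards [self_mem_nhdsWithin] with t ht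
  refine normH_eq fun j => ?_
  rw [lp.coeFn_sub, Pi.sub_apply, hU t ht, hU t₀ ht₀, Pi.sub_apply]; ring

theorem ContInPair.cb {k : Fin d → ℝ} {σ : ℝ} {I : Set ℝ} {u v : ℝ → PerFun d}
    (h : ContInPair k σ I u v) :
    CB 2 (mH k σ 0) I u (fun t => normH k σ 0 (u t)) ∧
      CB 2 (mH k σ (1 / 2)) I v (fun t => normH k σ (1 / 2) (v t)) := by
  constructor
  · refine cb_of_tendsto (fun t ht => (h.1 t ht).1) fun t₀ ht₀ => ?_
    exact squeeze_zero (fun _ => normH_nonneg _ _ _ _) (fun t => normH_le_left k σ _ _) (h.2 t₀ ht₀)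
  · refine cb_of_tendsto (fun t ht => (h.1 t ht).2) fun t₀ ht₀ => ?_
    exact squeeze_zero (fun _ => normH_nonneg _ _ _ _) (fun t => normH_le_right k σ _ _) (h.2 t₀ ht₀)

theorem ContInPair.continuousOn_normPair {k : Fin d → ℝ} {σ : ℝ} {I : Set ℝ} {u v : ℝ → PerFun d}
    (h : ContInPair k σ I u v) : ContinuousOn (fun t => normPair k σ (u t) (v t)) I :=
  (((h.cb.1.continuousOn_normH).pow 2).add ((h.cb.2.continuousOn_normH).pow 2)).sqrt

/-- A single state is treated as a family over the one-point time set `{0}`, so that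
time-independent statements use the same background estimates. -/
theorem contInPair_const {k : Fin d → ℝ} {σ : ℝ} {u v : PerFun d} (h : MemPair k σ u v) :
    ContInPair k σ {0} (fun _ => u) (fun _ => v) := by
  refine ⟨fun _ _ => h, fun t₀ _ => ?_⟩
  simpa [normPair, normH] using tendsto_const_nhds

/-! ### Comparison of weights -/

theorem freq_sq_le (k : Fin d → ℝ) (j) : 1 + freq k j ^ 2 ≤ (1 + ∑ i, k i ^ 2) * jap j := by
  have h := Finset.sum_mul_sq_le_sq_mul_sq Finset.univ (fun i => (j i : ℝ)) k
  have h1 : 0 ≤ ∑ i, k i ^ 2 := Finset.sum_nonneg fun _ _ => sq_nonneg _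
  have h2 : 0 ≤ ∑ i, (j i : ℝ) ^ 2 := Finset.sum_nonneg fun _ _ => sq_nonneg _
  simp only [freq, jap]
  nlinarith

theorem lam_sq_le (k : Fin d → ℝ) (j) : lam k j ^ 2 ≤ 2 * (1 + freq k j ^ 2) := by
  rw [lam]
  nlinarith [sq_abs (freq k j), sq_nonneg (1 - |freq k j|)]

/-- The constant in the comparison of `⟨ξ_α⟩` with `⟨j⟩`. -/
def cK (k : Fin d → ℝ) : ℝ := 2 * (1 + ∑ i, k i ^ 2)

theorem one_le_cK (k : Fin d → ℝ) : 1 ≤ cK k := by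
  have h1 : 0 ≤ ∑ i, k i ^ 2 := Finset.sum_nonneg fun _ _ => sq_nonneg _
  rw [cK]; linarith

theorem lam_sq_le_jap (k : Fin d → ℝ) (j) : lam k j ^ 2 ≤ cK k * jap j := by
  have := lam_sq_le k j
  have := freq_sq_le k j
  rw [cK]; linarith

theorem lam_le_jap (k : Fin d → ℝ) (j) : lam k j ≤ cK k * jap j ^ (1 / 2 : ℝ) := by
  have h1 := one_le_cK k
  refine le_of_sq_le_sq ?_ (mul_nonneg (by linarith) (Real.rpow_nonneg (jap_pos j).le _))
  rw [mul_pow, ← Real.rpow_natCast (jap j ^ (1 / 2 : ℝ)), ← Real.rpow_mul (jap_pos j).le]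
  norm_num
  have := jap_pos j
  nlinarith [lam_sq_le_jap k j, mul_nonneg (sub_nonneg.2 h1) this.le]

theorem lam_le_xi (k : Fin d → ℝ) (j) : lam k j ≤ 2 * (1 + freq k j ^ 2) ^ (1 / 2 : ℝ) := by
  refine le_of_sq_le_sq ?_ (by positivity)
  rw [mul_pow, ← Real.rpow_natCast ((1 + freq k j ^ 2) ^ (1 / 2 : ℝ)), ← Real.rpow_mul (by positivity)]
  norm_num
  nlinarith [lam_sq_le k j, sq_nonneg (freq k j)]

theorem wt_half_sq (k : Fin d → ℝ) (j) : wt k (1 / 2) j ^ 2 = lam k j := by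
  rw [wt, rpow_half_sq (lam_pos k j).le, Real.rpow_one]

theorem abs_freq_le_lam (k : Fin d → ℝ) (j) : |freq k j| ≤ lam k j := by simp [lam]

theorem mH_zero (k : Fin d → ℝ) (σ : ℝ) (j) : mH k σ 0 j = jap j ^ (σ / 2) := by simp [mH]

theorem wt_half_le_xi (k : Fin d → ℝ) (j) :
    wt k (1 / 2) j ≤ 2 * (1 + freq k j ^ 2) ^ (1 / 2 / 2 : ℝ) := by
  refine le_of_sq_le_sq ?_ (by positivity)
  rw [wt_half_sq, mul_pow, rpow_half_sq (by positivity)]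
  have : (0 : ℝ) ≤ (1 + freq k j ^ 2) ^ (1 / 2 : ℝ) := by positivity
  linarith [lam_le_xi k j]

/-- The sequence `⟨j⟩^{-(s-1/2)}`, square summable. -/
def japSeq {s : ℝ} (hs : ((d : ℝ) + 1) / 2 < s) : Seq d 2 :=
  ⟨fun j => (jap j ^ (-(s - 1 / 2) / 2) : ℝ), memℓp_gen (by
    refine (summable_jap (d := d) (τ := s - 1 / 2) (by linarith)).congr fun j => ?_
    simp only [ENNReal.toReal_ofNat, Real.rpow_ofNat]
    rw [Complex.norm_real, Real.norm_of_nonneg (Real.rpow_nonneg (jap_pos j).le _),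
      rpow_half_sq (jap_pos j).le])⟩

theorem CB.embed_of_le {s : ℝ} (hs : ((d : ℝ) + 1) / 2 < s) {m m' : (Fin d → ℤ) → ℝ} {I : Set ℝ}
    {u : ℝ → PerFun d} {β : ℝ → ℝ} (hu : CB 2 m I u β) (hm : ∀ j, 0 < m j) (hm' : ∀ j, 0 < m' j)
    {K : ℝ} (h : ∀ j, m' j * jap j ^ ((s - 1 / 2) / 2) ≤ K * m j) :
    CB 1 m' I u (fun t => ‖japSeq hs‖ * (K * β t)) := by
  have h1 : CB 2 (fun j => m' j * jap j ^ ((s - 1 / 2) / 2)) I u (fun t => K * β t) :=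
    hu.weight hm fun j => by
      rw [abs_of_pos (mul_pos (hm' j) (Real.rpow_pos_of_pos (jap_pos j) _))]; exact h j
  refine h1.embed (fun j => mul_pos (hm' j) (Real.rpow_pos_of_pos (jap_pos j) _)) fun j => ?_
  change ((jap j ^ (-(s - 1 / 2) / 2) : ℝ) : ℂ) = _
  congr 1
  rw [neg_div, Real.rpow_neg (jap_pos j).le]
  have := (hm' j).ne'
  have := (Real.rpow_pos_of_pos (jap_pos j) ((s - 1 / 2) / 2)).ne'
  field_simp

section compare
variable (k : Fin d → ℝ) (s : ℝ) (j : Fin d → ℤ)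

theorem cmp_W0 : wt k 0 j * jap j ^ ((s - 1 / 2) / 2) ≤ 1 * mH k (s - 1 / 2) 0 j := by
  rw [wt_zero, mH_zero]

/-- `λ ≤ cK ⟨j⟩`, so the half order between `s - 1/2` and `s` pays for half an `α`-derivative. -/
theorem cmp_Wh : wt k (1 / 2) j * jap j ^ ((s - 1 / 2) / 2) ≤ cK k * mH k s 0 j := by
  rw [mH_zero]
  have h1 := one_le_cK k
  refine le_of_sq_le_sq ?_ (mul_nonneg (by linarith) (Real.rpow_nonneg (jap_pos j).le _))
  rw [mul_pow, mul_pow, wt_half_sq, rpow_half_sq (jap_pos j).le, rpow_half_sq (jap_pos j).le]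
  calc lam k j * jap j ^ (s - 1 / 2) ≤ (cK k * jap j ^ (1 / 2 : ℝ)) * jap j ^ (s - 1 / 2) :=
        mul_le_mul_of_nonneg_right (lam_le_jap k j) (Real.rpow_nonneg (jap_pos j).le _)
    _ = cK k * jap j ^ s := by rw [mul_assoc, ← Real.rpow_add (jap_pos j)]; congr 2; ring
    _ ≤ _ := mul_le_mul_of_nonneg_right (by nlinarith) (Real.rpow_nonneg (jap_pos j).le _)

theorem cmp_Rh : wt k (1 / 2) j * jap j ^ ((s - 1 / 2) / 2) ≤ 2 * mH k (s - 1 / 2) (1 / 2) j := by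
  rw [mH]
  have := mul_le_mul_of_nonneg_right (wt_half_le_xi k j)
    (Real.rpow_nonneg (jap_pos j).le ((s - 1 / 2) / 2))
  linarith

theorem cmp_R1 : wt k 1 j * jap j ^ ((s - 1 / 2) / 2) ≤ 2 * cK k * mH k s (1 / 2) j := by
  have h0 : wt k 1 j = wt k (1 / 2) j * wt k (1 / 2) j := by rw [← wt_add]; norm_num
  have h1 := cmp_Wh k s j
  rw [mH_zero] at h1
  have h2 := wt_half_le_xi k j
  have h3 : (0 : ℝ) ≤ (1 + freq k j ^ 2) ^ (1 / 2 / 2 : ℝ) := by positivity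
  rw [h0, mH]
  calc _ = (wt k (1 / 2) j * jap j ^ ((s - 1 / 2) / 2)) * wt k (1 / 2) j := by ring
    _ ≤ (cK k * jap j ^ (s / 2)) * (2 * (1 + freq k j ^ 2) ^ (1 / 2 / 2 : ℝ)) :=
      mul_le_mul h1 h2 (wt_pos _ _ _).le (mul_nonneg (by linarith [one_le_cK k])
        (Real.rpow_nonneg (jap_pos j).le _))
    _ = _ := by ring

theorem cmp_DW : ‖Complex.I * (freq k j : ℂ)‖ * |jap j ^ ((s - 1) / 2)| ≤ cK k * mH k s 0 j := by
  rw [mH_zero, norm_mul, Complex.norm_I, one_mul, Complex.norm_real, Real.norm_eq_abs,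
    abs_of_pos (Real.rpow_pos_of_pos (jap_pos j) _)]
  calc _ ≤ (cK k * jap j ^ (1 / 2 : ℝ)) * jap j ^ ((s - 1) / 2) :=
        mul_le_mul_of_nonneg_right ((abs_freq_le_lam k j).trans (lam_le_jap k j))
          (Real.rpow_nonneg (jap_pos j).le _)
    _ = _ := by rw [mul_assoc, ← Real.rpow_add (jap_pos j)]; congr 2; ring

theorem cmp_DR : ‖Complex.I * (freq k j : ℂ)‖ * |jap j ^ ((s - 1) / 2) * wt k (1 / 2) j| ≤
    2 * cK k * mH k s (1 / 2) j := by
  have h1 := cmp_DW k s j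
  have h2 := wt_half_le_xi k j
  rw [mH_zero] at h1
  rw [abs_mul, abs_of_pos (wt_pos k _ j), mH, ← mul_assoc]
  calc _ ≤ (cK k * jap j ^ (s / 2)) * (2 * (1 + freq k j ^ 2) ^ (1 / 2 / 2 : ℝ)) :=
      mul_le_mul h1 h2 (wt_pos _ _ _).le (mul_nonneg (by linarith [one_le_cK k])
        (Real.rpow_nonneg (jap_pos j).le _))
    _ = _ := by ring

/-- For `d ≥ 1` the hypothesis forces `s > 1`, which pays for a full `α`-derivative. For `d = 0` it
only gives `s > 1/2`, but then both weights equal one. -/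
theorem cmp_W2 (hs : ((d : ℝ) + 1) / 2 < s) : |wt k 1 j| ≤ cK k * mH k s 0 j := by
  rw [mH_zero, abs_of_pos (wt_pos k _ j), wt_one]
  cases d with
  | zero =>
    have e1 : lam k j = 1 := by simp [lam, freq]
    have e2 : jap j = 1 := by simp [jap]
    rw [e1, e2, Real.one_rpow, mul_one]
    exact one_le_cK k
  | succ d =>
    push_cast at hs
    have hd : 0 ≤ (d : ℝ) := Nat.cast_nonneg d
    refine (lam_le_jap k j).trans (mul_le_mul_of_nonneg_left ?_ (by linarith [one_le_cK k]))
    exact Real.rpow_le_rpow_of_exponent_le (one_le_jap j) (by linarith)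

end compare

/-! ### The background -/

/-- Regularity of the background on the time interval `I`: `α` controls the norms of order `s - 1/2`
and `β` those of order `s`. -/
structure Background (k : Fin d → ℝ) (s : ℝ) (I : Set ℝ) (α β : ℝ → ℝ) (W R : ℝ → PerFun d) :
    Prop where
  schur : ∃ K : ℝ, 0 ≤ K ∧ (∀ t ∈ I, K ≤ α t) ∧ ∀ n, (Summable fun l : Fin d → ℤ =>
        (1 / (jap l ^ ((s - 1) / 2) * wt k (1 / 2) (n - l))) ^ 2) ∧
      ∑' l : Fin d → ℤ, (1 / (jap l ^ ((s - 1) / 2) * wt k (1 / 2) (n - l))) ^ 2 ≤ K ^ 2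
  hol_R : ∀ t ∈ I, IsHol k (R t)
  hol_Y : ∀ t ∈ I, IsHol k (Y (W t))
  inv : ∀ t ∈ I, (one + W t) ⊡ oneSubY (W t) = one
  W_zero : CO 1 (wt k 0) I α 1 1 W
  W_half : CO 1 (wt k (1 / 2)) I α 1 β W
  W_two : CO 2 (wt k 1) I α 1 β W
  V_zero : CO 1 (wt k 0) I α 1 1 (fun t => oneSubY (W t))
  Y_half : CO 1 (wt k (1 / 2)) I α 3 β (fun t => Y (W t))
  Y_two : ∀ t ∈ I, Mem 2 (wt k 1) (Y (W t))
  R_half : CO 1 (wt k (1 / 2)) I α 1 1 R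
  R_one : CO 1 (wt k 1) I α 1 β R
  dW : CO 2 (fun j => jap j ^ ((s - 1) / 2)) I α 1 β (fun t => dα k (W t))
  dR : CO 2 (fun j => jap j ^ ((s - 1) / 2) * wt k (1 / 2) j) I α 1 β (fun t => dα k (R t))

theorem continuousOn_of_norm_sub_le {E F : Type*} [SeminormedAddCommGroup E]
    [SeminormedAddCommGroup F] {I : Set ℝ} {f : ℝ → E} {x : ℝ → F} {g : ℝ → ℝ} (hg : ContinuousOn g I)
    (hx : ContinuousOn x I) (h : ∀ t ∈ I, ∀ t₀ ∈ I, ‖f t - f t₀‖ ≤ g t * (g t₀ * ‖x t - x t₀‖)) :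
    ContinuousOn f I := fun t₀ ht₀ => by
  refine tendsto_iff_norm_sub_tendsto_zero.2 ?_
  have h1 : Tendsto (fun t => g t * (g t₀ * ‖x t - x t₀‖)) (𝓝[I] t₀) (𝓝 0) := by
    have h2 : Tendsto (fun t => ‖x t - x t₀‖) (𝓝[I] t₀) (𝓝 0) :=
      tendsto_iff_norm_sub_tendsto_zero.1 (hx t₀ ht₀)
    simpa using (hg t₀ ht₀).tendsto.mul (h2.const_mul (g t₀))
  refine squeeze_zero' (Eventually.of_forall fun _ => norm_nonneg _) ?_ h1
  filter_upwards [self_mem_nhdsWithin] with t ht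
  exact h t ht t₀ ht₀

theorem cb_const {p : ENNReal} [Fact (1 ≤ p)] {m : (Fin d → ℤ) → ℝ} {u : PerFun d} (x : Seq d p)
    (hx : ∀ j, x j = (m j : ℂ) * u j) : CB p m {0} (fun _ => u) (fun _ => ‖x‖) :=
  ⟨fun _ => x, continuousOn_const, fun _ _ => ⟨hx, le_rfl⟩⟩

theorem CB.mul_wt {k : Fin d → ℝ} {θ : ℝ} (hθ : 0 ≤ θ) {p : ENNReal} [Fact (1 ≤ p)] [Fact (p ≠ ⊤)]
    {I : Set ℝ} {u v : ℝ → PerFun d} {β γ : ℝ → ℝ} (hu : CB 1 (wt k θ) I u β)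
    (hv : CB p (wt k θ) I v γ) : CB p (wt k θ) I (fun t => u t ⊡ v t) (fun t => β t * γ t) :=
  ((hu.bmul hv (m := wt k θ) (wt_pos k θ) (wt_pos k θ) (S₁ := fun _ => True) (S₂ := fun _ => True)
    (by simp) (by simp) (fun _ _ => 1) (K := 1) zero_le_one fun l n _ _ => by
      rw [norm_one, one_mul, one_mul, abs_of_pos (wt_pos _ _ _)]; exact wt_mul k hθ l n).congr
    fun t _ => mul_eq_bmul _ _).mono fun t _ => (one_mul _).le

theorem wt_mul_one (k : Fin d → ℝ) (θ : ℝ) (j) : (wt k θ j : ℂ) * (one : PerFun d) j = (one : PerFun d) j := by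
  by_cases h : j = 0
  · subst h; simp [wt, lam]
  · simp [one, h]

theorem one_lift (k : Fin d → ℝ) (θ : ℝ) (j) : (1 : Seq d 1) j = (wt k θ j : ℂ) * (one : PerFun d) j := by
  rw [wt_mul_one]; exact congrFun coe_one j

theorem norm_one_le : ‖(1 : Seq d 1)‖ ≤ 1 := (norm_mono 0).le

/-- The lift of `Y` to the Wiener algebra with weight `λ^{1/2}` is continuous. -/
theorem continuousOn_inverse_weight (k : Fin d → ℝ) {I : Set ℝ} {x v xh yh : ℝ → Seq d 1}
    (hx : ContinuousOn x I) (hxh : ContinuousOn xh I)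
    (hxxh : ∀ t ∈ I, ∀ j, xh t j = (wt k (1 / 2) j : ℂ) * x t j)
    (hv : ∀ t ∈ I, (1 + x t) * v t = 1)
    (hyh : ∀ t ∈ I, (∀ j, yh t j = (wt k (1 / 2) j : ℂ) * (1 - v t) j) ∧
      ‖yh t‖ ≤ ‖v t‖ * ((1 + ‖1 - v t‖) * ‖xh t‖)) : ContinuousOn yh I := by
  have hvc := continuousOn_inverse hx hv
  refine continuousOn_of_norm_sub_le (x := xh)
    (g := fun t => 1 + ‖v t‖ * ((1 + ‖1 - v t‖) * ‖xh t‖)) ?_ hxh fun t ht t₀ ht₀ => ?_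
  · exact continuousOn_const.add
      (hvc.norm.mul ((continuousOn_const.add (continuousOn_const.sub hvc).norm).mul hxh.norm))
  have hone := cb_const (1 : Seq d 1) (one_lift k (1 / 2))
  have hV : ∀ t ∈ I, CB 1 (wt k (1 / 2)) {0} (fun _ => (⇑(v t) : PerFun d))
      (fun _ => 1 + ‖v t‖ * ((1 + ‖1 - v t‖) * ‖xh t‖)) := fun t ht => by
    refine ((hone.sub (cb_const (yh t) (hyh t ht).1)).congr fun _ _ => ?_).mono fun _ _ =>
      add_le_add norm_one_le (hyh t ht).2
    rw [← coe_one, ← lp.coeFn_sub, sub_sub_cancel]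
  have hX : CB 1 (wt k (1 / 2)) {0} (fun _ => (⇑(x t - x t₀) : PerFun d))
      (fun _ => ‖xh t - xh t₀‖) := cb_const _ fun j => by
    rw [lp.coeFn_sub, lp.coeFn_sub, Pi.sub_apply, Pi.sub_apply, hxxh t ht, hxxh t₀ ht₀]; ring
  obtain ⟨U, -, hU⟩ := (hV t ht).mul_wt (by norm_num) ((hV t₀ ht₀).mul_wt (by norm_num) hX)
  have e : yh t - yh t₀ = U 0 := by
    ext j
    -- The resolvent identity: the weighted norm of a difference of inverses is controlled by that
    -- of the difference of the functions.
    have e1 : (1 - v t) - (1 - v t₀) = v t * (v t₀ * (x t - x t₀)) := by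
      linear_combination v t * hv t₀ ht₀ - v t₀ * hv t ht
    have e2 : U 0 j = (wt k (1 / 2) j : ℂ) * (v t * (v t₀ * (x t - x t₀))) j := by
      have := (hU 0 rfl).1 j
      simp only [← coe_mul] at this
      exact this
    rw [e2, ← e1, lp.coeFn_sub (yh t), lp.coeFn_sub (1 - v t) (1 - v t₀), Pi.sub_apply,
      Pi.sub_apply, (hyh t ht).1, (hyh t₀ ht₀).1]
    ring
  rw [e]
  exact (hU 0 rfl).2

/-- Norms of order `s - 1/2`, fixed constants and the Wiener norm of `1 / (1 + 𝐖)` go into `α`;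
norms of order `s` enter once, through `β = B`. The Wiener norm is kept as a separate quantity here,
so no lower bound on `|1 + 𝐖|` uniform in time is required. -/
theorem exists_background (k : Fin d → ℝ) (hk : LinearIndependent ℤ k) {s : ℝ}
    (hs : ((d : ℝ) + 1) / 2 < s) : ∃ C : ℝ, 1 ≤ C ∧ ∀ (I : Set ℝ) (W R : ℝ → PerFun d),
      (∀ t ∈ I, IsState k s (W t) (R t)) → ContInPair k s I W R →
      Background k s I (fun t => C * (2 + ctrlA k s (W t) (R t) + ∑' j, ‖oneSubY (W t) j‖))
        (fun t => ctrlB k s (W t) (R t)) W R := by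
  obtain ⟨K, hK0, hK⟩ := schur_sum k hk hs
  have hcK := one_le_cK k
  have hJ : 0 ≤ ‖japSeq hs‖ := norm_nonneg _
  set J := ‖japSeq hs‖
  -- Large enough for the lattice sum constant, the comparison constants and the embedding constants
  -- at once.
  set C := 1 + K + 2 * cK k + 2 * J * cK k with hCdef
  have hJc : 0 ≤ J * cK k := mul_nonneg hJ (by linarith)
  have hJc' : J ≤ J * cK k := le_mul_of_one_le_right hJ hcK
  refine ⟨C, by linarith, fun I W R hst hcont => ?_⟩
  obtain ⟨hW, hR⟩ := hcont.cb
  have hA0 : ∀ t, 0 ≤ ctrlA k s (W t) (R t) := fun t => normPair_nonneg _ _ _ _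
  have hB0 : ∀ t, 0 ≤ ctrlB k s (W t) (R t) := fun t => normPair_nonneg _ _ _ _
  have hv0 : ∀ t, 0 ≤ ∑' j, ‖oneSubY (W t) j‖ := fun t => tsum_nonneg fun _ => norm_nonneg _
  have hC1 : 1 ≤ C := by linarith
  set α : ℝ → ℝ := fun t => C * (2 + ctrlA k s (W t) (R t) + ∑' j, ‖oneSubY (W t) j‖) with hα
  have hα2 : ∀ t, 2 ≤ α t := fun t => by
    rw [hα]; nlinarith [hA0 t, hv0 t, mul_nonneg (sub_nonneg.2 hC1) (add_nonneg (hA0 t) (hv0 t))]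
  have hαC : ∀ t, C ≤ α t := fun t => by
    rw [hα]; nlinarith [hA0 t, hv0 t, mul_nonneg (zero_le_one.trans hC1) (add_nonneg (hA0 t) (hv0 t))]
  have hαA : ∀ t, C * ctrlA k s (W t) (R t) ≤ α t := fun t => by
    simp only [hα]; exact mul_le_mul_of_nonneg_left (by linarith [hv0 t]) (by linarith)
  have hαv : ∀ t, 2 + ∑' j, ‖oneSubY (W t) j‖ ≤ α t := fun t => by
    rw [hα]; nlinarith [hA0 t, hv0 t,
      mul_nonneg (sub_nonneg.2 hC1) (add_nonneg (add_nonneg (zero_le_two (α := ℝ)) (hA0 t)) (hv0 t))]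
  have hWB : ∀ t, normH k s 0 (W t) ≤ ctrlB k s (W t) (R t) := fun t => normH_le_left _ _ _ _
  have hRB : ∀ t, normH k s (1 / 2) (R t) ≤ ctrlB k s (W t) (R t) := fun t => normH_le_right _ _ _ _
  have hlow : ∀ θ j, |mH k (s - 1 / 2) θ j| ≤ 1 * mH k s θ j := fun θ j => by
    rw [abs_of_pos (mH_pos _ _ _ _), one_mul]
    exact mul_le_mul_of_nonneg_right (Real.rpow_le_rpow_of_exponent_le (one_le_jap j) (by linarith))
      (by positivity)
  have hWA := (hW.weight (m' := mH k (s - 1 / 2) 0) (mH_pos k s 0) (hlow 0)).normH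
  have hRA := (hR.weight (m' := mH k (s - 1 / 2) (1 / 2)) (mH_pos k s (1 / 2)) (hlow (1 / 2))).normH
  have hWA' : ∀ t, normH k (s - 1 / 2) 0 (W t) ≤ ctrlA k s (W t) (R t) :=
    fun t => normH_le_left _ _ _ _
  have hRA' : ∀ t, normH k (s - 1 / 2) (1 / 2) (R t) ≤ ctrlA k s (W t) (R t) :=
    fun t => normH_le_right _ _ _ _
  have bB : ∀ c x : ℝ, 0 ≤ c → c ≤ C → ∀ t ∈ I, x ≤ ctrlB k s (W t) (R t) →
      c * x ≤ α t ^ 1 * ctrlB k s (W t) (R t) := fun c x hc hcC t _ hx => by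
    rw [pow_one]
    exact (mul_le_mul_of_nonneg_left hx hc).trans
      (mul_le_mul_of_nonneg_right (hcC.trans (hαC t)) (hB0 t))
  have bA : ∀ c x : ℝ, 0 ≤ c → c ≤ C → ∀ t ∈ I, x ≤ ctrlA k s (W t) (R t) →
      c * x ≤ α t ^ 1 * (1 : ℝ → ℝ) t := fun c x hc hcC t _ hx => by
    rw [pow_one, Pi.one_apply, mul_one]
    exact ((mul_le_mul_of_nonneg_left hx hc).trans
      (mul_le_mul_of_nonneg_right hcC (hA0 t))).trans (hαA t)
  have W_zero : CB 1 (wt k 0) I W _ := hWA.embed_of_le hs (mH_pos _ _ _) (wt_pos k 0) (cmp_W0 k s)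
  have W_half : CB 1 (wt k (1 / 2)) I W _ := hW.embed_of_le hs (mH_pos _ _ _) (wt_pos k _) (cmp_Wh k s)
  have R_half : CB 1 (wt k (1 / 2)) I R _ := hRA.embed_of_le hs (mH_pos _ _ _) (wt_pos k _) (cmp_Rh k s)
  have R_one : CB 1 (wt k 1) I R _ := hR.embed_of_le hs (mH_pos _ _ _) (wt_pos k _) (cmp_R1 k s)
  obtain ⟨x, hxc, hx⟩ := id W_zero
  obtain ⟨xh, hxhc, hxh⟩ := id W_half
  have hxW : ∀ t ∈ I, (⇑(x t) : PerFun d) = W t := fun t ht => by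
    ext j; rw [(hx t ht).1, wt_zero]; simp
  choose! v hv hvW using fun t (ht : t ∈ I) => exists_inverse (x t) (hxW t ht) (hst t ht).ne_zero
  have hxxh : ∀ t ∈ I, ∀ j, xh t j = (wt k (1 / 2) j : ℂ) * x t j := fun t ht j => by
    rw [(hxh t ht).1, hxW t ht]
  choose! yh hyh using fun t (ht : t ∈ I) =>
    inverse_weight_one (subWeight_wt k (θ := 1 / 2) (by norm_num) (by norm_num)) (hv t ht) (hxxh t ht)
  have hyc := continuousOn_inverse_weight k hxc hxhc hxxh hv hyh
  have hvc := continuousOn_inverse hxc hv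
  have hY : ∀ t ∈ I, (⇑(1 - v t) : PerFun d) = Y (W t) := fun t ht => by
    rw [lp.coeFn_sub, hvW t ht, coe_one, oneSubY, sub_sub_cancel]
  have hvn : ∀ t ∈ I, ‖v t‖ = ∑' j, ‖oneSubY (W t) j‖ := fun t ht => by rw [l1_norm, hvW t ht]
  have h1v : ∀ t ∈ I, 1 + ‖1 - v t‖ ≤ α t := fun t ht => by
    have := norm_sub_le (1 : Seq d 1) (v t)
    have := norm_one_le (d := d)
    rw [hvn t ht] at *
    linarith [hαv t]
  have hW2 : CB 2 (wt k 1) I W _ := hW.weight (mH_pos _ _ _) (fun j => cmp_W2 k s j hs)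
  exact
  { schur := ⟨K, hK0, fun t _ => le_trans (by linarith) (hαC t), hK⟩
    hol_R := fun t ht => (hst t ht).hol_R
    hol_Y := fun t ht => (hst t ht).hol_Y
    inv := fun t ht => by
      rw [← hvW t ht, ← hxW t ht, ← coe_one, ← lp.coeFn_add, ← coe_mul, hv t ht]
    W_zero := ⟨fun t _ => hα2 t, wt_pos k _, W_zero.mono fun t ht => by
      rw [← mul_assoc]
      exact bA _ _ (by linarith) (by linarith) t ht (hWA' t)⟩
    W_half := ⟨fun t _ => hα2 t, wt_pos k _, W_half.mono fun t ht => by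
      rw [← mul_assoc]
      exact bB _ _ (by linarith) (by linarith) t ht (hWB t)⟩
    W_two := ⟨fun t _ => hα2 t, wt_pos k _, hW2.mono fun t ht =>
      bB _ _ (by linarith) (by linarith) t ht (hWB t)⟩
    V_zero := ⟨fun t _ => hα2 t, wt_pos k _, v, hvc, fun t ht => ⟨fun j => by
      rw [wt_zero, hvW t ht]; simp, by
      change _ ≤ α t ^ 1 * 1
      rw [hvn t ht, pow_one, mul_one]; linarith [hαv t]⟩⟩
    Y_half := ⟨fun t _ => hα2 t, wt_pos k _, yh, hyc, fun t ht => ⟨fun j => by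
      rw [(hyh t ht).1, hY t ht], by
      have h1 : ‖xh t‖ ≤ α t ^ 1 * ctrlB k s (W t) (R t) := (hxh t ht).2.trans (by
        change ‖japSeq hs‖ * (cK k * normH k s 0 (W t)) ≤ _
        rw [← mul_assoc]; exact bB _ _ (by linarith) (by linarith) t ht (hWB t))
      have h2 : ‖v t‖ ≤ α t := by rw [hvn t ht]; linarith [hαv t]
      have hα0 : 0 ≤ α t := by linarith [hα2 t]
      refine (hyh t ht).2.trans ?_
      calc _ ≤ α t * (α t * (α t ^ 1 * ctrlB k s (W t) (R t))) := by
            have := h1v t ht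
            gcongr
        _ = _ := by ring⟩⟩
    Y_two := fun t ht => by
      obtain ⟨X, hX⟩ := hW2.mem ht
      obtain ⟨Z, hZ, -⟩ := inverse_weight_two (subWeight_wt k (θ := 1) (by norm_num) le_rfl)
        (hv t ht) (X := X) (fun j => by rw [hX, hxW t ht])
      exact ⟨Z, fun j => by rw [hZ, hY t ht]⟩
    R_half := ⟨fun t _ => hα2 t, wt_pos k _, R_half.mono fun t ht => by
      rw [← mul_assoc]
      exact bA _ _ (by linarith) (by linarith) t ht (hRA' t)⟩
    R_one := ⟨fun t _ => hα2 t, wt_pos k _, R_one.mono fun t ht => by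
      rw [← mul_assoc]
      exact bB _ _ (by nlinarith) (by linarith) t ht (hRB t)⟩
    dW := ⟨fun t _ => hα2 t, fun j => Real.rpow_pos_of_pos (jap_pos j) _,
      (hW.mult (fun j => Complex.I * (freq k j : ℂ)) (mH_pos _ _ _) (cmp_DW k s)).mono fun t ht =>
        bB _ _ (by linarith) (by linarith) t ht (hWB t)⟩
    dR := ⟨fun t _ => hα2 t, fun j => mul_pos (Real.rpow_pos_of_pos (jap_pos j) _) (wt_pos k _ j),
      (hR.mult (fun j => Complex.I * (freq k j : ℂ)) (mH_pos _ _ _) (cmp_DR k s)).mono fun t ht =>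
        bB _ _ (by linarith) (by linarith) t ht (hRB t)⟩ }

/-- Uniform bound for the inverse of `1 + 𝐖`. -/
theorem exists_bound_oneSubY (k : Fin d → ℝ) {s : ℝ} (hs : ((d : ℝ) + 1) / 2 < s) (A₁ δ : ℝ)
    (hδ : 0 < δ) : ∃ C : ℝ, ∀ W R : PerFun d, IsState k s W R → Bounded k s A₁ δ W R →
      ∑' j, ‖oneSubY W j‖ ≤ C := by
  obtain ⟨C, hC⟩ := exists_bound_inverse (japSeq hs) A₁ δ hδ
  refine ⟨C, fun W R hst hb => ?_⟩
  have hW := (contInPair_const hst.mem).cb.1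
  have hm : Mem 2 (mH k (s - 1 / 2) 0) W :=
    (hW.mem (t := 0) rfl).mono (mH_pos _ _ _) (K := 1) fun j => by
      rw [abs_of_pos (mH_pos _ _ _ _), one_mul, mH_zero, mH_zero]
      exact Real.rpow_le_rpow_of_exponent_le (one_le_jap j) (by linarith)
  obtain ⟨y, hy⟩ := hm
  have hx : (⇑(l2ToL1 (japSeq hs) y) : PerFun d) = W := by
    ext j
    change ((jap j ^ (-(s - 1 / 2) / 2) : ℝ) : ℂ) * y j = _
    rw [hy, mH_zero, ← mul_assoc, ← Complex.ofReal_mul, ← Real.rpow_add (jap_pos j)]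
    ring_nf
    simp
  obtain ⟨v, hv, hvW⟩ := exists_inverse _ hx hst.ne_zero
  have := hC y (((normH_eq hy).ge.trans (normH_le_left _ _ _ _)).trans hb.1)
    (by rw [hx]; exact hb.2) v hv
  rwa [l1_norm, hvW] at this

/-! ### Bounds for the coefficients and the sources -/

theorem b_eq (k : Fin d → ℝ) (W R : PerFun d) :
    b k W R = P k (R ⊡ bar (oneSubY W)) + bar (P k (R ⊡ bar (oneSubY W))) := two_re _

theorem bar_b (k : Fin d → ℝ) (W R : PerFun d) : bar (b k W R) = b k W R := by
  rw [b_eq, bar_add, bar_bar, add_comm]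

/-- `P̄ z` is the conjugate of `P z̄`, so only one projected product remains, and it has the form
holomorphic times antiholomorphic. -/
theorem a_eq (k : Fin d → ℝ) (R : PerFun d) :
    a k R = (-Complex.I) • (P k (R ⊡ dα k (bar R)) - bar (P k (R ⊡ dα k (bar R)))) := by
  rw [a, Pbar_eq, bar_mul, bar_bar, ← dα_bar, neg_smul, ← smul_neg, neg_sub]

theorem bar_a (k : Fin d → ℝ) (R : PerFun d) : bar (a k R) = a k R := by
  rw [a_eq, bar_smul, bar_sub, bar_bar, star_neg, Complex.star_def, Complex.conj_I, neg_neg, neg_smul,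
    ← smul_neg, neg_sub]

theorem M_eq (k : Fin d → ℝ) (W R : PerFun d) :
    M k W R = P k (R ⊡ dα k (bar (Y W)) - dα k (bar R) ⊡ Y W) +
      bar (P k (R ⊡ dα k (bar (Y W)) - dα k (bar R) ⊡ Y W)) := by
  rw [M, Pbar_eq, bar_sub, bar_mul, bar_bar, bar_mul, bar_bar, ← dα_bar, ← dα_bar, add_comm]

/-- The product of two functions of `H^{0,1}` with absolutely convergent Fourier series. -/
theorem Mem.mul_two_one {k : Fin d → ℝ} {u v : PerFun d} (hu : Mem 1 (fun _ => 1) u)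
    (hu' : Mem 2 (wt k 1) u) (hv : Mem 1 (fun _ => 1) v) (hv' : Mem 2 (wt k 1) v) :
    Mem 2 (wt k 1) (u ⊡ v) := by
  have hdu : Mem 2 (fun _ => 1) (QPWaterWaves.dα k u) := by
    rw [← wt_zero k]; exact hu'.dα (by norm_num)
  have hdv : Mem 2 (fun _ => 1) (QPWaterWaves.dα k v) := by
    rw [← wt_zero k]; exact hv'.dα (by norm_num)
  have e := dα_mul k (Conv.symm fun n => hv.summable_mul hdu n) (fun n => hu.summable_mul hdv n)
  obtain ⟨x, hx⟩ := hu
  obtain ⟨y, hy⟩ := hv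
  obtain ⟨x', hx'⟩ := hdu
  obtain ⟨y', hy'⟩ := hdv
  have cu : (⇑x : PerFun d) = u := by ext j; simp [hx]
  have cv : (⇑y : PerFun d) = v := by ext j; simp [hy]
  have cu' : (⇑x' : PerFun d) = QPWaterWaves.dα k u := by ext j; simp [hx']
  have cv' : (⇑y' : PerFun d) = QPWaterWaves.dα k v := by ext j; simp [hy']
  obtain ⟨z₀, hz₀⟩ := (mem_coe (x * y)).one_two
  -- Since `|ξ| = (-i sgn ξ)(i ξ)`, the weighted coefficients of `u ⊡ v` are those of the product
  -- plus the Hilbert transform of its derivative, and Leibniz' rule makes the latter square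
  -- summable.
  have hσ : ∀ j, ‖(-Complex.I * Real.sign (freq k j) : ℂ)‖ ≤ 1 := fun j => by
    rw [norm_mul, norm_neg, Complex.norm_I, one_mul, Complex.norm_real]
    rcases Real.sign_apply_eq (freq k j) with h | h | h <;> simp [h]
  refine ⟨z₀ + diag 2 _ 1 hσ (y • x' + x • y'), fun j => ?_⟩
  have e1 : (y • x' + x • y') j = Complex.I * freq k j * (u ⊡ v) j := by
    have : (⇑(y • x' + x • y') : PerFun d) = QPWaterWaves.dα k (u ⊡ v) := by
      rw [lp.coeFn_add, coe_smul, coe_smul, cu, cv, cu', cv', e, mul_comm' (QPWaterWaves.dα k u) v]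
    exact congrFun this j
  rw [lp.coeFn_add, Pi.add_apply, diag_apply, e1, hz₀, coe_mul, cu, cv, wt_one, lam]
  have : ((|freq k j| : ℝ) : ℂ) = Real.sign (freq k j) * freq k j := by
    rw [← Complex.ofReal_mul]
    congr 1
    rcases lt_trichotomy (freq k j) 0 with h | h | h
    · rw [Real.sign_of_neg h, abs_of_neg h]; ring
    · simp [h]
    · rw [Real.sign_of_pos h, abs_of_pos h]; ring
  push_cast
  rw [this]
  linear_combination (-(Real.sign (freq k j) * freq k j * (u ⊡ v) j) : ℂ) * Complex.I_mul_I

/-! ### Size of the coefficients and of the sources of the linearized equation. -/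

namespace Background

variable {k : Fin d → ℝ} {s : ℝ} {I : Set ℝ} {α β : ℝ → ℝ} {W R : ℝ → PerFun d}

theorem supp_V (h : Background k s I α β W R) : ∀ t ∈ I, SuppNonpos k (oneSubY (W t)) :=
  fun t ht => suppNonpos_one.sub (h.hol_Y t ht).suppNonpos

theorem supp_R (h : Background k s I α β W R) : ∀ t ∈ I, SuppNonpos k (R t) :=
  fun t ht => (h.hol_R t ht).suppNonpos

theorem supp_Vbar (h : Background k s I α β W R) : ∀ t ∈ I, SuppNonneg k (bar (oneSubY (W t))) :=
  fun t ht => (h.supp_V t ht).bar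

theorem supp_dRbar (h : Background k s I α β W R) : ∀ t ∈ I, SuppNonneg k (dα k (bar (R t))) :=
  fun t ht => (h.supp_R t ht).bar.dα

theorem supp_dYbar (h : Background k s I α β W R) : ∀ t ∈ I, SuppNonneg k (dα k (bar (Y (W t)))) :=
  fun t ht => (h.hol_Y t ht).suppNonpos.bar.dα

theorem V_bar (h : Background k s I α β W R) :
    CO 1 (wt k 0) I α 1 1 (fun t => bar (oneSubY (W t))) := h.V_zero.bar (wt_neg k 0)

theorem one_zero (h : Background k s I α β W R) (θ : ℝ) :
    CO 1 (wt k θ) I α 0 1 (fun _ => (one : PerFun d)) :=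
  ⟨h.V_zero.two_le, wt_pos k θ, fun _ => 1, continuousOn_const, fun t _ => ⟨one_lift k θ, by
    simpa using norm_one_le⟩⟩

theorem Y_zero (h : Background k s I α β W R) : CO 1 (wt k 0) I α 2 1 (fun t => Y (W t)) :=
  ((h.one_zero 0).sub h.V_zero).congr fun t _ => by rw [oneSubY, sub_sub_cancel]

theorem dRbar (h : Background k s I α β W R) : CO 1 (wt k 0) I α 1 β (fun t => dα k (bar (R t))) :=
  (h.R_one.bar (wt_neg k 1)).dα (by norm_num)

theorem dRbar_neg (h : Background k s I α β W R) :
    CO 1 (wt k (-1 / 2)) I α 1 1 (fun t => dα k (bar (R t))) :=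
  (h.R_half.bar (wt_neg k _)).dα (by norm_num)

theorem dR_zero (h : Background k s I α β W R) : CO 1 (wt k 0) I α 1 β (fun t => dα k (R t)) :=
  h.R_one.dα (by norm_num)

theorem dYbar (h : Background k s I α β W R) :
    CO 1 (wt k (-1 / 2)) I α 3 β (fun t => dα k (bar (Y (W t)))) :=
  (h.Y_half.bar (wt_neg k _)).dα (by norm_num)

theorem b_one (h : Background k s I α β W R) :
    CO 1 (wt k 1) I α 3 β (fun t => b k (W t) (R t)) :=
  (((h.R_one.P_mul h.V_bar h.supp_R h.supp_Vbar (θ := 1) (by norm_num) (by norm_num)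
    (by norm_num)).add_bar).congr fun t _ => b_eq k _ _).weaken (by norm_num) (by ring)

theorem b_half (h : Background k s I α β W R) :
    CO 1 (wt k (1 / 2)) I α 3 1 (fun t => b k (W t) (R t)) :=
  (((h.R_half.P_mul h.V_bar h.supp_R h.supp_Vbar (θ := 1 / 2) (by norm_num) (by norm_num)
    (by norm_num)).add_bar).congr fun t _ => b_eq k _ _).weaken (by norm_num) (by ring)

/-- Half of the derivative in `R̄_α` is counted as a negative order and paid by `R`. No `β` appears,
as required for a coefficient of the energy itself. -/
theorem a_zero (h : Background k s I α β W R) : CO 1 (wt k 0) I α 3 1 (fun t => a k (R t)) :=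
  ((((h.R_half.P_mul h.dRbar_neg h.supp_R h.supp_dRbar (θ := 0) (by norm_num) (by norm_num)
    (by norm_num)).sub_bar).smul (c := -Complex.I) (by simp)).congr
      fun t _ => a_eq k _).weaken (by norm_num) (by ring)

/-- This bound is quadratic in `β` and serves only as qualitative regularity; it does not enter the
size of the energy's derivative. -/
theorem a_one (h : Background k s I α β W R) :
    CO 1 (wt k 1) I α 3 (β * β) (fun t => a k (R t)) :=
  ((((h.R_one.P_mul h.dRbar h.supp_R h.supp_dRbar (θ := 1) (by norm_num) (by norm_num)
    (by norm_num)).sub_bar).smul (c := -Complex.I) (by simp)).congr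
      fun t _ => a_eq k _).weaken (by norm_num) (by ring)

theorem M_zero (h : Background k s I α β W R) :
    CO 1 (wt k 0) I α 6 β (fun t => M k (W t) (R t)) := by
  have h1 := (h.R_half.P_mul h.dYbar h.supp_R h.supp_dYbar (θ := 0) (by norm_num) (by norm_num)
    (by norm_num)).weaken le_rfl (γ₁ := β) (by ring)
  have h2 := (h.Y_half.P_mul h.dRbar_neg (fun t ht => (h.hol_Y t ht).suppNonpos) h.supp_dRbar (θ := 0)
    (by norm_num) (by norm_num) (by norm_num)).weaken le_rfl (γ₁ := β) (by ring)
  exact ((h1.sub h2).add_bar.congr fun t _ => by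
    rw [M_eq, P_sub, mul_comm' (dα k (bar (R t))) (Y (W t))]).weaken (by decide) rfl

variable {N : ℝ → ℝ} {w r : ℝ → PerFun d}

/-- `r` already has half an `α`-derivative; in the other term it comes from `R`, because `w̄`
multiplies antiholomorphic factors only. Hence no `β` is needed. -/
theorem δb_half (h : Background k s I α β W R) (hw : CO 2 (wt k 0) I α 0 N w)
    (hr : CO 2 (wt k (1 / 2)) I α 0 N r) (hol_w : ∀ t ∈ I, IsHol k (w t))
    (hol_r : ∀ t ∈ I, IsHol k (r t)) :
    CO 2 (wt k (1 / 2)) I α 5 N (fun t => δb k (W t) (R t) (w t) (r t)) := by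
  have h1 := (hr.P_mul' h.V_bar (fun t ht => (hol_r t ht).suppNonpos) h.supp_Vbar (θ := 1 / 2)
    (by norm_num) (by norm_num) (by norm_num)).weaken le_rfl (γ₁ := N) (by ring)
  have h2 := (h.R_half.P_mul ((h.V_bar.mul le_rfl h.V_bar).mul le_rfl (hw.bar (wt_neg k 0))) h.supp_R
    (fun t ht => ((h.supp_Vbar t ht).mul (h.supp_Vbar t ht)).mul (hol_w t ht).suppNonpos.bar)
    (θ := 1 / 2) (by norm_num) (by norm_num) (by norm_num)).weaken le_rfl (γ₁ := N) (by ring)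
  refine ((h1.sub h2).add_bar.congr fun t ht => ?_).weaken (by decide) rfl
  have m1 : Mem 1 (fun _ => 1) (R t) := by
    rw [← wt_zero k]; exact (h.R_half.bound.mem ht).mono_wt (by norm_num)
  have m2 : Mem 2 (fun _ => 1) (bar (oneSubY (W t)) ⊡ bar (oneSubY (W t))) := by
    rw [← wt_zero k]; exact ((h.V_bar.mul le_rfl h.V_bar).bound.mem ht).one_two
  have m3 : Mem 2 (fun _ => 1) (bar (w t)) := by
    rw [← wt_zero k]; exact (hw.bar (wt_neg k 0)).bound.mem ht
  rw [δb, two_re, P_sub, mul_comm' _ (R t), m1.mul_assoc m2 m3, mul_comm' _ (r t)]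

theorem δa_aux {θ : ℝ} {γ : ℝ → ℝ}
    (h1 : CO 2 (wt k θ) I α 1 γ (fun t => P k (r t ⊡ dα k (bar (R t)))))
    (h2 : CO 2 (wt k θ) I α 1 γ (fun t => P k (R t ⊡ dα k (bar (r t))))) :
    CO 2 (wt k θ) I α 3 γ (fun t => δa k (R t) (r t)) := by
  refine (((h1.add h2).sub_bar.smul (c := -Complex.I) (by simp)).congr fun t _ => ?_).weaken
    (by decide) rfl
  rw [δa, two_im, P_add, mul_comm' _ (r t)]

theorem δa_half (h : Background k s I α β W R)
    (hr : CO 2 (wt k (1 / 2)) I α 0 N r) (hol_r : ∀ t ∈ I, IsHol k (r t)) :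
    CO 2 (wt k (1 / 2)) I α 3 (β * N) (fun t => δa k (R t) (r t)) := by
  refine δa_aux ?_ ?_
  · exact (hr.P_mul' h.dRbar (fun t ht => (hol_r t ht).suppNonpos) h.supp_dRbar (by norm_num)
      (by norm_num) (by norm_num)).weaken le_rfl (by ring)
  · exact (h.R_one.P_mul ((hr.bar (wt_neg k _)).dα (θ' := -1 / 2) (by norm_num)) h.supp_R
      (fun t ht => (hol_r t ht).suppNonpos.bar.dα) (by norm_num) (by norm_num)
      (by norm_num)).weaken le_rfl (by ring)

/-- Without a half derivative on the result no `β` is needed. In `Y ⊡ δa` this is the bound used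
when the half derivative falls on `Y`, whose norm already costs `β`. -/
theorem δa_zero (h : Background k s I α β W R)
    (hr : CO 2 (wt k (1 / 2)) I α 0 N r) (hol_r : ∀ t ∈ I, IsHol k (r t)) :
    CO 2 (wt k 0) I α 3 N (fun t => δa k (R t) (r t)) := by
  refine δa_aux ?_ ?_
  · exact (hr.P_mul' h.dRbar_neg (fun t ht => (hol_r t ht).suppNonpos) h.supp_dRbar (by norm_num)
      (by norm_num) (by norm_num)).weaken le_rfl (by ring)
  · exact (h.R_half.P_mul ((hr.bar (wt_neg k _)).dα (θ' := -1 / 2) (by norm_num)) h.supp_R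
      (fun t ht => (hol_r t ht).suppNonpos.bar.dα) (by norm_num) (by norm_num)
      (by norm_num)).weaken le_rfl (by ring)

theorem V_two (h : Background k s I α β W R) {t : ℝ} (ht : t ∈ I) :
    Mem 2 (wt k 1) (oneSubY (W t)) := by
  obtain ⟨x, hx⟩ := ((h.one_zero 1).bound.mem ht).one_two
  obtain ⟨y, hy⟩ := h.Y_two t ht
  exact ⟨x - y, fun j => by rw [lp.coeFn_sub, Pi.sub_apply, hx, hy, oneSubY, Pi.sub_apply]; ring⟩

/-- The derivatives on `w̄`, `r̄` and `Ȳ` are counted as negative orders and moved by `P` to `R`,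
`r` or `Y`. The last term needs no such cancellation, since `R̄_α` is bounded in `ℓ^1` by `β`. -/
theorem δM_zero (h : Background k s I α β W R) (hw : CO 2 (wt k 0) I α 0 N w)
    (hr : CO 2 (wt k (1 / 2)) I α 0 N r) (hol_w : ∀ t ∈ I, IsHol k (w t))
    (hol_r : ∀ t ∈ I, IsHol k (r t)) :
    CO 2 (wt k 0) I α 11 (β * N) (fun t => δM k (W t) (R t) (w t) (r t)) := by
  have hwb := hw.bar (wt_neg k 0)
  have swb : ∀ t ∈ I, SuppNonneg k (bar (w t)) := fun t ht => (hol_w t ht).suppNonpos.bar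
  have h1 := (hr.P_mul' h.dYbar (fun t ht => (hol_r t ht).suppNonpos) h.supp_dYbar (θ := 0)
    (by norm_num) (by norm_num) (by norm_num)).weaken le_rfl (γ₁ := β * N) (by ring)
  have h2 := (h.R_half.P_mul (h.V_bar.mul_anti (hwb.mul_anti' h.dYbar swb h.supp_dYbar (by norm_num)
    le_rfl) h.supp_Vbar (fun t ht => (swb t ht).mul (h.supp_dYbar t ht)) (by norm_num) le_rfl) h.supp_R
    (fun t ht => (h.supp_Vbar t ht).mul ((swb t ht).mul (h.supp_dYbar t ht))) (θ := 0)
    (by norm_num) (by norm_num) (by norm_num)).weaken le_rfl (γ₁ := β * N) (by ring)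
  have h3 := (h.R_one.P_mul ((h.V_bar.mul le_rfl h.V_bar).mul_anti (hwb.dα (θ' := -1) (by norm_num))
    (fun t ht => (h.supp_Vbar t ht).mul (h.supp_Vbar t ht)) (fun t ht => (swb t ht).dα) (by norm_num)
    le_rfl) h.supp_R
    (fun t ht => ((h.supp_Vbar t ht).mul (h.supp_Vbar t ht)).mul (swb t ht).dα) (θ := 0)
    (by norm_num) (by norm_num) (by norm_num)).weaken le_rfl (γ₁ := β * N) (by ring)
  have h4 := (h.Y_half.P_mul ((hr.bar (wt_neg k _)).dα (θ' := -1 / 2) (by norm_num))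
    (fun t ht => (h.hol_Y t ht).suppNonpos) (fun t ht => (hol_r t ht).suppNonpos.bar.dα) (θ := 0)
    (by norm_num) (by norm_num) (by norm_num)).weaken le_rfl (γ₁ := β * N) (by ring)
  have h5 := ((h.dRbar.mul le_rfl (h.V_zero.mul le_rfl h.V_zero)).mul le_rfl hw).P.weaken le_rfl
    (γ₁ := β * N) (by ring)
  refine (((((h1.sub (h2.add h2)).add h3).sub h4).sub h5).add_bar.congr fun t ht => ?_).weaken
    (by decide) rfl
  have mR : Mem 1 (wt k 1) (R t) := h.R_one.bound.mem ht
  have mR0 : Mem 1 (fun _ => 1) (R t) := by rw [← wt_zero k]; exact mR.mono_wt (by norm_num)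
  have mV : Mem 1 (fun _ => 1) (bar (oneSubY (W t))) := by
    rw [← wt_zero k]; exact h.V_bar.bound.mem ht
  have mw : Mem 2 (fun _ => 1) (bar (w t)) := by
    rw [← wt_zero k]; exact hwb.bound.mem ht
  have mY : Mem 2 (fun _ => 1) (dα k (bar (Y (W t)))) := by
    rw [← wt_zero k]; exact ((h.Y_two t ht).bar (wt_neg k 1)).dα (by norm_num)
  have mVw : Mem 2 (fun _ => 1) (bar (oneSubY (W t)) ⊡ bar (w t)) := by
    rw [← wt_zero k]; exact (h.V_bar.mul le_rfl hwb).bound.mem ht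
  have mV2 : Mem 2 (wt k 1) (bar (oneSubY (W t))) := (h.V_two ht).bar (wt_neg k 1)
  have mdw : Mem 2 (wt k (-1)) (dα k (bar (w t))) := (hwb.bound.mem ht).dα (by norm_num)
  -- The antiholomorphic factors must be grouped together before `P` can move the derivative on `Ȳ`
  -- to `R`.
  have e2 : R t ⊡ bar (oneSubY (W t)) ⊡ bar (w t) ⊡ dα k (bar (Y (W t))) =
      R t ⊡ (bar (oneSubY (W t)) ⊡ (bar (w t) ⊡ dα k (bar (Y (W t))))) := by
    rw [mR0.mul_assoc mV.one_two mw, mR0.mul_assoc mVw mY, mV.mul_assoc mw mY]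
  -- Here `w̄_α` has order `-1`, so reassociation needs a full `α`-derivative on the other two
  -- factors.
  have e3 : R t ⊡ (bar (oneSubY (W t)) ⊡ bar (oneSubY (W t))) ⊡ dα k (bar (w t)) =
      R t ⊡ (bar (oneSubY (W t)) ⊡ bar (oneSubY (W t)) ⊡ dα k (bar (w t))) :=
    mul_assoc_wt k zero_le_one mR (mV.mul_two_one mV2 mV mV2) mdw
  rw [δM, two_re]
  simp only [P_add, P_sub, two_smul, e2, e3, mul_comm' (dα k (bar (r t)))]

theorem one_add_W (h : Background k s I α β W R) :
    CO 1 (wt k 0) I α 2 1 (fun t => one + W t) := (h.one_zero 0).add h.W_zero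

/-- All terms are products of `ℓ^1` with `ℓ^2` functions except `𝐖_α δb`, where `𝐖_α` is used only
in `H^{s-1}`; the half derivative of `δb` and the lattice sum in `schur` close that estimate. -/
theorem sourceF_zero (h : Background k s I α β W R) (hw : CO 2 (wt k 0) I α 0 N w)
    (hr : CO 2 (wt k (1 / 2)) I α 0 N r) (hol_w : ∀ t ∈ I, IsHol k (w t))
    (hol_r : ∀ t ∈ I, IsHol k (r t)) :
    CO 2 (wt k 0) I α 20 (β * N) (fun t => sourceF k (W t) (R t) (w t) (r t)) := by
  obtain ⟨K, hK, hKα, hS⟩ := h.schur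
  have hb := h.δb_half hw hr hol_w hol_r
  have h1 := ((h.V_bar.mul le_rfl h.dR_zero).mul le_rfl hw).neg.weaken le_rfl (γ₁ := β * N) (by ring)
  have h2 := ((((h.V_bar.mul le_rfl h.V_bar).mul le_rfl h.one_add_W).mul le_rfl h.dR_zero).mul le_rfl
    (hw.bar (wt_neg k 0))).weaken le_rfl (γ₁ := β * N) (by ring)
  have h3 := (h.M_zero.mul le_rfl hw).weaken le_rfl (γ₁ := β * N) (by ring)
  have h4 : CO 2 (wt k 0) I α 7 (β * N) (fun t => dα k (W t) ⊡ δb k (W t) (R t) (w t) (r t)) := by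
    refine ⟨hb.two_le, wt_pos k 0, (((h.dW.bound.bmul22 hb.bound h.dW.pos hb.pos (m := wt k 0)
      (κ := fun _ _ => 1) (h := fun l n => 1 / (jap l ^ ((s - 1) / 2) * wt k (1 / 2) n))
      (fun l n => ?_) hK hS).congr fun t _ => ?_).mono fun t ht => ?_)⟩
    · have := mul_pos (h.dW.pos l) (wt_pos k (1 / 2) n)
      rw [mul_one_div_cancel this.ne', wt_zero]; simp
    · rw [mul_eq_bmul]; simp
    · have h1 := hKα t ht
      have h2 := h.dW.nonneg ht
      have h3 := hb.nonneg ht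
      have h4 := hb.two_le t ht
      rw [Pi.mul_apply]
      calc K * (α t ^ 1 * β t * (α t ^ 5 * N t)) ≤ α t * (α t ^ 1 * β t * (α t ^ 5 * N t)) := by
            gcongr
        _ = _ := by ring
  have h5 := (h.one_add_W.mul le_rfl (h.δM_zero hw hr hol_w hol_r)).weaken le_rfl (γ₁ := β * N)
    (by ring)
  exact ((((h1.add h2).add h3).sub h4).add h5).weaken (by decide) rfl

/-- In `R_α δb` the half derivative falls either on `R_α`, where the lattice sum is needed, or on
`δb`, where `R_α` is in `ℓ^1`. In the other term `1 - Y` is split, so that `1` and `Y` are treated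
separately and the bound stays linear in `β`. -/
theorem sourceG_half (h : Background k s I α β W R) (hw : CO 2 (wt k 0) I α 0 N w)
    (hr : CO 2 (wt k (1 / 2)) I α 0 N r) (hol_w : ∀ t ∈ I, IsHol k (w t))
    (hol_r : ∀ t ∈ I, IsHol k (r t)) :
    CO 2 (wt k (1 / 2)) I α 20 (β * N) (fun t => sourceG k (W t) (R t) (w t) (r t)) := by
  obtain ⟨K, hK, hKα, hS⟩ := h.schur
  have hb := h.δb_half hw hr hol_w hol_r
  have hb0 := hb.lower (θ' := 0) (by norm_num)
  have h1 : CO 2 (wt k (1 / 2)) I α 7 (β * N) (fun t => bmul (fun l n => (halfKer k l n : ℂ))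
      (dα k (R t)) (δb k (W t) (R t) (w t) (r t))) := by
    refine ⟨hb.two_le, wt_pos k _, ((h.dR.bound.bmul22 hb.bound h.dR.pos hb.pos (m := wt k (1 / 2))
      (κ := halfKer k) (h := fun l n => 1 / (jap l ^ ((s - 1) / 2) * wt k (1 / 2) n))
      (fun l n => ?_) hK hS).mono fun t ht => ?_)⟩
    · have h1 := Real.rpow_pos_of_pos (jap_pos l) ((s - 1) / 2)
      have h2 := wt_pos k (1 / 2) n
      rw [abs_of_nonneg (mul_nonneg (halfKer_nonneg k l n) (wt_pos _ _ _).le)]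
      refine (halfKer_mul_wt k l n).trans (le_of_eq ?_)
      field_simp
    · have h1 := hKα t ht
      have h2 := h.dR.nonneg ht
      have h3 := hb.nonneg ht
      have h4 := hb.two_le t ht
      rw [Pi.mul_apply]
      calc K * (α t ^ 1 * β t * (α t ^ 5 * N t)) ≤ α t * (α t ^ 1 * β t * (α t ^ 5 * N t)) := by
            gcongr
        _ = _ := by ring
  have h2 := (h.dR_zero.bmul' hb (wt_pos k (1 / 2)) (fun l n => (halfKer k n l : ℂ)) fun l n => by
    rw [Complex.norm_real, Real.norm_of_nonneg (halfKer_nonneg k n l), wt_zero, one_mul, add_comm]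
    exact halfKer_mul_wt k n l).weaken le_rfl (γ₁ := β * N) (by ring)
  have h3 := (h1.add h2).congr (v := fun t => dα k (R t) ⊡ δb k (W t) (R t) (w t) (r t)) fun t ht =>
    mul_eq_halfKer k fun n => by
      have hu1 : Mem 1 (fun _ => 1) (dα k (R t)) := by rw [← wt_zero k]; exact h.dR_zero.bound.mem ht
      have hv1 : Mem 2 (fun _ => 1) (δb k (W t) (R t) (w t) (r t)) := by
        rw [← wt_zero k]; exact hb0.bound.mem ht
      exact (hu1.summable_mul hv1 n).norm
  have ha := h.δa_half hr hol_r
  have ha0 := h.δa_zero hr hol_r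
  have h4 := h.Y_half.mul_half h.Y_zero ha ha0 (γ := β * N) rfl (by ring)
  have h5 := (ha.sub h4).congr (v := fun t => oneSubY (W t) ⊡ δa k (R t) (r t)) fun t ht => by
    have hY1 : Mem 1 (fun _ => 1) (Y (W t)) := by rw [← wt_zero k]; exact h.Y_zero.bound.mem ht
    have hO : Mem 1 (fun _ => 1) (one : PerFun d) := by
      rw [← wt_zero k]; exact (h.one_zero 0).bound.mem ht
    have hv1 : Mem 2 (fun _ => 1) (δa k (R t) (r t)) := by
      rw [← wt_zero k]; exact ha0.bound.mem ht
    rw [oneSubY, sub_mul' (fun n => hO.summable_mul hv1 n) (fun n => hY1.summable_mul hv1 n), one_mul']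
  exact (h3.neg.sub (h5.smul (c := Complex.I) (by simp))).weaken (by decide) rfl

end Background

/-! ### Derivatives of bilinear expressions -/

/-- The increment is split asymmetrically: `y` is taken at the current time in the first term, and
`x₂` is frozen in the second. So only continuity of `y` is needed, while its derivative, through
`y₂`, may live in a larger space. -/
theorem hasDerivWithinAt_bilin {E F E' F' G : Type*} [NormedAddCommGroup E] [NormedSpace ℂ E]
    [NormedAddCommGroup F] [NormedSpace ℂ F] [NormedAddCommGroup E'] [NormedSpace ℂ E']
    [NormedAddCommGroup F'] [NormedSpace ℂ F'] [NormedAddCommGroup G] [NormedSpace ℂ G]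
    (B₁ : E →L[ℂ] F →L[ℂ] G) (B₂ : E' →L[ℂ] F' →L[ℂ] G) {I : Set ℝ} {p : ℝ → G} {x : ℝ → E}
    {y : ℝ → F} {x₂ : E'} {y₂ : ℝ → F'} {t₀ : ℝ} {x' : E} {y₂' : F'}
    (hx : HasDerivWithinAt x x' I t₀) (hy : ContinuousWithinAt y I t₀)
    (hy₂ : HasDerivWithinAt y₂ y₂' I t₀)
    (h : ∀ t ∈ I, p t - p t₀ = B₁ (x t - x t₀) (y t) + B₂ x₂ (y₂ t - y₂ t₀)) :
    HasDerivWithinAt p (B₁ x' (y t₀) + B₂ x₂ y₂') I t₀ := by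
  rw [hasDerivWithinAt_iff_tendsto_slope] at hx hy₂ ⊢
  have hy' : Tendsto y (𝓝[I \ {t₀}] t₀) (𝓝 (y t₀)) := hy.tendsto.mono_left (nhdsWithin_mono _ Set.sdiff_subset)
  have h0 : Tendsto (fun t => B₁ (slope x t₀ t)) (𝓝[I \ {t₀}] t₀) (𝓝 (B₁ x')) :=
    (B₁.continuous.tendsto x').comp hx
  have h1 : Tendsto (fun t => B₁ (slope x t₀ t) (y t)) (𝓝[I \ {t₀}] t₀) (𝓝 (B₁ x' (y t₀))) :=
    (isBoundedBilinearMap_apply.continuous.tendsto (B₁ x', y t₀)).comp (h0.prodMk_nhds hy')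
  have h2 : Tendsto (fun t => B₂ x₂ (slope y₂ t₀ t)) (𝓝[I \ {t₀}] t₀) (𝓝 (B₂ x₂ y₂')) :=
    ((B₂ x₂).continuous.tendsto y₂').comp hy₂
  refine (h1.add h2).congr' ?_
  filter_upwards [self_mem_nhdsWithin] with t ht
  simp only [slope_def_module, h t ht.1, smul_add]
  rw [← Complex.coe_smul, ← Complex.coe_smul, ← Complex.coe_smul, ← Complex.coe_smul, map_smul,
    map_smul, _root_.smul_apply]

/-! ### Trilinear operators -/

/-- Translates of the bilinear operator with symbol `τ`. -/
def shiftBil (τ : (Fin d → ℤ) → (Fin d → ℤ) → ℂ) (K : ℝ) (h : ∀ l n, ‖τ l n‖ ≤ K) (p : Fin d → ℤ) :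
    Seq d 1 →L[ℂ] Seq d 1 →L[ℂ] Seq d 1 :=
  LinearMap.mkContinuous₂ (LinearMap.mk₂ ℂ (fun v x => shift 1 p (bil 1 τ K h v x))
    (fun v v' x => by rw [map_add, _root_.add_apply, map_add])
    (fun c v x => by rw [map_smul, _root_.smul_apply, map_smul])
    (fun v x x' => by rw [map_add, map_add]) (fun c v x => by rw [map_smul, map_smul])) K
    (fun v x => by
      have h1 := ((shift 1 p).le_opNorm (bil 1 τ K h v x)).trans
        (mul_le_mul_of_nonneg_right (shift_norm_le 1 p) (norm_nonneg _))
      have h2 := bil_le 1 τ K h v x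
      rw [mul_assoc]
      exact (h1.trans (one_mul _).le).trans h2)

theorem shiftBil_norm_le (τ : (Fin d → ℤ) → (Fin d → ℤ) → ℂ) (K : ℝ) (h) (p : Fin d → ℤ) :
    ‖shiftBil τ K h p‖ ≤ K :=
  LinearMap.mkContinuous₂_norm_le _ ((norm_nonneg _).trans (h 0 0)) _

theorem l1lift_le {Z : Type*} [NormedAddCommGroup Z] [NormedSpace ℂ Z] [CompleteSpace Z]
    (F : (Fin d → ℤ) → Z) (K : ℝ) (hF) (u : Seq d 1) : ‖l1lift F K hF u‖ ≤ K * ‖u‖ :=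
  ((l1lift F K hF).le_opNorm u).trans
    (mul_le_mul_of_nonneg_right (l1lift_norm_le F K hF) (norm_nonneg _))

/-- The trilinear operator on `ℓ^1` with symbol `τ`. -/
def tri (τ : (Fin d → ℤ) → (Fin d → ℤ) → (Fin d → ℤ) → ℂ) (K : ℝ) (h : ∀ p l n, ‖τ p l n‖ ≤ K) :
    Seq d 1 →L[ℂ] Seq d 1 →L[ℂ] Seq d 1 →L[ℂ] Seq d 1 :=
  l1lift (fun p => shiftBil (τ p) K (h p) p) K fun _ => shiftBil_norm_le _ _ _ _

theorem tri_le (τ : (Fin d → ℤ) → (Fin d → ℤ) → (Fin d → ℤ) → ℂ) (K : ℝ) (h) (u v x : Seq d 1) :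
    ‖tri τ K h u v x‖ ≤ K * (‖u‖ * (‖v‖ * ‖x‖)) := by
  have h0 : ‖tri τ K h u‖ ≤ K * ‖u‖ := l1lift_le _ K _ u
  calc _ ≤ ‖tri τ K h u‖ * ‖v‖ * ‖x‖ := (tri τ K h u).le_opNorm₂ v x
    _ ≤ K * ‖u‖ * ‖v‖ * ‖x‖ := by gcongr
    _ = _ := by ring

theorem tri_apply (τ : (Fin d → ℤ) → (Fin d → ℤ) → (Fin d → ℤ) → ℂ) (K : ℝ) (h) (u v x : Seq d 1)
    (n : Fin d → ℤ) : tri τ K h u v x n =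
      ∑' p, u p * ∑' l, v l * (τ p l (n - p - l) * x (n - p - l)) := by
  have hs := (l1lift_summable_norm (fun p => shiftBil (τ p) K (h p) p)
    (fun p => shiftBil_norm_le _ _ _ _) u).of_norm
  let φ : (Seq d 1 →L[ℂ] Seq d 1 →L[ℂ] Seq d 1) →L[ℂ] ℂ :=
    (lp.evalCLM ℂ (fun _ : Fin d → ℤ => ℂ) (p := 1) n).comp
      ((ContinuousLinearMap.apply ℂ (Seq d 1) x).comp
        (ContinuousLinearMap.apply ℂ (Seq d 1 →L[ℂ] Seq d 1) v))
  refine (φ.map_tsum hs).trans (tsum_congr fun p => ?_)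
  change u p * bil 1 (τ p) K (h p) v x (n - p) = _
  rw [bil_apply]

theorem CB.tri {I : Set ℝ} {u v x : ℝ → PerFun d} {β₁ β₂ β₃ : ℝ → ℝ} {m₁ m₂ m₃ : (Fin d → ℤ) → ℝ}
    (hu : CB 1 m₁ I u β₁) (hv : CB 1 m₂ I v β₂) (hx : CB 1 m₃ I x β₃) (hm₁ : ∀ j, 0 < m₁ j)
    (hm₂ : ∀ j, 0 < m₂ j) (hm₃ : ∀ j, 0 < m₃ j)
    (τ : (Fin d → ℤ) → (Fin d → ℤ) → (Fin d → ℤ) → ℂ)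
    (hτ : ∀ p l n, ‖τ p l n‖ ≤ m₁ p * m₂ l * m₃ n) :
    CB 1 (fun _ => 1) I (fun t n => ∑' p, u t p * ∑' l, v t l * (τ p l (n - p - l) * x t (n - p - l)))
      (fun t => β₁ t * (β₂ t * β₃ t)) := by
  have n1 : ∀ t ∈ I, 0 ≤ β₁ t := fun t ht => hu.nonneg ht
  have n2 : ∀ t ∈ I, 0 ≤ β₂ t := fun t ht => hv.nonneg ht
  obtain ⟨U, hU, hu⟩ := hu
  obtain ⟨V, hV, hv⟩ := hv
  obtain ⟨X, hX, hx⟩ := hx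
  have hτ' : ∀ p l n, ‖τ p l n / ((m₁ p * m₂ l * m₃ n : ℝ) : ℂ)‖ ≤ 1 := fun p l n => by
    have := mul_pos (mul_pos (hm₁ p) (hm₂ l)) (hm₃ n)
    rw [norm_div, Complex.norm_real, Real.norm_of_nonneg this.le, div_le_one this]
    exact hτ p l n
  let S := QPWaterWaves.tri (fun p l n => τ p l n / ((m₁ p * m₂ l * m₃ n : ℝ) : ℂ)) 1 hτ'
  refine ⟨fun t => S (U t) (V t) (X t), ((S.continuous.comp_continuousOn hU).clm_apply hV).clm_apply hX,
    fun t ht => ⟨fun n => ?_, ?_⟩⟩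
  · rw [tri_apply]
    simp only [Complex.ofReal_one, one_mul]
    refine tsum_congr fun p => ?_
    rw [(hu t ht).1, mul_comm (m₁ p : ℂ), mul_assoc, ← tsum_mul_left]
    congr 1
    refine tsum_congr fun l => ?_
    have e1 : (m₁ p : ℂ) ≠ 0 := by exact_mod_cast (hm₁ p).ne'
    have e2 : (m₂ l : ℂ) ≠ 0 := by exact_mod_cast (hm₂ l).ne'
    have e3 : (m₃ (n - p - l) : ℂ) ≠ 0 := by exact_mod_cast (hm₃ _).ne'
    rw [(hv t ht).1, (hx t ht).1]
    push_cast
    field_simp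
  · refine (tri_le _ _ hτ' _ _ _).trans ?_
    rw [one_mul]
    exact mul_le_mul (hu t ht).2 (mul_le_mul (hv t ht).2 (hx t ht).2 (norm_nonneg _) (n2 t ht))
      (by positivity) (n1 t ht)

/-! ### The Taylor coefficient as a quadratic form -/

/-- The kernel `min(|ξ_l|, |ξ_n|)` on frequencies `ξ_l < 0 < ξ_n`. -/
def minKer (k : Fin d → ℝ) (l n : Fin d → ℤ) : ℝ := min (max (-freq k l) 0) (max (freq k n) 0)

theorem minKer_nonneg (k : Fin d → ℝ) (l n) : 0 ≤ minKer k l n :=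
  le_min (le_max_right _ _) (le_max_right _ _)

theorem minKer_le_left (k : Fin d → ℝ) (l n) : minKer k l n ≤ lam k l :=
  (min_le_left _ _).trans (max_le ((neg_le_abs _).trans (abs_freq_le_lam k l)) (lam_pos k l).le)

theorem minKer_le_right (k : Fin d → ℝ) (l n) : minKer k l n ≤ lam k n :=
  (min_le_right _ _).trans (max_le ((le_abs_self _).trans (abs_freq_le_lam k n)) (lam_pos k n).le)

theorem minKer_symm (k : Fin d → ℝ) (l n) : minKer k (-n) (-l) = minKer k l n := by
  rw [minKer, minKer, freq_neg, freq_neg, neg_neg, min_comm]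

theorem norm_minKer (k : Fin d → ℝ) (l n) : ‖(minKer k l n : ℂ)‖ = minKer k l n := by
  rw [Complex.norm_real, Real.norm_of_nonneg (minKer_nonneg k l n)]

/-- The geometric mean of two bounds: the kernel is Lipschitz in its first frequency, and it is
nonnegative and at most `λ_n`. -/
theorem minKer_sub_le (k : Fin d → ℝ) (p l n) :
    |minKer k l n - minKer k (p + l) n| ≤ wt k (1 / 2) p * wt k (1 / 2) n := by
  refine le_of_sq_le_sq ?_ (mul_pos (wt_pos _ _ _) (wt_pos _ _ _)).le
  rw [mul_pow, wt_half_sq, wt_half_sq, sq]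
  refine mul_le_mul ?_ ?_ (abs_nonneg _) (lam_pos _ _).le
  · refine le_trans ?_ (abs_freq_le_lam k p)
    refine (abs_min_sub_min_le_max _ _ _ _).trans (max_le ?_ (by simp))
    refine (abs_max_sub_max_le_max _ _ _ _).trans (max_le ?_ (by simp))
    rw [freq_add]; ring_nf; exact le_rfl
  · have h1 := minKer_le_right k l n
    have h2 := minKer_le_right k (p + l) n
    have h3 := minKer_nonneg k l n
    have h4 := minKer_nonneg k (p + l) n
    rw [abs_le]; constructor <;> linarith

/-- The symmetric bilinear operator defining the Taylor coefficient. -/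
def minMul (k : Fin d → ℝ) (u v : PerFun d) : PerFun d := bmul (fun l n => (minKer k l n : ℂ)) u v

theorem minMul_summable {k : Fin d → ℝ} {u v : PerFun d} (hu : Mem 1 (wt k 0) u)
    (hv : Mem 1 (wt k 1) v) (n) : Summable fun l => (minKer k l (n - l) : ℂ) * u l * v (n - l) :=
  hu.summable_bmul hv (fun l n => (minKer k l n : ℂ)) n (C := 1) fun l => by
    rw [norm_minKer, one_mul, abs_of_pos (wt_pos _ _ _), abs_of_pos (wt_pos _ _ _), wt_zero, one_mul,
      wt_one]
    exact minKer_le_right k _ _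

theorem bar_minMul (k : Fin d → ℝ) (u v : PerFun d) :
    bar (minMul k u v) = minMul k (bar v) (bar u) := by
  ext n
  change star (∑' l, (minKer k l (-n - l) : ℂ) * u l * v (-n - l)) =
    ∑' l, (minKer k l (n - l) : ℂ) * star (v (-l)) * star (u (-(n - l)))
  rw [tsum_star, ← (Equiv.subRight n).tsum_eq]
  refine tsum_congr fun l => ?_
  simp only [Equiv.subRight_apply, star_mul']
  have e1 : -n - (l - n) = -l := by abel
  have e2 : -(n - l) = l - n := by abel
  rw [e1, e2, ← minKer_symm k l (n - l), e2, Complex.star_def, Complex.conj_ofReal]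
  ring

theorem minMul_summable' {k : Fin d → ℝ} {u v : PerFun d} (hu : Mem 1 (wt k 1) u)
    (hv : Mem 1 (wt k 0) v) (n) : Summable fun l => (minKer k l (n - l) : ℂ) * u l * v (n - l) :=
  hu.summable_bmul hv (fun l n => (minKer k l n : ℂ)) n (C := 1) fun l => by
    rw [norm_minKer, one_mul, abs_of_pos (wt_pos _ _ _), abs_of_pos (wt_pos _ _ _), wt_zero, mul_one,
      wt_one]
    exact minKer_le_left k _ _

theorem minMul_add_left {k : Fin d → ℝ} {u u' v : PerFun d} (hu : Mem 1 (wt k 0) u)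
    (hu' : Mem 1 (wt k 0) u') (hv : Mem 1 (wt k 1) v) :
    minMul k (u + u') v = minMul k u v + minMul k u' v := by
  ext n
  change ∑' l, (minKer k l (n - l) : ℂ) * (u l + u' l) * v (n - l) = ∑' l, _ + ∑' l, _
  rw [← (minMul_summable hu hv n).tsum_add (minMul_summable hu' hv n)]
  exact tsum_congr fun l => by ring

theorem minMul_neg_left (k : Fin d → ℝ) (u v : PerFun d) : minMul k (-u) v = -minMul k u v := by
  ext n
  change ∑' l, (minKer k l (n - l) : ℂ) * (-u l) * v (n - l) = -∑' l, _
  rw [← tsum_neg]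
  exact tsum_congr fun l => by ring

theorem dα_minMul {k : Fin d → ℝ} {u v : PerFun d} (hu : Mem 1 (wt k 1) u) (hv : Mem 1 (wt k 1) v) :
    dα k (minMul k u v) = minMul k (dα k u) v + minMul k u (dα k v) := by
  ext n
  change Complex.I * freq k n * ∑' l, _ = ∑' l, _ + ∑' l, _
  rw [← (minMul_summable (hu.dα (by norm_num)) hv n).tsum_add
    (minMul_summable' hu (hv.dα (by norm_num)) n), ← tsum_mul_left]
  refine tsum_congr fun l => ?_
  simp only [dα, freq_sub]
  push_cast
  ring

/-- If `ξ_n < 0`, only `P` contributes and the derivative sits on `R̄`; if `ξ_n > 0`, only `P̄`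
contributes and it sits on `R`. In both cases the differentiated factor has the smaller frequency in
modulus. For `ξ_n = 0` the two moduli agree and each projection contributes one half. -/
theorem a_eq_minMul {k : Fin d → ℝ} {R : PerFun d} (hol : IsHol k R) (hR : Mem 1 (wt k (1 / 2)) R) :
    a k R = minMul k R (bar R) := by
  have hRb : Mem 1 (wt k (1 / 2)) (bar R) := hR.bar (wt_neg k _)
  have c1 : Conv R (dα k (bar R)) := hR.conv (by norm_num) (hRb.dα (by norm_num))
  have c2 : Conv (dα k R) (bar R) := (hRb.conv (by norm_num) (hR.dα (by norm_num))).symm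
  have e : bar (P k (R ⊡ dα k (bar R))) = fun j => (symP (-freq k j) : ℂ) * (dα k R ⊡ bar R) j := by
    ext j
    have : (dα k R ⊡ bar R) j = bar (R ⊡ dα k (bar R)) j := by
      rw [bar_mul, dα_bar, bar_bar, mul_comm']
    rw [this]
    simp only [bar, P_apply, freq_neg, star_mul']
    rw [Complex.star_def, Complex.conj_ofReal]
  rw [a_eq, e]
  ext n
  change -Complex.I * (P k (R ⊡ dα k (bar R)) n - _ * ∑' l, _) = ∑' l, _
  rw [P_apply]
  change -Complex.I * (_ * ∑' l, _ - _ * ∑' l, _) = ∑' l, _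
  rw [← tsum_mul_left, ← tsum_mul_left, ← ((c1 n).mul_left _).tsum_sub ((c2 n).mul_left _),
    ← tsum_mul_left]
  refine tsum_congr fun l => ?_
  by_cases hl : 0 ≤ freq k l
  · simp [hol l hl, dα]
  by_cases hm : freq k (n - l) ≤ 0
  · have : bar R (n - l) = 0 := by
      simp only [bar]; rw [hol _ (by rw [freq_neg]; linarith)]; simp
    simp [this, dα]
  push Not at hl hm
  have key : symP (freq k n) * freq k (n - l) - symP (-freq k n) * freq k l = minKer k l (n - l) := by
    rw [minKer, max_eq_left (by linarith), max_eq_left hm.le]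
    have hn : freq k n = freq k l + freq k (n - l) := by rw [freq_sub]; ring
    rcases lt_trichotomy (freq k n) 0 with h | h | h
    · rw [symP_of_neg h, symP_of_pos (by linarith), min_eq_right (by linarith)]; ring
    · rw [h, neg_zero, symP_zero, min_eq_left (by linarith)]; linarith
    · rw [symP_of_pos h, symP_of_neg (by linarith), min_eq_left (by linarith)]; ring
  simp only [← key, dα]
  push_cast
  linear_combination (-(symP (freq k n) * freq k (n - l) * R l * bar R (n - l) : ℂ) +
    symP (-freq k n) * freq k l * R l * bar R (n - l)) * Complex.I_mul_I

theorem minMul_mul_left {k : Fin d → ℝ} {u v x : PerFun d} (hu : Mem 1 (wt k 0) u)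
    (hv : Mem 1 (wt k 0) v) (hx : Mem 1 (wt k 1) x) (n) :
    minMul k (u ⊡ v) x n =
      ∑' p, u p * ∑' l, v l * ((minKer k (p + l) (n - p - l) : ℂ) * x (n - p - l)) := by
  obtain ⟨U, hU⟩ := hu
  obtain ⟨V, hV⟩ := hv
  obtain ⟨X, hX⟩ := hx
  have hU' : ∀ j, u j = U j := fun j => by rw [hU, wt_zero]; simp
  have hV' : ∀ j, v j = V j := fun j => by rw [hV, wt_zero]; simp
  have hb : ∀ l, ‖(minKer k l (n - l) : ℂ) * x (n - l)‖ ≤ ‖X‖ := fun l => by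
    refine le_trans ?_ (norm_coord_le X (n - l))
    rw [hX, norm_mul, norm_mul, norm_minKer, Complex.norm_real, Real.norm_of_nonneg (wt_pos _ _ _).le,
      wt_one]
    exact mul_le_mul_of_nonneg_right (minKer_le_right k _ _) (norm_nonneg _)
  have hs1 : Summable fun q : (Fin d → ℤ) × (Fin d → ℤ) => ‖U q.1‖ * (‖V (q.2 - q.1)‖ * ‖X‖) :=
    summable_prod_mul (f := fun p => ‖U p‖) (g := fun p l => ‖V (l - p)‖ * ‖X‖)
      (fun _ => norm_nonneg _) (fun _ _ => by positivity) (l1_summable U) (C := ‖V‖ * ‖X‖) fun p => by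
        have h1 := ((Equiv.subRight p).hasSum_iff (f := fun l => ‖V l‖)).2 (l1_summable V).hasSum
        rw [← l1_norm] at h1
        exact ⟨(h1.mul_right ‖X‖).summable, (h1.mul_right ‖X‖).tsum_eq.le⟩
  have hs : Summable fun q : (Fin d → ℤ) × (Fin d → ℤ) =>
      u q.1 * (v (q.2 - q.1) * ((minKer k q.2 (n - q.2) : ℂ) * x (n - q.2))) := by
    refine Summable.of_norm_bounded hs1 fun q => ?_
    rw [norm_mul, norm_mul, hU', hV']
    have := hb q.2
    gcongr
  have e1 : minMul k (u ⊡ v) x n =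
      ∑' l, ∑' p, u p * (v (l - p) * ((minKer k l (n - l) : ℂ) * x (n - l))) := by
    change ∑' l, _ * (∑' p, u p * v (l - p)) * _ = _
    refine tsum_congr fun l => ?_
    rw [← tsum_mul_left, ← tsum_mul_right]
    exact tsum_congr fun p => by ring
  rw [e1, Summable.tsum_comm
    (f := fun p l => u p * (v (l - p) * ((minKer k l (n - l) : ℂ) * x (n - l)))) hs]
  refine tsum_congr fun p => ?_
  rw [tsum_mul_left, ← (Equiv.addLeft p).tsum_eq]
  congr 1
  refine tsum_congr fun l => ?_
  simp only [Equiv.coe_addLeft, add_sub_cancel_left, sub_sub]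

/-! ### Derivatives of products of families of square summable functions -/

/-- The inclusion of `ℓ^1` into `ℓ^2`. -/
def oneTwo : Seq d 1 →L[ℂ] Seq d 2 :=
  LinearMap.mkContinuous
    { toFun := fun x => ⟨x, (lp.memℓp x).of_exponent_ge (by norm_num)⟩
      map_add' := fun x y => by ext j; rfl
      map_smul' := fun c x => by ext j; rfl } 1 fun x => by
    have h := l2_norm_sq (⟨x, (lp.memℓp x).of_exponent_ge (by norm_num)⟩ : Seq d 2)
    rw [one_mul, l1_norm]
    refine le_of_sq_le_sq ?_ (tsum_nonneg fun j => norm_nonneg (x j))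
    refine h.trans_le ?_
    change ∑' j, ‖x j‖ ^ 2 ≤ _
    rw [sq (∑' j, ‖x j‖), ← tsum_mul_right]
    have hs := l1_summable x
    have hle : ∀ j, ‖x j‖ ^ 2 ≤ ‖x j‖ * ∑' j, ‖x j‖ := fun j => by
      rw [sq]; exact mul_le_mul_of_nonneg_left (hs.le_tsum j fun _ _ => norm_nonneg _) (norm_nonneg _)
    exact (Summable.of_nonneg_of_le (fun j => sq_nonneg _) hle (hs.mul_right _)).tsum_le_tsum hle
      (hs.mul_right _)

theorem oneTwo_apply (x : Seq d 1) (j) : oneTwo x j = x j := rfl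

theorem norm_oneTwo_le : ‖(oneTwo : Seq d 1 →L[ℂ] Seq d 2)‖ ≤ 1 :=
  LinearMap.mkContinuous_norm_le _ zero_le_one _

theorem CB.one_two {m : (Fin d → ℤ) → ℝ} {I : Set ℝ} {u : ℝ → PerFun d} {β : ℝ → ℝ}
    (hu : CB 1 m I u β) : CB 2 m I u β := by
  obtain ⟨U, hU, hu⟩ := hu
  refine ⟨fun t => oneTwo (U t), oneTwo.continuous.comp_continuousOn hU, fun t ht =>
    ⟨fun j => by rw [oneTwo_apply]; exact (hu t ht).1 j, ?_⟩⟩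
  refine (oneTwo.le_opNorm _).trans ?_
  exact (mul_le_of_le_one_left (norm_nonneg _) norm_oneTwo_le).trans (hu t ht).2

theorem pair_summable (κ : (Fin d → ℤ) → (Fin d → ℤ) → ℂ) {K : ℝ} (h : ∀ l n, ‖κ l n‖ ≤ K)
    (x y : Seq d 2) (n : Fin d → ℤ) : Summable fun l => κ l (n - l) * x l * y (n - l) := by
  refine Summable.of_norm_bounded ((l2_conv_summable x y n).1.mul_left K) fun l => ?_
  rw [mul_assoc, norm_mul, norm_mul]
  exact mul_le_mul_of_nonneg_right (h _ _) (by positivity)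

/-- The `n`-th Fourier coefficient of the bilinear operator with symbol `κ`, on `ℓ^2`. -/
def pair (κ : (Fin d → ℤ) → (Fin d → ℤ) → ℂ) (K : ℝ) (h : ∀ l n, ‖κ l n‖ ≤ K) (n : Fin d → ℤ) :
    Seq d 2 →L[ℂ] Seq d 2 →L[ℂ] ℂ :=
  LinearMap.mkContinuous₂ (LinearMap.mk₂ ℂ (fun x y => ∑' l, κ l (n - l) * x l * y (n - l))
    (fun x x' y => by
      rw [← (pair_summable κ h x y n).tsum_add (pair_summable κ h x' y n)]
      exact tsum_congr fun l => by rw [lp.coeFn_add, Pi.add_apply]; ring)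
    (fun c x y => by
      rw [smul_eq_mul, ← tsum_mul_left]
      exact tsum_congr fun l => by rw [lp.coeFn_smul, Pi.smul_apply, smul_eq_mul]; ring)
    (fun x y y' => by
      rw [← (pair_summable κ h x y n).tsum_add (pair_summable κ h x y' n)]
      exact tsum_congr fun l => by rw [lp.coeFn_add, Pi.add_apply]; ring)
    (fun c x y => by
      rw [smul_eq_mul, ← tsum_mul_left]
      exact tsum_congr fun l => by rw [lp.coeFn_smul, Pi.smul_apply, smul_eq_mul]; ring)) K
    (fun x y => by
      have hc := l2_conv_summable x y n
      have hle : ∀ l, ‖κ l (n - l) * x l * y (n - l)‖ ≤ K * (‖x l‖ * ‖y (n - l)‖) := fun l => by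
        rw [mul_assoc, norm_mul, norm_mul]
        exact mul_le_mul_of_nonneg_right (h _ _) (by positivity)
      refine (tsum_of_norm_bounded (hc.1.mul_left K).hasSum hle).trans ?_
      rw [tsum_mul_left, mul_assoc]
      exact mul_le_mul_of_nonneg_left hc.2 ((norm_nonneg _).trans (h 0 0)))

theorem pair_apply (κ : (Fin d → ℤ) → (Fin d → ℤ) → ℂ) (K : ℝ) (h) (n : Fin d → ℤ) (x y : Seq d 2) :
    pair κ K h n x y = ∑' l, κ l (n - l) * x l * y (n - l) := rfl

/-- The family `u` has the derivative `u'` at `t₀` in the space `ℓ^2` with weight `m`. -/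
def StrongDeriv (m : (Fin d → ℤ) → ℝ) (I : Set ℝ) (t₀ : ℝ) (u : ℝ → PerFun d) (u' : PerFun d) : Prop :=
  ∃ (U : ℝ → Seq d 2) (U' : Seq d 2), (∀ t ∈ I, ∀ j, U t j = (m j : ℂ) * u t j) ∧
    (∀ j, U' j = (m j : ℂ) * u' j) ∧ HasDerivWithinAt U U' I t₀

theorem CB.strongDeriv {m : (Fin d → ℤ) → ℝ} {T : ℝ} {u u' : ℝ → PerFun d} {β β' : ℝ → ℝ}
    (hu : CB 2 m (Icc 0 T) u β) (hu' : CB 2 m (Icc 0 T) u' β')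
    (h : ∀ t ∈ Icc 0 T, ∀ j, HasDerivWithinAt (fun τ => u τ j) (u' t j) (Icc 0 T) t) :
    ∀ t ∈ Icc 0 T, StrongDeriv m (Icc 0 T) t u (u' t) := by
  obtain ⟨U, -, hU⟩ := hu
  obtain ⟨U', hc, hU'⟩ := hu'
  have := hasDerivWithinAt_of_coord hc fun t ht j => by
    rw [(hU' t ht).1]
    exact ((h t ht j).const_mul (m j : ℂ)).congr (fun τ hτ => (hU τ hτ).1 j) ((hU t ht).1 j)
  exact fun t ht => ⟨U, U' t, fun τ hτ => (hU τ hτ).1, (hU' t ht).1, this t ht⟩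

theorem StrongDeriv.bar {m : (Fin d → ℤ) → ℝ} {I : Set ℝ} {t₀ : ℝ} {u : ℝ → PerFun d} {u' : PerFun d}
    (h : StrongDeriv m I t₀ u u') (hm : ∀ j, m (-j) = m j) :
    StrongDeriv m I t₀ (fun t => bar (u t)) (bar u') := by
  obtain ⟨U, U', h1, h2, h3⟩ := h
  refine ⟨fun t => CB.barSeq (U t), CB.barSeq U', fun t ht j => ?_, fun j => ?_, ?_⟩
  · rw [CB.barSeq_apply, h1 t ht, hm]; simp [QPWaterWaves.bar]
  · rw [CB.barSeq_apply, h2, hm]; simp [QPWaterWaves.bar]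
  · rw [hasDerivWithinAt_iff_tendsto_slope] at h3 ⊢
    refine ((CB.continuous_barSeq.tendsto U').comp h3).congr fun t => ?_
    ext j
    rw [Function.comp_apply, slope_def_module, slope_def_module, CB.barSeq_sub]
    change star ((t - t₀)⁻¹ • (U t - U t₀) (-j)) = (t - t₀)⁻¹ • star ((U t - U t₀) (-j))
    rw [star_smul, star_trivial]

/-- The product rule for the Fourier coefficients of a bilinear expression; the second factor may
have its derivative in a space larger than the one it is continuous in. -/
theorem hasDerivWithinAt_bmul {m₁ m₂ m₃ m₄ : (Fin d → ℤ) → ℝ} {I : Set ℝ} {u v : ℝ → PerFun d}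
    {u' v' : PerFun d} {γ : ℝ → ℝ} {t₀ : ℝ} (ht₀ : t₀ ∈ I) (hu : StrongDeriv m₁ I t₀ u u')
    (hv : CB 2 m₂ I v γ) (hu₀ : Mem 2 m₃ (u t₀)) (hv' : StrongDeriv m₄ I t₀ v v')
    (h₁ : ∀ j, 0 < m₁ j) (h₂ : ∀ j, 0 < m₂ j) (h₃ : ∀ j, 0 < m₃ j) (h₄ : ∀ j, 0 < m₄ j)
    (κ : (Fin d → ℤ) → (Fin d → ℤ) → ℂ) (n : Fin d → ℤ) {K : ℝ}
    (hκ : ∀ l, ‖κ l (n - l)‖ ≤ K * (m₁ l * m₂ (n - l)))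
    (hκ' : ∀ l, ‖κ l (n - l)‖ ≤ K * (m₃ l * m₄ (n - l))) :
    HasDerivWithinAt (fun t => bmul κ (u t) (v t) n)
      ((bmul κ u' (v t₀) + bmul κ (u t₀) v') n) I t₀ := by
  obtain ⟨U, U', hU, hU', dU⟩ := hu
  obtain ⟨V, cV, hV⟩ := hv
  obtain ⟨X, hX⟩ := hu₀
  obtain ⟨Z, Z', hZ, hZ', dZ⟩ := hv'
  have hK : 0 ≤ K := by
    have := (norm_nonneg _).trans (hκ 0)
    exact nonneg_of_mul_nonneg_left this (mul_pos (h₁ _) (h₂ _))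
  have hb : ∀ {m m' : (Fin d → ℤ) → ℝ}, (∀ j, 0 < m j) → (∀ j, 0 < m' j) →
      (∀ l, ‖κ l (n - l)‖ ≤ K * (m l * m' (n - l))) → ∀ l p,
      ‖(if l + p = n then κ l p / ((m l * m' p : ℝ) : ℂ) else 0)‖ ≤ K := fun {m m'} hm hm' h l p => by
    split_ifs with hn
    · obtain rfl : p = n - l := by rw [← hn]; abel
      have := mul_pos (hm l) (hm' (n - l))
      rw [norm_div, Complex.norm_real, Real.norm_of_nonneg this.le, div_le_iff₀ this]
      exact h l
    · simpa using hK
  have hp : ∀ {m m' : (Fin d → ℤ) → ℝ} (hm : ∀ j, 0 < m j) (hm' : ∀ j, 0 < m' j)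
      (h : ∀ l, ‖κ l (n - l)‖ ≤ K * (m l * m' (n - l))) (x y : Seq d 2) (f g : PerFun d),
      (∀ j, x j = (m j : ℂ) * f j) → (∀ j, y j = (m' j : ℂ) * g j) →
      pair _ K (hb hm hm' h) n x y = bmul κ f g n := fun {m m'} hm hm' h x y f g hx hy => by
    rw [pair_apply]
    refine tsum_congr fun l => ?_
    have e1 : (m l : ℂ) ≠ 0 := by exact_mod_cast (hm l).ne'
    have e2 : (m' (n - l) : ℂ) ≠ 0 := by exact_mod_cast (hm' (n - l)).ne'
    rw [hx, hy, if_pos (by abel)]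
    push_cast
    field_simp
  have hsub : ∀ {m : (Fin d → ℤ) → ℝ} {x y : Seq d 2} {f g : PerFun d}, (∀ j, x j = (m j : ℂ) * f j) →
      (∀ j, y j = (m j : ℂ) * g j) → ∀ j, (x - y) j = (m j : ℂ) * (f - g) j :=
    fun hx hy j => by rw [lp.coeFn_sub, Pi.sub_apply, hx, hy, Pi.sub_apply, mul_sub]
  have key := hasDerivWithinAt_bilin (pair _ K (hb h₁ h₂ hκ) n) (pair _ K (hb h₃ h₄ hκ') n)
    (p := fun t => bmul κ (u t) (v t) n) dU (cV t₀ ht₀) (x₂ := X) dZ fun t ht => by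
      have e1 := hp h₁ h₂ hκ (U t) (V t) _ _ (hU t ht) (hV t ht).1
      have e2 := hp h₁ h₂ hκ (U t₀) (V t) _ _ (hU t₀ ht₀) (hV t ht).1
      have e3 := hp h₃ h₄ hκ' X (Z t) _ _ hX (hZ t ht)
      have e4 := hp h₃ h₄ hκ' X (Z t₀) _ _ hX (hZ t₀ ht₀)
      rw [map_sub, map_sub, _root_.sub_apply, e1, e2, e3, e4]
      ring
  rwa [hp h₁ h₂ hκ U' (V t₀) _ _ hU' (hV t₀ ht₀).1, hp h₃ h₄ hκ' X Z' _ _ hX hZ'] at key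

/-! ### Transport of the Taylor coefficient -/

theorem tsum_kernel_bound {u v x : PerFun d} {k : Fin d → ℝ} (hu : Mem 1 (wt k 0) u)
    (hv : Mem 1 (wt k 0) v) (hx : Mem 1 (wt k 1) x) (τ : (Fin d → ℤ) → (Fin d → ℤ) → (Fin d → ℤ) → ℂ)
    (hτ : ∀ p l n, ‖τ p l n‖ ≤ lam k n) (n : Fin d → ℤ) :
    (∀ p, Summable fun l => v l * (τ p l (n - p - l) * x (n - p - l))) ∧
      Summable fun p => u p * ∑' l, v l * (τ p l (n - p - l) * x (n - p - l)) := by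
  obtain ⟨U, hU⟩ := hu
  obtain ⟨V, hV⟩ := hv
  obtain ⟨X, hX⟩ := hx
  have hb : ∀ p l, ‖v l * (τ p l (n - p - l) * x (n - p - l))‖ ≤ ‖V l‖ * ‖X‖ := fun p l => by
    have e : v l = V l := by rw [hV, wt_zero]; simp
    rw [norm_mul, e]
    refine mul_le_mul_of_nonneg_left (le_trans ?_ (norm_coord_le X (n - p - l))) (norm_nonneg _)
    rw [hX, norm_mul, norm_mul, Complex.norm_real, Real.norm_of_nonneg (wt_pos _ _ _).le, wt_one]
    exact mul_le_mul_of_nonneg_right (hτ _ _ _) (norm_nonneg _)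
  have hs := (l1_summable V).mul_right ‖X‖
  refine ⟨fun p => Summable.of_norm_bounded hs (hb p), ?_⟩
  refine Summable.of_norm_bounded ((l1_summable U).mul_right (∑' l, ‖V l‖ * ‖X‖)) fun p => ?_
  have e : u p = U p := by rw [hU, wt_zero]; simp
  rw [norm_mul, e]
  exact mul_le_mul_of_nonneg_left (tsum_of_norm_bounded hs.hasSum (hb p)) (norm_nonneg _)

/-- The two triple sums have kernels `minKer k l m` and `minKer k (p + l) m`; only their difference
survives in the commutator. -/
theorem mul_minMul_sub {k : Fin d → ℝ} {u v x : PerFun d} (hu : Mem 1 (wt k 0) u)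
    (hv : Mem 1 (wt k 0) v) (hx : Mem 1 (wt k 1) x) (n : Fin d → ℤ) :
    (u ⊡ minMul k v x - minMul k (u ⊡ v) x) n =
      ∑' p, u p * ∑' l, v l * (((minKer k l (n - p - l) - minKer k (p + l) (n - p - l) : ℝ) : ℂ) *
        x (n - p - l)) := by
  have h1 := tsum_kernel_bound hu hv hx (fun p l m => (minKer k l m : ℂ)) (fun p l m => by
    rw [norm_minKer]; exact minKer_le_right k _ _) n
  have h2 := tsum_kernel_bound hu hv hx (fun p l m => (minKer k (p + l) m : ℂ)) (fun p l m => by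
    rw [norm_minKer]; exact minKer_le_right k _ _) n
  rw [Pi.sub_apply, minMul_mul_left hu hv hx]
  change ∑' p, u p * ∑' l, (minKer k l (n - p - l) : ℂ) * v l * x (n - p - l) - _ = _
  have e : ∀ p, ∑' l, (minKer k l (n - p - l) : ℂ) * v l * x (n - p - l) =
      ∑' l, v l * ((minKer k l (n - p - l) : ℂ) * x (n - p - l)) := fun p =>
    tsum_congr fun l => by ring
  simp only [e]
  rw [← h1.2.tsum_sub h2.2]
  refine tsum_congr fun p => ?_
  rw [← mul_sub, ← (h1.1 p).tsum_sub (h2.1 p)]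
  congr 1
  refine tsum_congr fun l => ?_
  push_cast
  ring

/-- The source in the transport equation `a_t + b a_α = G` of the Taylor coefficient, where
`N = i (𝐖 - a) / (1 + 𝐖)`. -/
def sourceA (k : Fin d → ℝ) (b N R : PerFun d) : PerFun d :=
  (minMul k N (bar R) + (b ⊡ minMul k (dα k R) (bar R) - minMul k (b ⊡ dα k R) (bar R))) +
    bar (minMul k N (bar R) + (b ⊡ minMul k (dα k R) (bar R) - minMul k (b ⊡ dα k R) (bar R)))

/-- By Leibniz' rule and the reality of `b`, the term `b a_α` is `b` times the form in `R_α` and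
`R̄` plus its conjugate. Comparison with the form in `b R_α` and `R̄` leaves only a commutator. -/
theorem sourceA_eq {k : Fin d → ℝ} {b N R : PerFun d} (hb : Mem 1 (wt k 0) b) (hbb : bar b = b)
    (hN : Mem 1 (wt k 0) N) (hol : IsHol k R) (hR : Mem 1 (wt k 1) R) :
    minMul k (-b ⊡ dα k R + N) (bar R) + minMul k R (bar (-b ⊡ dα k R + N)) =
      -b ⊡ dα k (a k R) + sourceA k b N R := by
  have hRb : Mem 1 (wt k 1) (bar R) := hR.bar (wt_neg k 1)
  have hdR : Mem 1 (wt k 0) (dα k R) := hR.dα (by norm_num)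
  have hone : ∀ {u : PerFun d}, Mem 1 (wt k 0) u → Mem 1 (fun _ => 1) u := fun h => by
    rwa [wt_zero] at h
  have hm : ∀ {u v : PerFun d}, Mem 1 (wt k 0) u → Mem 1 (wt k 1) v → Mem 1 (wt k 0) (minMul k u v) := by
    rintro u v ⟨U, hU⟩ ⟨V, hV⟩
    have h1 := (cb_const U hU).bmul (cb_const V hV) (m := wt k 0) (wt_pos k 0) (wt_pos k 1)
      (S₁ := fun _ => True) (S₂ := fun _ => True) (by simp) (by simp)
      (fun l n => (minKer k l n : ℂ)) (K := 1) zero_le_one fun l n _ _ => by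
        rw [norm_minKer, wt_zero, abs_one, mul_one, one_mul, one_mul, wt_one]
        exact minKer_le_right k l n
    exact h1.mem rfl
  have hbR : Mem 1 (wt k 0) (b ⊡ dα k R) := by
    obtain ⟨x, hx⟩ := hb
    obtain ⟨y, hy⟩ := hdR
    exact ((cb_const x hx).mul_wt le_rfl (cb_const y hy)).mem rfl
  have e0 : minMul k (-b ⊡ dα k R + N) (bar R) =
      -minMul k (b ⊡ dα k R) (bar R) + minMul k N (bar R) := by
    have hn : Mem 1 (wt k 0) (-(b ⊡ dα k R)) := by
      obtain ⟨x, hx⟩ := hbR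
      exact ⟨-x, fun j => by rw [lp.coeFn_neg, Pi.neg_apply, hx, Pi.neg_apply, mul_neg]⟩
    rw [neg_mul', minMul_add_left hn hN hRb, minMul_neg_left]
  have e1 : minMul k R (bar (-b ⊡ dα k R + N)) =
      bar (-minMul k (b ⊡ dα k R) (bar R) + minMul k N (bar R)) := by
    rw [← e0, bar_minMul, bar_bar]
  have e2 : b ⊡ dα k (a k R) = b ⊡ minMul k (dα k R) (bar R) +
      bar (b ⊡ minMul k (dα k R) (bar R)) := by
    have h1 : minMul k R (dα k (bar R)) = bar (minMul k (dα k R) (bar R)) := by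
      rw [bar_minMul, bar_bar, dα_bar]
    have h2 := hm hdR hRb
    rw [a_eq_minMul hol (hR.mono_wt (by norm_num)), dα_minMul hR hRb, h1, mul_add', bar_mul, hbb]
    · exact fun n => (hone hb).summable_mul (hone h2) n
    · exact fun n => (hone hb).summable_mul (hone (h2.bar (wt_neg k 0))) n
  rw [e0, e1, neg_mul', e2, sourceA]
  simp only [bar_add, bar_sub, bar_neg]
  abel

namespace Background

variable {k : Fin d → ℝ} {s : ℝ} {I : Set ℝ} {α β : ℝ → ℝ} {W R : ℝ → PerFun d}

theorem force_zero (h : Background k s I α β W R) : CO 1 (wt k 0) I α 5 1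
    (fun t => Complex.I • ((W t - a k (R t)) ⊡ oneSubY (W t))) :=
  (((h.W_zero.sub h.a_zero).mul le_rfl h.V_zero).smul (c := Complex.I) (by simp)).weaken (by decide)
    (by ring)

/-- The commutator needs half a derivative on `b` and on `R̄`, both controlled by `α`, and none on
`R_α`, whose `ℓ^1` norm costs `β`. In the remaining term the full derivative is put on `R̄`. Hence a
single factor `β`. -/
theorem sourceA_zero (h : Background k s I α β W R) : CO 1 (wt k 0) I α 8 β
    (fun t => sourceA k (b k (W t) (R t))
      (Complex.I • ((W t - a k (R t)) ⊡ oneSubY (W t))) (R t)) := by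
  have h1 := (h.force_zero.bmul' (h.R_one.bar (wt_neg k 1)) (wt_pos k 0)
    (fun l n => (minKer k l n : ℂ)) fun l n => by
      rw [norm_minKer, wt_zero, mul_one, one_mul, wt_one]
      exact minKer_le_right k l n).weaken le_rfl (γ₁ := β) (by ring)
  have h2 : CO 1 (wt k 0) I α 5 β (fun t => b k (W t) (R t) ⊡ minMul k (dα k (R t)) (bar (R t)) -
      minMul k (b k (W t) (R t) ⊡ dα k (R t)) (bar (R t))) := by
    refine ⟨h.R_one.two_le, wt_pos k 0, ?_⟩
    have h3 := h.b_half.bound.tri h.dR_zero.bound (h.R_half.bar (wt_neg k _)).bound (wt_pos k _)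
      (wt_pos k _) (wt_pos k _) (fun p l n => ((minKer k l n - minKer k (p + l) n : ℝ) : ℂ))
      fun p l n => by
        rw [Complex.norm_real, wt_zero, mul_one]
        exact minKer_sub_le k p l n
    rw [wt_zero]
    refine (h3.congr fun t ht => ?_).mono fun t _ => le_of_eq ?_
    · ext n
      rw [mul_minMul_sub (h.b_half.lower (by norm_num) |>.bound.mem ht) (h.dR_zero.bound.mem ht)
        ((h.R_one.bar (wt_neg k 1)).bound.mem ht)]
    · simp only [Pi.one_apply]; ring
  exact ((h1.add h2).add_bar).weaken (by decide) rfl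

end Background

/-- `R` is differentiable in order `0` and continuous in order `1`. The kernel is bounded by `λ` at
either frequency, so the derivative can always be put on the undifferentiated factor. -/
theorem hasDerivWithinAt_a {k : Fin d → ℝ} {s T : ℝ} {α β : ℝ → ℝ} {W R : ℝ → PerFun d}
    (h : Background k s (Icc 0 T) α β W R) (hs : IsSolution k s T W R) :
    ∀ t ∈ Icc 0 T, ∀ n, HasDerivWithinAt (fun τ => a k (R τ) n)
      ((-(b k (W t) (R t)) ⊡ dα k (a k (R t)) + sourceA k (b k (W t) (R t))
        (Complex.I • ((W t - a k (R t)) ⊡ oneSubY (W t))) (R t)) n) (Icc 0 T) t := by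
  have hR' := (((h.b_half.lower (θ' := 0) (by norm_num)).neg.mul le_rfl h.dR_zero).bound.add
    h.force_zero.bound).one_two
  have hd := (h.R_one.lower (θ' := 0) (by norm_num)).bound.one_two.strongDeriv hR' hs.eq_R
  have hRb := (h.R_one.bar (wt_neg k 1)).bound.one_two
  have e : ∀ t ∈ Icc 0 T, a k (R t) = minMul k (R t) (bar (R t)) := fun t ht =>
    a_eq_minMul (h.hol_R t ht) ((h.R_one.bound.mem ht).mono_wt (by norm_num))
  intro t ht n
  have key := hasDerivWithinAt_bmul ht (hd t ht) hRb (h.R_one.bound.mem ht).one_two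
    ((hd t ht).bar (wt_neg k 0)) (wt_pos k 0) (wt_pos k 1) (wt_pos k 1) (wt_pos k 0)
    (fun l n => (minKer k l n : ℂ)) n (K := 1)
    (fun l => by
      rw [norm_minKer, wt_zero, one_mul, one_mul, wt_one]; exact minKer_le_right k _ _)
    (fun l => by
      rw [norm_minKer, wt_zero, mul_one, one_mul, wt_one]; exact minKer_le_left k _ _)
  refine HasDerivWithinAt.congr_deriv (key.congr (fun τ hτ => congrFun (e τ hτ) n) (congrFun (e t ht) n)) ?_
  exact congrFun (sourceA_eq ((h.b_half.lower (by norm_num)).bound.mem ht) (bar_b k _ _)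
    (h.force_zero.bound.mem ht) (h.hol_R t ht) (h.R_one.bound.mem ht)) n

/-! ### The equation for the diagonal variable -/

theorem summable_triple_wt (k : Fin d → ℝ) {θ : ℝ} (hθ : 0 ≤ θ) {u v x : PerFun d}
    (hu : Mem 1 (wt k θ) u) (hv : Mem 2 (wt k θ) v) (hx : Mem 2 (wt k (-θ)) x) (n : Fin d → ℤ) :
    Summable fun q : (Fin d → ℤ) × (Fin d → ℤ) => u q.1 * (v q.2 * x (n - q.1 - q.2)) := by
  obtain ⟨U, hU⟩ := hu
  obtain ⟨V, hV⟩ := hv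
  obtain ⟨X, hX⟩ := hx
  refine Summable.of_norm_bounded ((summable_triple_aux U V X n).mul_left (wt k θ n)) fun q => ?_
  obtain ⟨l, m⟩ := q
  simp only [hU, hV, hX, norm_mul, Complex.norm_real, Real.norm_eq_abs, abs_of_pos (wt_pos k _ _)]
  set r := n - l - m
  have h1 : wt k θ r ≤ wt k θ n * (wt k θ l * wt k θ m) := by
    have e : r = n + (-l + -m) := by simp [r]; abel
    rw [e]
    refine (wt_mul k hθ _ _).trans (mul_le_mul_of_nonneg_left ?_ (wt_pos k θ n).le)
    simpa using wt_mul k hθ (-l) (-m)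
  have h2 : wt k θ r * wt k (-θ) r = 1 := by rw [← wt_add]; simp [wt]
  calc ‖u l‖ * (‖v m‖ * ‖x r‖) = (wt k θ r * wt k (-θ) r) * (‖u l‖ * (‖v m‖ * ‖x r‖)) := by
        rw [h2, one_mul]
    _ ≤ ((wt k θ n * (wt k θ l * wt k θ m)) * wt k (-θ) r) * (‖u l‖ * (‖v m‖ * ‖x r‖)) := by
        have := (wt_pos k (-θ) r).le
        gcongr
    _ = _ := by ring

theorem mul_assoc_wt_neg (k : Fin d → ℝ) {θ : ℝ} (hθ : 0 ≤ θ) {u v x : PerFun d}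
    (hu : Mem 1 (wt k θ) u) (hv : Mem 2 (wt k (-θ)) v) (hx : Mem 2 (wt k θ) x) :
    u ⊡ v ⊡ x = u ⊡ (v ⊡ x) := by
  refine mul_assoc' fun n => ?_
  let e : (Fin d → ℤ) × (Fin d → ℤ) ≃ (Fin d → ℤ) × (Fin d → ℤ) :=
    { toFun := fun q => (q.1, n - q.1 - q.2)
      invFun := fun q => (q.1, n - q.1 - q.2)
      left_inv := fun q => by simp
      right_inv := fun q => by simp }
  refine (e.summable_iff.2 (summable_triple_wt k hθ hu hx hv n)).congr fun q => ?_
  simp only [Function.comp_apply, e, Equiv.coe_fn_mk, sub_sub_cancel]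
  ring

theorem coe_oneTwo (u : Seq d 1) : (⇑(oneTwo u) : PerFun d) = ⇑u := funext fun j => oneTwo_apply u j

theorem oneTwo_mul (u v : Seq d 1) : oneTwo (u * v) = u • oneTwo v := by
  ext j
  have h1 := congrFun (coe_smul u (oneTwo v)) j
  have h2 := congrFun (coe_mul u v) j
  rw [coe_oneTwo] at h1
  rw [oneTwo_apply, h1, h2]

/-- The zeroth order coefficient `(1 - Ȳ) R_α - M` in the equation for `1 / (1 + 𝐖)`. -/
def coefS (k : Fin d → ℝ) (W R : PerFun d) : PerFun d := bar (oneSubY W) ⊡ dα k R - M k W R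

namespace Background

variable {k : Fin d → ℝ} {s : ℝ} {I : Set ℝ} {α β : ℝ → ℝ} {W R : ℝ → PerFun d}

theorem coefS_zero (h : Background k s I α β W R) :
    CO 1 (wt k 0) I α 7 β (fun t => coefS k (W t) (R t)) :=
  (((h.V_bar.mul le_rfl h.dR_zero).weaken le_rfl (by ring)).sub h.M_zero).weaken (by decide) rfl

theorem dW_zero (h : Background k s I α β W R) : CO 2 (wt k 0) I α 1 β (fun t => dα k (W t)) :=
  h.W_two.dα (by norm_num)

theorem dV_eq (h : Background k s I α β W R) {t : ℝ} (ht : t ∈ I) :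
    dα k (oneSubY (W t)) = -(oneSubY (W t) ⊡ oneSubY (W t)) ⊡ dα k (W t) := by
  have mO : Mem 1 (fun _ => 1) (one + W t) := by rw [← wt_zero k]; exact h.one_add_W.bound.mem ht
  have mV : Mem 1 (fun _ => 1) (oneSubY (W t)) := by rw [← wt_zero k]; exact h.V_zero.bound.mem ht
  have mdW : Mem 2 (fun _ => 1) (dα k (W t)) := by rw [← wt_zero k]; exact h.dW_zero.bound.mem ht
  have mdV : Mem 2 (fun _ => 1) (dα k (oneSubY (W t))) := by
    rw [← wt_zero k]; exact (h.V_two ht).dα (by norm_num)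
  have e1 : dα k (one + W t) = dα k (W t) := by rw [dα_add, dα_one, zero_add]
  have e := dα_mul k (u := one + W t) (v := oneSubY (W t))
    (by rw [e1]; exact Conv.symm fun n => mV.summable_mul mdW n) (fun n => mO.summable_mul mdV n)
  rw [h.inv t ht, dα_one, e1] at e
  obtain ⟨o, ho⟩ := mO
  obtain ⟨v, hv⟩ := mV
  obtain ⟨x, hx⟩ := mdW
  obtain ⟨y, hy⟩ := mdV
  have co : (⇑o : PerFun d) = one + W t := by ext j; simp [ho]
  have cv : (⇑v : PerFun d) = oneSubY (W t) := by ext j; simp [hv]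
  have cx : (⇑x : PerFun d) = dα k (W t) := by ext j; simp [hx]
  have cy : (⇑y : PerFun d) = dα k (oneSubY (W t)) := by ext j; simp [hy]
  have e3 : o * v = 1 := by
    refine lp.ext ?_
    change (⇑(o * v) : PerFun d) = ⇑(1 : Seq d 1)
    rw [coe_mul, co, cv, h.inv t ht, coe_one]
  have e4 : v • x + o • y = 0 := by
    refine lp.ext ?_
    change (⇑(v • x + o • y) : PerFun d) = 0
    rw [lp.coeFn_add, coe_smul, coe_smul, co, cv, cx, cy, mul_comm' _ (dα k (W t))]
    exact e.symm
  have e5 : y = -((v * v) • x) := by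
    linear_combination (norm := module) v • e4 - e3 • y
  rw [← cy, e5, lp.coeFn_neg, coe_smul, coe_mul, cv, cx, neg_mul']

end Background

/-- `V = 1 - Y` satisfies `V_t = -V² 𝐖_t`. The relations `(1 + 𝐖) V = 1` and `V_α = -V² 𝐖_α` turn
this into a transport equation with zeroth order coefficient `coefS`. -/
theorem strongDeriv_V {k : Fin d → ℝ} {s T : ℝ} {α β : ℝ → ℝ} {W R : ℝ → PerFun d}
    (h : Background k s (Icc 0 T) α β W R) (hs : IsSolution k s T W R) {t : ℝ} (ht : t ∈ Icc 0 T) :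
    StrongDeriv (wt k 0) (Icc 0 T) t (fun τ => oneSubY (W τ))
      (-(b k (W t) (R t)) ⊡ dα k (oneSubY (W t)) + oneSubY (W t) ⊡ coefS k (W t) (R t)) := by
  have hb := h.b_half.lower (θ' := 0) (by norm_num)
  have h1 := (hb.neg.mul le_rfl h.dW_zero).bound
  have h2 := ((h.one_add_W.mul le_rfl h.V_bar).mul le_rfl h.dR_zero).bound.one_two
  have h3 := (h.one_add_W.mul le_rfl h.M_zero).bound.one_two
  obtain ⟨U, U', hU, hU', dU⟩ :=
    h.W_zero.bound.one_two.strongDeriv ((h1.sub h2).add h3) hs.eq_W t ht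
  obtain ⟨o, -, ho⟩ := h.one_add_W.bound
  obtain ⟨v, vc, hv⟩ := h.V_zero.bound
  have co : ∀ τ ∈ Icc 0 T, (⇑(o τ) : PerFun d) = one + W τ := fun τ hτ => by
    ext j; rw [(ho τ hτ).1, wt_zero]; simp
  have cv : ∀ τ ∈ Icc 0 T, (⇑(v τ) : PerFun d) = oneSubY (W τ) := fun τ hτ => by
    ext j; rw [(hv τ hτ).1, wt_zero]; simp
  have cU : ∀ τ ∈ Icc 0 T, (⇑(U τ) : PerFun d) = W τ := fun τ hτ => by
    ext j; rw [hU τ hτ, wt_zero]; simp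
  have e3 : ∀ τ ∈ Icc 0 T, o τ * v τ = 1 := fun τ hτ => by
    refine lp.ext ?_
    change (⇑(o τ * v τ) : PerFun d) = ⇑(1 : Seq d 1)
    rw [coe_mul, co τ hτ, cv τ hτ, h.inv τ hτ, coe_one]
  -- The difference of inverses at times `τ` and `t` is `-v τ v t` times the increment of `𝐖`, which
  -- is differentiable in `ℓ^2`, while `v` is continuous in `ℓ^1`. The second bilinear map is not
  -- needed and is zero.
  have key := hasDerivWithinAt_bilin (convCLM 2).flip (0 : ℂ →L[ℂ] ℂ →L[ℂ] Seq d 2)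
    (p := fun τ => oneTwo (v τ)) (y := fun τ => -(v τ * v t)) (x₂ := 0) (y₂ := fun _ => 0) (y₂' := 0)
    dU ((vc t ht).mul continuousWithinAt_const).neg (hasDerivWithinAt_const _ _ _) fun τ hτ => by
      have e5 : oneTwo (o τ) - oneTwo (o t) = U τ - U t := by
        ext j
        rw [lp.coeFn_sub, lp.coeFn_sub, Pi.sub_apply, Pi.sub_apply, oneTwo_apply, oneTwo_apply,
          co τ hτ, co t ht, cU τ hτ, cU t ht]
        simp
      rw [_root_.zero_apply, _root_.zero_apply, add_zero, ContinuousLinearMap.flip_apply, ← smul_def,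
        ← e5, ← map_sub, ← map_sub, ← oneTwo_mul]
      congr 1
      linear_combination v t * e3 τ hτ - v τ * e3 t ht
  rw [_root_.zero_apply, _root_.zero_apply, add_zero, ContinuousLinearMap.flip_apply, ← smul_def] at key
  refine ⟨fun τ => oneTwo (v τ), _, fun τ hτ j => by
    rw [oneTwo_apply]; exact (hv τ hτ).1 j, fun j => ?_, key⟩
  obtain ⟨x, hx⟩ := h.dW_zero.bound.mem ht
  obtain ⟨bb, hbb⟩ := hb.bound.mem ht
  obtain ⟨vb, hvb⟩ := h.V_bar.bound.mem ht
  obtain ⟨ρ, hρ⟩ := h.dR_zero.bound.mem ht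
  obtain ⟨m, hm⟩ := h.M_zero.bound.mem ht
  have cx : (⇑x : PerFun d) = dα k (W t) := by ext j; rw [hx, wt_zero]; simp
  have cb : (⇑bb : PerFun d) = b k (W t) (R t) := by ext j; rw [hbb, wt_zero]; simp
  have cvb : (⇑vb : PerFun d) = bar (oneSubY (W t)) := by ext j; rw [hvb, wt_zero]; simp
  have cρ : (⇑ρ : PerFun d) = dα k (R t) := by ext j; rw [hρ, wt_zero]; simp
  have cm : (⇑m : PerFun d) = M k (W t) (R t) := by ext j; rw [hm, wt_zero]; simp
  have eU : U' = -(bb • x) - (o t * vb * ρ) • oneTwo 1 + (o t * m) • oneTwo 1 := by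
    refine lp.ext ?_
    change (⇑U' : PerFun d) =
      ⇑(-(bb • x) - (o t * vb * ρ) • oneTwo 1 + (o t * m) • oneTwo 1 : Seq d 2)
    rw [← oneTwo_mul, ← oneTwo_mul, mul_one, mul_one, lp.coeFn_add, lp.coeFn_sub, lp.coeFn_neg,
      coe_smul, coe_oneTwo, coe_oneTwo, coe_mul, coe_mul, coe_mul, co t ht, cx, cb, cvb, cρ, cm, ← neg_mul']
    ext j
    rw [hU', wt_zero]; simp
  have e6 : -(v t * v t) • U' = -(bb • (-((v t * v t) • x))) + oneTwo (v t * (vb * ρ - m)) := by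
    rw [eU, ← mul_one (v t * (vb * ρ - m)), oneTwo_mul]
    linear_combination (norm := module) (v t * (vb * ρ - m)) • (e3 t ht • oneTwo 1)
  rw [e6, h.dV_eq ht, wt_zero, Complex.ofReal_one, one_mul]
  change (⇑(-(bb • (-((v t * v t) • x))) + oneTwo (v t * (vb * ρ - m)) : Seq d 2) : PerFun d) j = _
  rw [lp.coeFn_add, lp.coeFn_neg, coe_smul, lp.coeFn_neg, coe_smul, coe_oneTwo, coe_mul, coe_mul, lp.coeFn_sub,
    coe_mul, cb, cv t ht, cx, cvb, cρ, cm, coefS, neg_mul', neg_mul']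

theorem wt_neg_le (k : Fin d → ℝ) {θ : ℝ} (h : 0 ≤ θ) (l n : Fin d → ℤ) :
    wt k (-θ) (l + n) ≤ wt k θ l * wt k (-θ) n := by
  have h1 : wt k θ n ≤ wt k θ l * wt k θ (l + n) := by
    simpa using wt_mul k h (-l) (l + n)
  have e : ∀ j, wt k (-θ) j * wt k θ j = 1 := fun j => by rw [← wt_add]; simp [wt]
  have p1 := wt_pos k (-θ) n
  have p2 := wt_pos k (-θ) (l + n)
  calc wt k (-θ) (l + n) = wt k (-θ) (l + n) * (wt k (-θ) n * wt k θ n) := by rw [e, mul_one]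
    _ ≤ wt k (-θ) (l + n) * (wt k (-θ) n * (wt k θ l * wt k θ (l + n))) := by gcongr
    _ = wt k θ l * wt k (-θ) n * (wt k (-θ) (l + n) * wt k θ (l + n)) := by ring
    _ = _ := by rw [e, mul_one]

section CB
variable {p : ENNReal} [Fact (1 ≤ p)] [Fact (p ≠ ⊤)] {k : Fin d → ℝ} {θ θ' : ℝ} {I : Set ℝ}
  {u v : ℝ → PerFun d} {β γ : ℝ → ℝ}

theorem CB.mul_wt_neg (hθ : 0 ≤ θ) (hu : CB 1 (wt k θ) I u β) (hv : CB p (wt k (-θ)) I v γ) :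
    CB p (wt k (-θ)) I (fun t => u t ⊡ v t) (fun t => β t * γ t) :=
  ((hu.bmul hv (m := wt k (-θ)) (wt_pos k θ) (wt_pos k _) (S₁ := fun _ => True) (S₂ := fun _ => True)
    (by simp) (by simp) (fun _ _ => 1) (K := 1) zero_le_one fun l n _ _ => by
      rw [norm_one, one_mul, one_mul, abs_of_pos (wt_pos _ _ _)]; exact wt_neg_le k hθ l n).congr
    fun t _ => mul_eq_bmul _ _).mono fun t _ => (one_mul _).le

theorem CB.lower (hu : CB p (wt k θ) I u β) (h : θ' ≤ θ) : CB p (wt k θ') I u β :=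
  (hu.weight (K := 1) (wt_pos k θ) fun j => by
    rw [abs_of_pos (wt_pos k θ' j), one_mul]; exact wt_mono k h j).mono fun _ _ => (one_mul _).le

theorem CB.dα (hu : CB p (wt k θ) I u β) (h : θ' + 1 ≤ θ) :
    CB p (wt k θ') I (fun t => QPWaterWaves.dα k (u t)) β :=
  (hu.mult (m' := wt k θ') (fun j => Complex.I * (freq k j : ℂ)) (K := 1) (wt_pos k θ) fun j => by
    rw [norm_mul, Complex.norm_I, one_mul, Complex.norm_real, Real.norm_eq_abs, one_mul,
      abs_of_pos (wt_pos _ _ _)]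
    calc |freq k j| * wt k θ' j ≤ wt k 1 j * wt k θ' j := by
          rw [wt_one]
          exact mul_le_mul_of_nonneg_right (abs_freq_le_lam k j) (wt_pos _ _ _).le
      _ = wt k (θ' + 1) j := by rw [mul_comm, wt_add]
      _ ≤ _ := wt_mono k h j).mono fun _ _ => (one_mul _).le

end CB

/-- Products of two square summable sequences are bounded, hence can be multiplied with absolutely
summable ones. -/
theorem conv_mul_two {u v x : PerFun d} (hu : Mem 1 (fun _ => 1) u) (hv : Mem 2 (fun _ => 1) v)
    (hx : Mem 2 (fun _ => 1) x) : Conv u (v ⊡ x) := fun n => by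
  obtain ⟨U, hU⟩ := hu
  obtain ⟨V, hV⟩ := hv
  obtain ⟨X, hX⟩ := hx
  refine Summable.of_norm_bounded ((l1_summable U).mul_right (‖V‖ * ‖X‖)) fun l => ?_
  have e : u l = U l := by simp [hU]
  rw [norm_mul, e]
  refine mul_le_mul_of_nonneg_left ?_ (norm_nonneg _)
  have h1 := l2_conv_summable V X (n - l)
  refine (tsum_of_norm_bounded h1.1.hasSum fun m => ?_).trans h1.2
  rw [norm_mul, hV, hX]; simp

namespace Background

variable {k : Fin d → ℝ} {s : ℝ} {I : Set ℝ} {α β : ℝ → ℝ} {W R : ℝ → PerFun d}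

theorem V_half (h : Background k s I α β W R) :
    ∃ γ, CB 1 (wt k (1 / 2)) I (fun t => oneSubY (W t)) γ :=
  ⟨_, (h.one_zero (1 / 2)).bound.sub h.Y_half.bound⟩

theorem O_half (h : Background k s I α β W R) :
    ∃ γ, CB 1 (wt k (1 / 2)) I (fun t => one + W t) γ :=
  ⟨_, (h.one_zero (1 / 2)).bound.add h.W_half.bound⟩

/-- Algebra behind the equation for `w / (1 + 𝐖)`. -/
theorem hat_algebra (h : Background k s I α β W R) {t : ℝ} (ht : t ∈ I) {w r f : PerFun d}
    (hw : Mem 2 (wt k 0) w) (hr : Mem 2 (wt k (1 / 2)) r) (hf : Mem 2 (wt k 0) f) :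
    (-(b k (W t) (R t)) ⊡ dα k (oneSubY (W t)) + oneSubY (W t) ⊡ coefS k (W t) (R t)) ⊡ w +
      oneSubY (W t) ⊡ (-(b k (W t) (R t)) ⊡ dα k w
        - bar (oneSubY (W t)) ⊡ (one + W t) ⊡ dα k r + f) =
      -(b k (W t) (R t)) ⊡ dα k (oneSubY (W t) ⊡ w) - bar (oneSubY (W t)) ⊡ dα k r +
        (coefS k (W t) (R t) ⊡ (oneSubY (W t) ⊡ w) + oneSubY (W t) ⊡ f) := by
  have mb : Mem 1 (wt k 1) (b k (W t) (R t)) := h.b_one.bound.mem ht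
  have mS : Mem 1 (wt k 0) (coefS k (W t) (R t)) := h.coefS_zero.bound.mem ht
  obtain ⟨γ, hV⟩ := h.V_half
  obtain ⟨γ', hO⟩ := h.O_half
  have mV : Mem 1 (wt k (1 / 2)) (oneSubY (W t)) := hV.mem ht
  have mVb : Mem 1 (wt k (1 / 2)) (bar (oneSubY (W t))) := mV.bar (wt_neg k _)
  have mVO : Mem 1 (wt k (1 / 2)) (bar (oneSubY (W t)) ⊡ (one + W t)) :=
    ((hV.bar (wt_neg k _)).mul_wt (by norm_num) hO).mem ht
  have mV2 : Mem 2 (wt k 1) (oneSubY (W t)) := h.V_two ht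
  have one_of : ∀ {p : ENNReal} [Fact (1 ≤ p)] [Fact (p ≠ ⊤)] {θ : ℝ} {u : PerFun d}, 0 ≤ θ →
      Mem p (wt k θ) u → Mem p (fun _ => 1) u := fun hθ hu => by
    rw [← wt_zero k]; exact hu.mono_wt hθ
  have mdV : Mem 2 (wt k 0) (dα k (oneSubY (W t))) := mV2.dα (by norm_num)
  have mdw : Mem 2 (wt k (-1)) (dα k w) := hw.dα (by norm_num)
  have mdr : Mem 2 (wt k (-(1 / 2))) (dα k r) := hr.dα (by norm_num)
  have conv12 : ∀ {u v : PerFun d}, Mem 1 (fun _ => 1) u → Mem 2 (fun _ => 1) v → Conv u v :=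
    fun hu hv n => hu.summable_mul hv n
  -- the products of `ℓ^1` and `ℓ^2` functions
  have hbw : Mem 2 (wt k (-1)) (b k (W t) (R t) ⊡ dα k w) := by
    obtain ⟨x, hx⟩ := mb
    obtain ⟨y, hy⟩ := mdw
    exact ((cb_const x hx).mul_wt_neg zero_le_one (cb_const y hy)).mem rfl
  have hVr : Mem 2 (wt k (-(1 / 2))) (bar (oneSubY (W t)) ⊡ (one + W t) ⊡ dα k r) := by
    obtain ⟨x, hx⟩ := mVO
    obtain ⟨y, hy⟩ := mdr
    exact ((cb_const x hx).mul_wt_neg (by norm_num) (cb_const y hy)).mem rfl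
  have hSV : oneSubY (W t) ⊡ coefS k (W t) (R t) ⊡ w = coefS k (W t) (R t) ⊡ (oneSubY (W t) ⊡ w) := by
    rw [mul_comm' (oneSubY (W t)), (one_of le_rfl mS).mul_assoc (one_of (by norm_num) mV2)
      (one_of le_rfl hw)]
  have h1 : b k (W t) (R t) ⊡ dα k (oneSubY (W t)) ⊡ w =
      b k (W t) (R t) ⊡ (dα k (oneSubY (W t)) ⊡ w) :=
    (one_of zero_le_one mb).mul_assoc (one_of le_rfl mdV) (one_of le_rfl hw)
  have h2 : oneSubY (W t) ⊡ (b k (W t) (R t) ⊡ dα k w) =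
      b k (W t) (R t) ⊡ (oneSubY (W t) ⊡ dα k w) := by
    rw [mul_comm' (oneSubY (W t)), mul_assoc_wt_neg k zero_le_one mb mdw mV2,
      mul_comm' (dα k w)]
  have c1 : Conv (dα k (oneSubY (W t))) w := (one_of le_rfl mdV).conv22 (one_of le_rfl hw)
  -- The zero frequency fibre of the absolutely convergent triple sum whose first factor is the
  -- constant `1`.
  have conv_neg : ∀ {θ : ℝ} {u v : PerFun d}, Mem 2 (wt k θ) u → Mem 2 (wt k (-θ)) v → 0 ≤ θ →
      Conv u v := fun {θ u v} hu hv hθ => by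
    intro n
    have hO : Mem 1 (wt k θ) (one : PerFun d) := ⟨1, one_lift k θ⟩
    have := (summable_triple_wt k hθ hO hu hv n).prod_factor (0 : Fin d → ℤ)
    simpa [one] using this
  have c2 : Conv (oneSubY (W t)) (dα k w) := conv_neg mV2 mdw zero_le_one
  have h3 : dα k (oneSubY (W t) ⊡ w) = dα k (oneSubY (W t)) ⊡ w + oneSubY (W t) ⊡ dα k w :=
    dα_mul k c1 c2
  have c3 : Conv (b k (W t) (R t)) (dα k (oneSubY (W t)) ⊡ w) :=
    conv_mul_two (one_of zero_le_one mb) (one_of le_rfl mdV) (one_of le_rfl hw)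
  have c4 : Conv (b k (W t) (R t)) (oneSubY (W t) ⊡ dα k w) := by
    have mVw : Mem 2 (wt k 0) (oneSubY (W t) ⊡ w) := by
      obtain ⟨x, hx⟩ := mV.mono_wt (θ' := 0) (by norm_num)
      obtain ⟨y, hy⟩ := hw
      exact ((cb_const x hx).mul_wt le_rfl (cb_const y hy)).mem rfl
    -- Convergence of `b ⊡ (V ⊡ w_α)` is obtained by difference: `V w_α = (V w)_α - V_α w`, and `b`
    -- can be convolved with both terms on the right.
    have c5 : Conv (b k (W t) (R t)) (dα k (oneSubY (W t) ⊡ w)) :=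
      mb.conv zero_le_one (mVw.dα (by norm_num))
    intro n
    refine ((c5 n).sub (c3 n)).congr fun l => ?_
    rw [h3, Pi.add_apply]; ring
  have h4 : b k (W t) (R t) ⊡ dα k (oneSubY (W t) ⊡ w) =
      b k (W t) (R t) ⊡ dα k (oneSubY (W t)) ⊡ w + oneSubY (W t) ⊡ (b k (W t) (R t) ⊡ dα k w) := by
    rw [h3, mul_add' c3 c4, h1, h2]
  have h5 : oneSubY (W t) ⊡ (bar (oneSubY (W t)) ⊡ (one + W t) ⊡ dα k r) =
      bar (oneSubY (W t)) ⊡ dα k r := by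
    rw [← mul_assoc_wt k (by norm_num) mV mVO.one_two mdr, mul_comm' (oneSubY (W t)),
      ((one_of (by norm_num) mVb).mul_assoc (one_of (by norm_num) (hO.mem ht).one_two)
        (one_of (by norm_num) mV2)), h.inv t ht, mul_comm' _ one, one_mul']
  have c6 : Conv (oneSubY (W t)) (b k (W t) (R t) ⊡ dα k w) := conv_neg mV2 hbw zero_le_one
  have c7 : Conv (oneSubY (W t)) (bar (oneSubY (W t)) ⊡ (one + W t) ⊡ dα k r) :=
    mV.conv (by norm_num) hVr
  have c8 : Conv (oneSubY (W t)) f := conv12 (one_of (by norm_num) mV) (one_of le_rfl hf)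
  have c9 : Conv (b k (W t) (R t) ⊡ dα k (oneSubY (W t))) w := by
    have : Mem 2 (wt k 0) (b k (W t) (R t) ⊡ dα k (oneSubY (W t))) := by
      obtain ⟨x, hx⟩ := mb.mono_wt (zero_le_one)
      obtain ⟨y, hy⟩ := mdV
      exact ((cb_const x hx).mul_wt le_rfl (cb_const y hy)).mem rfl
    exact (one_of le_rfl this).conv22 (one_of le_rfl hw)
  have c10 : Conv (oneSubY (W t) ⊡ coefS k (W t) (R t)) w := by
    have : Mem 1 (wt k 0) (oneSubY (W t) ⊡ coefS k (W t) (R t)) :=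
      (h.V_zero.mul le_rfl h.coefS_zero).bound.mem ht
    exact conv12 (one_of le_rfl this) (one_of le_rfl hw)
  have neg_conv : ∀ {u v : PerFun d}, Conv u v → Conv (-u) v := fun h => h.symm.neg.symm
  have conv_sub : ∀ {u v x : PerFun d}, Conv u v → Conv u x → Conv u (v - x) := fun h h' n =>
    ((h n).sub (h' n)).congr fun l => by rw [Pi.sub_apply, mul_sub]
  rw [neg_mul', neg_mul', neg_mul', add_mul' (neg_conv c9) c10, neg_mul', mul_add' (conv_sub c6.neg c7) c8,
    mul_sub' c6.neg c7, mul_neg', h4, h5, hSV]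
  abel

end Background

/-- The equation for the diagonal variable `w / (1 + 𝐖)`. -/
theorem hasDerivWithinAt_hat {k : Fin d → ℝ} {s T : ℝ} {α β : ℝ → ℝ} {W R w r : ℝ → PerFun d}
    {N N₁ N₂ : ℝ → ℝ} (h : Background k s (Icc 0 T) α β W R) (hs : IsSolution k s T W R)
    (hl : IsLinSolution k T W R w r) (hw : CB 2 (wt k 0) (Icc 0 T) w N)
    (hr : CB 2 (wt k (1 / 2)) (Icc 0 T) r N₁)
    (hf : CB 2 (wt k 0) (Icc 0 T) (fun t => sourceF k (W t) (R t) (w t) (r t)) N₂) :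
    ∀ t ∈ Icc 0 T, ∀ n, HasDerivWithinAt (fun τ => (oneSubY (W τ) ⊡ w τ) n)
      ((-(b k (W t) (R t)) ⊡ dα k (oneSubY (W t) ⊡ w t) - bar (oneSubY (W t)) ⊡ dα k (r t) +
        (coefS k (W t) (R t) ⊡ (oneSubY (W t) ⊡ w t) +
          oneSubY (W t) ⊡ sourceF k (W t) (R t) (w t) (r t))) n) (Icc 0 T) t := by
  intro t ht n
  obtain ⟨γ, hV⟩ := h.V_half
  obtain ⟨γ', hO⟩ := h.O_half
  have h1 := h.b_one.bound.neg.mul_wt_neg zero_le_one (hw.dα (θ' := -1) (by norm_num))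
  have h2 := ((hV.bar (wt_neg k _)).mul_wt (by norm_num) hO).mul_wt_neg (by norm_num)
    (hr.dα (θ' := -(1 / 2)) (by norm_num))
  have h3 := (h1.sub (h2.lower (θ' := -1) (by norm_num))).add (hf.lower (θ' := -1) (by norm_num))
  have hd := (hw.lower (θ' := -1) (by norm_num)).strongDeriv h3 hl.eq_w t ht
  -- `V` is differentiable in `ℓ^2` and paired with `w` in `ℓ^2`; `w` is differentiable only in
  -- order `-1` and is paired with `V` in order `1`.
  have key := hasDerivWithinAt_bmul ht (strongDeriv_V h hs ht) hw (h.V_two ht) hd (wt_pos k _)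
    (wt_pos k _) (wt_pos k _) (wt_pos k _) (fun _ _ => 1) n (K := wt k 1 n)
    (fun l => by
      rw [norm_one, wt_zero, mul_one, mul_one, wt_one]; exact one_le_lam k n)
    (fun l => by
      have h2 : wt k 1 (n - l) * wt k (-1) (n - l) = 1 := by rw [← wt_add]; simp [wt]
      have h1 : wt k 1 (n - l) ≤ wt k 1 n * wt k 1 l := by
        simpa [sub_eq_add_neg] using wt_mul k zero_le_one n (-l)
      rw [norm_one, ← mul_assoc]
      exact h2.symm.le.trans (mul_le_mul_of_nonneg_right h1 (wt_pos k _ _).le))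
  simp only [← mul_eq_bmul] at key
  rwa [h.hat_algebra ht (hw.mem ht) (hr.mem ht) (hf.mem ht)] at key

/-- The second equation in terms of the diagonal variable. -/
theorem Background.hat_right {k : Fin d → ℝ} {s : ℝ} {I : Set ℝ} {α β : ℝ → ℝ} {W R : ℝ → PerFun d}
    (h : Background k s I α β W R) {t : ℝ} (ht : t ∈ I) {w : PerFun d} (hw : Mem 2 (wt k 0) w) :
    (one + a k (R t)) ⊡ (oneSubY (W t) ⊡ oneSubY (W t)) ⊡ w =
      (one + a k (R t)) ⊡ oneSubY (W t) ⊡ (oneSubY (W t) ⊡ w) := by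
  have m1 : Mem 1 (fun _ => 1) (one + a k (R t)) := by
    rw [← wt_zero k]; exact ((h.one_zero 0).add h.a_zero).bound.mem ht
  have mV : Mem 1 (fun _ => 1) (oneSubY (W t)) := by rw [← wt_zero k]; exact h.V_zero.bound.mem ht
  have m2 : Mem 1 (fun _ => 1) ((one + a k (R t)) ⊡ oneSubY (W t)) := by
    rw [← wt_zero k]; exact (((h.one_zero 0).add h.a_zero).mul le_rfl h.V_zero).bound.mem ht
  rw [wt_zero] at hw
  rw [← m2.mul_assoc mV.one_two hw, m1.mul_assoc mV.one_two mV.one_two]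

/-! ### Mollifiers and commutators -/

/-- The symbol of the mollifier. -/
def moll (N : ℕ) (x : ℝ) : ℝ := (N + 1) / (N + 1 + x ^ 2)

theorem moll_pos (N : ℕ) (x : ℝ) : 0 < moll N x := by unfold moll; positivity

theorem moll_le_one (N : ℕ) (x : ℝ) : moll N x ≤ 1 := by
  unfold moll
  rw [div_le_one (by positivity)]
  nlinarith [sq_nonneg x]

theorem moll_mul_sq (N : ℕ) (x : ℝ) : moll N x * (1 + |x|) ^ 2 ≤ 2 * (N + 1) := by
  unfold moll
  have hN : (0 : ℝ) ≤ N := N.cast_nonneg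
  have h1 : (1 + |x|) ^ 2 ≤ 2 * (1 + x ^ 2) := by nlinarith [sq_abs x, sq_nonneg (|x| - 1)]
  rw [div_mul_eq_mul_div, div_le_iff₀ (by positivity)]
  have h2 : 2 * (1 + x ^ 2) ≤ 2 * (N + 1 + x ^ 2) := by linarith
  nlinarith [h1.trans h2]

theorem tendsto_moll (x : ℝ) : Tendsto (fun N : ℕ => moll N x) atTop (𝓝 1) := by
  have h1 : Tendsto (fun N : ℕ => x ^ 2 * (1 / ((N : ℝ) + 1))) atTop (𝓝 (x ^ 2 * 0)) :=
    tendsto_one_div_add_atTop_nhds_zero_nat.const_mul _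
  have h2 := (h1.const_add 1).inv₀ (by simp)
  simp only [mul_zero, add_zero, inv_one] at h2
  refine h2.congr fun N => ?_
  unfold moll
  have : (0 : ℝ) < N + 1 := by positivity
  field_simp

theorem moll_sub_le_one (N : ℕ) (x y : ℝ) : |moll N x - moll N y| ≤ 1 := by
  rw [abs_le]
  constructor <;> linarith [moll_pos N x, moll_pos N y, moll_le_one N x, moll_le_one N y]

/-- The symbol is a fixed profile evaluated at `x / √(N+1)`, so the commutator bound for a first
order operator is scale invariant, hence uniform in `N`. -/
theorem moll_sub_mul (N : ℕ) (x y : ℝ) : |moll N x - moll N y| * |y| ≤ 2 * |x - y| := by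
  have hn : (1 : ℝ) ≤ N + 1 := by simp
  unfold moll
  set n : ℝ := N + 1
  have hx : 0 < n + x ^ 2 := by positivity
  have hy : 0 < n + y ^ 2 := by positivity
  have e : n / (n + x ^ 2) - n / (n + y ^ 2) =
      (y - x) * (n * (x + y) / ((n + x ^ 2) * (n + y ^ 2))) := by field_simp; ring
  rw [e, abs_mul, mul_assoc, abs_sub_comm, mul_comm 2]
  refine mul_le_mul_of_nonneg_left ?_ (abs_nonneg _)
  rw [← abs_mul, div_mul_eq_mul_div, abs_div, abs_of_pos (mul_pos hx hy), div_le_iff₀ (mul_pos hx hy),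
    abs_le]
  constructor <;> nlinarith [mul_nonneg (sq_nonneg x) (sq_nonneg y), sq_nonneg (x * n), sq_nonneg (x - y),
    sq_nonneg (x + y), mul_nonneg (zero_le_one.trans hn) (sq_nonneg (x - y)),
    mul_nonneg (zero_le_one.trans hn) (sq_nonneg (x + y)), mul_nonneg (zero_le_one.trans hn) (sq_nonneg x),
    mul_nonneg (zero_le_one.trans hn) (sq_nonneg y), sq_nonneg n]

theorem moll_sub_mul_lam (N : ℕ) (x y : ℝ) :
    |moll N x - moll N y| * (1 + |y|) ≤ 3 * (1 + |x - y|) := by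
  nlinarith [moll_sub_le_one N x y, moll_sub_mul N x y, abs_nonneg (x - y)]

/-- Interpolation: the difference `F` is at most one, so `F ≤ F^a F^c`. One power is spent on the
weight at `n`, the other on the weight at `l + n`; each of `F λ_n` and `F λ_{l+n}` is at most `3
λ_l`. -/
theorem moll_sub_mul_wt (k : Fin d → ℝ) (N : ℕ) (l n : Fin d → ℤ) {a c : ℝ} (ha : 0 ≤ a) (hc : 0 ≤ c)
    (hac : a + c ≤ 1) : |moll N (freq k (l + n)) - moll N (freq k n)| * (wt k a n * wt k c (l + n)) ≤
      3 * wt k (a + c) l := by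
  set F := |moll N (freq k (l + n)) - moll N (freq k n)| with hF
  have hF0 : 0 ≤ F := abs_nonneg _
  have hF1 : F ≤ 1 := moll_sub_le_one N _ _
  have h1 : F * lam k n ≤ 3 * lam k l := by
    have := moll_sub_mul_lam N (freq k (l + n)) (freq k n)
    rwa [← freq_sub, add_sub_cancel_right] at this
  have h2 : F * lam k (l + n) ≤ 3 * lam k l := by
    have := moll_sub_mul_lam N (freq k n) (freq k (l + n))
    rw [← freq_sub, abs_sub_comm, sub_add_cancel_right, freq_neg, abs_neg] at this
    exact this
  have p0 := (lam_pos k l).le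
  have e : F ≤ F ^ (a + c) := by
    rcases hF0.eq_or_lt with h | h
    · rw [← h]; exact Real.rpow_nonneg le_rfl _
    · calc F = F ^ (1 : ℝ) := (Real.rpow_one F).symm
        _ ≤ _ := Real.rpow_le_rpow_of_exponent_ge h hF1 hac
  calc F * (wt k a n * wt k c (l + n)) ≤ F ^ (a + c) * (wt k a n * wt k c (l + n)) :=
        mul_le_mul_of_nonneg_right e (mul_pos (wt_pos _ _ _) (wt_pos _ _ _)).le
    _ = (F * lam k n) ^ a * (F * lam k (l + n)) ^ c := by
        rw [Real.mul_rpow hF0 (lam_pos _ _).le, Real.mul_rpow hF0 (lam_pos _ _).le,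
          Real.rpow_add_of_nonneg hF0 ha hc, wt, wt]
        ring
    _ ≤ (3 * lam k l) ^ a * (3 * lam k l) ^ c := by
        have := (lam_pos k n).le
        have := (lam_pos k (l + n)).le
        gcongr
    _ = 3 ^ (a + c) * wt k (a + c) l := by
        rw [← Real.rpow_add_of_nonneg (by positivity) ha hc, Real.mul_rpow (by norm_num) p0, wt]
    _ ≤ 3 * wt k (a + c) l := by
        refine mul_le_mul_of_nonneg_right ?_ (wt_pos _ _ _).le
        calc (3 : ℝ) ^ (a + c) ≤ 3 ^ (1 : ℝ) := Real.rpow_le_rpow_of_exponent_le (by norm_num) hac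
          _ = 3 := Real.rpow_one 3

/-- The symbol of the commutator of the mollifier with a product, between weighted spaces. -/
def comKer (k : Fin d → ℝ) (a c θ : ℝ) (σ : (Fin d → ℤ) → ℂ) (N : ℕ) (l n : Fin d → ℤ) : ℂ :=
  ((moll N (freq k (l + n)) - moll N (freq k n) : ℝ) : ℂ) * σ n * (wt k c (l + n) : ℂ) /
    ((wt k (a + c) l : ℂ) * (wt k θ n : ℂ))

section comKer
variable {k : Fin d → ℝ} {a c θ : ℝ} {σ : (Fin d → ℤ) → ℂ}

theorem comKer_le (ha : 0 ≤ a) (hc : 0 ≤ c) (hac : a + c ≤ 1) (hσ : ∀ n, ‖σ n‖ ≤ wt k (a + θ) n)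
    (N : ℕ) (l n : Fin d → ℤ) : ‖comKer k a c θ σ N l n‖ ≤ 3 := by
  have p1 := wt_pos k (a + c) l
  have p2 := wt_pos k θ n
  have p3 := wt_pos k c (l + n)
  rw [comKer, norm_div, norm_mul, norm_mul, norm_mul, Complex.norm_real, Complex.norm_real,
    Complex.norm_real, Complex.norm_real, Real.norm_of_nonneg p1.le, Real.norm_of_nonneg p2.le,
    Real.norm_of_nonneg p3.le, div_le_iff₀ (by positivity), Real.norm_eq_abs]
  have h := moll_sub_mul_wt k N l n ha hc hac
  calc |moll N (freq k (l + n)) - moll N (freq k n)| * ‖σ n‖ * wt k c (l + n)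
      ≤ |moll N (freq k (l + n)) - moll N (freq k n)| * wt k (a + θ) n * wt k c (l + n) := by
        gcongr; exact hσ n
    _ = |moll N (freq k (l + n)) - moll N (freq k n)| * (wt k a n * wt k c (l + n)) * wt k θ n := by
        rw [wt_add]; ring
    _ ≤ 3 * wt k (a + c) l * wt k θ n := by gcongr
    _ = _ := by ring

theorem comKer_tendsto (l n : Fin d → ℤ) :
    Tendsto (fun N => comKer k a c θ σ N l n) atTop (𝓝 0) := by
  have h1 := (tendsto_moll (freq k (l + n))).sub (tendsto_moll (freq k n))
  have h2 := (((Complex.continuous_ofReal.tendsto _).comp h1).mul_const (σ n)).mul_const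
    (wt k c (l + n) : ℂ)
  have h3 := h2.div_const ((wt k (a + c) l : ℂ) * (wt k θ n : ℂ))
  simpa [comKer] using h3

theorem moll_mul_comm {u v : PerFun d} {U : Seq d 1} {V : Seq d 2}
    (hU : ∀ j, U j = (wt k (a + c) j : ℂ) * u j) (hV : ∀ j, V j = (wt k θ j : ℂ) * v j) {K : ℝ} (N : ℕ)
    (hK : ∀ l n, ‖comKer k a c θ σ N l n‖ ≤ K)
    (h1 : Conv u (fun j => σ j * v j)) (h2 : Conv u (fun j => (moll N (freq k j) : ℂ) * (σ j * v j)))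
    (n : Fin d → ℤ) :
    (wt k c n : ℂ) * ((moll N (freq k n) : ℂ) * (u ⊡ fun j => σ j * v j) n) =
      (wt k c n : ℂ) * (u ⊡ fun j => (moll N (freq k j) : ℂ) * (σ j * v j)) n +
        bil 2 (comKer k a c θ σ N) K hK U V n := by
  have h3 := ((h1 n).mul_left ((wt k c n : ℂ) * (moll N (freq k n) : ℂ)))
  have h4 := (h2 n).mul_left (wt k c n : ℂ)
  rw [bil_apply, ← sub_eq_iff_eq_add']
  change _ * (_ * ∑' l, _) - _ * ∑' l, _ = _
  rw [← mul_assoc, ← tsum_mul_left, ← tsum_mul_left, ← h3.tsum_sub h4]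
  refine tsum_congr fun l => ?_
  have e1 : (wt k (a + c) l : ℂ) ≠ 0 := by exact_mod_cast (wt_pos k (a + c) l).ne'
  have e2 : (wt k θ (n - l) : ℂ) ≠ 0 := by exact_mod_cast (wt_pos k θ (n - l)).ne'
  rw [hU, hV, comKer, add_sub_cancel]
  push_cast
  field_simp

end comKer

/-! ### Multiplication operators on the Hilbert space `ℓ^2` -/

theorem inner_seq (x y : Seq d 2) : inner ℂ x y = ∑' j, star (x j) * y j := by
  rw [lp.inner_eq_tsum]
  exact tsum_congr fun j => by rw [RCLike.inner_apply, mul_comm]; rfl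

theorem inner_shift (x y : Seq d 2) (l : Fin d → ℤ) :
    inner ℂ (shift 2 l x) y = inner ℂ x (shift 2 (-l) y) := by
  rw [inner_seq, inner_seq, ← (Equiv.addRight l).tsum_eq]
  refine tsum_congr fun j => ?_
  simp [shift_apply]

theorem conv_eq_tsum (u : Seq d 1) (x : Seq d 2) :
    (Summable fun l => u l • shift 2 l x) ∧ u • x = ∑' l, u l • shift 2 l x := by
  have e : diag 2 (fun _ : Fin d → ℤ => (1 : ℂ)) 1 (fun _ => by simp) x = x := by ext j; simp
  have h1 := bil_summable 2 (fun _ _ => 1) 1 (fun _ _ => by simp) u x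
  have h2 := bil_apply_eq_tsum 2 (fun _ _ => 1) 1 (fun _ _ => by simp) u x
  simp only [e] at h1 h2
  exact ⟨h1, h2⟩

theorem inner_smul_seq (u : Seq d 1) (x y : Seq d 2) :
    inner ℂ (u • x) y = inner ℂ x (CB.barSeq u • y) := by
  obtain ⟨s1, e1⟩ := conv_eq_tsum u x
  obtain ⟨s2, e2⟩ := conv_eq_tsum (CB.barSeq u) y
  have h2 := (innerSL ℂ x).map_tsum s2
  have h1 := (innerSL ℂ y).map_tsum s1
  simp only [innerSL_apply_apply] at h1 h2
  rw [e2, h2, ← inner_conj_symm, e1, h1, Complex.conj_tsum, ← (Equiv.neg (Fin d → ℤ)).tsum_eq]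
  refine tsum_congr fun l => ?_
  rw [inner_smul_right, inner_smul_right, map_mul, inner_conj_symm, CB.barSeq_apply, inner_shift]
  simp

/-- `y` is the derivative `∂_α x`. -/
def IsDα (k : Fin d → ℝ) {p : ENNReal} (x y : Seq d p) : Prop :=
  ∀ j, y j = Complex.I * (freq k j : ℂ) * x j

theorem IsDα.coe {k : Fin d → ℝ} {p : ENNReal} {x y : Seq d p} (h : IsDα k x y) :
    (⇑y : PerFun d) = dα k ⇑x := funext fun j => h j

theorem IsDα.smul {k : Fin d → ℝ} {σ σ' : Seq d 1} {x x' : Seq d 2} (h : IsDα k σ σ')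
    (hx : IsDα k x x') : IsDα k (σ • x) (σ' • x + σ • x') := by
  intro j
  have e := dα_mul k (u := ⇑σ) (v := ⇑x)
    (by rw [← h.coe]; exact fun n => (mem_coe σ').summable_mul (mem_coe x) n)
    (by rw [← hx.coe]; exact fun n => (mem_coe σ).summable_mul (mem_coe x') n)
  rw [← h.coe, ← hx.coe, ← coe_smul, ← coe_smul, ← coe_smul] at e
  rw [lp.coeFn_add]
  exact (congrFun e j).symm

theorem IsDα.mul {k : Fin d → ℝ} {σ σ' τ τ' : Seq d 1} (h : IsDα k σ σ') (h' : IsDα k τ τ') :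
    IsDα k (σ * τ) (σ' * τ + σ * τ') := by
  intro j
  have e := dα_mul k (u := ⇑σ) (v := ⇑τ)
    (by rw [← h.coe]; exact fun n => (mem_coe σ').summable_mul (mem_coe τ) n)
    (by rw [← h'.coe]; exact fun n => (mem_coe σ).summable_mul (mem_coe τ') n)
  rw [← h.coe, ← h'.coe, ← coe_mul, ← coe_mul, ← coe_mul] at e
  rw [lp.coeFn_add]
  exact (congrFun e j).symm

theorem IsDα.inner_skew {k : Fin d → ℝ} {x x' y y' : Seq d 2} (hx : IsDα k x x') (hy : IsDα k y y') :
    inner ℂ x' y = -inner ℂ x y' := by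
  rw [inner_seq, inner_seq, ← tsum_neg]
  refine tsum_congr fun j => ?_
  rw [hx, hy, star_mul', star_mul', Complex.star_def, Complex.conj_I, Complex.conj_ofReal]
  ring

/-- Integration by parts; a real `σ` acts as a self-adjoint operator, so both halves of the product
rule have the same real part. -/
theorem IsDα.inner_transport {k : Fin d → ℝ} {σ σ' : Seq d 1} {x x' : Seq d 2} (h : IsDα k σ σ')
    (hσ : CB.barSeq σ = σ) (hx : IsDα k x x') :
    2 * (inner ℂ x' (σ • x)).re = -(inner ℂ x (σ' • x)).re := by
  have h1 := hx.inner_skew (h.smul hx)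
  have h2 : (inner ℂ x (σ • x')).re = (inner ℂ x' (σ • x)).re := by
    rw [← hσ, ← inner_smul_seq, ← inner_conj_symm, Complex.conj_re, hσ]
  rw [inner_add_right] at h1
  have h3 := congrArg Complex.re h1
  simp only [Complex.neg_re, Complex.add_re] at h3
  linarith

theorem barSeq_mul (u v : Seq d 1) : CB.barSeq (u * v) = CB.barSeq u * CB.barSeq v := by
  refine lp.ext ?_
  have h : ∀ x : Seq d 1, (⇑(CB.barSeq x) : PerFun d) = bar ⇑x := fun x => rfl
  change (⇑(CB.barSeq (u * v)) : PerFun d) = ⇑(CB.barSeq u * CB.barSeq v)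
  rw [coe_mul, h, h, h, coe_mul, bar_mul]

/-- The algebra of the energy estimate, for smooth functions. -/
theorem energy_algebra {k : Fin d → ℝ} {b b' ρ ρ' q c G : Seq d 1} {x x' y y' φ : Seq d 2}
    (hb : IsDα k b b') (hρ : IsDα k ρ ρ') (hx : IsDα k x x') (hy : IsDα k y y')
    (b_real : CB.barSeq b = b) (ρ_real : CB.barSeq ρ = ρ) (hc : c = ρ * CB.barSeq q) :
    (inner ℂ (-(b • x') - q • y' + φ) (ρ • x) +
        inner ℂ x ((-(b * ρ') + G) • x + ρ • (-(b • x') - q • y' + φ))).re +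
      2 * (inner ℂ (y + Complex.I • y') (-(b • y') + Complex.I • (c • x))).re =
    (inner ℂ x ((b' * ρ + G) • x) + 2 * inner ℂ φ (ρ • x) + inner ℂ y (b' • y) +
      2 * inner ℂ y (Complex.I • (c • x))).re := by
  set z := -(b • x') - q • y' + φ with hz
  have e1 : (inner ℂ x (ρ • z)).re = (inner ℂ z (ρ • x)).re := by
    rw [← ρ_real, ← inner_smul_seq, ← inner_conj_symm, Complex.conj_re, ρ_real]
  have e2 : inner ℂ (b • x') (ρ • x) = inner ℂ x' ((b * ρ) • x) := by
    rw [inner_smul_seq, b_real, mul_smul]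
  -- The relation `c = ρ q̄` turns this into the pairing of `y'` with `c x`, which cancels the one
  -- produced by the second equation in `e12`.
  have e3 : inner ℂ (q • y') (ρ • x) = inner ℂ y' (c • x) := by
    rw [inner_smul_seq, ← mul_smul, hc, mul_comm]
  have e4 := (hb.mul hρ).inner_transport (by rw [barSeq_mul, b_real, ρ_real]) hx
  have e5 := hb.inner_transport b_real hy
  have e6 : (inner ℂ y (b • y')).re = (inner ℂ y' (b • y)).re := by
    rw [← b_real, ← inner_smul_seq, ← inner_conj_symm, Complex.conj_re, b_real]
  -- Multiplication by `b` is self-adjoint, so this pairing is real and its multiple by `i` drops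
  -- out of the real part.
  have e7 : (inner ℂ y' (b • y')).im = 0 := by
    have : inner ℂ y' (b • y') = (starRingEnd ℂ) (inner ℂ y' (b • y')) := by
      rw [inner_conj_symm]
      conv_lhs => rw [← b_real, ← inner_smul_seq]
    have := congrArg Complex.im this
    rw [Complex.conj_im] at this
    linarith
  have e8 : (inner ℂ z (ρ • x)).re = -(inner ℂ x' ((b * ρ) • x)).re - (inner ℂ y' (c • x)).re +
      (inner ℂ φ (ρ • x)).re := by
    rw [hz, inner_add_left, inner_sub_left, inner_neg_left, e2, e3]
    simp only [Complex.add_re, Complex.sub_re, Complex.neg_re]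
  have e9 : (inner ℂ x ((-(b * ρ') + G) • x)).re = -(inner ℂ x ((b * ρ') • x)).re +
      (inner ℂ x (G • x)).re := by
    rw [add_smul, neg_smul, inner_add_right, inner_neg_right]; simp
  have e10 : (inner ℂ x ((b' * ρ + G) • x)).re = (inner ℂ x ((b' * ρ) • x)).re +
      (inner ℂ x (G • x)).re := by
    rw [add_smul, inner_add_right]; simp
  have e11 : (inner ℂ x ((b' * ρ + b * ρ') • x)).re = (inner ℂ x ((b' * ρ) • x)).re +
      (inner ℂ x ((b * ρ') • x)).re := by
    rw [add_smul, inner_add_right]; simp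
  have e12 : (inner ℂ (y + Complex.I • y') (-(b • y') + Complex.I • (c • x))).re =
      -(inner ℂ y (b • y')).re + (inner ℂ y (Complex.I • (c • x))).re +
        (inner ℂ y' (c • x)).re := by
    rw [inner_add_left, inner_add_right, inner_add_right, inner_neg_right, inner_neg_right,
      inner_smul_left, inner_smul_left]
    have e13 : ∀ v : Seq d 2, inner ℂ v (Complex.I • (c • x)) = Complex.I * inner ℂ v (c • x) :=
      fun v => inner_smul_right _ _ _
    simp [e7, e13]
  have two_re' : ∀ z : ℂ, (2 * z).re = 2 * z.re := fun z => by simp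
  rw [inner_add_right]
  simp only [Complex.add_re, two_re']
  rw [e1, e8, e9, e10, e12, e6]
  linarith

/-! ### Bounded convergence of families -/

/-- Bounded pointwise convergence of a sequence of continuous functions on `I` to a continuous
function. -/
structure BddTendsto {E : Type*} [NormedAddCommGroup E] (I : Set ℝ) (g : ℕ → ℝ → E) (g' : ℝ → E) :
    Prop where
  cont : ∀ n, ContinuousOn (g n) I
  cont_lim : ContinuousOn g' I
  bdd : ∃ K, ∀ n, ∀ t ∈ I, ‖g n t‖ ≤ K
  lim : ∀ t ∈ I, Tendsto (fun n => g n t) atTop (𝓝 (g' t))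

namespace BddTendsto

variable {E F G : Type*} [NormedAddCommGroup E] [NormedAddCommGroup F] [NormedAddCommGroup G]
  {I : Set ℝ}

theorem const (hI : IsCompact I) {g : ℝ → E} (hg : ContinuousOn g I) :
    BddTendsto I (fun _ => g) g where
  cont _ := hg
  cont_lim := hg
  bdd := by
    obtain ⟨K, hK⟩ := hI.exists_bound_of_continuousOn hg
    exact ⟨K, fun _ => hK⟩
  lim _ _ := tendsto_const_nhds

theorem add {g h : ℕ → ℝ → E} {g' h' : ℝ → E} (hg : BddTendsto I g g') (hh : BddTendsto I h h') :
    BddTendsto I (fun n t => g n t + h n t) (fun t => g' t + h' t) where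
  cont n := (hg.cont n).add (hh.cont n)
  cont_lim := hg.cont_lim.add hh.cont_lim
  bdd := by
    obtain ⟨K, hK⟩ := hg.bdd
    obtain ⟨K', hK'⟩ := hh.bdd
    exact ⟨K + K', fun n t ht => (norm_add_le _ _).trans (add_le_add (hK n t ht) (hK' n t ht))⟩
  lim t ht := (hg.lim t ht).add (hh.lim t ht)

theorem smul [NormedSpace ℂ E] {g : ℕ → ℝ → E} {g' : ℝ → E} (hg : BddTendsto I g g') (c : ℂ) :
    BddTendsto I (fun n t => c • g n t) (fun t => c • g' t) where
  cont n := (hg.cont n).const_smul c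
  cont_lim := hg.cont_lim.const_smul c
  bdd := by
    obtain ⟨K, hK⟩ := hg.bdd
    exact ⟨‖c‖ * K, fun n t ht => by
      rw [norm_smul]; exact mul_le_mul_of_nonneg_left (hK n t ht) (norm_nonneg _)⟩
  lim t ht := (hg.lim t ht).const_smul c

theorem sub [NormedSpace ℂ E] {g h : ℕ → ℝ → E} {g' h' : ℝ → E} (hg : BddTendsto I g g')
    (hh : BddTendsto I h h') : BddTendsto I (fun n t => g n t - h n t) (fun t => g' t - h' t) := by
  simpa [sub_eq_add_neg] using hg.add (hh.smul (-1))

theorem bilin [NormedSpace ℂ E] [NormedSpace ℂ F] [NormedSpace ℂ G] (B : E →L[ℂ] F →L[ℂ] G)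
    {g : ℕ → ℝ → E} {g' : ℝ → E} {h : ℕ → ℝ → F} {h' : ℝ → F} (hg : BddTendsto I g g')
    (hh : BddTendsto I h h') : BddTendsto I (fun n t => B (g n t) (h n t)) (fun t => B (g' t) (h' t)) where
  cont n := (B.continuous.comp_continuousOn (hg.cont n)).clm_apply (hh.cont n)
  cont_lim := (B.continuous.comp_continuousOn hg.cont_lim).clm_apply hh.cont_lim
  bdd := by
    obtain ⟨K, hK⟩ := hg.bdd
    obtain ⟨K', hK'⟩ := hh.bdd
    refine ⟨‖B‖ * K * K', fun n t ht => (B.le_opNorm₂ _ _).trans ?_⟩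
    have h1 := hK n t ht
    have h2 := hK' n t ht
    have h3 := (norm_nonneg _).trans h1
    gcongr
  lim t ht := (isBoundedBilinearMap_apply.continuous.tendsto (B (g' t), h' t)).comp
    (((B.continuous.tendsto (g' t)).comp (hg.lim t ht)).prodMk_nhds (hh.lim t ht))

theorem inner [InnerProductSpace ℂ E] {g h : ℕ → ℝ → E} {g' h' : ℝ → E} (hg : BddTendsto I g g')
    (hh : BddTendsto I h h') :
    BddTendsto I (fun n t => inner ℂ (g n t) (h n t)) (fun t => inner ℂ (g' t) (h' t)) where
  cont n := ContinuousOn.inner (hg.cont n) (hh.cont n)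
  cont_lim := ContinuousOn.inner hg.cont_lim hh.cont_lim
  bdd := by
    obtain ⟨K, hK⟩ := hg.bdd
    obtain ⟨K', hK'⟩ := hh.bdd
    refine ⟨K * K', fun n t ht => (norm_inner_le_norm _ _).trans ?_⟩
    have h1 := hK n t ht
    exact mul_le_mul h1 (hK' n t ht) (norm_nonneg _) ((norm_nonneg _).trans h1)
  lim t ht := (hg.lim t ht).inner (hh.lim t ht)

theorem re {g : ℕ → ℝ → ℂ} {g' : ℝ → ℂ} (hg : BddTendsto I g g') :
    BddTendsto I (fun n t => (g n t).re) (fun t => (g' t).re) where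
  cont n := Complex.continuous_re.comp_continuousOn (hg.cont n)
  cont_lim := Complex.continuous_re.comp_continuousOn hg.cont_lim
  bdd := by
    obtain ⟨K, hK⟩ := hg.bdd
    exact ⟨K, fun n t ht => (Complex.abs_re_le_norm _).trans (hK n t ht)⟩
  lim t ht := (Complex.continuous_re.tendsto _).comp (hg.lim t ht)

/-- The integrated identities converge by bounded convergence, and continuity of the limiting
integrand makes the limit differentiable. Pointwise convergence of the derivatives suffices. -/
theorem hasDerivWithinAt {T : ℝ} {E e : ℕ → ℝ → ℝ} {E' e' : ℝ → ℝ}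
    (hE : ∀ n, ∀ t ∈ Icc 0 T, HasDerivWithinAt (E n) (e n t) (Icc 0 T) t)
    (hlim : BddTendsto (Icc 0 T) E E') (he : BddTendsto (Icc 0 T) e e') :
    ∀ t ∈ Icc 0 T, HasDerivWithinAt E' (e' t) (Icc 0 T) t := by
  obtain ⟨K, hK⟩ := he.bdd
  have key : ∀ t ∈ Icc 0 T, E' t = E' 0 + ∫ τ in (0 : ℝ)..t, e' τ := by
    intro t ht
    have hsub : Icc 0 t ⊆ Icc 0 T := Icc_subset_Icc_right ht.2
    have h0 : (0 : ℝ) ∈ Icc 0 T := ⟨le_rfl, ht.1.trans ht.2⟩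
    have h1 : ∀ n, ∫ τ in (0 : ℝ)..t, e n τ = E n t - E n 0 := fun n =>
      intervalIntegral.integral_eq_sub_of_hasDerivAt_of_le ht.1
        (fun τ hτ => ((hE n τ (hsub hτ)).continuousWithinAt).mono hsub)
        (fun τ hτ => (hE n τ (hsub (Ioo_subset_Icc_self hτ))).hasDerivAt
          (Icc_mem_nhds hτ.1 (hτ.2.trans_le ht.2)))
        (((he.cont n).mono hsub).intervalIntegrable_of_Icc ht.1)
    have hmem : ∀ τ ∈ Set.uIoc 0 t, τ ∈ Icc 0 T := fun τ hτ => by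
      rw [uIoc_of_le ht.1] at hτ
      exact hsub (Ioc_subset_Icc_self hτ)
    have h2 : Tendsto (fun n => ∫ τ in (0 : ℝ)..t, e n τ) atTop (𝓝 (∫ τ in (0 : ℝ)..t, e' τ)) := by
      refine intervalIntegral.tendsto_integral_filter_of_dominated_convergence (fun _ => K)
        (Eventually.of_forall fun n => ?_) (Eventually.of_forall fun n => ?_) (by simp) ?_
      · exact IntervalIntegrable.aestronglyMeasurable_restrict_uIoc
          (((he.cont n).mono hsub).intervalIntegrable_of_Icc ht.1)
      · exact Eventually.of_forall fun τ hτ => hK n τ (hmem τ hτ)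
      · exact Eventually.of_forall fun τ hτ => he.lim τ (hmem τ hτ)
    simp only [h1] at h2
    have h3 := tendsto_nhds_unique h2 ((hlim.lim t ht).sub (hlim.lim 0 h0))
    rw [h3]; ring
  intro t ht
  have : Fact (t ∈ Icc 0 T) := ⟨ht⟩
  have h3 : HasDerivWithinAt (fun t => ∫ τ in (0 : ℝ)..t, e' τ) (e' t) (Icc 0 T) t :=
    intervalIntegral.integral_hasDerivWithinAt_right
      ((he.cont_lim.mono (Icc_subset_Icc_right ht.2)).intervalIntegrable_of_Icc ht.1)
      (he.cont_lim.stronglyMeasurableAtFilter_nhdsWithin measurableSet_Icc t) (he.cont_lim t ht)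
  exact (h3.const_add (E' 0)).congr (fun τ hτ => key τ hτ) (key t ht)

end BddTendsto

/-! ### Mollified families -/

theorem norm_moll_le (k : Fin d → ℝ) (N : ℕ) (j) : ‖(moll N (freq k j) : ℂ)‖ ≤ 1 := by
  rw [Complex.norm_real, Real.norm_of_nonneg (moll_pos _ _).le]; exact moll_le_one _ _

theorem moll_mul_lam (k : Fin d → ℝ) (N : ℕ) (j) : moll N (freq k j) * lam k j ≤ 2 * (N + 1) := by
  refine le_trans (mul_le_mul_of_nonneg_left ?_ (moll_pos _ _).le) (moll_mul_sq N (freq k j))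
  rw [sq]
  exact le_mul_of_one_le_left (lam_pos k j).le (one_le_lam k j)

theorem norm_moll_freq_le (k : Fin d → ℝ) (N : ℕ) (j) :
    ‖Complex.I * (freq k j : ℂ) * (moll N (freq k j) : ℂ)‖ ≤ 2 * (N + 1) := by
  rw [norm_mul, norm_mul, Complex.norm_I, one_mul, Complex.norm_real, Complex.norm_real,
    Real.norm_eq_abs, Real.norm_of_nonneg (moll_pos _ _).le, mul_comm]
  exact (mul_le_mul_of_nonneg_left (abs_freq_le_lam k j) (moll_pos _ _).le).trans (moll_mul_lam k N j)

/-- The mollifier. -/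
def mollOp (k : Fin d → ℝ) (N : ℕ) : Seq d 2 →L[ℂ] Seq d 2 := diag 2 _ 1 (norm_moll_le k N)

/-- The derivative of the mollifier. -/
def mollD (k : Fin d → ℝ) (N : ℕ) : Seq d 2 →L[ℂ] Seq d 2 := diag 2 _ _ (norm_moll_freq_le k N)

theorem mollOp_apply (k : Fin d → ℝ) (N : ℕ) (x : Seq d 2) (j) :
    mollOp k N x j = (moll N (freq k j) : ℂ) * x j := rfl

theorem mollD_apply (k : Fin d → ℝ) (N : ℕ) (x : Seq d 2) (j) :
    mollD k N x j = Complex.I * (freq k j : ℂ) * (moll N (freq k j) : ℂ) * x j := rfl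

theorem isDα_mollD (k : Fin d → ℝ) (N : ℕ) (x : Seq d 2) : IsDα k (mollOp k N x) (mollD k N x) :=
  fun j => by rw [mollOp_apply, mollD_apply]; ring

theorem BddTendsto.mollOp (k : Fin d → ℝ) {I : Set ℝ} (hI : IsCompact I) {x : ℝ → Seq d 2}
    (hx : ContinuousOn x I) : BddTendsto I (fun N t => mollOp k N (x t)) x where
  cont N := (QPWaterWaves.mollOp k N).continuous.comp_continuousOn hx
  cont_lim := hx
  bdd := by
    obtain ⟨K, hK⟩ := hI.exists_bound_of_continuousOn hx
    refine ⟨K, fun N t ht => ((QPWaterWaves.mollOp k N).le_opNorm _).trans ?_⟩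
    exact (mul_le_of_le_one_left (norm_nonneg _) (diag_norm_le _ _ _ _)).trans (hK t ht)
  lim t _ := by
    have := diag_tendsto (p := 2) (fun N j => (moll N (freq k j) : ℂ)) (fun _ => 1) 1 (norm_moll_le k)
      (by simp) (fun j => by
        have := (Complex.continuous_ofReal.tendsto _).comp (tendsto_moll (freq k j))
        simpa [Function.comp_def] using this) (x t)
    have e : diag 2 (fun _ : Fin d → ℤ => (1 : ℂ)) 1 (fun _ => by simp) (x t) = x t := by ext j; simp
    rwa [e] at this

theorem BddTendsto.comm {k : Fin d → ℝ} {a c θ : ℝ} {σ : (Fin d → ℤ) → ℂ} {I : Set ℝ}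
    (hI : IsCompact I) {u : ℝ → Seq d 1} {v : ℝ → Seq d 2} (hu : ContinuousOn u I)
    (hv : ContinuousOn v I) (hK : ∀ N l n, ‖comKer k a c θ σ N l n‖ ≤ 3) :
    BddTendsto I (fun N t => bil 2 (comKer k a c θ σ N) 3 (hK N) (u t) (v t)) (fun _ => 0) where
  cont N := ((bil 2 _ 3 (hK N)).continuous.comp_continuousOn hu).clm_apply hv
  cont_lim := continuousOn_const
  bdd := by
    obtain ⟨K, h1⟩ := hI.exists_bound_of_continuousOn hu
    obtain ⟨K', h2⟩ := hI.exists_bound_of_continuousOn hv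
    refine ⟨3 * (K * K'), fun N t ht => (bil_le _ _ _ _ _ _).trans ?_⟩
    have h3 := h1 t ht
    have := mul_le_mul h3 (h2 t ht) (norm_nonneg _) ((norm_nonneg _).trans h3)
    linarith
  lim t _ := bil_tendsto_zero _ 3 hK comKer_tendsto (u t) (v t)

/-! ### The energy estimate for the diagonalized system -/

theorem wt_half_mul_self (k : Fin d → ℝ) (j) : wt k (1 / 2) j * wt k (1 / 2) j = lam k j := by
  rw [← sq, wt_half_sq]

/-- The mollified unknowns satisfy the same equation, the two commutators being moved into the
source. -/
theorem moll_apply_left {k : Fin d → ℝ} {b q w r f : PerFun d} {b₀ b₁ q₀ qh : Seq d 1}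
    {ω ρ₀ rh f₀ : Seq d 2} (hb₀ : ⇑b₀ = b) (hb₁ : ∀ j, b₁ j = (wt k (1 + 0) j : ℂ) * b j) (hq₀ : ⇑q₀ = q)
    (hqh : ∀ j, qh j = (wt k (1 / 2 + 0) j : ℂ) * q j) (hω : ⇑ω = w) (hr₀ : ⇑ρ₀ = r)
    (hrh : ∀ j, rh j = (wt k (1 / 2) j : ℂ) * r j) (hf : ⇑f₀ = f)
    (h₁ : Conv b (dα k w)) (h₂ : Conv q (dα k r)) (N : ℕ)
    (hK₁ : ∀ l n, ‖comKer k 1 0 0 (fun j => Complex.I * (freq k j : ℂ)) N l n‖ ≤ 3)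
    (hK₂ : ∀ l n, ‖comKer k (1 / 2) 0 (1 / 2) (fun j => Complex.I * (freq k j : ℂ)) N l n‖ ≤ 3) (j) :
    (moll N (freq k j) : ℂ) * (-b ⊡ dα k w - q ⊡ dα k r + f) j =
      (-(b₀ • mollD k N ω) - q₀ • mollD k N ρ₀ + (mollOp k N f₀ - bil 2 _ 3 hK₁ b₁ ω -
        bil 2 _ 3 hK₂ qh rh)) j := by
  have hD : ∀ x : Seq d 2, (fun j => (moll N (freq k j) : ℂ) * (Complex.I * (freq k j : ℂ) * x j)) =
      ⇑(mollD k N x) := fun x => funext fun j => by rw [mollD_apply]; ring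
  have m₁ := moll_mul_comm hb₁ (v := w) (V := ω) (θ := 0) (fun j => by
    rw [wt_zero, ← hω]; simp) N hK₁ h₁ (by
      rw [← hω, hD, ← hb₀]; exact fun n => (mem_coe b₀).summable_mul (mem_coe _) n) j
  have m₂ := moll_mul_comm hqh hrh N hK₂ h₂ (by
      rw [← hr₀, hD, ← hq₀]; exact fun n => (mem_coe q₀).summable_mul (mem_coe _) n) j
  have e₁ := congrFun (coe_smul b₀ (mollD k N ω)) j
  have e₂ := congrFun (coe_smul q₀ (mollD k N ρ₀)) j
  simp only [wt_zero, Complex.ofReal_one, one_mul] at m₁ m₂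
  rw [← hD, hω, hb₀] at e₁
  rw [← hD, hr₀, hq₀] at e₂
  rw [lp.coeFn_add, lp.coeFn_sub, lp.coeFn_neg, lp.coeFn_sub, lp.coeFn_sub]
  simp only [Pi.add_apply, Pi.sub_apply, Pi.neg_apply]
  rw [e₁, e₂, mollOp_apply, hf, neg_mul', Pi.neg_apply]
  have m₁' : (moll N (freq k j) : ℂ) * (b ⊡ dα k w) j = _ := m₁
  have m₂' : (moll N (freq k j) : ℂ) * (q ⊡ dα k r) j = _ := m₂
  linear_combination -m₁' - m₂'

/-- The commutators are estimated with half a derivative on the output; half of the derivative on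
`b`, or that of `c`, pays for it. The main terms are left with an explicit factor `λ^{1/2}`, to be
paired off in `inner_half`. -/
theorem moll_apply_right {k : Fin d → ℝ} {b c w r g : PerFun d} {b₀ b₁ c₀ ch : Seq d 1}
    {ω ρ₀ rh gh : Seq d 2} (hb₀ : ⇑b₀ = b) (hb₁ : ∀ j, b₁ j = (wt k (1 / 2 + 1 / 2) j : ℂ) * b j)
    (hc₀ : ⇑c₀ = c) (hch : ∀ j, ch j = (wt k (0 + 1 / 2) j : ℂ) * c j) (hω : ⇑ω = w) (hr₀ : ⇑ρ₀ = r)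
    (hrh : ∀ j, rh j = (wt k (1 / 2) j : ℂ) * r j) (hgh : ∀ j, gh j = (wt k (1 / 2) j : ℂ) * g j)
    (h₁ : Conv b (dα k r)) (N : ℕ)
    (hK₁ : ∀ l n, ‖comKer k (1 / 2) (1 / 2) (1 / 2) (fun j => Complex.I * (freq k j : ℂ)) N l n‖ ≤ 3)
    (hK₂ : ∀ l n, ‖comKer k 0 (1 / 2) 0 (fun _ => 1) N l n‖ ≤ 3) (j) :
    (wt k (1 / 2) j : ℂ) * ((moll N (freq k j) : ℂ) * (-b ⊡ dα k r + Complex.I • (c ⊡ w) + g) j) =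
      (wt k (1 / 2) j : ℂ) * (-(b₀ • mollD k N ρ₀) + Complex.I • (c₀ • mollOp k N ω)) j +
        (mollOp k N gh - bil 2 _ 3 hK₁ b₁ rh + Complex.I • bil 2 _ 3 hK₂ ch ω) j := by
  have hD : ∀ x : Seq d 2, (fun j => (moll N (freq k j) : ℂ) * (Complex.I * (freq k j : ℂ) * x j)) =
      ⇑(mollD k N x) := fun x => funext fun j => by rw [mollD_apply]; ring
  have hO : ∀ x : Seq d 2, (fun j => (moll N (freq k j) : ℂ) * (1 * x j)) = ⇑(mollOp k N x) :=
    fun x => funext fun j => by rw [mollOp_apply]; ring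
  have m₁ := moll_mul_comm hb₁ hrh N hK₁ h₁ (by
      rw [← hr₀, hD, ← hb₀]; exact fun n => (mem_coe b₀).summable_mul (mem_coe _) n) j
  have m₂ := moll_mul_comm hch (v := w) (V := ω) (θ := 0) (fun j => by
    rw [wt_zero, ← hω]; simp) N hK₂ (by
      simp only [one_mul]
      rw [← hω, ← hc₀]; exact fun n => (mem_coe c₀).summable_mul (mem_coe _) n) (by
      rw [← hω, hO, ← hc₀]; exact fun n => (mem_coe c₀).summable_mul (mem_coe _) n) j
  have e₁ := congrFun (coe_smul b₀ (mollD k N ρ₀)) j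
  have e₂ := congrFun (coe_smul c₀ (mollOp k N ω)) j
  rw [← hD, hr₀, hb₀] at e₁
  rw [← hO, hω, hc₀] at e₂
  have m₁' : (wt k (1 / 2) j : ℂ) * ((moll N (freq k j) : ℂ) * (b ⊡ dα k r) j) = _ := m₁
  have e₃ : (fun j => (1 : ℂ) * w j) = w := funext fun j => one_mul _
  rw [e₃] at m₂
  rw [lp.coeFn_add, lp.coeFn_neg, lp.coeFn_smul, lp.coeFn_add, lp.coeFn_sub, lp.coeFn_smul]
  simp only [Pi.add_apply, Pi.sub_apply, Pi.neg_apply, Pi.smul_apply, smul_eq_mul]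
  rw [e₁, e₂, mollOp_apply, hgh, neg_mul', Pi.neg_apply]
  linear_combination -m₁' + Complex.I * m₂

/-- On negative frequencies `λ = 1 - ξ`, the symbol of `1 + i∂_α`. The two half weights in the
pairing thus combine into a differential operator, and no fractional derivative remains in the main
terms. -/
theorem inner_half {k : Fin d → ℝ} {r : PerFun d} {ρ₀ rh κ v ψ : Seq d 2} (hol : IsHol k r)
    (hr₀ : ⇑ρ₀ = r) (hrh : ∀ j, rh j = (wt k (1 / 2) j : ℂ) * r j) (N : ℕ)
    (h : ∀ j, κ j = (wt k (1 / 2) j : ℂ) * v j + ψ j) :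
    inner ℂ (mollOp k N rh) κ =
      inner ℂ (mollOp k N ρ₀ + Complex.I • mollD k N ρ₀) v + inner ℂ (mollOp k N rh) ψ := by
  have e : κ = (κ - ψ) + ψ := by abel
  rw [e, inner_add_right]
  congr 1
  rw [inner_seq, inner_seq]
  refine tsum_congr fun j => ?_
  have e1 : (κ - ψ) j = (wt k (1 / 2) j : ℂ) * v j := by
    rw [lp.coeFn_sub, Pi.sub_apply, h]; ring
  have e2 : (wt k (1 / 2) j : ℂ) * mollOp k N rh j = (mollOp k N ρ₀ + Complex.I • mollD k N ρ₀) j := by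
    rw [lp.coeFn_add, lp.coeFn_smul, Pi.add_apply, Pi.smul_apply, smul_eq_mul, mollOp_apply, mollOp_apply,
      mollD_apply, hrh, hr₀]
    have e3 : (wt k (1 / 2) j : ℂ) * wt k (1 / 2) j = lam k j := by
      rw [← Complex.ofReal_mul, wt_half_mul_self]
    by_cases hj : 0 ≤ freq k j
    · rw [hol j hj]; simp
    · have e4 : lam k j = 1 - freq k j := by rw [lam, abs_of_neg (by linarith)]; ring
      have e5 : (lam k j : ℂ) = 1 - freq k j := by rw [e4]; push_cast; ring
      linear_combination (moll N (freq k j) : ℂ) * r j * (e3 + e5) -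
        (freq k j : ℂ) * moll N (freq k j) * r j * Complex.I_mul_I
  rw [e1, ← e2, star_mul', Complex.star_def, Complex.conj_ofReal]
  ring

/-- The energy of the diagonalized system. -/
def energy (k : Fin d → ℝ) (ρ w r : PerFun d) : ℝ :=
  (∑' j, star (w j) * (ρ ⊡ w) j).re + ∑' j, lam k j * ‖r j‖ ^ 2

theorem energy_eq {k : Fin d → ℝ} {ρ w r : PerFun d} {ρ₀ : Seq d 1} {ω rh : Seq d 2} (hρ : ⇑ρ₀ = ρ)
    (hω : ⇑ω = w) (hrh : ∀ j, rh j = (wt k (1 / 2) j : ℂ) * r j) :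
    energy k ρ w r = (inner ℂ ω (ρ₀ • ω) + inner ℂ rh rh).re := by
  rw [energy, Complex.add_re, inner_seq, coe_smul, hρ, hω]
  congr 1
  have h : (inner ℂ rh rh).re = ‖rh‖ ^ 2 := inner_self_eq_norm_sq (𝕜 := ℂ) rh
  rw [h, l2_norm_sq]
  refine tsum_congr fun j => ?_
  rw [hrh, norm_mul, mul_pow, Complex.norm_real, Real.norm_of_nonneg (wt_pos _ _ _).le, wt_half_sq]

theorem CB.exists_lift_zero {p : ENNReal} [Fact (1 ≤ p)] {k : Fin d → ℝ} {I : Set ℝ}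
    {u : ℝ → PerFun d} {β : ℝ → ℝ} (hu : CB p (wt k 0) I u β) :
    ∃ U : ℝ → Seq d p, ContinuousOn U I ∧ (∀ t ∈ I, ⇑(U t) = u t) ∧ ∀ t ∈ I, ‖U t‖ ≤ β t := by
  obtain ⟨U, h1, h2⟩ := hu
  exact ⟨U, h1, fun t ht => funext fun j => by rw [(h2 t ht).1, wt_zero]; simp,
    fun t ht => (h2 t ht).2⟩

theorem norm_freq_le (k : Fin d → ℝ) (n) : ‖Complex.I * (freq k n : ℂ)‖ ≤ lam k n := by
  rw [norm_mul, Complex.norm_I, one_mul, Complex.norm_real, Real.norm_eq_abs]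
  exact abs_freq_le_lam k n

-- The bounds named `γ` express regularity needed to justify the computation and do not occur in the
-- conclusion. What remains after the cancellations involves the `ℓ^1` norms `β₁`, …, `β₄` of `b_α`,
-- `ρ`, `G` and `c`, and the norms of the unknowns and sources.
set_option maxHeartbeats 2000000 in
theorem hasDerivWithinAt_energy {k : Fin d → ℝ} {T : ℝ} {b ρ G q c w f r g : ℝ → PerFun d}
    {γb γρ γq γc β₁ β₂ β₃ β₄ Nw Nf Nr Nr₀ Ng : ℝ → ℝ}
    (hb : CB 1 (wt k 1) (Icc 0 T) b γb) (hb' : CB 1 (wt k 0) (Icc 0 T) (fun t => dα k (b t)) β₁)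
    (hρ : CB 1 (wt k 1) (Icc 0 T) ρ γρ) (hρ₀ : CB 1 (wt k 0) (Icc 0 T) ρ β₂)
    (hG : CB 1 (wt k 0) (Icc 0 T) G β₃) (hq : CB 1 (wt k (1 / 2)) (Icc 0 T) q γq)
    (hc : CB 1 (wt k (1 / 2)) (Icc 0 T) c γc) (hc₀ : CB 1 (wt k 0) (Icc 0 T) c β₄)
    (hw : CB 2 (wt k 0) (Icc 0 T) w Nw) (hf : CB 2 (wt k 0) (Icc 0 T) f Nf)
    (hr : CB 2 (wt k (1 / 2)) (Icc 0 T) r Nr) (hr₀ : CB 2 (wt k 0) (Icc 0 T) r Nr₀)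
    (hg : CB 2 (wt k (1 / 2)) (Icc 0 T) g Ng)
    (b_real : ∀ t ∈ Icc 0 T, bar (b t) = b t) (ρ_real : ∀ t ∈ Icc 0 T, bar (ρ t) = ρ t)
    (c_eq : ∀ t ∈ Icc 0 T, c t = ρ t ⊡ bar (q t)) (hol : ∀ t ∈ Icc 0 T, IsHol k (r t))
    (dρ : ∀ t ∈ Icc 0 T, ∀ j, HasDerivWithinAt (fun τ => ρ τ j)
      ((-(b t) ⊡ dα k (ρ t) + G t) j) (Icc 0 T) t)
    (dw : ∀ t ∈ Icc 0 T, ∀ j, HasDerivWithinAt (fun τ => w τ j)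
      ((-(b t) ⊡ dα k (w t) - q t ⊡ dα k (r t) + f t) j) (Icc 0 T) t)
    (dr : ∀ t ∈ Icc 0 T, ∀ j, HasDerivWithinAt (fun τ => r τ j)
      ((-(b t) ⊡ dα k (r t) + Complex.I • (c t ⊡ w t) + g t) j) (Icc 0 T) t) :
    ∀ t ∈ Icc 0 T, ∃ e, HasDerivWithinAt (fun τ => energy k (ρ τ) (w τ) (r τ)) e (Icc 0 T) t ∧
      |e| ≤ (β₁ t * β₂ t + β₃ t) * Nw t ^ 2 + 2 * (Nf t * (β₂ t * Nw t)) + β₁ t * Nr₀ t ^ 2 +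
        2 * (Nr₀ t * (β₄ t * Nw t)) + 2 * (Nr t * Ng t) := by
  have hI : IsCompact (Icc 0 T) := isCompact_Icc
  -- The time derivative of `r` is only of order `-1/2`, because of `b r_α`, while the energy needs
  -- order `1/2`; this forces the mollification.
  have hr' := ((hb.lower (θ' := 1 / 2) (by norm_num)).neg.mul_wt_neg (by norm_num)
    (hr.dα (θ' := -(1 / 2)) (by norm_num))).add
      (((hc₀.mul_wt le_rfl hw).lower (θ' := -(1 / 2)) (by norm_num)).smul Complex.I) |>.add
      (hg.lower (θ' := -(1 / 2)) (by norm_num))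
  have conv_b : ∀ t ∈ Icc 0 T, Conv (b t) (dα k (w t)) := fun t ht =>
    (hb.mem ht).conv zero_le_one ((hw.mem ht).dα (by norm_num))
  have conv_br : ∀ t ∈ Icc 0 T, Conv (b t) (dα k (r t)) := fun t ht =>
    (hb.mem ht).conv zero_le_one ((hr.mem ht).dα (by norm_num))
  have conv_q : ∀ t ∈ Icc 0 T, Conv (q t) (dα k (r t)) := fun t ht =>
    (hq.mem ht).conv (by norm_num) ((hr.mem ht).dα (by norm_num))
  obtain ⟨b₀, cb₀, eb₀, -⟩ := (hb.lower (θ' := 0) zero_le_one).exists_lift_zero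
  obtain ⟨b', cb', eb', nb'⟩ := hb'.exists_lift_zero
  obtain ⟨b₁, cb₁, hb₁⟩ := hb
  obtain ⟨ρ', cρ', eρ', -⟩ := (hρ.dα (θ' := 0) (by norm_num)).exists_lift_zero
  obtain ⟨ρ₀, cρ₀, eρ₀, nρ₀⟩ := hρ₀.exists_lift_zero
  obtain ⟨G₀, cG, eG, nG⟩ := hG.exists_lift_zero
  obtain ⟨q₀, cq₀, eq₀, -⟩ := (hq.lower (θ' := 0) (by norm_num)).exists_lift_zero
  obtain ⟨qh, cqh, hqh⟩ := hq
  obtain ⟨c₀, cc₀, ec₀, nc₀⟩ := hc₀.exists_lift_zero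
  obtain ⟨ch, cch, hch⟩ := hc
  obtain ⟨ω, cω, eω, nω⟩ := hw.exists_lift_zero
  obtain ⟨f₀, cf₀, ef₀, nf₀⟩ := hf.exists_lift_zero
  obtain ⟨rh, crh, hrh⟩ := hr
  obtain ⟨r₀, cr₀, er₀, nr₀⟩ := hr₀.exists_lift_zero
  obtain ⟨gh, cgh, hgh⟩ := hg
  have smul_cont : ∀ {u : ℝ → Seq d 1} {x : ℝ → Seq d 2}, ContinuousOn u (Icc 0 T) →
      ContinuousOn x (Icc 0 T) → ContinuousOn (fun t => u t • x t) (Icc 0 T) := fun hu hx =>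
    ((convCLM 2).continuous.comp_continuousOn hu).clm_apply hx
  -- the derivative of the density
  have Dρ : ∀ t ∈ Icc 0 T, HasDerivWithinAt ρ₀ (-(b₀ t * ρ' t) + G₀ t) (Icc 0 T) t :=
    hasDerivWithinAt_of_coord ((cb₀.mul cρ').neg.add cG) fun t ht j => by
      have e : (-(b₀ t * ρ' t) + G₀ t : Seq d 1) j = (-(b t) ⊡ dα k (ρ t) + G t) j := by
        rw [lp.coeFn_add, lp.coeFn_neg, coe_mul, eb₀ t ht, eρ' t ht, eG t ht, neg_mul']
      rw [e]
      exact (dρ t ht j).congr (fun τ hτ => by rw [eρ₀ τ hτ]) (by rw [eρ₀ t ht])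
  -- commutators
  have K₁ : ∀ N l n, ‖comKer k 1 0 0 (fun j => Complex.I * (freq k j : ℂ)) N l n‖ ≤ 3 :=
    comKer_le zero_le_one le_rfl (by norm_num) fun n => by
      rw [add_zero, wt_one]; exact norm_freq_le k n
  have K₂ : ∀ N l n, ‖comKer k (1 / 2) 0 (1 / 2) (fun j => Complex.I * (freq k j : ℂ)) N l n‖ ≤ 3 :=
    comKer_le (by norm_num) le_rfl (by norm_num) fun n => by
      rw [add_halves, wt_one]; exact norm_freq_le k n
  have K₃ : ∀ N l n,
      ‖comKer k (1 / 2) (1 / 2) (1 / 2) (fun j => Complex.I * (freq k j : ℂ)) N l n‖ ≤ 3 :=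
    comKer_le (by norm_num) (by norm_num) (by norm_num) fun n => by
      rw [add_halves, wt_one]; exact norm_freq_le k n
  have K₄ : ∀ N l n, ‖comKer k 0 (1 / 2) 0 (fun _ => 1) N l n‖ ≤ 3 :=
    comKer_le le_rfl (by norm_num) (by norm_num) fun n => by simp [wt_zero]
  let φ : ℕ → ℝ → Seq d 2 := fun N t => mollOp k N (f₀ t) - bil 2 _ 3 (K₁ N) (b₁ t) (ω t) -
    bil 2 _ 3 (K₂ N) (qh t) (rh t)
  let ψ : ℕ → ℝ → Seq d 2 := fun N t => mollOp k N (gh t) - bil 2 _ 3 (K₃ N) (b₁ t) (rh t) +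
    Complex.I • bil 2 _ 3 (K₄ N) (ch t) (ω t)
  have Bφ : BddTendsto (Icc 0 T) φ f₀ := by
    have h := ((BddTendsto.mollOp k hI cf₀).sub (BddTendsto.comm hI cb₁ cω K₁)).sub
      (BddTendsto.comm hI cqh crh K₂)
    simp only [sub_zero] at h
    exact h
  have Bψ : BddTendsto (Icc 0 T) ψ gh := by
    have h := ((BddTendsto.mollOp k hI cgh).sub (BddTendsto.comm hI cb₁ crh K₃)).add
      ((BddTendsto.comm hI cch cω K₄).smul Complex.I)
    simp only [sub_zero, smul_zero, add_zero] at h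
    exact h
  have Bx := BddTendsto.mollOp k hI cω
  have By := BddTendsto.mollOp k hI cr₀
  have Bh := BddTendsto.mollOp k hI crh
  let X' : ℕ → ℝ → Seq d 2 := fun N t =>
    -(b₀ t • mollD k N (ω t)) - q₀ t • mollD k N (r₀ t) + φ N t
  have Dx : ∀ N, ∀ t ∈ Icc 0 T,
      HasDerivWithinAt (fun τ => mollOp k N (ω τ)) (X' N t) (Icc 0 T) t := fun N =>
    hasDerivWithinAt_of_coord
      (((smul_cont cb₀ ((mollD k N).continuous.comp_continuousOn cω)).neg.sub
        (smul_cont cq₀ ((mollD k N).continuous.comp_continuousOn cr₀))).add (Bφ.cont N)) fun t ht j => by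
      rw [← moll_apply_left (eb₀ t ht) (by simpa using (hb₁ t ht).1) (eq₀ t ht)
        (by simpa using (hqh t ht).1) (eω t ht) (er₀ t ht) (hrh t ht).1 (ef₀ t ht) (conv_b t ht)
        (conv_q t ht)]
      exact ((dw t ht j).const_mul (moll N (freq k j) : ℂ)).congr
        (fun τ hτ => by rw [mollOp_apply, eω τ hτ]) (by rw [mollOp_apply, eω t ht])
  -- the derivative of the mollification of `r`
  have Dh : ∀ N, ∃ κ : ℝ → Seq d 2, ∀ t ∈ Icc 0 T,
      HasDerivWithinAt (fun τ => mollOp k N (rh τ)) (κ t) (Icc 0 T) t ∧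
      inner ℂ (mollOp k N (rh t)) (κ t) =
        inner ℂ (mollOp k N (r₀ t) + Complex.I • mollD k N (r₀ t))
          (-(b₀ t • mollD k N (r₀ t)) + Complex.I • (c₀ t • mollOp k N (ω t))) +
        inner ℂ (mollOp k N (rh t)) (ψ N t) := fun N => by
    -- For fixed `N` the mollifier gains a full derivative, with constant `2 (N + 1)`, which makes
    -- `λ^{1/2}` of the derivative of `r` square summable. The constant does not survive in the
    -- limit.
    obtain ⟨κ, cκ, eκ, -⟩ := (hr'.mult (m' := wt k 0)
      (fun j => (wt k (1 / 2) j : ℂ) * (moll N (freq k j) : ℂ)) (K := 2 * (N + 1)) (wt_pos k _)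
      fun j => by
        have h1 : wt k (1 / 2) j = lam k j * wt k (-(1 / 2)) j := by
          rw [← wt_one, ← wt_add]; norm_num
        rw [wt_zero, abs_one, mul_one, norm_mul, Complex.norm_real, Complex.norm_real,
          Real.norm_of_nonneg (wt_pos _ _ _).le, Real.norm_of_nonneg (moll_pos _ _).le, h1]
        have h2 := mul_le_mul_of_nonneg_right (moll_mul_lam k N j) (wt_pos k (-(1 / 2)) j).le
        linarith).exists_lift_zero
    have hκ := hasDerivWithinAt_of_coord (U := fun τ => mollOp k N (rh τ)) cκ fun t ht j => by
      rw [eκ t ht]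
      refine ((dr t ht j).const_mul ((wt k (1 / 2) j : ℂ) * (moll N (freq k j) : ℂ))).congr
        (fun τ hτ => ?_) ?_
      · rw [mollOp_apply, (hrh τ hτ).1]; ring
      · rw [mollOp_apply, (hrh t ht).1]; ring
    refine ⟨κ, fun t ht => ⟨hκ t ht, ?_⟩⟩
    refine inner_half (hol t ht) (er₀ t ht) (hrh t ht).1 N fun j => ?_
    rw [← moll_apply_right (eb₀ t ht) (by rw [add_halves]; exact (hb₁ t ht).1) (ec₀ t ht)
      (by simpa using (hch t ht).1) (eω t ht) (er₀ t ht) (hrh t ht).1 (hgh t ht).1 (conv_br t ht) N,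
      eκ t ht]
    exact mul_assoc _ _ _
  let F : ℕ → ℝ → ℝ := fun N t => (inner ℂ (mollOp k N (ω t)) (ρ₀ t • mollOp k N (ω t)) +
    inner ℂ (mollOp k N (rh t)) (mollOp k N (rh t))).re
  let e : ℕ → ℝ → ℝ := fun N t =>
    (inner ℂ (mollOp k N (ω t)) ((b' t * ρ₀ t + G₀ t) • mollOp k N (ω t)) +
      (2 : ℂ) • inner ℂ (φ N t) (ρ₀ t • mollOp k N (ω t)) +
      inner ℂ (mollOp k N (r₀ t)) (b' t • mollOp k N (r₀ t)) +
      (2 : ℂ) • inner ℂ (mollOp k N (r₀ t)) (Complex.I • (c₀ t • mollOp k N (ω t))) +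
      (2 : ℂ) • inner ℂ (mollOp k N (rh t)) (ψ N t)).re
  have bar_coe : ∀ {u : Seq d 1} {v : PerFun d}, ⇑u = v → bar v = v → CB.barSeq u = u := fun h1 h2 => by
    refine lp.ext ?_
    change bar _ = _
    rw [h1, h2]
  have DF : ∀ N, ∀ t ∈ Icc 0 T, HasDerivWithinAt (F N) (e N t) (Icc 0 T) t := fun N t ht => by
    obtain ⟨κ, hκ⟩ := Dh N
    obtain ⟨h1, h2⟩ := hκ t ht
    have h3 : HasDerivWithinAt (fun τ => ρ₀ τ • mollOp k N (ω τ))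
        ((-(b₀ t * ρ' t) + G₀ t) • mollOp k N (ω t) + ρ₀ t • X' N t) (Icc 0 T) t :=
      hasDerivWithinAt_bilin (convCLM 2) (convCLM 2) (Dρ t ht)
        (Dx N t ht).continuousWithinAt (Dx N t ht) fun τ hτ => by
          change convCLM 2 _ _ - convCLM 2 _ _ = _
          rw [map_sub, _root_.sub_apply, map_sub]
          abel
    have h4 := ((Dx N t ht).inner ℂ h3).add (h1.inner ℂ h1)
    have h5 := Complex.reCLM.hasFDerivAt.comp_hasDerivWithinAt t h4
    refine h5.congr_deriv ?_
    have h6 := energy_algebra (k := k) (b := b₀ t) (b' := b' t) (ρ := ρ₀ t) (ρ' := ρ' t) (q := q₀ t)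
      (c := c₀ t) (G := G₀ t) (φ := φ N t)
      (fun j => by rw [eb' t ht, eb₀ t ht]; rfl) (fun j => by rw [eρ' t ht, eρ₀ t ht]; rfl)
      (isDα_mollD k N (ω t)) (isDα_mollD k N (r₀ t)) (bar_coe (eb₀ t ht) (b_real t ht))
      (bar_coe (eρ₀ t ht) (ρ_real t ht)) (by
        refine lp.ext ?_
        change (⇑(c₀ t) : PerFun d) = ⇑(ρ₀ t * CB.barSeq (q₀ t))
        rw [coe_mul, ec₀ t ht, eρ₀ t ht, c_eq t ht, ← eq₀ t ht]; rfl)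
    have h7 : (inner ℂ (κ t) (mollOp k N (rh t))).re = (inner ℂ (mollOp k N (rh t)) (κ t)).re := by
      rw [← inner_conj_symm, Complex.conj_re]
    have two_re' : ∀ z : ℂ, ((2 : ℂ) • z).re = 2 * z.re := fun z => by simp
    have two_re'' : ∀ z : ℂ, (2 * z).re = 2 * z.re := fun z => by simp
    change (inner ℂ (mollOp k N (ω t)) _ + inner ℂ _ (ρ₀ t • mollOp k N (ω t)) +
      (inner ℂ (mollOp k N (rh t)) (κ t) + inner ℂ (κ t) (mollOp k N (rh t)))).re = e N t
    simp only [e, Complex.add_re, two_re', two_re''] at h6 ⊢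
    rw [h7, h2, Complex.add_re]
    linarith
  have Be : BddTendsto (Icc 0 T) e fun t => (inner ℂ (ω t) ((b' t * ρ₀ t + G₀ t) • ω t) +
      (2 : ℂ) • inner ℂ (f₀ t) (ρ₀ t • ω t) + inner ℂ (r₀ t) (b' t • r₀ t) +
      (2 : ℂ) • inner ℂ (r₀ t) (Complex.I • (c₀ t • ω t)) + (2 : ℂ) • inner ℂ (rh t) (gh t)).re := by
    have bρ := BddTendsto.const hI ((cb'.mul cρ₀).add cG)
    exact (((((Bx.inner (BddTendsto.bilin (convCLM 2) bρ Bx)).add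
      ((Bφ.inner (BddTendsto.bilin (convCLM 2) (BddTendsto.const hI cρ₀) Bx)).smul 2)).add
      (By.inner (BddTendsto.bilin (convCLM 2) (BddTendsto.const hI cb') By))).add
      ((By.inner ((BddTendsto.bilin (convCLM 2) (BddTendsto.const hI cc₀) Bx).smul Complex.I)).smul
        2)).add ((Bh.inner Bψ).smul 2)).re
  have BF : BddTendsto (Icc 0 T) F fun t => (inner ℂ (ω t) (ρ₀ t • ω t) + inner ℂ (rh t) (rh t)).re :=
    ((Bx.inner (BddTendsto.bilin (convCLM 2) (BddTendsto.const hI cρ₀) Bx)).add (Bh.inner Bh)).re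
  intro t ht
  refine ⟨_, (BddTendsto.hasDerivWithinAt DF BF Be t ht).congr
    (fun τ hτ => energy_eq (eρ₀ τ hτ) (eω τ hτ) (hrh τ hτ).1)
    (energy_eq (eρ₀ t ht) (eω t ht) (hrh t ht).1), ?_⟩
  have n1 : ∀ {x y : Seq d 2} {u : Seq d 1} {A A' K : ℝ}, ‖x‖ ≤ A → ‖u‖ ≤ K → ‖y‖ ≤ A' →
      ‖inner ℂ x (u • y)‖ ≤ A * (K * A') := fun {x y u A A' K} h1 h2 h3 =>
    (norm_inner_le_norm _ _).trans (mul_le_mul h1 ((norm_smul_le' _ _).trans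
      (mul_le_mul h2 h3 (norm_nonneg _) ((norm_nonneg _).trans h2))) (norm_nonneg _)
        ((norm_nonneg _).trans h1))
  have m1 := n1 (nω t ht) (u := b' t * ρ₀ t + G₀ t) (K := β₁ t * β₂ t + β₃ t)
    ((norm_add_le _ _).trans (add_le_add ((norm_mul_le _ _).trans
      (mul_le_mul (nb' t ht) (nρ₀ t ht) (norm_nonneg _) ((norm_nonneg _).trans (nb' t ht))))
        (nG t ht))) (nω t ht)
  have m2 := n1 (nf₀ t ht) (nρ₀ t ht) (nω t ht)
  have m3 := n1 (nr₀ t ht) (nb' t ht) (nr₀ t ht)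
  have m4 := n1 (nr₀ t ht) (nc₀ t ht) (nω t ht)
  have m5 : ‖inner ℂ (rh t) (gh t)‖ ≤ Nr t * Ng t := (norm_inner_le_norm _ _).trans
    (mul_le_mul (hrh t ht).2 (hgh t ht).2 (norm_nonneg _) ((norm_nonneg _).trans (hrh t ht).2))
  have e4 : inner ℂ (r₀ t) (Complex.I • (c₀ t • ω t)) = Complex.I * inner ℂ (r₀ t) (c₀ t • ω t) :=
    inner_smul_right _ _ _
  refine (Complex.abs_re_le_norm _).trans ?_
  refine (norm_add_le _ _).trans ?_
  refine (add_le_add_left ((norm_add_le _ _).trans (add_le_add_left ((norm_add_le _ _).trans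
    (add_le_add_left (norm_add_le _ _) _)) _)) _).trans ?_
  rw [e4]
  simp only [norm_smul, norm_mul, Complex.norm_I, one_mul, Complex.norm_two]
  nlinarith [m1, m2, m3, m4, m5]

/-! ### The energy estimate for the linearized equation -/

theorem cmp_zero_half (k : Fin d → ℝ) (j) : |wt k (1 / 2) j| ≤ 2 * mH k 0 (1 / 2) j := by
  rw [abs_of_pos (wt_pos k _ j), mH, zero_div, Real.rpow_zero, one_mul]
  exact wt_half_le_xi k j

theorem mH_zero_zero (k : Fin d → ℝ) : mH k 0 0 = wt k 0 := by
  ext j; rw [wt_zero, mH_zero, zero_div, Real.rpow_zero]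

theorem MemH.mem_zero {k : Fin d → ℝ} {u : PerFun d} (h : MemH k 0 0 u) : Mem 2 (wt k 0) u := by
  rw [← mH_zero_zero]; exact h.exists_lift

theorem MemH.mem_half {k : Fin d → ℝ} {u : PerFun d} (h : MemH k 0 (1 / 2) u) :
    Mem 2 (wt k (1 / 2)) u :=
  Mem.mono h.exists_lift (mH_pos k 0 (1 / 2)) (cmp_zero_half k)

theorem ContInPair.cb_zero {k : Fin d → ℝ} {I : Set ℝ} {w r : ℝ → PerFun d}
    (h : ContInPair k 0 I w r) : CB 2 (wt k 0) I w (fun t => normH k 0 0 (w t)) := by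
  rw [← mH_zero_zero]; exact h.cb.1

theorem ContInPair.cb_half {k : Fin d → ℝ} {I : Set ℝ} {w r : ℝ → PerFun d}
    (h : ContInPair k 0 I w r) :
    CB 2 (wt k (1 / 2)) I r (fun t => 2 * normH k 0 (1 / 2) (r t)) :=
  h.cb.2.weight (mH_pos k 0 (1 / 2)) (cmp_zero_half k)

theorem ContInPair.cb_right_zero {k : Fin d → ℝ} {I : Set ℝ} {w r : ℝ → PerFun d}
    (h : ContInPair k 0 I w r) : CB 2 (wt k 0) I r (fun t => normH k 0 0 (r t)) := by
  have h1 := h.cb_half.lower (θ' := 0) (by norm_num)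
  rw [← mH_zero_zero] at h1 ⊢
  exact h1.normH

theorem normH_le_of_weight {k : Fin d → ℝ} {σ θ σ' θ' : ℝ} {u : PerFun d}
    (hw : ∀ j, weight k σ θ j ≤ weight k σ' θ' j) (h : MemH k σ' θ' u) :
    normH k σ θ u ≤ normH k σ' θ' u := by
  have hle : ∀ j, weight k σ θ j * ‖u j‖ ^ 2 ≤ weight k σ' θ' j * ‖u j‖ ^ 2 := fun j =>
    mul_le_mul_of_nonneg_right (hw j) (sq_nonneg _)
  refine Real.sqrt_le_sqrt (Summable.tsum_le_tsum hle (Summable.of_nonneg_of_le (fun j => ?_) hle h) h)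
  rw [← mH_sq]
  positivity

theorem normH_zero_le {k : Fin d → ℝ} {u : PerFun d} (h : MemH k 0 (1 / 2) u) :
    normH k 0 0 u ≤ normH k 0 (1 / 2) u :=
  normH_le_of_weight (fun j => by
    simp only [weight, Real.rpow_zero, one_mul]
    exact Real.one_le_rpow (by nlinarith [sq_nonneg (freq k j)]) (by norm_num)) h

theorem ctrlA_le_ctrlB {k : Fin d → ℝ} {s : ℝ} {W R : PerFun d} (h : MemPair k s W R) :
    ctrlA k s W R ≤ ctrlB k s W R := by
  have hw : ∀ θ j, weight k (s - 1 / 2) θ j ≤ weight k s θ j := fun θ j =>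
    mul_le_mul_of_nonneg_right (Real.rpow_le_rpow_of_exponent_le (one_le_jap j) (by linarith))
      (Real.rpow_nonneg (by positivity) _)
  exact Real.sqrt_le_sqrt (add_le_add
    (pow_le_pow_left₀ (normH_nonneg _ _ _ _) (normH_le_of_weight (hw 0) h.1) 2)
    (pow_le_pow_left₀ (normH_nonneg _ _ _ _) (normH_le_of_weight (hw _) h.2) 2))

/-- The energy estimate applies with `ρ = 1 + a`, `q = 1 - Ȳ` and `c = (1 + a)(1 - Y)`. Every
resulting term carries `β`, except the pairing of `r` with `c ŵ`, which is bounded by powers of `α`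
and `‖w‖ ‖r‖`. -/
theorem hasDerivWithinAt_energy_lin {k : Fin d → ℝ} {s T : ℝ} {α β : ℝ → ℝ}
    {W R w r : ℝ → PerFun d} (h : Background k s (Icc 0 T) α β W R) (hs : IsSolution k s T W R)
    (hl : IsLinSolution k T W R w r) :
    ∀ t ∈ Icc 0 T, ∃ e, HasDerivWithinAt
        (fun τ => energy k (one + a k (R τ)) (oneSubY (W τ) ⊡ w τ) (r τ)) e (Icc 0 T) t ∧
      |e| ≤ 28 * α t ^ 27 *
        (β t * normPair k 0 (w t) (r t) ^ 2 + normH k 0 0 (w t) * normH k 0 0 (r t)) := by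
  set N : ℝ → ℝ := fun t => 2 * normPair k 0 (w t) (r t) with hN
  have cw := hl.cont.cb_zero
  have cr := hl.cont.cb_half
  have cr₀ := hl.cont.cb_right_zero
  have hα := h.V_zero.two_le
  have ow₀ : CO 2 (wt k 0) (Icc 0 T) α 0 (fun t => normH k 0 0 (w t)) w :=
    ⟨hα, wt_pos k _, cw.mono fun t _ => by simp⟩
  have ow : CO 2 (wt k 0) (Icc 0 T) α 0 N w :=
    ⟨hα, wt_pos k _, cw.mono fun t _ => by
      rw [pow_zero, one_mul]
      linarith [normH_le_left k 0 (w t) (r t), normPair_nonneg k 0 (w t) (r t)]⟩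
  have or : CO 2 (wt k (1 / 2)) (Icc 0 T) α 0 N r :=
    ⟨hα, wt_pos k _, cr.mono fun t _ => by
      rw [pow_zero, one_mul]
      linarith [normH_le_right k 0 (w t) (r t)]⟩
  have hol_w : ∀ t ∈ Icc 0 T, IsHol k (w t) := fun t ht => (hl.state t ht).hol_w
  have hol_r : ∀ t ∈ Icc 0 T, IsHol k (r t) := fun t ht => (hl.state t ht).hol_r
  have oF := h.sourceF_zero ow or hol_w hol_r
  have oG := h.sourceG_half ow or hol_w hol_r
  have oW₀ := (h.V_zero.mul le_rfl ow₀).weaken (n' := 1) le_rfl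
    (γ₁ := fun t => normH k 0 0 (w t)) (by ring)
  have oW := (h.V_zero.mul le_rfl ow).weaken (n' := 1) le_rfl (γ₁ := N) (by ring)
  have of := ((h.coefS_zero.mul le_rfl oW).add
    ((h.V_zero.mul le_rfl oF).weaken le_rfl (γ₁ := β * N) (by ring))).weaken (n' := 22) (by decide) rfl
  have oρ := (h.one_zero 0).add h.a_zero
  have cρ := (h.one_zero 1).bound.add h.a_one.bound
  obtain ⟨γ, hV⟩ := h.V_half
  have cq := hV.bar (wt_neg k (1 / 2))
  have oc := (oρ.mul le_rfl h.V_zero).weaken (n' := 5) le_rfl (γ₁ := 1) (by ring)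
  have cc := (cρ.lower (θ' := 1 / 2) (by norm_num)).mul_wt (by norm_num) hV
  have hmain := hasDerivWithinAt_energy (k := k) (T := T)
    (b := fun t => b k (W t) (R t)) (ρ := fun t => one + a k (R t))
    (G := fun t => sourceA k (b k (W t) (R t))
      (Complex.I • ((W t - a k (R t)) ⊡ oneSubY (W t))) (R t))
    (q := fun t => bar (oneSubY (W t))) (c := fun t => (one + a k (R t)) ⊡ oneSubY (W t))
    (w := fun t => oneSubY (W t) ⊡ w t)
    (f := fun t => coefS k (W t) (R t) ⊡ (oneSubY (W t) ⊡ w t) +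
      oneSubY (W t) ⊡ sourceF k (W t) (R t) (w t) (r t)) (r := r)
    (g := fun t => sourceG k (W t) (R t) (w t) (r t))
    h.b_one.bound (h.b_one.dα (θ' := 0) (by norm_num)).bound cρ oρ.bound h.sourceA_zero.bound cq cc
    oc.bound oW₀.bound of.bound or.bound cr₀ oG.bound (fun t _ => bar_b k _ _)
    (fun t _ => by rw [bar_add, bar_one, bar_a]) (fun t _ => by rw [bar_bar]) hol_r
    (fun t ht j => by
      have h1 := (hasDerivWithinAt_a h hs t ht j).const_add ((one : PerFun d) j)
      rw [dα_add, dα_one, zero_add]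
      exact h1)
    (hasDerivWithinAt_hat h hs hl ow.bound or.bound oF.bound)
    (fun t ht j => by
      have h1 := hl.eq_r t ht j
      rwa [h.hat_right ht (hl.state t ht).mem.1.mem_zero] at h1)
  intro t ht
  obtain ⟨e, he, hb⟩ := hmain t ht
  refine ⟨e, he, hb.trans ?_⟩
  have hβ : 0 ≤ β t := h.R_one.nonneg ht
  have hx := normH_nonneg k 0 0 (w t)
  have hy := normH_nonneg k 0 0 (r t)
  have hxP := normH_le_left k 0 (w t) (r t)
  have hyP := (normH_zero_le (hl.state t ht).mem.2).trans (normH_le_right k 0 (w t) (r t))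
  have hP := normPair_nonneg k 0 (w t) (r t)
  have h2 := hα t ht
  have hm : 1 * 1 = 1 := rfl
  simp only [hN, Pi.one_apply, Pi.mul_apply, mul_one]
  generalize normH k 0 0 (w t) = x at *
  generalize normH k 0 0 (r t) = y at *
  generalize normPair k 0 (w t) (r t) = p at *
  generalize α t = A at *
  generalize β t = B at *
  have hA1 : (1 : ℝ) ≤ A := by linarith
  have hpow : ∀ n ≤ 27, A ^ n ≤ A ^ 27 := fun n hn => pow_le_pow_right₀ hA1 hn
  have hx2 : x ^ 2 ≤ p ^ 2 := pow_le_pow_left₀ hx hxP 2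
  have hy2 : y ^ 2 ≤ p ^ 2 := pow_le_pow_left₀ hy hyP 2
  have hxp : x * p ≤ p ^ 2 := by nlinarith
  have key : ∀ (n : ℕ), n ≤ 27 → ∀ z, 0 ≤ z → z ≤ p ^ 2 → A ^ n * (B * z) ≤ A ^ 27 * (B * p ^ 2) :=
    fun n hn z hz hzp => mul_le_mul (hpow n hn) (mul_le_mul_of_nonneg_left hzp hβ)
      (mul_nonneg hβ hz) (by positivity)
  have k1 := key 9 (by norm_num) _ (sq_nonneg x) hx2
  have k2 := key 10 (by norm_num) _ (sq_nonneg x) hx2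
  -- The largest power: `27 = 22 + 4 + 1`, from the source of the `ŵ` equation, `1 + a` and `1 - Y`.
  have k3 := key 27 le_rfl _ (mul_nonneg hx hP) hxp
  have k4 := key 3 (by norm_num) _ (sq_nonneg y) hy2
  have k5 := key 20 (by norm_num) _ (sq_nonneg p) le_rfl
  have k6 : A ^ 6 * (x * y) ≤ A ^ 27 * (x * y) :=
    mul_le_mul_of_nonneg_right (hpow 6 (by norm_num)) (mul_nonneg hx hy)
  have k7 : 0 ≤ A ^ 27 * (x * y) := by positivity
  have k8 : 0 ≤ A ^ 27 * (B * p ^ 2) := by positivity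
  norm_num
  ring_nf at k1 k2 k3 k4 k5 k6 k7 k8 ⊢
  linarith

/-! ### Positivity of the frequency shift -/

/-- A layer cake decomposition by induction on the smallest value `f a`. The constant layer `f a -
c` contributes a nonnegative multiple of a squared norm. In the rest, with `c` replaced by `f a`,
the index `a` contributes zero and the sum runs over the remaining set. -/
theorem sum_min_sub_inner_nonneg {ι E : Type*} [DecidableEq ι] [NormedAddCommGroup E]
    [InnerProductSpace ℂ E] (f : ι → ℝ) (y : ι → E) (F : Finset ι) : ∀ c, (∀ i ∈ F, c ≤ f i) →
      0 ≤ ∑ i ∈ F, ∑ j ∈ F, (min (f i) (f j) - c) * (inner ℂ (y i) (y j)).re := by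
  induction F using Finset.induction_on_min_value f with
  | empty => simp
  | insert a F ha hmin ih =>
    intro c hc
    have h1 := ih (f a) hmin
    have h2 : ∑ i ∈ insert a F, ∑ j ∈ insert a F, (min (f i) (f j) - c) * (inner ℂ (y i) (y j)).re =
        ∑ i ∈ F, ∑ j ∈ F, (min (f i) (f j) - f a) * (inner ℂ (y i) (y j)).re +
          (f a - c) * ‖∑ i ∈ insert a F, y i‖ ^ 2 := by
      have h3 : ‖∑ i ∈ insert a F, y i‖ ^ 2 =
          ∑ i ∈ insert a F, ∑ j ∈ insert a F, (inner ℂ (y i) (y j)).re := by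
        rw [← inner_self_eq_norm_sq (𝕜 := ℂ), sum_inner]
        simp only [inner_sum, map_sum]
        rfl
      have h4 : ∑ i ∈ F, ∑ j ∈ F, (min (f i) (f j) - f a) * (inner ℂ (y i) (y j)).re =
          ∑ i ∈ insert a F, ∑ j ∈ insert a F, (min (f i) (f j) - f a) * (inner ℂ (y i) (y j)).re := by
        rw [Finset.sum_insert ha]
        have h5 : ∀ j ∈ insert a F, min (f a) (f j) = f a := fun j hj => by
          rcases Finset.mem_insert.1 hj with rfl | hj
          · exact min_self _
          · exact min_eq_left (hmin j hj)
        rw [Finset.sum_eq_zero (s := insert a F) fun j hj => by rw [h5 j hj, sub_self, zero_mul],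
          zero_add]
        refine Finset.sum_congr rfl fun i hi => ?_
        rw [Finset.sum_insert ha, min_eq_right (hmin i hi), sub_self, zero_mul, zero_add]
      rw [h3, h4, Finset.mul_sum, ← Finset.sum_add_distrib]
      refine Finset.sum_congr rfl fun i _ => ?_
      rw [Finset.mul_sum, ← Finset.sum_add_distrib]
      exact Finset.sum_congr rfl fun j _ => by ring
    rw [h2]
    have := hc a (Finset.mem_insert_self _ _)
    have : 0 ≤ f a - c := by linarith
    positivity

theorem inner_shift_shift (x : Seq d 2) (l p : Fin d → ℤ) :
    inner ℂ (shift 2 (-l) x) (shift 2 (-p) x) = inner ℂ x (shift 2 (l - p) x) := by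
  rw [inner_shift]
  congr 1
  ext j
  simp only [shift_apply]
  exact congrArg (fun i => x i) (by abel)

/-- Expanded in translations, the quadratic form is `∑ min(|ξ_l|, |ξ_p|)` times the Gram matrix of
the vectors `R̄_l` times translates of `x`, over negative frequencies. Positivity of the `min`
kernel applies to finite sections; half a derivative on `R` makes the double sum absolutely
convergent. -/
theorem inner_minMul_nonneg {k : Fin d → ℝ} {R : PerFun d} (hR : Mem 1 (wt k (1 / 2)) R) {A : Seq d 1}
    (hA : ⇑A = minMul k R (bar R)) (x : Seq d 2) : 0 ≤ (inner ℂ x (A • x)).re := by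
  classical
  obtain ⟨S, hS⟩ := hR
  let F : (Fin d → ℤ) × (Fin d → ℤ) → ℂ := fun q =>
    (minKer k q.1 (-q.2) : ℂ) * R q.1 * star (R q.2) * inner ℂ x (shift 2 (q.1 - q.2) x)
  have hnorm : ∀ l, wt k (1 / 2) l * ‖R l‖ = ‖S l‖ := fun l => by
    rw [hS, norm_mul, Complex.norm_real, Real.norm_of_nonneg (wt_pos _ _ _).le]
  have hker : ∀ l p, minKer k l (-p) ≤ wt k (1 / 2) l * wt k (1 / 2) p := fun l p => by
    refine le_of_sq_le_sq ?_ (mul_pos (wt_pos _ _ _) (wt_pos _ _ _)).le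
    rw [mul_pow, wt_half_sq, wt_half_sq, sq]
    refine mul_le_mul (minKer_le_left _ _ _) ?_ (minKer_nonneg _ _ _) (lam_pos _ _).le
    have h := minKer_le_right k l (-p)
    rwa [lam_neg] at h
  have hF : Summable F := by
    refine Summable.of_norm_bounded
      (((l1_summable S).mul_of_nonneg (l1_summable S) (fun _ => norm_nonneg _)
        (fun _ => norm_nonneg _)).mul_right (‖x‖ * ‖x‖)) fun q => ?_
    have h1 : ‖inner ℂ x (shift 2 (q.1 - q.2) x)‖ ≤ ‖x‖ * ‖x‖ :=
      (norm_inner_le_norm _ _).trans (mul_le_mul_of_nonneg_left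
        (((shift 2 _).le_opNorm x).trans (by
          simpa using mul_le_mul_of_nonneg_right (shift_norm_le 2 (q.1 - q.2)) (norm_nonneg x)))
        (norm_nonneg _))
    rw [norm_mul, norm_mul, norm_mul, norm_minKer, norm_star, ← hnorm, ← hnorm]
    refine mul_le_mul ?_ h1 (norm_nonneg _) (by
      rw [hnorm, hnorm]; positivity)
    calc _ ≤ wt k (1 / 2) q.1 * wt k (1 / 2) q.2 * ‖R q.1‖ * ‖R q.2‖ := by
          gcongr; exact hker _ _
      _ = _ := by ring
  let e : (Fin d → ℤ) × (Fin d → ℤ) ≃ (Fin d → ℤ) × (Fin d → ℤ) :=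
    { toFun := fun q => (q.2, q.2 - q.1)
      invFun := fun q => (q.1 - q.2, q.1)
      left_inv := fun q => by simp
      right_inv := fun q => by simp }
  have key : inner ℂ x (A • x) = ∑' q, F q := by
    obtain ⟨c1, c2⟩ := conv_eq_tsum A x
    rw [c2]
    refine ((innerSL ℂ x).map_tsum c1).trans ?_
    refine Eq.trans ?_ (((e.summable_iff.2 hF).tsum_prod).symm.trans (e.tsum_eq F))
    refine tsum_congr fun n => ?_
    change inner ℂ x (A n • shift 2 n x) = ∑' l, F (l, l - n)
    rw [inner_smul_right, hA]
    change (∑' l, (minKer k l (n - l) : ℂ) * R l * bar R (n - l)) * _ = _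
    rw [← tsum_mul_right]
    refine tsum_congr fun l => ?_
    simp only [F, bar, neg_sub, sub_sub_cancel]
  rw [key]
  -- The double sum is exhausted by squares `G × G`, to which the finite inequality applies.
  have lim := (Complex.continuous_re.tendsto _).comp
    (hF.hasSum.comp (tendsto_finsetProd_atTop.comp
      ((tendsto_id.prodMk tendsto_id).mono_right prod_atTop_atTop_eq.le)))
  refine ge_of_tendsto' lim fun G => ?_
  have h := sum_min_sub_inner_nonneg (fun l => max (-freq k l) 0)
    (fun l => star (R l) • shift 2 (-l) x) G 0 fun i _ => le_max_right _ _
  refine h.trans_eq ?_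
  simp only [Function.comp_apply, id, Finset.sum_product, Complex.re_sum]
  refine Finset.sum_congr rfl fun l _ => Finset.sum_congr rfl fun p _ => ?_
  rw [inner_smul_left, inner_smul_right, inner_shift_shift, sub_zero]
  have e1 : minKer k l (-p) = min (max (-freq k l) 0) (max (-freq k p) 0) := by
    rw [minKer, freq_neg]
  simp only [F]
  rw [← e1, ← Complex.re_ofReal_mul]
  congr 1
  simp only [Complex.star_def, Complex.conj_conj]
  ring

/-! ### The linearized energy -/

theorem mul_bar_zero (k : Fin d → ℝ) (r : PerFun d) :
    (r ⊡ bar r) 0 = ∑' j, ((‖r j‖ ^ 2 : ℝ) : ℂ) ∧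
      (r ⊡ dα k (bar r)) 0 = ∑' j, Complex.I * ((-freq k j * ‖r j‖ ^ 2 : ℝ) : ℂ) := by
  have h : ∀ z : ℂ, z * star z = ((‖z‖ ^ 2 : ℝ) : ℂ) := fun z => by
    rw [Complex.star_def, Complex.mul_conj, Complex.normSq_eq_norm_sq]
  constructor
  · refine tsum_congr fun j => ?_
    rw [← h]; simp [bar]
  · refine tsum_congr fun j => ?_
    simp only [bar, dα, zero_sub, neg_neg, freq_neg]
    rw [Complex.ofReal_mul, ← h]
    push_cast; ring

/-- On holomorphic functions `Im (r r̄_α)` integrates to `∑ |ξ| |r_j|²` up to the volume factor;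
adding `|r|²` completes the weight `λ`. -/
theorem elin_right {k : Fin d → ℝ} {r : PerFun d} (hol : IsHol k r) (hr : Mem 2 (wt k (1 / 2)) r) :
    ((imPart (r ⊡ dα k (bar r)) + r ⊡ bar r) 0).re = ∑' j, lam k j * ‖r j‖ ^ 2 := by
  obtain ⟨x, hx⟩ := hr
  have hs : Summable fun j => lam k j * ‖r j‖ ^ 2 := (l2_summable x).congr fun j => by
    rw [hx, norm_mul, mul_pow, Complex.norm_real, Real.norm_of_nonneg (wt_pos _ _ _).le, wt_half_sq]
  have e : ∀ j, lam k j * ‖r j‖ ^ 2 = -freq k j * ‖r j‖ ^ 2 + ‖r j‖ ^ 2 := fun j => by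
    by_cases hj : 0 ≤ freq k j
    · simp [hol j hj]
    · rw [lam, abs_of_neg (not_le.1 hj)]; ring
  have h1 : Summable fun j => ‖r j‖ ^ 2 := Summable.of_nonneg_of_le (fun _ => sq_nonneg _)
    (fun j => le_mul_of_one_le_left (sq_nonneg _) (by simp [lam])) hs
  have h2 : Summable fun j => -freq k j * ‖r j‖ ^ 2 := (hs.sub h1).congr fun j => by rw [e]; ring
  obtain ⟨m1, m2⟩ := mul_bar_zero k r
  rw [tsum_congr e, h2.tsum_add h1, Pi.add_apply, Complex.add_re, m1, ← Complex.ofReal_tsum,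
    Complex.ofReal_re]
  congr 1
  simp only [imPart, Pi.smul_apply, Pi.sub_apply, bar, neg_zero, smul_eq_mul]
  rw [m2, tsum_mul_left, ← Complex.ofReal_tsum]
  generalize ∑' j, -freq k j * ‖r j‖ ^ 2 = y
  have : (1 / (2 * Complex.I)) * (Complex.I * (y : ℂ) - star (Complex.I * (y : ℂ))) = y := by
    simp only [Complex.star_def, map_mul, Complex.conj_I, Complex.conj_ofReal]
    field_simp
    ring
  rw [this, Complex.ofReal_re]

namespace Background

variable {k : Fin d → ℝ} {s : ℝ} {I : Set ℝ} {α β : ℝ → ℝ} {W R : ℝ → PerFun d}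

theorem elin_eq (h : Background k s I α β W R) {t : ℝ} (ht : t ∈ I) {w r : PerFun d}
    (hl : IsLinState k w r) :
    Elin k (W t) (R t) w r =
      (2 * Real.pi) ^ d * energy k (one + a k (R t)) (oneSubY (W t) ⊡ w) r := by
  have mρ : Mem 1 (fun _ => 1) (one + a k (R t)) := by
    rw [← wt_zero k]; exact ((h.one_zero 0).add h.a_zero).bound.mem ht
  have mV : Mem 1 (fun _ => 1) (oneSubY (W t)) := by rw [← wt_zero k]; exact h.V_zero.bound.mem ht
  have mw := hl.mem.1.mem_zero
  rw [wt_zero] at mw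
  obtain ⟨ρ, hρ⟩ := mρ
  obtain ⟨V, hV⟩ := mV
  obtain ⟨x, hx⟩ := mw
  have eρ : ⇑ρ = one + a k (R t) := funext fun j => by rw [hρ]; simp
  have eV : ⇑V = oneSubY (W t) := funext fun j => by rw [hV]; simp
  have ex : ⇑x = w := funext fun j => by rw [hx]; simp
  have eVb : ⇑(CB.barSeq V) = bar (oneSubY (W t)) := by rw [← eV]; rfl
  have exb : ⇑(CB.barSeq x) = bar w := by rw [← ex]; rfl
  have assoc : ∀ (u : Seq d 1) (y z : Seq d 2), (⇑u : PerFun d) ⊡ (y : PerFun d) ⊡ (z : PerFun d) =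
      (u : PerFun d) ⊡ ((y : PerFun d) ⊡ (z : PerFun d)) := fun u y z =>
    mul_assoc_wt_neg k (θ := 0) le_rfl ⟨u, fun j => by simp [wt_zero]⟩
      ⟨y, fun j => by simp [wt_zero]⟩ ⟨z, fun j => by simp [wt_zero]⟩
  have e1 : (one + a k (R t)) ⊡ (oneSubY (W t) ⊡ bar (oneSubY (W t))) ⊡ (w ⊡ bar w) =
      bar (oneSubY (W t) ⊡ w) ⊡ ((one + a k (R t)) ⊡ (oneSubY (W t) ⊡ w)) := by
    rw [bar_mul, ← eVb, ← exb, ← eρ, ← eV, ← ex]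
    have s1 : (⇑ρ : PerFun d) ⊡ ((V : PerFun d) ⊡ (CB.barSeq V : PerFun d)) ⊡
        ((x : PerFun d) ⊡ (CB.barSeq x : PerFun d)) =
          (⇑((ρ * (V * CB.barSeq V)) • x) : PerFun d) ⊡ (CB.barSeq x : PerFun d) := by
      rw [coe_smul, assoc, coe_mul, coe_mul]
    have s2 : (⇑ρ : PerFun d) ⊡ ((V : PerFun d) ⊡ (x : PerFun d)) = ⇑(ρ • V • x) := by
      rw [coe_smul, coe_smul]
    have s3 : (ρ * (V * CB.barSeq V)) • x = CB.barSeq V • ρ • V • x := by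
      rw [← mul_smul, ← mul_smul]
      congr 1
      ring
    rw [s1, s2, s3, assoc, mul_comm' (CB.barSeq x : PerFun d), ← assoc, coe_smul (CB.barSeq V)]
  have e2 : ∀ u v : PerFun d, (bar u ⊡ v) 0 = ∑' j, star (u j) * v j := fun u v => by
    rw [← (Equiv.neg _).tsum_eq]
    exact tsum_congr fun j => by simp [bar]
  rw [Elin, integral, energy, ← elin_right hl.hol_r hl.mem.2.mem_half, e1, add_assoc, Pi.add_apply, e2,
    Complex.re_ofReal_mul, Complex.add_re]

/-- From below: `1 + a ≥ 1` as an operator, and `w = (1 + 𝐖) ŵ` recovers `w` from `ŵ`. From above: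
`1 + a` and `1 - Y` are bounded in the Wiener algebra. The weight `λ` is comparable with `⟨ξ⟩` up to
a factor two. -/
theorem coercive (h : Background k s I α β W R) {t : ℝ} (ht : t ∈ I) {w r : PerFun d}
    (hl : IsLinState k w r) :
    normPair k 0 w r ^ 2 ≤
        α t ^ 4 * energy k (one + a k (R t)) (oneSubY (W t) ⊡ w) r ∧
      energy k (one + a k (R t)) (oneSubY (W t) ⊡ w) r ≤ α t ^ 6 * normPair k 0 w r ^ 2 := by
  have h2 := h.V_zero.two_le t ht
  obtain ⟨A, -, eA, -⟩ := h.a_zero.bound.exists_lift_zero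
  obtain ⟨ρ, -, eρ, nρ⟩ := ((h.one_zero 0).add h.a_zero).bound.exists_lift_zero
  obtain ⟨V, -, eV, nV⟩ := h.V_zero.bound.exists_lift_zero
  obtain ⟨O, -, eO, nO⟩ := h.one_add_W.bound.exists_lift_zero
  replace eA := eA t ht
  replace eρ := eρ t ht
  replace eV := eV t ht
  replace eO := eO t ht
  replace nρ := nρ t ht
  replace nV := nV t ht
  replace nO := nO t ht
  norm_num at nρ nV nO
  obtain ⟨x, hx⟩ := hl.mem.1.exists_lift
  obtain ⟨y, hy⟩ := hl.mem.2.exists_lift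
  obtain ⟨rh, hrh⟩ := hl.mem.2.mem_half
  have ex : ⇑x = w := funext fun j => by rw [hx, mH_zero_zero, wt_zero]; simp
  have eω : ⇑(V t • x) = oneSubY (W t) ⊡ w := by rw [coe_smul, eV, ex]
  have hOV : O t * V t = 1 := by
    refine lp.ext ?_
    change ⇑(O t * V t) = _
    rw [coe_mul, eO, eV, h.inv t ht]
    exact coe_one.symm
  have hρA : ρ t = 1 + A t := by
    refine lp.ext ?_
    change ⇑(ρ t) = ⇑(1 + A t)
    rw [lp.coeFn_add, coe_one, eA, eρ]
  rw [energy_eq eρ eω hrh, Complex.add_re, normPair_sq, normH_eq hx, normH_eq hy]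
  have hrr : (inner ℂ rh rh).re = ‖rh‖ ^ 2 := inner_self_eq_norm_sq (𝕜 := ℂ) rh
  rw [hrr]
  have pos := inner_minMul_nonneg (h.R_half.bound.mem ht)
    (by rw [eA]; exact a_eq_minMul (h.hol_R t ht) (h.R_half.bound.mem ht)) (V t • x)
  have low : ‖V t • x‖ ^ 2 ≤ (inner ℂ (V t • x) (ρ t • V t • x)).re := by
    have hxx : (inner ℂ (V t • x) (V t • x)).re = ‖V t • x‖ ^ 2 :=
      inner_self_eq_norm_sq (𝕜 := ℂ) _
    rw [hρA, add_smul, one_smul, inner_add_right, Complex.add_re, hxx]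
    linarith
  have hα0 : 0 ≤ α t := by linarith
  have up : (inner ℂ (V t • x) (ρ t • V t • x)).re ≤ α t ^ 6 * ‖x‖ ^ 2 := by
    have h1 : ‖V t • x‖ ≤ α t * ‖x‖ := (norm_smul_le' _ _).trans
      (mul_le_mul_of_nonneg_right nV (norm_nonneg _))
    have h3 : ‖ρ t • V t • x‖ ≤ α t ^ 4 * (α t * ‖x‖) := (norm_smul_le' _ _).trans
      (mul_le_mul nρ h1 (norm_nonneg _) (by positivity))
    calc _ ≤ ‖V t • x‖ * ‖ρ t • V t • x‖ := (Complex.re_le_norm _).trans (norm_inner_le_norm _ _)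
      _ ≤ (α t * ‖x‖) * (α t ^ 4 * (α t * ‖x‖)) := by gcongr
      _ = _ := by ring
  have hxV : ‖x‖ ≤ α t ^ 2 * ‖V t • x‖ := by
    have h1 : x = O t • V t • x := by rw [← mul_smul, hOV, one_smul]
    calc ‖x‖ = ‖O t • V t • x‖ := by rw [← h1]
      _ ≤ ‖O t‖ * ‖V t • x‖ := norm_smul_le' _ _
      _ ≤ _ := mul_le_mul_of_nonneg_right nO (norm_nonneg _)
  have sq_rh : ∀ j, ‖rh j‖ ^ 2 = lam k j * ‖r j‖ ^ 2 := fun j => by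
    rw [hrh, norm_mul, mul_pow, Complex.norm_real, Real.norm_of_nonneg (wt_pos _ _ _).le, wt_half_sq]
  have sq_y : ∀ j, ‖y j‖ ^ 2 = (1 + freq k j ^ 2) ^ (1 / 2 : ℝ) * ‖r j‖ ^ 2 := fun j => by
    rw [hy, norm_mul, mul_pow, Complex.norm_real, Real.norm_of_nonneg (mH_pos _ _ _ _).le, mH_sq,
      weight, Real.rpow_zero, one_mul]
  have yr : ‖y‖ ^ 2 ≤ ‖rh‖ ^ 2 := by
    rw [l2_norm_sq, l2_norm_sq]
    refine Summable.tsum_le_tsum (fun j => ?_) (l2_summable y) (l2_summable rh)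
    rw [sq_y, sq_rh]
    refine mul_le_mul_of_nonneg_right ?_ (sq_nonneg _)
    rw [← Real.sqrt_eq_rpow, lam]
    refine Real.sqrt_le_iff.2 ⟨by positivity, ?_⟩
    nlinarith [sq_abs (freq k j), abs_nonneg (freq k j)]
  have ry : ‖rh‖ ^ 2 ≤ 2 * ‖y‖ ^ 2 := by
    rw [l2_norm_sq, l2_norm_sq, ← tsum_mul_left]
    refine Summable.tsum_le_tsum (fun j => ?_) (l2_summable rh) ((l2_summable y).mul_left 2)
    rw [sq_y, sq_rh, ← mul_assoc]
    exact mul_le_mul_of_nonneg_right (lam_le_xi k j) (sq_nonneg _)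
  have a4 : 1 ≤ α t ^ 4 := one_le_pow₀ (by linarith)
  have a6 : 2 ≤ α t ^ 6 := h2.trans (le_self_pow₀ (by linarith) (by norm_num))
  constructor
  · have h1 : ‖x‖ ^ 2 ≤ α t ^ 4 * ‖V t • x‖ ^ 2 := by
      calc ‖x‖ ^ 2 ≤ (α t ^ 2 * ‖V t • x‖) ^ 2 := pow_le_pow_left₀ (norm_nonneg _) hxV 2
        _ = _ := by ring
    rw [mul_add]
    refine add_le_add (h1.trans (mul_le_mul_of_nonneg_left low (by positivity))) ?_
    exact yr.trans (le_mul_of_one_le_left (sq_nonneg _) a4)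
  · rw [mul_add]
    exact add_le_add up (ry.trans (mul_le_mul_of_nonneg_right a6 (sq_nonneg _)))

end Background

/-! ### Uniform estimates -/

/-- Grönwall's inequality with a continuous rate. -/
theorem le_mul_exp_integral {T : ℝ} {E φ e : ℝ → ℝ} (hφ : ContinuousOn φ (Icc 0 T))
    (hE : ∀ t ∈ Icc 0 T, HasDerivWithinAt E (e t) (Icc 0 T) t)
    (h : ∀ t ∈ Icc 0 T, e t ≤ φ t * E t) :
    ∀ t ∈ Icc 0 T, E t ≤ E 0 * Real.exp (∫ τ in (0 : ℝ)..t, φ τ) := by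
  intro t ht
  have hT : 0 ≤ T := ht.1.trans ht.2
  -- Extending the rate by constants outside `[0,T]` makes its primitive differentiable on the whole
  -- line.
  set ψ : ℝ → ℝ := IccExtend hT ((Icc 0 T).domRestrict φ) with hψ
  have cψ : Continuous ψ := (continuousOn_iff_continuous_domRestrict.1 hφ).Icc_extend'
  have eψ : ∀ τ ∈ Icc 0 T, ψ τ = φ τ := fun τ hτ => IccExtend_of_mem hT _ hτ
  set Φ : ℝ → ℝ := fun t => ∫ τ in (0 : ℝ)..t, ψ τ with hΦ
  have dΦ : ∀ τ, HasDerivAt Φ (ψ τ) τ := fun τ =>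
    intervalIntegral.integral_hasDerivAt_right (cψ.intervalIntegrable _ _)
      (cψ.stronglyMeasurableAtFilter _ _) cψ.continuousAt
  have dg : ∀ τ ∈ Icc 0 T, HasDerivWithinAt (fun τ => E τ * Real.exp (-Φ τ))
      ((e τ - ψ τ * E τ) * Real.exp (-Φ τ)) (Icc 0 T) τ := fun τ hτ => by
    refine ((hE τ hτ).mul ((dΦ τ).neg.exp.hasDerivWithinAt)).congr_deriv ?_
    simp only [Pi.neg_apply]
    ring
  have anti : AntitoneOn (fun τ => E τ * Real.exp (-Φ τ)) (Icc 0 T) := by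
    refine antitoneOn_of_hasDerivWithinAt_nonpos (convex_Icc 0 T)
      (fun τ hτ => (dg τ hτ).continuousWithinAt)
      (fun τ hτ => (dg τ (interior_subset hτ)).mono interior_subset) fun τ hτ => ?_
    have h1 := h τ (interior_subset hτ)
    rw [← eψ τ (interior_subset hτ)] at h1
    exact mul_nonpos_of_nonpos_of_nonneg (by linarith) (Real.exp_pos _).le
  have h1 := anti ⟨le_rfl, hT⟩ ht ht.1
  have h2 : Φ 0 = 0 := intervalIntegral.integral_same
  have h3 : Φ t = ∫ τ in (0 : ℝ)..t, φ τ := intervalIntegral.integral_congr fun τ hτ => by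
    rw [uIcc_of_le ht.1] at hτ
    exact eψ τ ⟨hτ.1, hτ.2.trans ht.2⟩
  simp only [h2, neg_zero, Real.exp_zero, mul_one] at h1
  rw [h3, Real.exp_neg, ← div_eq_mul_inv, div_le_iff₀ (Real.exp_pos _)] at h1
  exact h1

/-- The compactness bound for the inverse enters here and turns `α` into a constant depending only
on `d`, `k`, `s`, `A₁` and `δ`, at each time at which the state is bounded. -/
theorem exists_background_le (k : Fin d → ℝ) (hk : LinearIndependent ℤ k) {s : ℝ}
    (hs : ((d : ℝ) + 1) / 2 < s) (A₁ δ : ℝ) (hδ : 0 < δ) :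
    ∃ D : ℝ, 2 ≤ D ∧ ∀ (I : Set ℝ) (W R : ℝ → PerFun d),
    (∀ t ∈ I, IsState k s (W t) (R t)) → ContInPair k s I W R →
    ∃ α : ℝ → ℝ, Background k s I α (fun t => ctrlB k s (W t) (R t)) W R ∧
      ∀ t ∈ I, Bounded k s A₁ δ (W t) (R t) → α t ≤ D := by
  obtain ⟨C₀, hC₀, bg⟩ := exists_background k hk hs
  obtain ⟨C₁, hC₁⟩ := exists_bound_oneSubY k hs A₁ δ hδ
  refine ⟨C₀ * (2 + |A₁| + |C₁|), ?_, fun I W R hst hc => ⟨_, bg I W R hst hc, fun t ht hb => ?_⟩⟩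
  · nlinarith [abs_nonneg A₁, abs_nonneg C₁, mul_nonneg (sub_nonneg.2 hC₀)
      (add_nonneg (add_nonneg zero_le_two (abs_nonneg A₁)) (abs_nonneg C₁))]
  · refine mul_le_mul_of_nonneg_left ?_ (by linarith)
    linarith [hb.1, le_abs_self A₁, hC₁ _ _ (hst t ht) hb, le_abs_self C₁]

theorem exists_coercive (k : Fin d → ℝ) (hk : LinearIndependent ℤ k) {s : ℝ}
    (hs : ((d : ℝ) + 1) / 2 < s) (A₁ δ : ℝ) (hδ : 0 < δ) :
    ∃ C : ℝ, 1 ≤ C ∧ ∀ W R : PerFun d, IsState k s W R →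
    Bounded k s A₁ δ W R → ∀ w r : PerFun d, IsLinState k w r →
      normPair k 0 w r ^ 2 ≤ C * Elin k W R w r ∧
        Elin k W R w r ≤ C * normPair k 0 w r ^ 2 := by
  obtain ⟨D, hD, bg⟩ := exists_background_le k hk hs A₁ δ hδ
  set K : ℝ := (2 * Real.pi) ^ d with hKdef
  have hK : 0 < K := pow_pos (by positivity) _
  have hKi : 0 < K⁻¹ := inv_pos.2 hK
  have hD0 : 0 < D := by linarith
  have p1 : 0 < K⁻¹ * D ^ 4 := by positivity
  have p2 : 0 < K * D ^ 6 := by positivity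
  refine ⟨K⁻¹ * D ^ 4 + K * D ^ 6 + 1, by linarith, fun W R hst hb w r hl => ?_⟩
  obtain ⟨α, h, hα⟩ := bg {0} (fun _ => W) (fun _ => R) (fun _ _ => hst) (contInPair_const hst.mem)
  have hα := hα 0 rfl hb
  have h2 := h.V_zero.two_le 0 rfl
  obtain ⟨c1, c2⟩ := h.coercive rfl hl
  have e := h.elin_eq (t := 0) rfl hl
  have hP : 0 ≤ normPair k 0 w r ^ 2 := sq_nonneg _
  rw [e]
  generalize energy k (one + a k R) (oneSubY W ⊡ w) r = E at *
  have hα0 : 0 < α 0 := by linarith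
  have hE : 0 ≤ E := nonneg_of_mul_nonneg_right (hP.trans c1) (by positivity)
  have c3 : normPair k 0 w r ^ 2 ≤ D ^ 4 * E :=
    c1.trans (mul_le_mul_of_nonneg_right (pow_le_pow_left₀ hα0.le hα 4) hE)
  have c4 : E ≤ D ^ 6 * normPair k 0 w r ^ 2 :=
    c2.trans (mul_le_mul_of_nonneg_right (pow_le_pow_left₀ hα0.le hα 6) hP)
  have hKE : 0 ≤ K * E := mul_nonneg hK.le hE
  constructor
  · calc _ ≤ D ^ 4 * E := c3
      _ = K⁻¹ * D ^ 4 * (K * E) := by field_simp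
      _ ≤ _ := mul_le_mul_of_nonneg_right (by linarith) hKE
  · calc K * E ≤ K * (D ^ 6 * normPair k 0 w r ^ 2) := mul_le_mul_of_nonneg_left c4 hK.le
      _ = K * D ^ 6 * normPair k 0 w r ^ 2 := by ring
      _ ≤ _ := mul_le_mul_of_nonneg_right (by linarith) hP

theorem exists_deriv_bound (k : Fin d → ℝ) (hk : LinearIndependent ℤ k) {s : ℝ}
    (hs : ((d : ℝ) + 1) / 2 < s) (A₁ δ : ℝ) (hδ : 0 < δ) :
    ∃ C : ℝ, 0 < C ∧ ∀ T : ℝ, ∀ W R w r : ℝ → PerFun d,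
    IsSolution k s T W R → IsLinSolution k T W R w r → ∀ t ∈ Icc 0 T,
      Bounded k s A₁ δ (W t) (R t) →
        ∃ e : ℝ, HasDerivWithinAt (fun τ => Elin k (W τ) (R τ) (w τ) (r τ)) e (Icc 0 T) t ∧
          |e| ≤ C * (ctrlB k s (W t) (R t) * normPair k 0 (w t) (r t) ^ 2 +
            normH k 0 0 (w t) * normH k 0 0 (r t)) := by
  obtain ⟨D, hD, bg⟩ := exists_background_le k hk hs A₁ δ hδ
  set K : ℝ := (2 * Real.pi) ^ d with hKdef
  have hK : 0 < K := pow_pos (by positivity) _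
  have hD0 : 0 < D := by linarith
  refine ⟨K * (28 * D ^ 27), by positivity, fun T W R w r hs hl t ht hb => ?_⟩
  obtain ⟨α, h, hα⟩ := bg _ W R hs.state hs.cont
  have hα := hα t ht hb
  have h2 := h.V_zero.two_le t ht
  obtain ⟨e, he, hle⟩ := hasDerivWithinAt_energy_lin h hs hl t ht
  refine ⟨K * e, (he.const_mul K).congr (fun τ hτ => h.elin_eq hτ (hl.state τ hτ))
    (h.elin_eq ht (hl.state t ht)), ?_⟩
  rw [abs_mul, abs_of_pos hK, mul_assoc]
  refine mul_le_mul_of_nonneg_left (hle.trans ?_) hK.le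
  have hB : 0 ≤ ctrlB k s (W t) (R t) := normPair_nonneg _ _ _ _
  have hx := normH_nonneg k 0 0 (w t)
  have hy := normH_nonneg k 0 0 (r t)
  have hα0 : 0 ≤ α t := by linarith
  gcongr

/-- Grönwall for the energy, with coercivity used at both ends. The rate `φ` is left free, so that
both growth bounds are instances: `φ = B` and `φ = 1 + B`. -/
theorem exists_growth (k : Fin d → ℝ) (hk : LinearIndependent ℤ k) {s : ℝ}
    (hs : ((d : ℝ) + 1) / 2 < s) (A₁ δ : ℝ) (hδ : 0 < δ)
    (C₁ : ℝ) (hC₁ : 0 < C₁) : ∃ C : ℝ, 0 < C ∧ ∀ T : ℝ, ∀ W R w r : ℝ → PerFun d,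
    ∀ φ : ℝ → ℝ, IsSolution k s T W R → IsLinSolution k T W R w r →
      (∀ t ∈ Icc 0 T, Bounded k s A₁ δ (W t) (R t)) → ContinuousOn φ (Icc 0 T) →
      (∀ t ∈ Icc 0 T, 0 ≤ φ t) →
      (∀ t ∈ Icc 0 T,
        ∃ e : ℝ, HasDerivWithinAt (fun τ => Elin k (W τ) (R τ) (w τ) (r τ)) e (Icc 0 T) t ∧
          |e| ≤ C₁ * (φ t * normPair k 0 (w t) (r t) ^ 2)) →
      ∀ t ∈ Icc 0 T, normPair k 0 (w t) (r t) ≤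
        C * Real.exp (C * ∫ τ in (0 : ℝ)..t, φ τ) * normPair k 0 (w 0) (r 0) := by
  obtain ⟨C₂, hC₂, coer⟩ := exists_coercive k hk hs A₁ δ hδ
  have hC₂' : 0 < C₂ := by linarith
  have hCC : 0 < C₁ * C₂ := mul_pos hC₁ hC₂'
  refine ⟨C₂ + C₁ * C₂, by linarith, fun T W R w r φ hs hl hb hφ hφ0 hd t ht => ?_⟩
  choose! e he hle using hd
  have h0 : (0 : ℝ) ∈ Icc 0 T := ⟨le_rfl, ht.1.trans ht.2⟩
  have co := fun τ (hτ : τ ∈ Icc 0 T) =>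
    coer _ _ (hs.state τ hτ) (hb τ hτ) _ _ (hl.state τ hτ)
  have gr := le_mul_exp_integral (φ := fun τ => C₁ * C₂ * φ τ) (hφ.const_mul _) he
    (fun τ hτ => by
      refine (le_abs_self _).trans ((hle τ hτ).trans ?_)
      calc C₁ * (φ τ * normPair k 0 (w τ) (r τ) ^ 2) ≤
          C₁ * (φ τ * (C₂ * Elin k (W τ) (R τ) (w τ) (r τ))) := by
            have := (co τ hτ).1
            have := hφ0 τ hτ
            gcongr
        _ = _ := by ring) t ht
  rw [intervalIntegral.integral_const_mul] at gr
  have hJ : 0 ≤ ∫ τ in (0 : ℝ)..t, φ τ :=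
    intervalIntegral.integral_nonneg ht.1 fun τ hτ => hφ0 τ ⟨hτ.1, hτ.2.trans ht.2⟩
  set J := ∫ τ in (0 : ℝ)..t, φ τ
  have hp := normPair_nonneg k 0 (w 0) (r 0)
  have hsq : normPair k 0 (w t) (r t) ^ 2 ≤
      (C₂ * Real.exp (C₁ * C₂ * J) * normPair k 0 (w 0) (r 0)) ^ 2 := by
    -- The exponential is replaced by its square, at least as large because the exponent is
    -- nonnegative, so that a root can be taken without halving the exponent.
    have hexp : Real.exp (C₁ * C₂ * J) ≤ Real.exp (C₁ * C₂ * J) ^ 2 :=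
      le_self_pow₀ (Real.one_le_exp (by positivity)) (by norm_num)
    calc _ ≤ C₂ * (Elin k (W 0) (R 0) (w 0) (r 0) * Real.exp (C₁ * C₂ * J)) :=
          (co t ht).1.trans (mul_le_mul_of_nonneg_left gr hC₂'.le)
      _ ≤ C₂ * (C₂ * normPair k 0 (w 0) (r 0) ^ 2 * Real.exp (C₁ * C₂ * J)) := by
          have := (co 0 h0).2
          gcongr
      _ ≤ C₂ * (C₂ * normPair k 0 (w 0) (r 0) ^ 2 * Real.exp (C₁ * C₂ * J) ^ 2) := by gcongr
      _ = _ := by ring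
  refine (le_of_sq_le_sq hsq (by positivity)).trans ?_
  gcongr <;> linarith

end QPWaterWaves

end

/-! ### Assembly of the three assertions. -/

open QPWaterWaves in
theorem theorem3p2 {d : ℕ} (k : Fin d → ℝ) (hk : LinearIndependent ℤ k)
    (s : ℝ) (hs : ((d : ℝ) + 1) / 2 < s) (A₁ δ : ℝ) (hδ : 0 < δ) :
    -- coercivity
    (∃ C > 0, ∀ W R : PerFun d, IsState k s W R → Bounded k s A₁ δ W R →
      ∀ w r : PerFun d, IsLinState k w r →
        C⁻¹ * normPair k 0 w r ^ 2 ≤ Elin k W R w r ∧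
          Elin k W R w r ≤ C * normPair k 0 w r ^ 2) ∧
    -- growth bound, with constants depending on a positive lower bound for `A` as well
    (∀ A₀ > 0, ∃ C > 0, ∀ T > 0, ∀ W R w r : ℝ → PerFun d,
      IsSolution k s T W R → IsLinSolution k T W R w r →
      (∀ t ∈ Set.Icc 0 T, A₀ ≤ ctrlA k s (W t) (R t) → Bounded k s A₁ δ (W t) (R t) →
        ∃ e : ℝ, HasDerivWithinAt (fun τ => Elin k (W τ) (R τ) (w τ) (r τ)) e (Set.Icc 0 T) t ∧
          |e| ≤ C * (ctrlB k s (W t) (R t) * normPair k 0 (w t) (r t) ^ 2)) ∧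
      ((∀ t ∈ Set.Icc 0 T, A₀ ≤ ctrlA k s (W t) (R t) ∧ Bounded k s A₁ δ (W t) (R t)) →
        ∀ t ∈ Set.Icc 0 T, normPair k 0 (w t) (r t) ≤
          C * Real.exp (C * ∫ τ in (0 : ℝ)..t, ctrlB k s (W τ) (R τ)) *
            normPair k 0 (w 0) (r 0))) ∧
    -- growth bound, uniformly for small `A` (including the zero background)
    (∃ C > 0, ∀ T > 0, ∀ W R w r : ℝ → PerFun d,
      IsSolution k s T W R → IsLinSolution k T W R w r →
      (∀ t ∈ Set.Icc 0 T, Bounded k s A₁ δ (W t) (R t) →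
        ∃ e : ℝ, HasDerivWithinAt (fun τ => Elin k (W τ) (R τ) (w τ) (r τ)) e (Set.Icc 0 T) t ∧
          |e| ≤ C * (ctrlB k s (W t) (R t) * normPair k 0 (w t) (r t) ^ 2 +
            normH k 0 0 (w t) * normH k 0 0 (r t))) ∧
      ((∀ t ∈ Set.Icc 0 T, Bounded k s A₁ δ (W t) (R t)) →
        ∀ t ∈ Set.Icc 0 T, normPair k 0 (w t) (r t) ≤
          C * Real.exp (C * ∫ τ in (0 : ℝ)..t, (1 + ctrlB k s (W τ) (R τ))) *
            normPair k 0 (w 0) (r 0))) := by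
  obtain ⟨C, hC, coer⟩ := exists_coercive k hk hs A₁ δ hδ
  obtain ⟨C₁, hC₁, der⟩ := exists_deriv_bound k hk hs A₁ δ hδ
  have small : ∀ {w r : PerFun d}, IsLinState k w r →
      normH k 0 0 w * normH k 0 0 r ≤ normPair k 0 w r ^ 2 := fun {w r} hl => by
    rw [sq]
    exact mul_le_mul (normH_le_left k 0 w r)
      ((normH_zero_le hl.mem.2).trans (normH_le_right k 0 w r)) (normH_nonneg _ _ _ _)
      (normPair_nonneg _ _ _ _)
  have hB0 : ∀ W R : PerFun d, 0 ≤ ctrlB k s W R := fun W R => normPair_nonneg _ _ _ _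
  refine ⟨⟨C, by linarith, fun W R hst hb w r hl => ?_⟩, fun A₀ hA₀ => ?_, ?_⟩
  · obtain ⟨c1, c2⟩ := coer W R hst hb w r hl
    exact ⟨(inv_mul_le_iff₀ (by linarith)).2 c1, c2⟩
  · have hC₂ : 0 < C₁ * (1 + A₀⁻¹) := by positivity
    obtain ⟨C₃, hC₃, growth⟩ := exists_growth k hk hs A₁ δ hδ _ hC₂
    have der' : ∀ T : ℝ, ∀ W R w r : ℝ → PerFun d, IsSolution k s T W R →
        IsLinSolution k T W R w r → ∀ t ∈ Set.Icc 0 T, A₀ ≤ ctrlA k s (W t) (R t) →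
        Bounded k s A₁ δ (W t) (R t) →
        ∃ e : ℝ, HasDerivWithinAt (fun τ => Elin k (W τ) (R τ) (w τ) (r τ)) e (Set.Icc 0 T) t ∧
          |e| ≤ C₁ * (1 + A₀⁻¹) * (ctrlB k s (W t) (R t) * normPair k 0 (w t) (r t) ^ 2) := by
      intro T W R w r hsol hl t ht hA hb
      obtain ⟨e, he, hle⟩ := der T W R w r hsol hl t ht hb
      refine ⟨e, he, hle.trans ?_⟩
      rw [mul_assoc]
      refine mul_le_mul_of_nonneg_left ?_ hC₁.le
      -- `A₀ ≤ A ≤ B` makes `B / A₀` at least one, which turns the term without `B` into one with it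
      -- at the cost of the factor `1 + A₀⁻¹`.
      have h1 : 1 ≤ A₀⁻¹ * ctrlB k s (W t) (R t) := by
        rw [← div_eq_inv_mul, one_le_div hA₀]
        exact hA.trans (ctrlA_le_ctrlB (hsol.state t ht).mem)
      have h2 := small (hl.state t ht)
      have h3 := mul_le_mul_of_nonneg_right h1 (sq_nonneg (normPair k 0 (w t) (r t)))
      linarith
    have hCm : C₁ * (1 + A₀⁻¹) ≤ max (C₁ * (1 + A₀⁻¹)) C₃ := le_max_left _ _
    refine ⟨max (C₁ * (1 + A₀⁻¹)) C₃, lt_max_of_lt_left hC₂, fun T _ W R w r hsol hl =>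
      ⟨fun t ht hA hb => ?_, fun hall t ht => ?_⟩⟩
    · obtain ⟨e, he, hle⟩ := der' T W R w r hsol hl t ht hA hb
      exact ⟨e, he, hle.trans (mul_le_mul_of_nonneg_right hCm
        (mul_nonneg (hB0 _ _) (sq_nonneg _)))⟩
    · refine (growth T W R w r (fun τ => ctrlB k s (W τ) (R τ)) hsol hl (fun t ht => (hall t ht).2)
        hsol.cont.continuousOn_normPair (fun _ _ => hB0 _ _)
        (fun t ht => der' T W R w r hsol hl t ht (hall t ht).1 (hall t ht).2) t ht).trans ?_
      have hJ : 0 ≤ ∫ τ in (0 : ℝ)..t, ctrlB k s (W τ) (R τ) :=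
        intervalIntegral.integral_nonneg ht.1 fun _ _ => hB0 _ _
      have hp := normPair_nonneg k 0 (w 0) (r 0)
      have := le_max_right (C₁ * (1 + A₀⁻¹)) C₃
      gcongr
  · obtain ⟨C₃, hC₃, growth⟩ := exists_growth k hk hs A₁ δ hδ C₁ hC₁
    refine ⟨max C₁ C₃, lt_max_of_lt_left hC₁, fun T _ W R w r hsol hl =>
      ⟨fun t ht hb => ?_, fun hall t ht => ?_⟩⟩
    · obtain ⟨e, he, hle⟩ := der T W R w r hsol hl t ht hb
      exact ⟨e, he, hle.trans (mul_le_mul_of_nonneg_right (le_max_left _ _)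
        (add_nonneg (mul_nonneg (hB0 _ _) (sq_nonneg _))
          (mul_nonneg (normH_nonneg _ _ _ _) (normH_nonneg _ _ _ _))))⟩
    · refine (growth T W R w r (fun τ => 1 + ctrlB k s (W τ) (R τ)) hsol hl hall
        (continuousOn_const.add hsol.cont.continuousOn_normPair)
        (fun _ _ => add_nonneg zero_le_one (hB0 _ _)) (fun t ht => ?_) t ht).trans ?_
      · obtain ⟨e, he, hle⟩ := der T W R w r hsol hl t ht (hall t ht)
        refine ⟨e, he, hle.trans (mul_le_mul_of_nonneg_left ?_ hC₁.le)⟩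
        have := small (hl.state t ht)
        linarith
      · have hJ : 0 ≤ ∫ τ in (0 : ℝ)..t, (1 + ctrlB k s (W τ) (R τ)) :=
          intervalIntegral.integral_nonneg ht.1 fun _ _ => add_nonneg zero_le_one (hB0 _ _)
        have hp := normPair_nonneg k 0 (w 0) (r 0)
        have := le_max_right C₁ C₃
        gcongr
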